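/- Let $\chi$ denote the factor in the functional equation $\zeta(1-s)=\chi(1-s)\zeta(s)$ of the Riemann zeta function, that is, $\chi(1-s)=2(2\pi)^{-s}\Gamma(s)\cos\frac{\pi s}{2}$. For complex $a\ne b$ and real $t$ put $c=a-b$ and $$M_{a,b}(t)=\zeta(1+c)+\zeta(1-c)\,\chi\left(\tfrac12+a+it\right)\chi\left(\tfrac12-b-it\right);$$ if $a=b$ (so $c=0$), let $M_{a,b}(t)$ be the pointwise limit of this expression as $c\to0$, that is, $M_{a,b}(t)=\lim M_{a',b'}(t)$ as $(a',b')\to(a,b)$ with $a'\neq b'$. Theorem. For every constant $C$ there are constants $K$ and $T_0\ge 2$, depending only on $C$, such that for all real $T\ge T_0$ and all $a,b\in\mathbb C$ (which may depend on $T$, with imaginary parts of any size) satisfying $$|\Re a|\le\frac{C}{\log T},\qquad |\Re b|\le\frac{C}{\log T},$$ the limit defining $M_{a,b}(t)$ exists for all $t\in[0,T]$ when $a=b$, both integrands below are integrable on $[0,T]$, and $$\left|\int_0^T\zeta\left(\tfrac12+a+it\right)\zeta\left(\tfrac12-b-it\right)dt-\int_0^T M_{a,b}(t)\,dt\right|\le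 K\left(T^{1/2}+|\Im a|^{1/2}+|\Im b|^{1/2}\right)\log^2T .$$ -/

import Mathlib

open Filter Topology

/-- The factor `χ` of the functional equation `ζ(1 - s) = χ(1 - s) ζ(s)`, that is
`χ(1 - s) = 2 (2π)^(-s) Γ(s) cos(π s / 2)`, written in the variable `w = 1 - s`. -/
noncomputable def zetaChi (w : ℂ) : ℂ :=
  2 * (2 * (Real.pi : ℂ)) ^ (-(1 - w)) * Complex.Gamma (1 - w) *
    Complex.cos ((Real.pi : ℂ) * (1 - w) / 2)

/-- The product of the two shifted zeta functions on the critical line,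
`ζ(1/2 + a + it) ζ(1/2 - b - it)`. -/
noncomputable def shiftedZetaProduct (a b : ℂ) (t : ℝ) : ℂ :=
  riemannZeta (1 / 2 + a + Complex.I * t) * riemannZeta (1 / 2 - b - Complex.I * t)

/-- The expression `ζ(1 + c) + ζ(1 - c) χ(1/2 + a + it) χ(1/2 - b - it)` with `c = a - b`,
meaningful for `a ≠ b`. -/
noncomputable def mainIntegrandOffDiag (a b : ℂ) (t : ℝ) : ℂ :=
  riemannZeta (1 + (a - b)) +
    riemannZeta (1 - (a - b)) *
      (zetaChi (1 / 2 + a + Complex.I * t) * zetaChi (1 / 2 - b - Complex.I * t))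

/-- The integrand of the main term: the expression above if `c = a - b ≠ 0`, and for `c = 0` its
pointwise limit as `c → 0`, i.e. as `(a', b')` tends to `(a, b)` with `a' - b' ≠ 0`. -/
noncomputable def mainIntegrand (a b : ℂ) (t : ℝ) : ℂ :=
  open Classical in
  if a = b then
    limUnder (𝓝[{p : ℂ × ℂ | p.1 ≠ p.2}] (a, b))
      (fun p : ℂ × ℂ => mainIntegrandOffDiag p.1 p.2 t)
  else mainIntegrandOffDiag a b t

noncomputable section

open Set (EqOn Icc Icc_subset_Icc_left Icc_subset_Icc_right Iic Iic_union_Ioi Ioc_subset_Icc_self Ioi Ioo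
  Ioo_subset_Icc_self mem_Ioi mem_singleton_iff uIcc uIcc_of_le uIcc_subset_Icc uIoc_of_le)
open scoped Real Complex ComplexConjugate
open MeasureTheory (volume IntegrableOn ae_of_all integrable_norm_iff ae_restrict_iff'
  norm_integral_le_integral_norm setIntegral_congr_fun Integrable integrableOn_univ
  intervalIntegral_tendsto_integral_Ioi)
open Complex (I I_ne_zero norm_exp_ofReal_mul_I norm_I norm_real ofRealCLM continuous_ofReal
  exp_add continuous_exp cpow_def_of_ne_zero ofReal_exp ofReal_log re_add_im conj_ofReal exp_conj
  conj_I continuousAt_ofReal_cpow_const ofReal_natCast norm_cpow_eq_rpow_re_of_pos neg_re sub_re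
  one_re cpow_neg continuous_re ofReal_one one_cpow conj_conj abs_im_le_norm sub_im one_im
  slitPlane norm_def normSq_apply add_re add_im ofReal_re ofReal_im re log_ofReal_mul GammaSeq
  exp_neg natCast_re exp_ne_zero norm_exp ofReal_div I_sq neg_im mul_im I_re I_im exp_sub cpow_conj
  arg_ofReal_of_nonneg cpow_add cpow_neg_one abs_re_le_norm inv_cpow mul_re real_smul mem_reProdIm
  ofReal_zero cpow_one ofReal_mul natCast_arg conj_natCast exp_zero cpow_zero conj_re conj_im)
open Real (log norm_eq_abs sqrt_pos mul_self_sqrt cos sin pi_ne_zero pi_pos pi_gt_three log_nonneg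
  rpow_def_of_pos rpow_pos_of_pos sqrt_nonneg sq_sqrt sqrt_sq rpow_le_rpow_of_nonpos rpow_natCast
  rpow_mul rpow_le_rpow_of_exponent_le one_le_sqrt sqrt_le_sqrt log_le_log log_two_gt_d9
  rpow_le_rpow sqrt_eq_rpow one_le_exp rpow_zero sqrt_le_iff rpow_add rpow_one
  log_le_sub_one_of_pos norm_of_nonneg div_rpow rpow_neg one_le_rpow log_pow sqrt_mul exp_mul
  log_div exp_le_exp exp_pos pi_lt_four log_natCast_nonneg log_zero sign sign_of_neg sign_of_pos
  log_rpow)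
open intervalIntegral (integral_const_mul norm_integral_le_of_norm_le
  integral_hasDerivAt_right integral_same integral_eq_sub_of_hasDerivAt
  integral_sub integral_congr integral_neg norm_integral_le_of_norm_le_const
  integral_add_adjacent_intervals integral_of_le integral_add integral_mul_const integral_mono_on
  integral_div integral_comp_neg integral_comp_add_right integral_symm)
open Int (fract fract_nonneg fract_lt_one)
open Finset (Ioc range mem_Ioc mem_range sum_singleton sum_const sum_range_succ sum_le_sum sum_sub_distrib sum_congr mul_sum
  sum_Ioc_consecutive card_range sum_comm sum_Ioc_succ_top sum_nbij' range_mono sum_add_distrib)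
open Nat (cast_one cast_nonneg floor_pos floor_le le_floor_iff card_Ioc cast_sub lt_floor_add_one
  le_ceil floor_le_floor le_floor)
open Metric (ball mem_ball)
open Function (comp_def uncurry comp_apply)

local notation "ζ" => riemannZeta

/-! Put c = a − b, y = t + Im b and s = 1/2 + Re b + iy. The product becomes ζ(1 − s)ζ(s + c) on a
line close to the critical one, and the functional equation turns it into χ(1 − s)ζ(s)ζ(s + c). Let
N be an integer of the size of all heights involved. On a line Re s = 1 + O(1/log N) the product
ζ(s)ζ(s + c) is the absolutely convergent double series ∑ d^(-c) (de)^(-s), so it can be integrated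
termwise. The phase of χ(1 − s) n^(-s) is stationary only at y = 2πn; Gonek's lemma
(`exists_norm_integral_zetaChi_mul_cpow_sub_le`) says that its integral over 2π ≤ y ≤ 2πX is 2π if n
≤ X and 0 otherwise, up to errors whose weighted sum is O(√N log² N). Moving the line costs no more,
by the convexity bound, once the pole of ζ(s + c) has been split off. Hence the moment is 2π ∑_{de ≤
X} d^(-c) + O(√N log² N) (`exists_norm_integral_zeta_mul_zeta_sub_le`).

This divisor sum equals Xζ(1 + c) + X^(1-c) ζ(1 − c)/(1 − c) + O(√N log² N), uniformly for Im c up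
to N (`norm_twistedDivisorSum_sub_le`). Uniformity comes from Poisson summation of d^(-c){x/d} over
the ranges where ⌊x/d⌋ is constant. Differentiated in X, the main term is ζ(1 + c) + ζ(1 −
c)(y/2π)^(-c).

It remains to exchange the power (y/2π)^(-c) for the product of two χ-factors, `chiPair`. If |Im c|
≥ √N, both have small integrals by oscillation. If |Im c| < √N, they are close by Stirling's
formula, and a partial integration supplies the saving 1/|1 − c| that a pointwise comparison lacks
(`exists_norm_integral_chiPair_sub_le`). For small c the pole of ζ(1 − c) has to be compensated:
power and product are both 1 at c = 0, so the Schwarz lemma bounds their difference by a multiple of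
|c| (`exists_norm_integral_chiPair_sub_le_mul_norm`).

The errors so far carry log N. If V = |Im a| + |Im b| is at most T^100, then log N and log T are
comparable. If V > T^100, the integral is estimated pointwise: the subconvex bound ζ(1/2 + it) ≪
t^0.24 (`exists_norm_riemannZeta₀_le_rpow`) bounds the integrand by V^0.48, and the length T is
below V^0.01, so that V^(1/2) suffices without any logarithm of V. The case a = b follows by
continuity from b = a − iδ with δ → 0. -/

/-! ### Oscillatory integrals: partial integration and the derivative tests -/

lemma integral_mul_eq_sub_integral_primitive {E g g' : ℝ → ℂ} {p q : ℝ} (hpq : p ≤ q) (hE : ContinuousOn E (Icc p q))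
    (hg : ∀ w ∈ Icc p q, HasDerivAt g (g' w) w) (hg' : ContinuousOn g' (Icc p q)) :
    ContinuousOn (fun r => ∫ w in p..r, E w) (Icc p q) ∧
      ∫ w in p..q, g w*E w = g q * (∫ w in p..q, E w) - ∫ w in p..q, g' w * ∫ x in p..w, E x := by
  have hu : uIcc p q = Icc p q := uIcc_of_le hpq
  have hEi : IntervalIntegrable E volume p q := (hu ▸ hE).intervalIntegrable
  have hcont : ContinuousOn (fun r => ∫ w in p..r, E w) (Icc p q) := by
    have := intervalIntegral.continuousOn_primitive_interval (f := E) (μ := volume) (a := p) (b := q)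
      ((hu ▸ hE : ContinuousOn E (uIcc p q)).integrableOn_compact isCompact_uIcc)
    rwa [hu] at this
  have hderiv : ∀ r ∈ Ioo p q, HasDerivAt (fun r => ∫ w in p..r, E w) (E r) r := fun r hr => by
    refine integral_hasDerivAt_right (hEi.mono_set (by rw [hu, uIcc_of_le hr.1.le]; grind)) ?_ ?_
    · exact (hE.mono Ioo_subset_Icc_self).stronglyMeasurableAtFilter isOpen_Ioo r hr
    · exact hE.continuousAt (Icc_mem_nhds hr.1 hr.2)
  have hparts := intervalIntegral.integral_mul_deriv_eq_deriv_mul_of_hasDeriv_right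
    (u := g) (v := fun r => ∫ w in p..r, E w) (u' := g') (v' := E) (a := p) (b := q)
    (hu ▸ HasDerivAt.continuousOn hg) (hu ▸ hcont)
    (fun x hx => by
      rw [min_eq_left hpq, max_eq_right hpq] at hx; exact (hg x (Ioo_subset_Icc_self hx)).hasDerivWithinAt)
    (fun x hx => by rw [min_eq_left hpq, max_eq_right hpq] at hx; exact (hderiv x hx).hasDerivWithinAt)
    ((hu ▸ hg').intervalIntegrable) hEi
  simp only [integral_same, mul_zero, sub_zero] at hparts
  exact ⟨hcont, hparts⟩

lemma norm_integral_mul_le_mul_integral_norm {g h : ℝ → ℂ} {p q B : ℝ} (hpq : p ≤ q) (hg : ContinuousOn g (Icc p q))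
    (hB : ∀ r ∈ Icc p q, ‖h r‖ ≤ B) : ‖∫ w in p..q, g w*h w‖ ≤ B * ∫ w in p..q, ‖g w‖ := by
  rw [← integral_const_mul]
  refine norm_integral_le_of_norm_le hpq (.of_forall fun w hw => ?_) (((uIcc_of_le hpq ▸ hg).norm.intervalIntegrable).const_mul B)
  rw [norm_mul, mul_comm]
  exact mul_le_mul_of_nonneg_right (hB w (Ioc_subset_Icc_self hw)) (norm_nonneg _)

/-- Amplitudes of bounded variation may be inserted into a uniformly bounded integral. -/
lemma norm_integral_mul_le_of_partial {E g g' : ℝ → ℂ} {p q B : ℝ} (hpq : p ≤ q) (hE : ContinuousOn E (Icc p q))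
    (hg : ∀ w ∈ Icc p q, HasDerivAt g (g' w) w) (hg' : ContinuousOn g' (Icc p q))
    (hB : ∀ r ∈ Icc p q, ‖∫ w in p..r, E w‖ ≤ B) :
    ‖∫ w in p..q, g w*E w‖ ≤ B*(‖g q‖ + ∫ w in p..q, ‖g' w‖) := by
  rw [(integral_mul_eq_sub_integral_primitive hpq hE hg hg').2]
  have h1 : ‖g q * ∫ w in p..q, E w‖ ≤ B*‖g q‖ := by
    rw [norm_mul, mul_comm]; exact mul_le_mul_of_nonneg_right (hB q ⟨hpq, le_rfl⟩) (norm_nonneg _)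
  linarith [norm_sub_le (g q * ∫ w in p..q, E w) (∫ w in p..q, g' w * ∫ x in p..w, E x),
    norm_integral_mul_le_mul_integral_norm hpq hg' hB]

/-- First derivative test. -/
lemma norm_integral_exp_le_of_le_abs_deriv {φ φ' φ'' : ℝ → ℝ} {p q l : ℝ} (hpq : p ≤ q)
    (h1 : ∀ w ∈ Icc p q, HasDerivAt φ (φ' w) w) (h2 : ∀ w ∈ Icc p q, HasDerivAt φ' (φ'' w) w)
    (h3 : ContinuousOn φ'' (Icc p q))
    (hs : (∀ w ∈ Icc p q, 0 ≤ φ'' w) ∨ (∀ w ∈ Icc p q, φ'' w ≤ 0))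
    (hl0 : 0 < l) (hl : ∀ w ∈ Icc p q, l ≤ |φ' w|) :
    ‖∫ w in p..q, cexp (I*φ w)‖ ≤ 4/l := by
  have hu : uIcc p q = Icc p q := uIcc_of_le hpq
  have hne : ∀ w ∈ Icc p q, φ' w ≠ 0 := fun w hw h => by grind
  have hφc : ContinuousOn φ (Icc p q) := HasDerivAt.continuousOn h1
  have hφ'c : ContinuousOn φ' (Icc p q) := HasDerivAt.continuousOn h2
  have hEc : ContinuousOn (fun w => cexp (I*φ w)) (Icc p q) := by fun_prop
  have hEd : ∀ w ∈ Icc p q, HasDerivAt (fun w : ℝ => cexp (I*φ w)) (cexp (I*φ w)*(I*φ' w)) w := fun w hw =>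
    ((h1 w hw).ofReal_comp.const_mul I).cexp
  -- e^{iφ}/(iφ') is a primitive of e^{iφ} up to a term of modulus |φ''|/φ'², the derivative of 1/φ'
  -- in modulus.
  have hFd : ∀ w ∈ Icc p q, HasDerivAt (fun w : ℝ => cexp (I*φ w)/(I*φ' w)) (cexp (I*φ w) -
        cexp (I*φ w)*(φ'' w/(I*(φ' w)^2))) w := fun w hw => by
    have hn : (φ' w : ℂ) ≠ 0 := mod_cast hne w hw
    have := (hEd w hw).div ((h2 w hw).ofReal_comp.const_mul I) (mul_ne_zero I_ne_zero hn)
    refine this.congr_deriv ?_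
    field_simp
  have hRc : ContinuousOn (fun w => cexp (I*φ w)*((φ'' w : ℂ)/(I*(φ' w : ℂ)^2))) (Icc p q) := by
    refine hEc.mul (ContinuousOn.div (by fun_prop) (by fun_prop) fun w hw => ?_)
    have hn : (φ' w : ℂ) ≠ 0 := mod_cast hne w hw
    exact mul_ne_zero I_ne_zero (pow_ne_zero 2 hn)
  have hint := integral_eq_sub_of_hasDerivAt (a := p) (b := q)
    (fun w hw => hFd w (hu ▸ hw)) ((hu ▸ hEc.sub hRc).intervalIntegrable)
  rw [integral_sub ((hu ▸ hEc).intervalIntegrable) ((hu ▸ hRc).intervalIntegrable), sub_eq_iff_eq_add] at hint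
  rw [hint]
  have hFb : ∀ w ∈ Icc p q, ‖cexp (I*φ w)/(I*φ' w)‖ ≤ 1/l := fun w hw => by
    rw [norm_div, mul_comm, norm_exp_ofReal_mul_I, norm_mul, norm_I, one_mul, norm_real]
    exact one_div_le_one_div_of_le hl0 (hl w hw)
  have hinv : ∀ w ∈ Icc p q, HasDerivAt (fun w => -(φ' w)⁻¹) (φ'' w/φ' w^2) w := fun w hw => by
    have := ((h2 w hw).inv (hne w hw)).neg
    refine this.congr_deriv ?_
    ring
  have hic : ContinuousOn (fun w => φ'' w/φ' w^2) (Icc p q) := h3.div (hφ'c.pow 2) fun w hw => pow_ne_zero 2 (hne w hw)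
  have hfin := integral_eq_sub_of_hasDerivAt (a := p) (b := q) (fun w hw => hinv w (hu ▸ hw)) ((hu ▸ hic).intervalIntegrable)
  have hinvb : ∀ w ∈ Icc p q, |(φ' w)⁻¹| ≤ 1/l := fun w hw => by
    rw [abs_inv, ← one_div]; exact one_div_le_one_div_of_le hl0 (hl w hw)
  -- Since φ'' keeps one sign, the total variation of 1/φ' is the difference of its two end values,
  -- each at most 1/l in modulus.
  have habs : ∫ w in p..q, |φ'' w|/φ' w^2 ≤ 2/l := by
    have hp := abs_le.1 (hinvb p ⟨le_rfl, hpq⟩)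
    have hq := abs_le.1 (hinvb q ⟨hpq, le_rfl⟩)
    have h2l : 2/l = 1/l + 1/l := by ring
    rcases hs with hs | hs
    · have : ∫ w in p..q, |φ'' w|/φ' w^2 = ∫ w in p..q, φ'' w/φ' w^2 :=
        integral_congr fun w hw => by simp only [abs_of_nonneg (hs w (hu ▸ hw))]
      linarith
    · have : ∫ w in p..q, |φ'' w|/φ' w^2 = ∫ w in p..q, -(φ'' w/φ' w^2) := integral_congr fun w hw => by grind
      rw [this, integral_neg, hfin]; linarith
  have hR : ‖∫ w in p..q, cexp (I*φ w)*((φ'' w : ℂ)/(I*(φ' w : ℂ)^2))‖ ≤ 2/l := by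
    refine le_trans (norm_integral_le_of_norm_le hpq (g := fun w => |φ'' w|/φ' w^2) ?_ ?_) habs
    · simp
    · exact (hu ▸ (h3.abs.div (hφ'c.pow 2) fun w hw => pow_ne_zero 2 (hne w hw)) : ContinuousOn _ (uIcc p q)).intervalIntegrable
  calc _ ≤ _ := norm_add_le _ _
    _ ≤ (1/l + 1/l) + 2/l := add_le_add ((norm_sub_le _ _).trans (add_le_add (hFb q ⟨hpq, le_rfl⟩) (hFb p ⟨le_rfl, hpq⟩))) hR
    _ = 4/l := by ring

lemma norm_integral_exp_le_length (φ : ℝ → ℝ) {p q : ℝ} (hpq : p ≤ q) : ‖∫ w in p..q, cexp (I*φ w)‖ ≤ q - p := by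
  have := norm_integral_le_of_norm_le_const (a := p) (b := q) (C := 1) (f := fun w => cexp (I*φ w)) (fun w _ => by simp)
  grind

/-- Second derivative test. -/
lemma norm_integral_exp_le_of_le_deriv2 {φ φ' φ'' : ℝ → ℝ} {p q r : ℝ} (hpq : p ≤ q)
    (h1 : ∀ w ∈ Icc p q, HasDerivAt φ (φ' w) w) (h2 : ∀ w ∈ Icc p q, HasDerivAt φ' (φ'' w) w)
    (h3 : ContinuousOn φ'' (Icc p q)) (hr : 0 < r) (hs : ∀ w ∈ Icc p q, r ≤ φ'' w) :
    ‖∫ w in p..q, cexp (I*φ w)‖ ≤ 10/√r := by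
  have hφ'c : ContinuousOn φ' (Icc p q) := HasDerivAt.continuousOn h2
  have hφc : ContinuousOn φ (Icc p q) := HasDerivAt.continuousOn h1
  have hgrow : ∀ x ∈ Icc p q, ∀ y ∈ Icc p q, x ≤ y → r*(y - x) ≤ φ' y - φ' x := by
    refine (convex_Icc p q).mul_sub_le_image_sub_of_le_deriv hφ'c ?_ ?_
    · intro w hw; exact (h2 w (interior_subset hw)).differentiableAt.differentiableWithinAt
    · intro w hw; rw [(h2 w (interior_subset hw)).deriv]; exact hs w (interior_subset hw)
  -- w₀ is a zero of the increasing function φ', or the endpoint nearest to where the zero would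
  -- lie; the implications allow for an endpoint.
  obtain ⟨w₀, hw₀, hpos, hneg⟩ : ∃ w₀ ∈ Icc p q, (w₀ < q → 0 ≤ φ' w₀) ∧ (p < w₀ → φ' w₀ ≤ 0) := by
    rcases le_or_gt 0 (φ' p) with hp | hp
    · grind
    rcases le_or_gt (φ' q) 0 with hq | hq
    · grind
    obtain ⟨w, hw, hw0⟩ := intermediate_value_Icc hpq hφ'c ⟨hp.le, hq.le⟩
    grind
  -- Within d of w₀ the trivial bound gives 2/√r. Farther away |φ'| has grown to at least rd = √r,
  -- and the first derivative test gives 4/√r on each side.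
  set d := 1/√r with hd
  have hsr : 0 < √r := sqrt_pos.2 hr
  have hd0 : 0 < d := by positivity
  have hrd : r*d = √r := by rw [hd, mul_one_div, div_eq_iff hsr.ne']; grind
  set a := max p (w₀ - d)
  set b := min q (w₀ + d)
  have hpa : p ≤ a := le_max_left _ _
  have haw : a ≤ w₀ := max_le hw₀.1 (by linarith)
  have hwb : w₀ ≤ b := le_min hw₀.2 (by linarith)
  have hbq : b ≤ q := min_le_left _ _
  have hab : a ≤ b := haw.trans hwb
  have hEc : ContinuousOn (fun w => cexp (I*φ w)) (Icc p q) := by fun_prop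
  have hii : ∀ x ∈ Icc p q, ∀ y ∈ Icc p q, IntervalIntegrable (fun w => cexp (I*φ w)) volume x y := fun x hx y hy =>
    (hEc.mono (uIcc_subset_Icc hx hy)).intervalIntegrable
  have hpI : p ∈ Icc p q := ⟨le_rfl, hpq⟩
  have hqI : q ∈ Icc p q := ⟨hpq, le_rfl⟩
  have haI : a ∈ Icc p q := ⟨hpa, hab.trans hbq⟩
  have hbI : b ∈ Icc p q := ⟨hpa.trans hab, hbq⟩
  have hsplit : ∫ w in p..q, cexp (I*φ w) = ((∫ w in p..a, cexp (I*φ w)) + ∫ w in a..b, cexp (I*φ w)) +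
        ∫ w in b..q, cexp (I*φ w) := by
    rw [integral_add_adjacent_intervals (hii p hpI a haI) (hii a haI b hbI),
      integral_add_adjacent_intervals (hii p hpI b hbI) (hii b hbI q hqI)]
  have hA : ‖∫ w in p..a, cexp (I*φ w)‖ ≤ 4/√r := by
    rcases hpa.eq_or_lt with h | h
    · rw [← h]; simp only [integral_same, norm_zero]; positivity
    have hsub : Icc p a ⊆ Icc p q := Icc_subset_Icc_right haI.2
    refine norm_integral_exp_le_of_le_abs_deriv hpa (fun w hw => h1 w (hsub hw)) (fun w hw => h2 w (hsub hw)) (h3.mono hsub)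
      (Or.inl fun w hw => hr.le.trans (hs w (hsub hw))) hsr fun w hw => ?_
    have ha' : a = w₀ - d := by
      rcases max_choice p (w₀ - d) with h' | h'
      · exact absurd h' h.ne'
      · exact h'
    have h4 := hgrow w (hsub hw) w₀ hw₀ (hw.2.trans haw)
    have h5 : r*d ≤ r*(w₀ - w) := mul_le_mul_of_nonneg_left (by linarith [hw.2]) hr.le
    have h6 := hneg (lt_of_lt_of_le h haw)
    rw [abs_of_nonpos (by nlinarith)]
    linarith
  have hB : ‖∫ w in b..q, cexp (I*φ w)‖ ≤ 4/√r := by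
    rcases hbq.eq_or_lt with h | h
    · rw [h]; simp only [integral_same, norm_zero]; positivity
    have hsub : Icc b q ⊆ Icc p q := Icc_subset_Icc_left hbI.1
    refine norm_integral_exp_le_of_le_abs_deriv hbq (fun w hw => h1 w (hsub hw)) (fun w hw => h2 w (hsub hw)) (h3.mono hsub)
      (Or.inl fun w hw => hr.le.trans (hs w (hsub hw))) hsr fun w hw => ?_
    have ha' : b = w₀ + d := by
      rcases min_choice q (w₀ + d) with h' | h'
      · exact absurd h' h.ne
      · exact h'
    have h4 := hgrow w₀ hw₀ w (hsub hw) (hwb.trans hw.1)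
    have h5 : r*d ≤ r*(w - w₀) := mul_le_mul_of_nonneg_left (by linarith [hw.1]) hr.le
    have h6 := hpos (lt_of_le_of_lt hwb h)
    rw [abs_of_nonneg (by nlinarith)]
    linarith
  have hM : ‖∫ w in a..b, cexp (I*φ w)‖ ≤ 2/√r := by
    refine (norm_integral_exp_le_length φ hab).trans ?_
    have h4 : w₀ - d ≤ a := le_max_right _ _
    have h5 : b ≤ w₀ + d := min_le_right _ _
    have : 2/√r = 2*d := by rw [hd]; ring
    linarith
  rw [hsplit]
  calc _ ≤ _ := norm_add₃_le
    _ ≤ 4/√r + 2/√r + 4/√r := add_le_add (add_le_add hA hM) hB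
    _ = 10/√r := by ring

lemma norm_integral_mul_exp_le_of_le_abs_deriv {φ φ' φ'' : ℝ → ℝ} {g g' : ℝ → ℂ} {p q l : ℝ} (hpq : p ≤ q)
    (h1 : ∀ w ∈ Icc p q, HasDerivAt φ (φ' w) w) (h2 : ∀ w ∈ Icc p q, HasDerivAt φ' (φ'' w) w)
    (h3 : ContinuousOn φ'' (Icc p q))
    (hs : (∀ w ∈ Icc p q, 0 ≤ φ'' w) ∨ (∀ w ∈ Icc p q, φ'' w ≤ 0))
    (hl0 : 0 < l) (hl : ∀ w ∈ Icc p q, l ≤ |φ' w|)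
    (hg : ∀ w ∈ Icc p q, HasDerivAt g (g' w) w) (hg' : ContinuousOn g' (Icc p q)) :
    ‖∫ w in p..q, g w*cexp (I*φ w)‖ ≤ 4/l*(‖g q‖ + ∫ w in p..q, ‖g' w‖) := by
  have hφc : ContinuousOn φ (Icc p q) := HasDerivAt.continuousOn h1
  refine norm_integral_mul_le_of_partial hpq (by fun_prop) hg hg' fun r hr => ?_
  have hsub : Icc p r ⊆ Icc p q := Icc_subset_Icc_right hr.2
  exact norm_integral_exp_le_of_le_abs_deriv hr.1 (fun w hw => h1 w (hsub hw)) (fun w hw => h2 w (hsub hw)) (h3.mono hsub)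
      (hs.imp (fun h w hw => h w (hsub hw)) (fun h w hw => h w (hsub hw))) hl0
      fun w hw => hl w (hsub hw)

lemma norm_integral_mul_exp_le_of_le_deriv2 {φ φ' φ'' : ℝ → ℝ} {g g' : ℝ → ℂ} {p q r : ℝ} (hpq : p ≤ q)
    (h1 : ∀ w ∈ Icc p q, HasDerivAt φ (φ' w) w) (h2 : ∀ w ∈ Icc p q, HasDerivAt φ' (φ'' w) w)
    (h3 : ContinuousOn φ'' (Icc p q)) (hr : 0 < r) (hs : ∀ w ∈ Icc p q, r ≤ φ'' w)
    (hg : ∀ w ∈ Icc p q, HasDerivAt g (g' w) w) (hg' : ContinuousOn g' (Icc p q)) :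
    ‖∫ w in p..q, g w*cexp (I*φ w)‖ ≤ 10/√r*(‖g q‖ + ∫ w in p..q, ‖g' w‖) := by
  have hφc : ContinuousOn φ (Icc p q) := HasDerivAt.continuousOn h1
  refine norm_integral_mul_le_of_partial hpq (by fun_prop) hg hg' fun s hs' => ?_
  have hsub : Icc p s ⊆ Icc p q := Icc_subset_Icc_right hs'.2
  exact norm_integral_exp_le_of_le_deriv2 hs'.1 (fun w hw => h1 w (hsub hw))
      (fun w hw => h2 w (hsub hw)) (h3.mono hsub) hr fun w hw => hs w (hsub hw)

/-! ### The periodic Bernoulli function and Euler–Maclaurin summation -/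

/-- The `k`-th term (indexed from `0`) of the Fourier series of half the second periodic Bernoulli
function. -/
def bernoulliTerm (k : ℕ) (w : ℝ) : ℝ := cos (2*π*(k + 1)*w)/(2*π^2*(k + 1)^2)

lemma abs_bernoulliTerm_le (k : ℕ) (w : ℝ) :
    |bernoulliTerm k w| ≤ 1/(2*π^2*(k + 1)^2) := by
  rw [bernoulliTerm, abs_div, abs_of_pos (a := 2*π^2*((k : ℝ) + 1)^2) (by positivity)]
  gcongr
  exact Real.abs_cos_le_one _

lemma summable_bernoulliBound : Summable fun k : ℕ => 1/(2*π^2*((k : ℝ) + 1)^2) := by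
  have h : Summable fun k : ℕ => 1/((k : ℝ) + 1)^2 := by
    have := (summable_nat_add_iff 1).2 (Real.summable_one_div_nat_pow.2 (one_lt_two))
    simpa using this
  refine (h.mul_left (1/(2*π^2))).congr fun k => ?_
  field_simp

lemma hasSum_bernoulliTerm (w : ℝ) : HasSum (fun k => bernoulliTerm k w) ((fract w^2 - fract w + 1/6)/2) := by
  have h := hasSum_one_div_nat_pow_mul_cos (k := 1) one_ne_zero (x := fract w) ⟨fract_nonneg _, (fract_lt_one _).le⟩
  have h2 := (hasSum_nat_add_iff' 1).2 h
  simp only [Finset.range_one, sum_singleton] at h2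
  have h3 := h2.mul_left (1/(2*π^2))
  convert! h3 using 1
  · funext k
    rw [bernoulliTerm]
    have : cos (2*π*((k + 1 : ℕ) : ℝ)*fract w) = cos (2*π*((k : ℝ) + 1)*w) := by
      rw [← Real.cos_add_int_mul_two_pi _ ((k + 1 : ℤ)*⌊w⌋)]; congr 1
      have := Int.fract_add_floor w
      push_cast
      linear_combination 2*π*((k : ℝ) + 1)*this
    rw [this]; push_cast; field_simp
  · have hb : Polynomial.eval (fract w) (Polynomial.map (algebraMap ℚ ℝ)
        (Polynomial.bernoulli (2*1))) = bernoulliFun 2 (fract w) := rfl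
    rw [hb, bernoulliFun_two]; simp only [Nat.factorial]; norm_num; field_simp

lemma continuous_bernoulliTerm (k : ℕ) : Continuous (bernoulliTerm k) := by unfold bernoulliTerm; fun_prop

lemma continuous_fract_quadratic : Continuous fun w : ℝ => (fract w^2 - fract w + 1/6)/2 := by
  have : (fun w : ℝ => (fract w^2 - fract w + 1/6)/2) = fun w => ∑' k, bernoulliTerm k w := by
    funext w; exact (hasSum_bernoulliTerm w).tsum_eq.symm
  rw [this]
  exact continuous_tsum continuous_bernoulliTerm summable_bernoulliBound fun k w => by
    rw [norm_eq_abs]; exact abs_bernoulliTerm_le k w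

/-- At the integers the function has a corner, so only a one-sided derivative exists everywhere;
integration by parts in its right-derivative form needs no more. -/
lemma hasDerivWithinAt_fract_quadratic (w : ℝ) : HasDerivWithinAt (fun w : ℝ => (fract w^2 - fract w + 1/6)/2)
      (fract w - 1/2) (Ioi w) w := by
  have h : HasDerivWithinAt (fun x : ℝ => (((x - ⌊w⌋)^2 - (x - ⌊w⌋) + 1/6)/2)) (fract w - 1/2) (Ioi w) w := by
    have h1 : HasDerivAt (fun x : ℝ => x - (⌊w⌋ : ℝ)) 1 w := (hasDerivAt_id w).sub_const _
    have := (((h1.pow 2).sub h1).add_const (1/6 : ℝ)).div_const 2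
    refine (this.congr_deriv ?_).hasDerivWithinAt
    simp only [fract]; ring
  refine h.congr_of_eventuallyEq ?_ (by simp only [fract])
  have : ∀ᶠ x : ℝ in 𝓝[>] w, x < (⌊w⌋ : ℝ) + 1 := nhdsWithin_le_nhds (Iio_mem_nhds (Int.lt_floor_add_one w))
  filter_upwards [this, self_mem_nhdsWithin] with x hx hx'
  have : ⌊x⌋ = ⌊w⌋ := Int.floor_eq_iff.2 ⟨(Int.floor_le w).trans (le_of_lt hx'), hx⟩
  simp only [fract, this]

lemma intervalIntegrable_fract_sub_half (p q : ℝ) : IntervalIntegrable (fun w : ℝ => fract w - 1/2) volume p q := by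
  have hm : Measurable fun w : ℝ => fract w - 1/2 := measurable_fract.sub_const _
  refine (intervalIntegrable_const (c := (1 : ℝ))).mono_fun hm.aestronglyMeasurable ?_
  refine Eventually.of_forall fun w => ?_
  simp only [norm_one, norm_eq_abs, abs_le]
  constructor <;> linarith [fract_nonneg w, fract_lt_one w]

lemma intervalIntegrable_ofReal_fract_sub_half (p q : ℝ) :
    IntervalIntegrable (fun w : ℝ => ((fract w - 1/2 : ℝ) : ℂ)) volume p q :=
  ⟨(intervalIntegrable_fract_sub_half p q).1.ofReal, (intervalIntegrable_fract_sub_half p q).2.ofReal⟩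

section
variable {F F' F'' : ℝ → ℂ} {p q : ℝ}

/-- Euler–Maclaurin summation of first order. -/
lemma sum_Ioc_eq_integral_add_fract (hp : 0 ≤ p) (hpq : p ≤ q)
    (h1 : ∀ w ∈ Icc p q, HasDerivAt F (F' w) w) (h2 : ContinuousOn F' (Icc p q)) :
    ∑ n ∈ Ioc ⌊p⌋₊ ⌊q⌋₊, F n = (∫ w in p..q, F w) - F q*(fract q - 1/2 : ℝ) +
      F p*(fract p - 1/2 : ℝ) + ∫ w in p..q, F' w*(fract w - 1/2 : ℝ) := by
  have hu : uIcc p q = Icc p q := uIcc_of_le hpq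
  have hFc : ContinuousOn F (Icc p q) := HasDerivAt.continuousOn h1
  have hd : EqOn (deriv F) F' (Icc p q) := fun w hw => (h1 w hw).deriv
  have hA := sum_mul_eq_sub_sub_integral_mul (fun _ => (1 : ℂ)) hp hpq (fun t ht => (h1 t ht).differentiableAt)
    ((h2.integrableOn_compact isCompact_Icc).congr_fun hd.symm measurableSet_Icc)
  simp only [mul_one, sum_const, Nat.card_Icc, nsmul_eq_mul, tsub_zero, Nat.cast_add, cast_one] at hA
  rw [hA, ← integral_of_le hpq]
  -- The summatory function of the constant 1 counts n = 0 as well, hence the extra 1.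
  have hfl : ∀ w ∈ Icc p q, ((⌊w⌋₊ : ℕ) : ℂ) + 1 = (w : ℂ) - (fract w - 1/2 : ℝ) + 1/2 := fun w hw => by
    have h0 : 0 ≤ w := hp.trans hw.1
    have : ((⌊w⌋₊ : ℕ) : ℝ) = w - fract w := by rw [natCast_floor_eq_intCast_floor h0]; simp
    have h' : ((⌊w⌋₊ : ℕ) : ℂ) = ((w - fract w : ℝ) : ℂ) := by rw [← this]; norm_cast
    rw [h']; push_cast; ring
  have hint : ∫ t in p..q, deriv F t*(((⌊t⌋₊ : ℕ) : ℂ) + 1) =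
      ∫ t in p..q, ((F t + F' t*(t : ℂ)) - F t) + F' t*(1/2) - F' t*(fract t - 1/2 : ℝ) := by
    refine integral_congr fun t ht => ?_
    grind
  have hF'i : IntervalIntegrable F' volume p q := (hu ▸ h2).intervalIntegrable
  have hFi : IntervalIntegrable F volume p q := (hu ▸ hFc).intervalIntegrable
  have hGc : ContinuousOn (fun t : ℝ => F t + F' t*(t : ℂ)) (Icc p q) := by fun_prop
  have hGi : IntervalIntegrable (fun t : ℝ => F t + F' t*(t : ℂ)) volume p q := (hu ▸ hGc).intervalIntegrable
  have hψi : IntervalIntegrable (fun t : ℝ => F' t*((fract t - 1/2 : ℝ) : ℂ)) volume p q :=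
    (intervalIntegrable_ofReal_fract_sub_half p q).continuousOn_mul (hu ▸ h2)
  have hT : ∫ t in p..q, (F t + F' t*(t : ℂ)) = F q*q - F p*p := by
    refine integral_eq_sub_of_hasDerivAt (f := fun t : ℝ => F t*(t : ℂ)) (fun t ht => ?_) hGi
    have := (h1 t (hu ▸ ht)).mul (hasDerivAt_id t).ofReal_comp
    refine this.congr_deriv ?_
    simp; ring
  have hT' : ∫ t in p..q, F' t = F q - F p := integral_eq_sub_of_hasDerivAt (fun t ht => h1 t (hu ▸ ht)) hF'i
  rw [hint, integral_sub ((hGi.sub hFi).add (hF'i.mul_const _)) hψi, integral_add (hGi.sub hFi) (hF'i.mul_const _),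
    integral_sub hGi hFi, hT, integral_mul_const, hT',
    hfl q ⟨hpq, le_rfl⟩, hfl p ⟨le_rfl, hpq⟩]
  push_cast
  ring

/-- One integration by parts replaces the sawtooth by half the second periodic Bernoulli function,
whose Fourier series converges absolutely, so the sum comes out of the integral by dominated
convergence. Summability is recorded because the series is later split at a finite frequency. -/
lemma integral_mul_fract_sub_half (hpq : p ≤ q) (h2 : ∀ w ∈ Icc p q, HasDerivAt F' (F'' w) w) (h3 : ContinuousOn F'' (Icc p q)) :
    ∫ w in p..q, F' w*(fract w - 1/2 : ℝ) = ∑' k, (F' q*bernoulliTerm k q - F' p*bernoulliTerm k p -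
        ∫ w in p..q, F'' w*bernoulliTerm k w) ∧
      Summable (fun k => F' q*bernoulliTerm k q - F' p*bernoulliTerm k p - ∫ w in p..q, F'' w*bernoulliTerm k w) := by
  have hu : uIcc p q = Icc p q := uIcc_of_le hpq
  have hF'c : ContinuousOn F' (Icc p q) := HasDerivAt.continuousOn h2
  set B : ℝ → ℂ := fun w => (((fract w^2 - fract w + 1/6)/2 : ℝ) : ℂ)
  have hBs : ∀ w, HasSum (fun k => (bernoulliTerm k w : ℂ)) (B w) := fun w => ofRealCLM.hasSum (hasSum_bernoulliTerm w)
  have hparts := intervalIntegral.integral_mul_deriv_eq_deriv_mul_of_hasDeriv_right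
    (u := F') (v := B) (u' := F'') (v' := fun w => ((fract w - 1/2 : ℝ) : ℂ)) (a := p) (b := q)
    (hu ▸ hF'c) (continuous_ofReal.comp continuous_fract_quadratic).continuousOn
    (fun x hx => by
      rw [min_eq_left hpq, max_eq_right hpq] at hx; exact (h2 x (Ioo_subset_Icc_self hx)).hasDerivWithinAt)
    (fun x _ => (hasDerivWithinAt_fract_quadratic x).ofReal_comp)
    ((hu ▸ h3).intervalIntegrable) (intervalIntegrable_ofReal_fract_sub_half p q)
  have hS : HasSum (fun k => ∫ w in p..q, F'' w*bernoulliTerm k w) (∫ w in p..q, F'' w*B w) := by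
    refine intervalIntegral.hasSum_integral_of_dominated_convergence
      (fun k w => ‖F'' w‖*(1/(2*π^2*((k : ℝ) + 1)^2))) ?_ ?_ ?_ ?_ ?_
    · intro k
      have : ContinuousOn (fun w => F'' w*(bernoulliTerm k w : ℂ)) (uIcc p q) := by
        rw [hu]; exact h3.mul (continuous_ofReal.comp (continuous_bernoulliTerm k)).continuousOn
      exact this.intervalIntegrable.def'.aestronglyMeasurable
    · intro k; refine Eventually.of_forall fun w _ => ?_
      rw [norm_mul, norm_real, norm_eq_abs]
      exact mul_le_mul_of_nonneg_left (abs_bernoulliTerm_le k w) (norm_nonneg _)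
    · exact Eventually.of_forall fun w _ => summable_bernoulliBound.mul_left _
    · simp_rw [tsum_mul_left]; exact ((hu ▸ h3).norm.intervalIntegrable).mul_const _
    · exact Eventually.of_forall fun w _ => (hBs w).mul_left _
  have := (((hBs q).mul_left (F' q)).sub ((hBs p).mul_left (F' p))).sub hS
  rw [hparts]
  exact ⟨this.tsum_eq.symm, this.summable⟩

/-- Undoes the integration by parts in a single frequency. Low frequencies are used in the form on
the right, as cosine integrals with boundary sines; high frequencies in the form on the left, which
decays like 1/k². -/
lemma integral_mul_bernoulliTerm (hpq : p ≤ q) (h1 : ∀ w ∈ Icc p q, HasDerivAt F (F' w) w)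
    (h2 : ∀ w ∈ Icc p q, HasDerivAt F' (F'' w) w) (h3 : ContinuousOn F'' (Icc p q)) (k : ℕ) :
    F' q*bernoulliTerm k q - F' p*bernoulliTerm k p - ∫ w in p..q, F'' w*bernoulliTerm k w =
      (∫ w in p..q, F w*(2*cos (2*π*(k + 1)*w) : ℝ)) -
      (F q*(sin (2*π*(k + 1)*q)/(π*(k + 1)) : ℝ) - F p*(sin (2*π*(k + 1)*p)/(π*(k + 1)) : ℝ)) := by
  have hu : uIcc p q = Icc p q := uIcc_of_le hpq
  have hFc : ContinuousOn F (Icc p q) := HasDerivAt.continuousOn h1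
  have hlin : ∀ w : ℝ, HasDerivAt (fun w : ℝ => 2*π*(k + 1)*w) (2*π*(k + 1)) w := fun w => by
    simpa using (hasDerivAt_id w).const_mul (2*π*((k : ℝ) + 1))
  have hk : ((k : ℝ) + 1) ≠ 0 := by positivity
  have hb : ∀ w : ℝ, HasDerivAt (bernoulliTerm k) (-(sin (2*π*(k + 1)*w)/(π*(k + 1)))) w := fun w => by
    refine ((hlin w).cos.div_const (2*π^2*((k : ℝ) + 1)^2)).congr_deriv ?_
    field_simp
  have hs : ∀ w : ℝ, HasDerivAt (fun w => sin (2*π*(k + 1)*w)/(π*(k + 1))) (2*cos (2*π*(k + 1)*w)) w := fun w => by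
    refine ((hlin w).sin.div_const (π*((k : ℝ) + 1))).congr_deriv ?_
    field_simp
  set G : ℝ → ℂ := fun w => F' w*bernoulliTerm k w + F w*(sin (2*π*(k + 1)*w)/(π*(k + 1)) : ℝ)
  have hGd : ∀ w ∈ Icc p q, HasDerivAt G (F'' w*bernoulliTerm k w + F w*(2*cos (2*π*(k + 1)*w) : ℝ)) w := fun w hw => by
    refine (((h2 w hw).mul (hb w).ofReal_comp).add ((h1 w hw).mul (hs w).ofReal_comp)).congr_deriv ?_
    push_cast; ring
  have hc1 : ContinuousOn (fun w => F'' w*(bernoulliTerm k w : ℂ)) (Icc p q) :=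
    h3.mul (continuous_ofReal.comp (continuous_bernoulliTerm k)).continuousOn
  have hc2 : ContinuousOn (fun w => F w*((2*cos (2*π*(k + 1)*w) : ℝ) : ℂ)) (Icc p q) := by
    refine hFc.mul (Continuous.continuousOn ?_)
    fun_prop
  have := integral_eq_sub_of_hasDerivAt (fun w hw => hGd w (hu ▸ hw)) ((hu ▸ hc1.add hc2).intervalIntegrable)
  rw [integral_add (hu ▸ hc1).intervalIntegrable (hu ▸ hc2).intervalIntegrable] at this
  grind

end

/-! ### Truncated Poisson summation -/

lemma integral_abs_le_of_const_sign {f' f'' : ℝ → ℝ} {p q θ : ℝ} (hpq : p ≤ q)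
    (h2 : ∀ w ∈ Icc p q, HasDerivAt f' (f'' w) w) (h3 : ContinuousOn f'' (Icc p q))
    (hs : (∀ w ∈ Icc p q, 0 ≤ f'' w) ∨ (∀ w ∈ Icc p q, f'' w ≤ 0))
    (hθ : ∀ w ∈ Icc p q, |f' w| ≤ θ) : ∫ w in p..q, |f'' w| ≤ 2*θ := by
  have hu : uIcc p q = Icc p q := uIcc_of_le hpq
  have hfin := integral_eq_sub_of_hasDerivAt (a := p) (b := q) (fun w hw => h2 w (hu ▸ hw)) ((hu ▸ h3).intervalIntegrable)
  have hp := abs_le.1 (hθ p ⟨le_rfl, hpq⟩)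
  have hq := abs_le.1 (hθ q ⟨hpq, le_rfl⟩)
  rcases hs with hs | hs
  · have : ∫ w in p..q, |f'' w| = ∫ w in p..q, f'' w := integral_congr fun w hw => abs_of_nonneg (hs w (hu ▸ hw))
    linarith
  · have : ∫ w in p..q, |f'' w| = ∫ w in p..q, -f'' w := integral_congr fun w hw => abs_of_nonpos (hs w (hu ▸ hw))
    rw [this, integral_neg, hfin]; linarith

lemma exp_mul_cos_eq (x y : ℝ) : cexp (I*x)*(2*cos y : ℝ) = cexp (I*(x + y : ℝ)) + cexp (I*(x - y : ℝ)) := by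
  push_cast
  rw [Complex.two_cos, mul_add, ← exp_add, ← exp_add]
  congr 2 <;> ring

lemma sum_range_one_div_le_one_add_log (K : ℕ) : ∑ k ∈ range K, 1/((k : ℝ) + 1) ≤ 1 + log K := by
  have := harmonic_le_one_add_log K
  simpa [harmonic, one_div] using this

lemma tsum_one_div_sq_tail_le {K : ℕ} (hK : 1 ≤ K) : ∑' k : ℕ, 1/((k : ℝ) + K + 1)^2 ≤ (1/K : ℝ) := by
  refine Real.tsum_le_of_sum_range_le (fun k => by positivity) fun n => ?_
  have h : ∀ n : ℕ, ∑ k ∈ range n, 1/((k : ℝ) + K + 1)^2 ≤ (1/K - 1/((n : ℝ) + K) : ℝ) := fun n => by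
    have hK' : (1 : ℝ) ≤ K := mod_cast hK
    induction n with
    | zero => simp
    | succ n ih =>
      rw [sum_range_succ]
      have : 1/((n : ℝ) + K + 1)^2 ≤ 1/((n : ℝ) + K) - 1/((n : ℝ) + K + 1) := by
        rw [div_sub_div _ _ (by positivity) (by positivity), div_le_div_iff₀ (by positivity) (by positivity)]
        nlinarith
      grind
  have := h n
  have : (0 : ℝ) ≤ 1/((n : ℝ) + K) := by positivity
  linarith [h n]

section
variable {f f' f'' : ℝ → ℝ} {p q θ : ℝ}

/-- As |m| ≥ 2θ, the phase f + mw has derivative at least |m|/2 in modulus and the first derivative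
test applies; the amplitude f'² has variation at most 4θ² because f'' keeps one sign. -/
lemma norm_integral_deriv_sq_mul_exp_le (hpq : p ≤ q)
    (h1 : ∀ w ∈ Icc p q, HasDerivAt f (f' w) w) (h2 : ∀ w ∈ Icc p q, HasDerivAt f' (f'' w) w)
    (h3 : ContinuousOn f'' (Icc p q))
    (hs : (∀ w ∈ Icc p q, 0 ≤ f'' w) ∨ (∀ w ∈ Icc p q, f'' w ≤ 0))
    (hθ : ∀ w ∈ Icc p q, |f' w| ≤ θ) {m : ℝ} (hm : θ + |m|/2 ≤ |m|) (hm0 : 0 < |m|) :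
    ‖∫ w in p..q, ((f' w^2 : ℝ) : ℂ)*cexp (I*(f w + m*w : ℝ))‖ ≤ 40*θ^2/|m| := by
  have hu : uIcc p q = Icc p q := uIcc_of_le hpq
  have hθ0 : 0 ≤ θ := (abs_nonneg _).trans (hθ p ⟨le_rfl, hpq⟩)
  have hf'c : ContinuousOn f' (Icc p q) := HasDerivAt.continuousOn h2
  have hg : ∀ w ∈ Icc p q, HasDerivAt (fun w => ((f' w^2 : ℝ) : ℂ)) ((2*f' w*f'' w : ℝ) : ℂ) w := fun w hw => by
    refine (((h2 w hw).pow 2).ofReal_comp).congr_deriv ?_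
    push_cast; ring
  have hg'c : ContinuousOn (fun w => ((2*f' w*f'' w : ℝ) : ℂ)) (Icc p q) := continuous_ofReal.comp_continuousOn (by fun_prop)
  have := norm_integral_mul_exp_le_of_le_abs_deriv (φ := fun w => f w + m*w) (φ' := fun w => f' w + m) (φ'' := f'') (l := |m|/2)
    (g := fun w => ((f' w^2 : ℝ) : ℂ)) hpq
    (fun w hw => ((h1 w hw).add ((hasDerivAt_id w).const_mul m)).congr_deriv (by simp))
    (fun w hw => (h2 w hw).add_const m) h3 hs (by positivity)
    (fun w hw => by grind) hg hg'c
  refine this.trans ?_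
  have hvar : ∫ w in p..q, ‖((2*f' w*f'' w : ℝ) : ℂ)‖ ≤ 4*θ^2 := by
    calc _ ≤ ∫ w in p..q, 2*θ*|f'' w| := by
          refine integral_mono_on hpq (hu ▸ hg'c.norm).intervalIntegrable
            ((hu ▸ h3.abs).intervalIntegrable.const_mul _) fun w hw => ?_
          rw [norm_real, norm_eq_abs, abs_mul, abs_mul, abs_two]; gcongr; exact hθ w hw
      _ ≤ 2*θ*(2*θ) := by rw [integral_const_mul]; gcongr; exact integral_abs_le_of_const_sign hpq h2 h3 hs hθ
      _ = _ := by ring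
  have hend : ‖((f' q^2 : ℝ) : ℂ)‖ ≤ θ^2 := by rw [norm_real, norm_eq_abs, abs_pow]; gcongr; grind
  calc _ ≤ 4/(|m|/2)*(θ^2 + 4*θ^2) := by gcongr
    _ = _ := by field_simp; ring

/-- Truncated Poisson summation for an exponential sum with monotone frequency. -/
lemma norm_sum_exp_sub_integrals_le {K : ℕ} (hp : 0 ≤ p) (hpq : p ≤ q)
    (h1 : ∀ w ∈ Icc p q, HasDerivAt f (f' w) w) (h2 : ∀ w ∈ Icc p q, HasDerivAt f' (f'' w) w)
    (h3 : ContinuousOn f'' (Icc p q))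
    (hs : (∀ w ∈ Icc p q, 0 ≤ f'' w) ∨ (∀ w ∈ Icc p q, f'' w ≤ 0))
    (hθ : ∀ w ∈ Icc p q, |f' w| ≤ θ) (hK : 1 ≤ K) (hθK : θ ≤ π*K) :
    ‖∑ n ∈ Ioc ⌊p⌋₊ ⌊q⌋₊, cexp (I*f n) - ((∫ w in p..q, cexp (I*f w)) + ∑ k ∈ range K, ∫ w in p..q, cexp (I*f w) *
          (2*cos (2*π*(k + 1)*w) : ℝ))‖ ≤ 10*(1 + log K) := by
  have hu : uIcc p q = Icc p q := uIcc_of_le hpq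
  have hpI : p ∈ Icc p q := ⟨le_rfl, hpq⟩
  have hqI : q ∈ Icc p q := ⟨hpq, le_rfl⟩
  have hθ0 : 0 ≤ θ := (abs_nonneg _).trans (hθ p hpI)
  have hfc : ContinuousOn f (Icc p q) := HasDerivAt.continuousOn h1
  have hf'c : ContinuousOn f' (Icc p q) := HasDerivAt.continuousOn h2
  have hpi : 0 < π := pi_pos
  have hKR : (1 : ℝ) ≤ K := mod_cast hK
  set F : ℝ → ℂ := fun w => cexp (I*f w) with hF
  set F' : ℝ → ℂ := fun w => F w*(I*f' w) with hF'
  set F'' : ℝ → ℂ := fun w => F w*(I*f'' w) - F w*((f' w^2 : ℝ) : ℂ) with hF''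
  have hFn : ∀ w, ‖F w‖ = 1 := fun w => by simp only [hF]; simp
  have hFd : ∀ w ∈ Icc p q, HasDerivAt F (F' w) w := fun w hw => ((h1 w hw).ofReal_comp.const_mul I).cexp
  have hF'd : ∀ w ∈ Icc p q, HasDerivAt F' (F'' w) w := fun w hw => by
    refine ((hFd w hw).mul ((h2 w hw).ofReal_comp.const_mul I)).congr_deriv ?_
    simp only [hF'', hF']; push_cast
    linear_combination (F w*(f' w)^2)*Complex.I_mul_I
  have hFc : ContinuousOn F (Icc p q) := HasDerivAt.continuousOn hFd
  have hF1c : ContinuousOn (fun w => F w*(I*f'' w)) (Icc p q) := by fun_prop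
  have hF2c : ContinuousOn (fun w => F w*((f' w^2 : ℝ) : ℂ)) (Icc p q) :=
    hFc.mul (continuous_ofReal.comp_continuousOn (by fun_prop))
  have hF''c : ContinuousOn F'' (Icc p q) := hF1c.sub hF2c
  have hF'c : ContinuousOn F' (Icc p q) := fun w hw => (hF'd w hw).continuousAt.continuousWithinAt
  have hsum := sum_Ioc_eq_integral_add_fract hp hpq hFd hF'c
  obtain ⟨hψ, hsm⟩ := integral_mul_fract_sub_half hpq hF'd hF''c
  set T : ℕ → ℂ := fun k => F' q*bernoulliTerm k q - F' p*bernoulliTerm k p - ∫ w in p..q, F'' w*bernoulliTerm k w with hT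
  have hTk := integral_mul_bernoulliTerm hpq hFd hF'd hF''c
  have hF'n : ∀ w ∈ Icc p q, ‖F' w‖ ≤ θ := fun w hw => by
    simp only [hF']; rw [norm_mul, norm_mul, hFn, norm_I, norm_real, norm_eq_abs, one_mul, one_mul]
    exact hθ w hw
  -- the tail
  have htail : ∀ k : ℕ, ‖T (k + K)‖ ≤ 12*K/π*(1/((k : ℝ) + K + 1)^2) := fun k => by
    set m : ℝ := (k : ℝ) + K + 1 with hm
    have hmK : (K : ℝ) ≤ m := by linarith
    have hcast : (((k + K : ℕ) : ℝ) + 1) = m := by push_cast; rw [hm]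
    set D := 2*π^2*m^2 with hD
    have hD0 : 0 < D := by positivity
    have hb : ∀ w, ‖(bernoulliTerm (k + K) w : ℂ)‖ ≤ 1/D := fun w => by
      rw [norm_real, norm_eq_abs, hD, ← hcast]; exact abs_bernoulliTerm_le _ w
    have hθm : θ ≤ π*m := hθK.trans (by gcongr)
    have e1 : ‖F' q*(bernoulliTerm (k + K) q : ℂ)‖ ≤ θ*(1/D) := by
      rw [norm_mul]; exact mul_le_mul (hF'n q hqI) (hb q) (norm_nonneg _) hθ0
    have e2 : ‖F' p*(bernoulliTerm (k + K) p : ℂ)‖ ≤ θ*(1/D) := by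
      rw [norm_mul]; exact mul_le_mul (hF'n p hpI) (hb p) (norm_nonneg _) hθ0
    have hbc : Continuous fun w => (bernoulliTerm (k + K) w : ℂ) := continuous_ofReal.comp (continuous_bernoulliTerm _)
    have hi1 : IntervalIntegrable (fun w => F w*(I*f'' w)*(bernoulliTerm (k + K) w : ℂ))
        volume p q := (hu ▸ hF1c.mul hbc.continuousOn).intervalIntegrable
    have hi2 : IntervalIntegrable (fun w => F w*((f' w^2 : ℝ) : ℂ)*(bernoulliTerm (k + K) w : ℂ))
        volume p q := (hu ▸ hF2c.mul hbc.continuousOn).intervalIntegrable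
    -- F'' consists of a part with f'', absolutely integrable with total at most 2θ, and a part with
    -- f'², where cancellation is needed: split into the frequencies ±2πm it gains a factor O(θ/m) =
    -- O(1). Both parts are then O(θ/m²).
    have e3 : ∫ w in p..q, F'' w*(bernoulliTerm (k + K) w : ℂ) = (∫ w in p..q, F w*(I*f'' w)*(bernoulliTerm (k + K) w : ℂ)) -
        ∫ w in p..q, F w*((f' w^2 : ℝ) : ℂ)*(bernoulliTerm (k + K) w : ℂ) := by
      rw [← integral_sub hi1 hi2]; simp only [hF'', sub_mul]
    have e4 : ‖∫ w in p..q, F w*(I*f'' w)*(bernoulliTerm (k + K) w : ℂ)‖ ≤ 2*θ*(1/D) := by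
      refine (norm_integral_le_of_norm_le hpq (g := fun w => |f'' w| *(1/D)) ?_
        ((hu ▸ h3.abs).intervalIntegrable.mul_const _)).trans ?_
      · refine Eventually.of_forall fun w _ => ?_
        rw [norm_mul, norm_mul, norm_mul, hFn, norm_I, one_mul, one_mul, norm_real, norm_eq_abs]
        exact mul_le_mul_of_nonneg_left (hb w) (abs_nonneg _)
      · rw [integral_mul_const]; gcongr; exact integral_abs_le_of_const_sign hpq h2 h3 hs hθ
    have e5 : ‖∫ w in p..q, F w*((f' w^2 : ℝ) : ℂ)*(bernoulliTerm (k + K) w : ℂ)‖ ≤ 20*θ*(1/D) := by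
      have habs : |2*π*m| = 2*π*m := abs_of_pos (by positivity)
      have hA := norm_integral_deriv_sq_mul_exp_le hpq h1 h2 h3 hs hθ (m := 2*π*m)
        (by rw [habs]; nlinarith) (by rw [habs]; positivity)
      have hB := norm_integral_deriv_sq_mul_exp_le hpq h1 h2 h3 hs hθ (m := -(2*π*m))
        (by rw [abs_neg, habs]; nlinarith) (by rw [abs_neg, habs]; positivity)
      rw [abs_neg] at hB; rw [habs] at hA hB
      have hcc : ∀ c : ℝ, ContinuousOn (fun w => ((f' w^2 : ℝ) : ℂ) * cexp (I*(f w + c*w : ℝ))) (uIcc p q) := fun c => by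
        rw [hu]; fun_prop
      have : ∫ w in p..q, F w*((f' w^2 : ℝ) : ℂ)*(bernoulliTerm (k + K) w : ℂ) =
          (1/(2*D) : ℝ)*((∫ w in p..q, ((f' w^2 : ℝ) : ℂ)*cexp (I*(f w + 2*π*m*w : ℝ))) +
            ∫ w in p..q, ((f' w^2 : ℝ) : ℂ)*cexp (I*(f w + -(2*π*m)*w : ℝ))) := by
        rw [← integral_add (hcc _).intervalIntegrable (hcc _).intervalIntegrable, ← integral_const_mul]
        refine integral_congr fun w _ => ?_
        have hx := exp_mul_cos_eq (f w) (2*π*m*w)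
        rw [neg_mul, ← sub_eq_add_neg, ← mul_add, ← hx, bernoulliTerm, hcast, ← hD]; simp only [hF]
        have : (D : ℂ) ≠ 0 := mod_cast hD0.ne'
        push_cast; field_simp
      rw [this, norm_mul, norm_real, norm_eq_abs, abs_of_pos (by positivity)]
      have h20 : 40*θ^2/(2*π*m) ≤ 20*θ := by rw [div_le_iff₀ (by positivity)]; nlinarith
      calc _ ≤ 1/(2*D)*(20*θ + 20*θ) := by
            gcongr; exact (norm_add_le _ _).trans (add_le_add (hA.trans h20) (hB.trans h20))
        _ = _ := by field_simp; ring
    have : ‖T (k + K)‖ ≤ 24*θ*(1/D) := by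
      simp only [hT]; rw [e3]
      calc _ ≤ _ := norm_sub_le _ _
        _ ≤ _ := add_le_add (norm_sub_le _ _) (norm_sub_le _ _)
        _ ≤ (θ*(1/D) + θ*(1/D)) + (2*θ*(1/D) + 20*θ*(1/D)) := add_le_add (add_le_add e1 e2) (add_le_add e4 e5)
        _ = _ := by ring
    refine this.trans ?_
    rw [hD, mul_one_div, ← mul_div_assoc, mul_one, div_div, div_le_div_iff₀ (by positivity) (by positivity)]
    nlinarith [mul_le_mul_of_nonneg_right hθK (by positivity : 0 ≤ π*m^2)]
  have hsq : Summable fun k : ℕ => 1/((k : ℝ) + K + 1)^2 := by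
    have := (summable_nat_add_iff (K + 1)).2 (Real.summable_one_div_nat_pow.2 (one_lt_two))
    refine this.congr fun k => ?_
    push_cast; ring
  -- θ ≤ πK makes the tail terms O(K/m²), and these sum to O(1) beyond K.
  have htailsum : ‖∑' k, T (k + K)‖ ≤ 4 := by
    refine (tsum_of_norm_bounded (hsq.mul_left (12*K/π)).hasSum htail).trans ?_
    rw [tsum_mul_left]
    calc _ ≤ 12*K/π*(1/K) := by gcongr; exact tsum_one_div_sq_tail_le hK
      _ = 12/π := by field_simp
      _ ≤ 4 := by rw [div_le_iff₀ hpi]; linarith [pi_gt_three]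
  -- The boundary sines of the retained frequencies form a harmonic sum, the only source of the
  -- logarithm.
  have hbd : ‖∑ k ∈ range K, (F q*(sin (2*π*(k + 1)*q)/(π*(k + 1)) : ℝ) -
        F p*(sin (2*π*(k + 1)*p)/(π*(k + 1)) : ℝ))‖ ≤ 1 + log K := by
    refine (norm_sum_le _ _).trans (le_trans ?_ (sum_range_one_div_le_one_add_log K))
    refine sum_le_sum fun k _ => ?_
    have hx : ∀ y : ℝ, ‖F y*((sin (2*π*(k + 1)*y)/(π*(k + 1)) : ℝ) : ℂ)‖ ≤ 1/(π*(k + 1)) := fun y => by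
      rw [norm_mul, hFn, one_mul, norm_real, norm_eq_abs, abs_div, abs_of_pos (a := π*((k : ℝ) + 1)) (by positivity)]
      gcongr; exact Real.abs_sin_le_one _
    calc _ ≤ _ := norm_sub_le _ _
      _ ≤ 1/(π*(k + 1)) + 1/(π*(k + 1)) := add_le_add (hx q) (hx p)
      _ = 2/(π*(k + 1)) := by ring
      _ ≤ 1/(k + 1) := by
        rw [div_le_div_iff₀ (by positivity) (by positivity)]
        nlinarith [pi_gt_three, (cast_nonneg k : (0 : ℝ) ≤ k)]
  have hfr : ∀ w, ‖F w*((fract w - 1/2 : ℝ) : ℂ)‖ ≤ 1 := fun w => by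
    rw [norm_mul, hFn, one_mul, norm_real, norm_eq_abs, abs_le]
    constructor <;> linarith [fract_nonneg w, fract_lt_one w]
  have key : ∑ n ∈ Ioc ⌊p⌋₊ ⌊q⌋₊, F n - ((∫ w in p..q, F w) + ∑ k ∈ range K, ∫ w in p..q, F w*(2*cos (2*π*(k + 1)*w) : ℝ)) =
      (F p*((fract p - 1/2 : ℝ) : ℂ) - F q*((fract q - 1/2 : ℝ) : ℂ)) +
      ((∑' k, T (k + K)) - ∑ k ∈ range K, (F q*(sin (2*π*(k + 1)*q)/(π*(k + 1)) : ℝ) -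
        F p*(sin (2*π*(k + 1)*p)/(π*(k + 1)) : ℝ))) := by
    have hsplit := hsm.sum_add_tsum_nat_add K
    have hTs : ∑ k ∈ range K, T k = (∑ k ∈ range K, (∫ w in p..q, F w*(2*cos (2*π*(k + 1)*w) : ℝ))) -
      ∑ k ∈ range K, (F q*(sin (2*π*(k + 1)*q)/(π*(k + 1)) : ℝ) - F p*(sin (2*π*(k + 1)*p)/(π*(k + 1)) : ℝ)) := by
      rw [← sum_sub_distrib]; exact sum_congr rfl fun k _ => hTk k
    rw [hsum, hψ, ← hsplit, hTs]; ring
  rw [key]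
  have hlog : 0 ≤ log K := log_nonneg hKR
  calc _ ≤ _ := norm_add_le _ _
    _ ≤ (1 + 1) + (4 + (1 + log K)) := add_le_add ((norm_sub_le _ _).trans (add_le_add (hfr p) (hfr q)))
        ((norm_sub_le _ _).trans (add_le_add htailsum hbd))
    _ ≤ _ := by linarith

end

/-- The Dirichlet kernel `∑_{|k| ≤ K} e(k w)`. -/
def dirichletKernel (K : ℕ) (w : ℝ) : ℝ := 1 + ∑ k ∈ range K, 2*cos (2*π*(k + 1)*w)

lemma continuous_dirichletKernel (K : ℕ) : Continuous (dirichletKernel K) := by unfold dirichletKernel; fun_prop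

lemma integral_mul_dirichletKernel {F : ℝ → ℂ} {p q : ℝ} (K : ℕ) (hF : ContinuousOn F (uIcc p q)) :
    ∫ w in p..q, F w*dirichletKernel K w = (∫ w in p..q, F w) + ∑ k ∈ range K, ∫ w in p..q, F w*(2*cos (2*π*(k + 1)*w) : ℝ) := by
  have hc : ∀ k : ℕ, ContinuousOn (fun w => F w*((2*cos (2*π*(k + 1)*w) : ℝ) : ℂ)) (uIcc p q) := fun k =>
    hF.mul (Continuous.continuousOn (by fun_prop))
  rw [← intervalIntegral.integral_finsetSum (fun k _ => (hc k).intervalIntegrable), ← integral_add hF.intervalIntegrable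
      (continuousOn_finsetSum _ fun k _ => hc k).intervalIntegrable]
  refine integral_congr fun w _ => ?_
  simp only [dirichletKernel]
  push_cast
  rw [mul_add, mul_one, mul_sum]

section
variable {f f' f'' : ℝ → ℝ} {g g' : ℝ → ℂ} {p q θ : ℝ}

/-- Truncated Poisson summation with an amplitude. -/
lemma norm_sum_mul_exp_sub_integral_le {K : ℕ} (hp : 0 ≤ p) (hpq : p ≤ q)
    (h1 : ∀ w ∈ Icc p q, HasDerivAt f (f' w) w) (h2 : ∀ w ∈ Icc p q, HasDerivAt f' (f'' w) w)
    (h3 : ContinuousOn f'' (Icc p q))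
    (hs : (∀ w ∈ Icc p q, 0 ≤ f'' w) ∨ (∀ w ∈ Icc p q, f'' w ≤ 0))
    (hθ : ∀ w ∈ Icc p q, |f' w| ≤ θ) (hK : 1 ≤ K) (hθK : θ ≤ π*K)
    (hg : ∀ w ∈ Icc p q, HasDerivAt g (g' w) w) (hg' : ContinuousOn g' (Icc p q)) :
    ‖∑ n ∈ Ioc ⌊p⌋₊ ⌊q⌋₊, g n*cexp (I*f n) - ∫ w in p..q, g w*cexp (I*f w)*dirichletKernel K w‖ ≤
      10*(1 + log K)*(‖g q‖ + ∫ w in p..q, ‖g' w‖) := by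
  have hu : uIcc p q = Icc p q := uIcc_of_le hpq
  set E : ℝ → ℂ := fun w => cexp (I*f w)*dirichletKernel K w with hE
  have hfc : ContinuousOn f (Icc p q) := HasDerivAt.continuousOn h1
  have hexpc : ContinuousOn (fun w => cexp (I*f w)) (Icc p q) := by fun_prop
  have hEc : ContinuousOn E (Icc p q) := hexpc.mul (continuous_ofReal.comp (continuous_dirichletKernel K)).continuousOn
  set B := 10*(1 + log K)
  -- Coefficients up to ⌊p⌋ are set to zero because Abel summation counts from n = 0.
  set c : ℕ → ℂ := fun n => if ⌊p⌋₊ < n then cexp (I*f n) else 0 with hc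
  have hcs : ∀ t ∈ Icc p q, ∑ n ∈ Finset.Icc 0 ⌊t⌋₊, c n = ∑ n ∈ Ioc ⌊p⌋₊ ⌊t⌋₊, cexp (I*f n) := fun t _ => by
    rw [hc, ← Finset.sum_filter]; refine sum_congr ?_ fun _ _ => rfl
    grind
  -- The discrepancy between partial sums and partial integrals is bounded uniformly in the upper
  -- limit. Abel summation of the sum and partial integration of the integral leave g and g' acting
  -- on this discrepancy only.
  have hD : ∀ t ∈ Icc p q, ‖∑ n ∈ Finset.Icc 0 ⌊t⌋₊, c n - ∫ w in p..t, E w‖ ≤ B := fun t ht => by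
    have hsub : Icc p t ⊆ Icc p q := Icc_subset_Icc_right ht.2
    rw [hcs t ht, integral_mul_dirichletKernel K (by rw [uIcc_of_le ht.1]; exact hexpc.mono hsub)]
    exact norm_sum_exp_sub_integrals_le hp ht.1 (fun w hw => h1 w (hsub hw)) (fun w hw => h2 w (hsub hw)) (h3.mono hsub)
      (hs.imp (fun h w hw => h w (hsub hw)) (fun h w hw => h w (hsub hw)))
      (fun w hw => hθ w (hsub hw)) hK hθK
  have hd : EqOn (deriv g) g' (Icc p q) := fun w hw => (hg w hw).deriv
  have hdi : IntegrableOn (deriv g) (Icc p q) := (hg'.integrableOn_compact isCompact_Icc).congr_fun hd.symm measurableSet_Icc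
  have hA := sum_mul_eq_sub_sub_integral_mul c hp hpq (fun t ht => (hg t ht).differentiableAt) hdi
  have hAi := integrableOn_mul_sum_Icc c (m := 0) hp hdi
  have hAi' : IntervalIntegrable (fun t => deriv g t * ∑ n ∈ Finset.Icc 0 ⌊t⌋₊, c n) volume p q := by
    rw [intervalIntegrable_iff_integrableOn_Icc_of_le hpq]; exact hAi
  have hlhs : ∑ n ∈ Ioc ⌊p⌋₊ ⌊q⌋₊, g n*c n = ∑ n ∈ Ioc ⌊p⌋₊ ⌊q⌋₊, g n*cexp (I*f n) := by
    refine sum_congr rfl fun n hn => ?_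
    grind
  obtain ⟨hcont, hparts⟩ := integral_mul_eq_sub_integral_primitive hpq hEc hg hg'
  have hgE : ∀ w, g w*cexp (I*f w)*dirichletKernel K w = g w*E w := fun w => by simp only [hE, mul_assoc]
  simp_rw [hgE]
  have hzero : ∑ n ∈ Finset.Icc 0 ⌊p⌋₊, c n = 0 := by rw [hcs p ⟨le_rfl, hpq⟩]; simp
  rw [← hlhs, hA, hzero, mul_zero, sub_zero, hparts, ← integral_of_le hpq]
  have hI2 : IntervalIntegrable (fun t => g' t * ∫ w in p..t, E w) volume p q := (hu ▸ hg'.mul hcont).intervalIntegrable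
  have hcongr : ∫ t in p..q, deriv g t * ∑ n ∈ Finset.Icc 0 ⌊t⌋₊, c n =
      ∫ t in p..q, (g' t*(∑ n ∈ Finset.Icc 0 ⌊t⌋₊, c n - ∫ w in p..t, E w) + g' t * ∫ w in p..t, E w) := by
    refine integral_congr fun t ht => ?_
    rw [hu] at ht; simp only [hd ht]; ring
  have hI1 : IntervalIntegrable (fun t => g' t*(∑ n ∈ Finset.Icc 0 ⌊t⌋₊, c n - ∫ w in p..t, E w)) volume p q := by
    refine (hAi'.sub hI2).congr fun t ht => ?_
    have ht' : t ∈ Icc p q := by rw [uIoc_of_le hpq] at ht; exact Ioc_subset_Icc_self ht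
    simp only [hd ht']; ring
  rw [hcongr, integral_add hI1 hI2]
  have hfin : g q*(∑ k ∈ Finset.Icc 0 ⌊q⌋₊, c k) -
      ((∫ t in p..q, g' t*(∑ n ∈ Finset.Icc 0 ⌊t⌋₊, c n - ∫ w in p..t, E w)) + ∫ t in p..q, g' t * ∫ w in p..t, E w) -
      (g q*(∫ w in p..q, E w) - ∫ t in p..q, g' t * ∫ w in p..t, E w) =
      g q*(∑ k ∈ Finset.Icc 0 ⌊q⌋₊, c k - ∫ w in p..q, E w) -
        ∫ t in p..q, g' t*(∑ n ∈ Finset.Icc 0 ⌊t⌋₊, c n - ∫ w in p..t, E w) := by ring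
  rw [hfin]
  have e1 : ‖g q*(∑ k ∈ Finset.Icc 0 ⌊q⌋₊, c k - ∫ w in p..q, E w)‖ ≤ B*‖g q‖ := by
    rw [norm_mul, mul_comm]; exact mul_le_mul_of_nonneg_right (hD q ⟨hpq, le_rfl⟩) (norm_nonneg _)
  have e2 := norm_integral_mul_le_mul_integral_norm hpq hg' hD
  calc _ ≤ _ := norm_sub_le _ _
    _ ≤ _ := by linarith

end

/-! ### Sums of n^(-s), truncations of the zeta function and the convexity bound -/

lemma cpow_neg_eq_rpow_mul_exp {w : ℝ} (hw : 0 < w) (s : ℂ) :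
    (w : ℂ)^(-s) = ((w^(-s.re) : ℝ) : ℂ)*cexp (I*(-s.im*log w : ℝ)) := by
  rw [cpow_def_of_ne_zero (mod_cast hw.ne'), rpow_def_of_pos hw, ofReal_exp, ← exp_add, ← ofReal_log hw.le]
  congr 1
  nth_rewrite 1 [← re_add_im s]
  push_cast; ring

lemma hasDerivAt_ofReal_rpow_neg {w : ℝ} (hw : 0 < w) (r : ℝ) :
    HasDerivAt (fun w : ℝ => ((w^(-r) : ℝ) : ℂ)) ((-r*w^(-r - 1) : ℝ) : ℂ) w :=
  (Real.hasDerivAt_rpow_const (Or.inl hw.ne')).ofReal_comp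

lemma continuousOn_ofReal_rpow_deriv {p q : ℝ} (hp : 0 < p) (r : ℝ) :
    ContinuousOn (fun w : ℝ => ((-r*w^(-r - 1) : ℝ) : ℂ)) (Icc p q) := by
  refine continuous_ofReal.comp_continuousOn (continuousOn_const.mul ?_)
  exact continuousOn_id.rpow_const fun w hw => Or.inl (hp.trans_le hw.1).ne'

/-- A power is monotone, so its total variation is the difference of its end values. -/
lemma rpow_variation_le {p q M r : ℝ} (hp : 0 < p) (hpq : p ≤ q) (hM : ∀ w ∈ Icc p q, w^(-r) ≤ M) :
    ‖((q^(-r) : ℝ) : ℂ)‖ + ∫ w in p..q, ‖((-r*w^(-r - 1) : ℝ) : ℂ)‖ ≤ 2*M := by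
  have hu : uIcc p q = Icc p q := uIcc_of_le hpq
  have hq : 0 < q := hp.trans_le hpq
  have hfin : ∫ w in p..q, (-r*w^(-r - 1)) = q^(-r) - p^(-r) := by
    refine integral_eq_sub_of_hasDerivAt (f := fun w : ℝ => w^(-r)) (fun w hw => ?_) ?_
    · exact Real.hasDerivAt_rpow_const (Or.inl (hp.trans_le (hu ▸ hw).1).ne')
    · refine ContinuousOn.intervalIntegrable (hu ▸ continuousOn_const.mul ?_)
      exact continuousOn_id.rpow_const fun w hw => Or.inl (hp.trans_le hw.1).ne'
  have hqM := hM q ⟨hpq, le_rfl⟩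
  have hpM := hM p ⟨le_rfl, hpq⟩
  have hq0 : 0 < q^(-r) := rpow_pos_of_pos hq _
  have hp0 : 0 < p^(-r) := rpow_pos_of_pos hp _
  rw [norm_real, norm_eq_abs, abs_of_pos hq0]
  rcases le_total 0 r with hr | hr
  · have : ∫ w in p..q, ‖((-r*w^(-r - 1) : ℝ) : ℂ)‖ = ∫ w in p..q, -(-r*w^(-r - 1)) := by
      refine integral_congr fun w hw => ?_
      have hw0 : 0 < w := hp.trans_le (hu ▸ hw).1
      have : 0 < w^(-r - 1) := rpow_pos_of_pos hw0 _
      simp only [norm_real, norm_eq_abs]; grind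
    rw [this, integral_neg, hfin]; linarith
  · have : ∫ w in p..q, ‖((-r*w^(-r - 1) : ℝ) : ℂ)‖ = ∫ w in p..q, (-r*w^(-r - 1)) := by
      refine integral_congr fun w hw => ?_
      have hw0 : 0 < w := hp.trans_le (hu ▸ hw).1
      have : 0 < w^(-r - 1) := rpow_pos_of_pos hw0 _
      simp only [norm_real, norm_eq_abs]; exact abs_of_nonneg (by nlinarith)
    linarith

lemma hasDerivAt_neg_mul_log {w : ℝ} (hw : 0 < w) (t : ℝ) : HasDerivAt (fun w : ℝ => -t*log w) (-t/w) w :=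
  ((Real.hasDerivAt_log hw.ne').const_mul (-t)).congr_deriv (by ring)

lemma hasDerivAt_neg_div {w : ℝ} (hw : 0 < w) (t : ℝ) : HasDerivAt (fun w : ℝ => -t/w) (t/w^2) w := by
  have := (hasDerivAt_inv hw.ne').const_mul (-t)
  grind

/-- Poisson summation for the phase −Im s · log w, whose derivative is at most |Im s|/p in modulus;
the cut-off K has to cover this frequency. -/
lemma norm_sum_cpow_sub_integral_le {p q M : ℝ} {K : ℕ} (s : ℂ) (hp : 0 < p) (hpq : p ≤ q)
    (hM : ∀ w ∈ Icc p q, w^(-s.re) ≤ M) (hK : 1 ≤ K) (hθK : |s.im|/p ≤ π*K) :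
    ‖∑ n ∈ Ioc ⌊p⌋₊ ⌊q⌋₊, (n : ℂ)^(-s) - ∫ w in p..q, (w : ℂ)^(-s)*dirichletKernel K w‖ ≤ 20*(1 + log K)*M := by
  have hu : uIcc p q = Icc p q := uIcc_of_le hpq
  have hpos : ∀ w ∈ Icc p q, 0 < w := fun w hw => hp.trans_le hw.1
  have h := norm_sum_mul_exp_sub_integral_le (f := fun w => -s.im*log w)
    (f' := fun w => -s.im/w) (f'' := fun w => s.im/w^2) (θ := |s.im|/p) (K := K)
    (g := fun w => ((w^(-s.re) : ℝ) : ℂ)) hp.le hpq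
    (fun w hw => hasDerivAt_neg_mul_log (hpos w hw) _) (fun w hw => hasDerivAt_neg_div (hpos w hw) _)
    (continuousOn_const.div (by fun_prop) fun w hw => pow_ne_zero 2 (hpos w hw).ne')
    (by
      rcases le_total 0 s.im with h | h
      · exact Or.inl fun w _ => by positivity
      · exact Or.inr fun w _ => div_nonpos_of_nonpos_of_nonneg h (by positivity))
    (fun w hw => by
      rw [abs_div, abs_neg, abs_of_pos (hpos w hw)]
      exact div_le_div_of_nonneg_left (abs_nonneg _) hp hw.1) hK hθK
    (fun w hw => hasDerivAt_ofReal_rpow_neg (hpos w hw) _) (continuousOn_ofReal_rpow_deriv hp _)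
  have e1 : ∑ n ∈ Ioc ⌊p⌋₊ ⌊q⌋₊, (n : ℂ)^(-s) = ∑ n ∈ Ioc ⌊p⌋₊ ⌊q⌋₊, (((n : ℝ)^(-s.re) : ℝ) : ℂ)*cexp (I*(-s.im*log n : ℝ)) := by
    refine sum_congr rfl fun n hn => ?_
    have hn0 : 0 < n := by grind
    rw [← cpow_neg_eq_rpow_mul_exp (mod_cast hn0)]; norm_cast
  have e2 : ∫ w in p..q, (w : ℂ)^(-s)*dirichletKernel K w = ∫ w in p..q,
      ((w^(-s.re) : ℝ) : ℂ)*cexp (I*(-s.im*log w : ℝ))*dirichletKernel K w := by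
    refine integral_congr fun w hw => ?_
    simp only [cpow_neg_eq_rpow_mul_exp (hpos w (hu ▸ hw)) s]
  rw [e1, e2]
  calc _ ≤ _ := h
    _ ≤ 10*(1 + log K)*(2*M) := by gcongr; exact rpow_variation_le hp hpq hM
    _ = _ := by ring

/-- For m < 0 the phase has no stationary point. For m > 0 the stationary point is t/m: beyond 2t/m
the derivative is at least m/2, and before it the second derivative t/w² is at least m²/(4t). Both
tests save 1/|m|, at the cost of at most a factor √t. -/
lemma norm_integral_rpow_mul_exp_le {p q M m : ℝ} {r t : ℝ} (hp : 0 < p) (hpq : p ≤ q)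
    (hM : ∀ w ∈ Icc p q, w^(-r) ≤ M) (ht : 0 ≤ t) (hm : m ≠ 0) :
    ‖∫ w in p..q, ((w^(-r) : ℝ) : ℂ)*cexp (I*(-t*log w + m*w : ℝ))‖ ≤ 40*M*(1 + √t)/|m| := by
  have hpos : ∀ w ∈ Icc p q, 0 < w := fun w hw => hp.trans_le hw.1
  have hM0 : 0 ≤ M := (Real.rpow_nonneg hp.le _).trans (hM p ⟨le_rfl, hpq⟩)
  have h1 : ∀ w, 0 < w → HasDerivAt (fun w : ℝ => -t*log w + m*w) (-t/w + m) w :=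
    fun w hw => ((hasDerivAt_neg_mul_log hw t).add ((hasDerivAt_id w).const_mul m)).congr_deriv (by simp)
  have h2 : ∀ w, 0 < w → HasDerivAt (fun w : ℝ => -t/w + m) (t/w^2) w := fun w hw => (hasDerivAt_neg_div hw t).add_const m
  have h3 : ∀ a b : ℝ, 0 < a → ContinuousOn (fun w : ℝ => t/w^2) (Icc a b) := fun a b ha =>
    continuousOn_const.div (by fun_prop) fun w hw => pow_ne_zero 2 (ha.trans_le hw.1).ne'
  have fd : ∀ a b l : ℝ, p ≤ a → a ≤ b → b ≤ q → 0 < l → (∀ w ∈ Icc a b, l ≤ |-t/w + m|) →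
      ‖∫ w in a..b, ((w^(-r) : ℝ) : ℂ)*cexp (I*(-t*log w + m*w : ℝ))‖ ≤ 8*M/l := fun a b l hpa hab hbq hl0 hl => by
    have ha : 0 < a := hp.trans_le hpa
    refine (norm_integral_mul_exp_le_of_le_abs_deriv hab (fun w hw => h1 w (ha.trans_le hw.1))
      (fun w hw => h2 w (ha.trans_le hw.1)) (h3 a b ha)
      (Or.inl fun w hw => by positivity) hl0 hl
      (fun w hw => hasDerivAt_ofReal_rpow_neg (ha.trans_le hw.1) _)
      (continuousOn_ofReal_rpow_deriv ha _)).trans ?_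
    calc _ ≤ 4/l*(2*M) := by
          gcongr; exact rpow_variation_le ha hab fun w hw => hM w ⟨hpa.trans hw.1, hw.2.trans hbq⟩
      _ = _ := by ring
  have hs0 := sqrt_nonneg t
  rcases lt_or_gt_of_ne hm with hm | hm
  · refine (fd p q |m| le_rfl hpq le_rfl (abs_pos.2 hm.ne) fun w hw => ?_).trans ?_
    · have : 0 ≤ t/w := div_nonneg ht (hpos w hw).le
      rw [abs_of_neg hm, abs_of_neg (by rw [neg_div]; linarith), neg_div]; linarith
    · refine div_le_div_of_nonneg_right ?_ (abs_nonneg m)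
      nlinarith [mul_nonneg hM0 hs0]
  · rw [abs_of_pos hm]
    -- The break point 2t/m, clamped to the interval.
    set b := max p (min q (2*t/m)) with hb
    have hpb : p ≤ b := le_max_left _ _
    have hbq : b ≤ q := max_le hpq (min_le_left _ _)
    have hc : ContinuousOn (fun w => ((w^(-r) : ℝ) : ℂ) * cexp (I*(-t*log w + m*w : ℝ))) (Icc p q) := fun w hw => by
      have := (hasDerivAt_ofReal_rpow_neg (hpos w hw) r).continuousAt.mul
        (((h1 w (hpos w hw)).ofReal_comp.const_mul I).cexp).continuousAt
      exact this.continuousWithinAt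
    have hsplit := integral_add_adjacent_intervals (μ := volume)
      (hc.mono (by rw [uIcc_of_le hpb]; gcongr) : ContinuousOn _ (uIcc p b)).intervalIntegrable
      (hc.mono (by rw [uIcc_of_le hbq]; gcongr) : ContinuousOn _ (uIcc b q)).intervalIntegrable
    rw [← hsplit]
    have e2 : ‖∫ w in b..q, ((w^(-r) : ℝ) : ℂ)*cexp (I*(-t*log w + m*w : ℝ))‖ ≤ 16*M/m := by
      rcases hbq.eq_or_lt with h | h
      · rw [h]; simp only [integral_same, norm_zero]; positivity
      refine (fd b q (m/2) hpb hbq le_rfl (by positivity) fun w hw => ?_).trans (le_of_eq (by ring))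
      have hw0 : 0 < w := (hp.trans_le hpb).trans_le hw.1
      have h4 : 2*t/m ≤ w := by
        rcases le_total q (2*t/m) with h' | h'
        · grind
        · refine le_trans ?_ hw.1
          rw [hb, min_eq_right h']; simp
      have h5 : t/w ≤ m/2 := by rw [div_le_iff₀ hm] at h4; rw [div_le_div_iff₀ hw0 two_pos]; linarith
      rw [abs_of_nonneg (by rw [neg_div]; linarith), neg_div]; linarith
    have e1 : ‖∫ w in p..b, ((w^(-r) : ℝ) : ℂ)*cexp (I*(-t*log w + m*w : ℝ))‖ ≤ 40*M*√t/m := by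
      rcases hpb.eq_or_lt with h | h
      · rw [← h]; simp only [integral_same, norm_zero]; positivity
      have h4 : b ≤ 2*t/m := by
        rcases le_total (min q (2*t/m)) p with h' | h'
        · rw [hb, max_eq_left h'] at h; linarith
        grind
      have ht0 : 0 < t := by grind
      refine (norm_integral_mul_exp_le_of_le_deriv2 (r := (m/(2*√t))^2) hpb (fun w hw => h1 w (hp.trans_le hw.1))
        (fun w hw => h2 w (hp.trans_le hw.1)) (h3 p b hp) (by positivity) (fun w hw => ?_)
        (fun w hw => hasDerivAt_ofReal_rpow_neg (hp.trans_le hw.1) _)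
        (continuousOn_ofReal_rpow_deriv hp _)).trans ?_
      · have hw0 : 0 < w := hp.trans_le hw.1
        have hw2 : w*m ≤ 2*t := by rw [← le_div_iff₀ hm]; exact hw.2.trans h4
        rw [div_pow, mul_pow, sq_sqrt ht, div_le_div_iff₀ (by positivity) (by positivity)]
        have : (w*m)^2 ≤ (2*t)^2 := by gcongr
        nlinarith
      · rw [sqrt_sq (by positivity)]
        calc _ ≤ 10/(m/(2*√t))*(2*M) := by
              gcongr; exact rpow_variation_le hp hpb fun w hw => hM w ⟨hw.1, hw.2.trans hbq⟩
          _ = _ := by field_simp; ring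
    calc _ ≤ _ := norm_add_le _ _
      _ ≤ 40*M*√t/m + 16*M/m := add_le_add e1 e2
      _ ≤ 40*M*(1 + √t)/m := by rw [← add_div]; refine div_le_div_of_nonneg_right ?_ hm.le; linarith

lemma norm_integral_cpow_mul_cos_le {p q M : ℝ} (s : ℂ) (hp : 0 < p) (hpq : p ≤ q)
    (hM : ∀ w ∈ Icc p q, w^(-s.re) ≤ M) {k : ℝ} (hk : 0 < k) :
    ‖∫ w in p..q, (w : ℂ)^(-s)*(2*cos (2*π*k*w) : ℝ)‖ ≤ 14*M*(1 + √|s.im|)/k := by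
  have hu : uIcc p q = Icc p q := uIcc_of_le hpq
  have hpos : ∀ w ∈ Icc p q, 0 < w := fun w hw => hp.trans_le hw.1
  have hM0 : 0 ≤ M := (Real.rpow_nonneg hp.le _).trans (hM p ⟨le_rfl, hpq⟩)
  have key : ∀ t : ℝ, 0 ≤ t → ‖∫ w in p..q, ((w^(-s.re) : ℝ) : ℂ) * cexp (I*(-t*log w : ℝ))*(2*cos (2*π*k*w) : ℝ)‖ ≤
      14*M*(1 + √t)/k := fun t ht => by
    have hc : ∀ m : ℝ, ContinuousOn (fun w => ((w^(-s.re) : ℝ) : ℂ) * cexp (I*(-t*log w + m*w : ℝ))) (uIcc p q) := fun m => by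
      rw [hu]; intro w hw
      have := (hasDerivAt_ofReal_rpow_neg (hpos w hw) s.re).continuousAt.mul (((((hasDerivAt_neg_mul_log (hpos w hw) t).add
          ((hasDerivAt_id w).const_mul m))).ofReal_comp.const_mul I).cexp).continuousAt
      exact this.continuousWithinAt
    have e : ∫ w in p..q, ((w^(-s.re) : ℝ) : ℂ)*cexp (I*(-t*log w : ℝ))*(2*cos (2*π*k*w) : ℝ) =
      (∫ w in p..q, ((w^(-s.re) : ℝ) : ℂ)*cexp (I*(-t*log w + 2*π*k*w : ℝ))) +
      ∫ w in p..q, ((w^(-s.re) : ℝ) : ℂ)*cexp (I*(-t*log w + -(2*π*k)*w : ℝ)) := by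
      rw [← integral_add (hc _).intervalIntegrable (hc _).intervalIntegrable]
      refine integral_congr fun w _ => ?_
      simp only [mul_assoc (((w^(-s.re) : ℝ) : ℂ)), exp_mul_cos_eq, mul_add, neg_mul, ← sub_eq_add_neg]
    rw [e]
    have hpk : 0 < 2*π*k := by positivity
    have b1 := norm_integral_rpow_mul_exp_le hp hpq hM ht hpk.ne'
    have b2 := norm_integral_rpow_mul_exp_le hp hpq hM ht (neg_ne_zero.2 hpk.ne')
    rw [abs_neg] at b2; rw [abs_of_pos hpk] at b1 b2
    calc _ ≤ _ := norm_add_le _ _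
      _ ≤ _ := add_le_add b1 b2
      _ ≤ _ := by
        rw [← add_div, div_le_div_iff₀ hpk hk]
        have : 0 ≤ M*(1 + √t)*k := by positivity
        nlinarith [pi_gt_three]
  rcases le_total 0 s.im with h | h
  · rw [abs_of_nonneg h]
    convert key s.im h using 2
    refine integral_congr fun w hw => ?_
    simp only [cpow_neg_eq_rpow_mul_exp (hpos w (hu ▸ hw)) s]
  -- Complex conjugation reverses the sign of Im s and leaves the cosine unchanged.
  · rw [abs_of_nonpos h]; refine le_trans (le_of_eq ?_) (key (-s.im) (by linarith))
    rw [← RCLike.norm_conj]; rw [← intervalIntegral.intervalIntegral_conj]; congr 1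
    refine integral_congr fun w hw => ?_
    simp only [cpow_neg_eq_rpow_mul_exp (hpos w (hu ▸ hw)) s, map_mul, conj_ofReal, ← exp_conj, conj_I]; simp

lemma sub_one_mul_integral_cpow {p q : ℝ} (hp : 0 < p) (hpq : p ≤ q) (s : ℂ) :
    (s - 1) * ∫ w in p..q, (w : ℂ)^(-s) = (p : ℂ)^(1 - s) - (q : ℂ)^(1 - s) := by
  rcases eq_or_ne s 1 with rfl | hs
  · simp
  have h0 : (0 : ℝ) ∉ uIcc p q := by rw [uIcc_of_le hpq]; grind
  rw [integral_cpow (Or.inr ⟨fun h => hs (by linear_combination -h), h0⟩)]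
  grind

/-- First-order Euler–Maclaurin with the sawtooth bounded trivially. The factor ‖s‖ is wasteful but
harmless when M is a high power of it. -/
lemma norm_sum_cpow_sub_integral_le_of_re_pos {M N : ℕ} (hM : 1 ≤ M) (hMN : M ≤ N) {s : ℂ} (hs : 0 < s.re) :
    ‖∑ n ∈ Ioc M N, (n : ℂ)^(-s) - ∫ w in (M : ℝ)..N, (w : ℂ)^(-s)‖ ≤ (1 + ‖s‖/s.re)*(M : ℝ)^(-s.re) := by
  have hM0 : (0 : ℝ) < M := mod_cast hM
  have hMN' : (M : ℝ) ≤ N := mod_cast hMN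
  have hN0 : (0 : ℝ) < N := hM0.trans_le hMN'
  have hs0 : s ≠ 0 := fun h => by simp [h] at hs
  have hpos : ∀ w ∈ Icc (M : ℝ) N, 0 < w := fun w hw => hM0.trans_le hw.1
  have hd : ∀ w ∈ Icc (M : ℝ) N, HasDerivAt (fun w : ℝ => (w : ℂ)^(-s)) (-s*(w : ℂ)^(-s - 1)) w := fun w hw => by
    exact hasDerivAt_ofReal_cpow_const (hpos w hw).ne' (neg_ne_zero.2 hs0)
  have hc : ContinuousOn (fun w : ℝ => -s*(w : ℂ)^(-s - 1)) (Icc (M : ℝ) N) := by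
    refine continuousOn_const.mul fun w hw => ?_
    exact (continuousAt_ofReal_cpow_const w _ (Or.inr (hpos w hw).ne')).continuousWithinAt
  have h := sum_Ioc_eq_integral_add_fract hM0.le hMN' hd hc
  simp only [Nat.floor_natCast, Int.fract_natCast, ofReal_natCast] at h
  rw [h]
  have hn : ∀ w : ℝ, 0 < w → ‖(w : ℂ)^(-s)‖ = w^(-s.re) := fun w hw => by rw [norm_cpow_eq_rpow_re_of_pos hw, neg_re]
  have hMn : ‖(M : ℂ)^(-s)‖ = (M : ℝ)^(-s.re) := by simpa using hn M hM0
  have hNn : ‖(N : ℂ)^(-s)‖ ≤ (M : ℝ)^(-s.re) := by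
    have := hn N hN0
    rw [ofReal_natCast] at this; rw [this]; exact rpow_le_rpow_of_nonpos hM0 hMN' (by linarith)
  have hu : uIcc (M : ℝ) N = Icc (M : ℝ) N := uIcc_of_le hMN'
  have hint : ‖∫ w in (M : ℝ)..N, -s*(w : ℂ)^(-s - 1)*((fract w - 1/2 : ℝ) : ℂ)‖ ≤ ‖s‖/s.re*(M : ℝ)^(-s.re) := by
    have hci : ContinuousOn (fun w : ℝ => w^(-s.re - 1)) (Icc (M : ℝ) N) :=
      continuousOn_id.rpow_const fun w hw => Or.inl (hpos w hw).ne'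
    refine (norm_integral_le_of_norm_le hMN' (g := fun w => ‖s‖*w^(-s.re - 1)) ?_
      ((hu ▸ hci).intervalIntegrable.const_mul _)).trans ?_
    · refine Eventually.of_forall fun w hw => ?_
      have hw0 : 0 < w := hpos w (Ioc_subset_Icc_self hw)
      rw [norm_mul, norm_mul, norm_neg, norm_cpow_eq_rpow_re_of_pos hw0, norm_real, norm_eq_abs, sub_re, neg_re, one_re]
      have : |fract w - 1/2| ≤ 1 := by rw [abs_le]; constructor <;> linarith [fract_nonneg w, fract_lt_one w]
      have h0 : 0 ≤ ‖s‖*w^(-s.re - 1) := by positivity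
      nlinarith
    · rw [integral_const_mul, integral_rpow (Or.inr ⟨by linarith, by grind⟩)]
      have e : -s.re - 1 + 1 = -s.re := by ring
      rw [e, div_mul_eq_mul_div, mul_div_assoc]; gcongr ‖s‖ * ?_
      rw [div_neg, ← neg_div]; gcongr
      have : 0 < (N : ℝ)^(-s.re) := rpow_pos_of_pos hN0 _
      linarith
  have e : ∀ I J A B : ℂ, I - A*((0 - 1/2 : ℝ) : ℂ) + B*((0 - 1/2 : ℝ) : ℂ) + J - I =
      (A*(1/2) - B*(1/2)) + J := by intros; push_cast; ring
  rw [e]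
  calc _ ≤ _ := norm_add_le _ _
    _ ≤ ((M : ℝ)^(-s.re)*(1/2) + (M : ℝ)^(-s.re)*(1/2)) + ‖s‖/s.re*(M : ℝ)^(-s.re) := by
      refine add_le_add ((norm_sub_le _ _).trans (add_le_add ?_ ?_)) hint
      · rw [norm_mul]; norm_num; exact hNn
      · rw [norm_mul, hMn]; norm_num
    _ = _ := by ring

/-- `(s - 1)` times the truncated zeta sum with its first correction term. -/
def zetaPartial (N : ℕ) (s : ℂ) : ℂ := (s - 1) * ∑ n ∈ Ioc 0 N, (n : ℂ)^(-s) + (N : ℂ)^(1 - s)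

lemma norm_zetaPartial_sub_le {M N : ℕ} (hM : 1 ≤ M) (hMN : M ≤ N) {s : ℂ} (hs : 0 < s.re) :
    ‖zetaPartial N s - zetaPartial M s‖ ≤ ‖s - 1‖*((1 + ‖s‖/s.re)*(M : ℝ)^(-s.re)) := by
  have hM0 : (0 : ℝ) < M := mod_cast hM
  have h := sub_one_mul_integral_cpow hM0 (mod_cast hMN : (M : ℝ) ≤ N) s
  have hsum : ∑ n ∈ Ioc 0 N, (n : ℂ)^(-s) = ∑ n ∈ Ioc 0 M, (n : ℂ)^(-s) + ∑ n ∈ Ioc M N, (n : ℂ)^(-s) :=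
    (sum_Ioc_consecutive _ (Nat.zero_le _) hMN).symm
  have : zetaPartial N s - zetaPartial M s = (s - 1) * (∑ n ∈ Ioc M N, (n : ℂ)^(-s) - ∫ w in (M : ℝ)..N, (w : ℂ)^(-s)) := by
    rw [zetaPartial, zetaPartial, hsum, mul_sub, h]; push_cast; ring
  rw [this, norm_mul]
  exact mul_le_mul_of_nonneg_left (norm_sum_cpow_sub_integral_le_of_re_pos hM hMN hs) (norm_nonneg _)

lemma differentiable_zetaPartial {N : ℕ} (hN : 1 ≤ N) : Differentiable ℂ (zetaPartial N) := by
  have hc : ∀ n : ℕ, 0 < n → ∀ f : ℂ → ℂ, Differentiable ℂ f → Differentiable ℂ fun s => (n : ℂ)^f s := fun n hn f hf => by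
    exact hf.const_cpow (Or.inl (mod_cast hn.ne'))
  refine ((differentiable_id.sub_const 1).mul (Differentiable.fun_sum fun n hn => ?_)).add ?_
  · exact hc n (mem_Ioc.1 hn).1 _ differentiable_neg
  · exact hc N hN _ (differentiable_id.const_sub 1)

lemma tendsto_zetaPartial_of_one_lt_re {s : ℂ} (hs : 1 < s.re) :
    Tendsto (fun N : ℕ => zetaPartial N s) atTop (𝓝 (riemannZeta₁ s)) := by
  have hs1 : s ≠ 1 := fun h => by simp [h] at hs
  have hz : riemannZeta₁ s = (s - 1)*ζ s + 0 := by rw [riemannZeta_eq_inv_sub_mul hs1]; grind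
  rw [hz]
  refine Tendsto.add (Tendsto.const_mul _ ?_) ?_
  · rw [zeta_eq_tsum_one_div_nat_add_one_cpow hs]
    have hsum : Summable fun n : ℕ => 1/((n : ℂ) + 1)^s := by
      have := (summable_nat_add_iff 1).2 (Complex.summable_one_div_nat_cpow.2 hs)
      simpa using this
    refine hsum.hasSum.tendsto_sum_nat.congr fun N => ?_
    rw [← Finset.Ico_add_one_add_one_eq_Ioc, Finset.sum_Ico_eq_sum_range]
    refine sum_congr (by simp) fun n _ => ?_
    rw [cpow_neg, one_div]; push_cast; ring_nf
  · rw [tendsto_zero_iff_norm_tendsto_zero]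
    have h1 : Tendsto (fun N : ℕ => (N : ℝ)^(-(s.re - 1))) atTop (𝓝 0) :=
      (tendsto_rpow_neg_atTop (by linarith)).comp tendsto_natCast_atTop_atTop
    refine h1.congr' ?_
    filter_upwards [eventually_gt_atTop 0] with N hN
    rw [Complex.norm_natCast_cpow_of_pos hN]; simp

/-- Along powers of 2 the increments decay geometrically, uniformly on bounded sets with Re s > a >
0, so the limit is holomorphic there. It agrees with `riemannZeta₁` near 2, where the Dirichlet
series converges, hence everywhere by the identity theorem. -/
lemma tendsto_zetaPartial_two_pow {s : ℂ} (hs : 0 < s.re) :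
    Tendsto (fun k : ℕ => zetaPartial (2^k) s) atTop (𝓝 (riemannZeta₁ s)) := by
  set R := ‖s‖ + 3
  set a := min (s.re/2) 1
  have ha0 : 0 < a := lt_min (by linarith) one_pos
  -- A convex region containing both s and the base point 2; its boundedness makes the factors in
  -- ‖z‖ and ‖z − 1‖ uniform.
  set U : Set ℂ := {z | a < z.re} ∩ ball 0 R
  have hUo : IsOpen U := (isOpen_lt continuous_const continuous_re).inter Metric.isOpen_ball
  have hUc : Convex ℝ U := (convex_halfSpace_re_gt a).inter (convex_ball 0 R)
  have hsU : s ∈ U := ⟨(min_le_left _ _ : a ≤ s.re/2).trans_lt (by linarith), by simp only [mem_ball, dist_zero_right]; linarith⟩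
  have h2U : (2 : ℂ) ∈ U := ⟨(min_le_right _ _ : a ≤ 1).trans_lt (by norm_num), by
    simp only [mem_ball, dist_zero_right]
    have := norm_nonneg s
    norm_num; linarith⟩
  set d : ℕ → ℂ → ℂ := fun k z => zetaPartial (2^(k + 1)) z - zetaPartial (2^k) z with hd
  have hdiff : ∀ k, DifferentiableOn ℂ (d k) U := fun k => ((differentiable_zetaPartial Nat.one_le_two_pow).sub
      (differentiable_zetaPartial Nat.one_le_two_pow)).differentiableOn
  have hdb : ∀ k z, z ∈ U → ‖d k z‖ ≤ (R + 1)*(1 + R/a)*((2 : ℝ)^(-a))^k := fun k z hz => by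
    have hz1 : a < z.re := hz.1
    have hz2 : ‖z‖ < R := by simpa using hz.2
    refine (norm_zetaPartial_sub_le Nat.one_le_two_pow (pow_le_pow_right₀ one_le_two (Nat.le_succ k)) (ha0.trans hz1)).trans ?_
    rw [← mul_assoc]
    have e1 : ‖z - 1‖ ≤ R + 1 := (norm_sub_le _ _).trans (by rw [norm_one]; linarith)
    have e2 : ‖z‖/z.re ≤ R/a := by gcongr
    have e3 : ((2^k : ℕ) : ℝ)^(-z.re) ≤ ((2 : ℝ)^(-a))^k := by
      push_cast; rw [← rpow_natCast, ← rpow_natCast, ← rpow_mul two_pos.le, ← rpow_mul two_pos.le]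
      refine rpow_le_rpow_of_exponent_le one_le_two ?_
      nlinarith [(cast_nonneg k : (0 : ℝ) ≤ k)]
    have h4 : 0 ≤ ‖z‖/z.re := div_nonneg (norm_nonneg _) (ha0.trans hz1).le
    gcongr
  have hgeo : Summable fun k : ℕ => (R + 1)*(1 + R/a)*((2 : ℝ)^(-a))^k := by
    refine (summable_geometric_of_lt_one (by positivity) ?_).mul_left _
    exact Real.rpow_lt_one_of_one_lt_of_neg one_lt_two (by linarith)
  have hsumd := Complex.differentiableOn_tsum_of_summable_norm hgeo hdiff hUo hdb
  set G : ℂ → ℂ := fun z => zetaPartial 1 z + ∑' k, d k z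
  have hGd : DifferentiableOn ℂ G U := (differentiable_zetaPartial le_rfl).differentiableOn.add hsumd
  have hlim : ∀ z ∈ U, Tendsto (fun k : ℕ => zetaPartial (2^k) z) atTop (𝓝 (G z)) := fun z hz => by
    have hsm : Summable fun k => d k z := Summable.of_norm_bounded hgeo fun k => hdb k z hz
    refine (hsm.hasSum.tendsto_sum_nat.const_add (zetaPartial 1 z)).congr fun n => ?_
    simp only [hd]; rw [Finset.sum_range_sub (fun k => zetaPartial (2^k) z)]
    simp
  have heq : EqOn G riemannZeta₁ U := by
    refine AnalyticOnNhd.eqOn_of_preconnected_of_eventuallyEq (hGd.analyticOnNhd hUo)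
      (differentiable_riemannZeta₁.differentiableOn.analyticOnNhd hUo) hUc.isPreconnected h2U ?_
    have : ∀ᶠ z : ℂ in 𝓝 2, 1 < z.re := (isOpen_lt continuous_const continuous_re).mem_nhds (by norm_num)
    filter_upwards [this, hUo.mem_nhds h2U] with z hz hzU
    exact tendsto_nhds_unique (hlim z hzU) ((tendsto_zetaPartial_of_one_lt_re hz).comp
      (tendsto_pow_atTop_atTop_of_one_lt one_lt_two))
  grind

lemma norm_riemannZeta_sub_le {M : ℕ} (hM : 1 ≤ M) {s : ℂ} (hs : 0 < s.re) (hs1 : s ≠ 1) :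
    ‖ζ s - ∑ n ∈ Ioc 0 M, (n : ℂ)^(-s) - (M : ℂ)^(1 - s)/(s - 1)‖ ≤ (1 + ‖s‖/s.re)*(M : ℝ)^(-s.re) := by
  have hne := sub_ne_zero.2 hs1
  have h : ‖riemannZeta₁ s - zetaPartial M s‖ ≤ ‖s - 1‖*((1 + ‖s‖/s.re)*(M : ℝ)^(-s.re)) := by
    refine le_of_tendsto ((tendsto_zetaPartial_two_pow hs).sub_const (zetaPartial M s)).norm ?_
    have : ∀ᶠ k : ℕ in atTop, M ≤ 2^k := (tendsto_pow_atTop_atTop_of_one_lt one_lt_two).eventually_ge_atTop M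
    filter_upwards [this] with k hk
    exact norm_zetaPartial_sub_le hM hk hs
  have e : ζ s - ∑ n ∈ Ioc 0 M, (n : ℂ)^(-s) - (M : ℂ)^(1 - s)/(s - 1) = (riemannZeta₁ s - zetaPartial M s)/(s - 1) := by
    rw [riemannZeta_eq_inv_sub_mul hs1, zetaPartial]; field_simp; ring
  rw [e, norm_div, div_le_iff₀ (norm_pos_iff.2 hne), mul_comm]
  exact h

/-- Truncation of the zeta sum at an arbitrary length, with square root error in the height. -/
lemma norm_riemannZeta₀_sub_le {N : ℕ} (hN : 2 ≤ N) {s : ℂ} (hs : 1/4 ≤ s.re) (hs2 : s.re ≤ 2)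
    (hs1 : s ≠ 1) (ht : |s.im| ≤ N) {u : ℝ} (hu1 : 1 ≤ u) (huN : u ≤ N) :
    ‖riemannZeta₀ s - ∑ n ∈ Ioc 0 ⌊u⌋₊, (n : ℂ)^(-s) - ((u : ℂ)^(1 - s) - 1)/(s - 1)‖ ≤ 100*√N*u^(-s.re)*(1 + log N) := by
  have hN2 : (2 : ℝ) ≤ N := mod_cast hN
  have hN0 : (0 : ℝ) < N := by linarith
  have hne := sub_ne_zero.2 hs1
  have hu0 : 0 < u := by linarith
  have hsre : 0 < s.re := by linarith
  -- As Re s ≥ 1/4, X^(-Re s) ≤ N^(-4). This beats the factor ‖s‖ of the classical truncation error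
  -- even in comparison with u^(-Re s) ≥ N^(-2).
  set X : ℕ := N^16 with hX
  have hX1 : 1 ≤ X := Nat.one_le_pow _ _ (by omega)
  have hNX : (N : ℝ) ≤ (X : ℝ) := by
    have : N ≤ X := Nat.le_self_pow (by norm_num) N
    exact_mod_cast this
  have huX : u ≤ X := huN.trans hNX
  set M := u^(-s.re)
  have hM0 : 0 < M := rpow_pos_of_pos hu0 _
  have hM : ∀ w ∈ Icc u (X : ℝ), w^(-s.re) ≤ M := fun w hw => rpow_le_rpow_of_nonpos hu0 hw.1 (by linarith)
  have hK : 1 ≤ N := by omega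
  have hpi := pi_gt_three
  have hP := norm_sum_cpow_sub_integral_le (K := N) s hu0 huX hM hK ((div_le_self (abs_nonneg _) hu1).trans (by nlinarith))
  have hcont : ContinuousOn (fun w : ℝ => (w : ℂ)^(-s)) (uIcc u (X : ℝ)) := by
    rw [uIcc_of_le huX]; intro w hw
    exact (continuousAt_ofReal_cpow_const w _ (Or.inr (hu0.trans_le hw.1).ne')).continuousWithinAt
  rw [integral_mul_dirichletKernel N hcont, Nat.floor_natCast] at hP
  set S := ∑ k ∈ range N, ∫ w in u..(X : ℝ), (w : ℂ)^(-s)*(2*cos (2*π*(k + 1)*w) : ℝ)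
  have hlogN : 0 ≤ log N := log_nonneg (by linarith)
  have hsq1 : 1 ≤ √(N : ℝ) := by rw [one_le_sqrt]; linarith
  have hSb : ‖S‖ ≤ 28*√N*M*(1 + log N) := by
    refine (norm_sum_le _ _).trans ?_
    calc _ ≤ ∑ k ∈ range N, 28*√N*M*(1/((k : ℝ) + 1)) := by
          refine sum_le_sum fun k _ => ?_
          refine (norm_integral_cpow_mul_cos_le s hu0 huX hM (by positivity : (0 : ℝ) < (k : ℝ) + 1)).trans ?_
          rw [mul_one_div]
          have : √|s.im| ≤ √N := sqrt_le_sqrt ht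
          refine div_le_div_of_nonneg_right ?_ (by positivity)
          nlinarith
      _ ≤ _ := by rw [← mul_sum]; gcongr; exact sum_range_one_div_le_one_add_log N
  have hZ := norm_riemannZeta_sub_le hX1 hsre hs1
  have hI := sub_one_mul_integral_cpow hu0 huX s
  have hI' : ∫ w in u..(X : ℝ), (w : ℂ)^(-s) = ((u : ℂ)^(1 - s) - (X : ℂ)^(1 - s))/(s - 1) := by
    rw [eq_div_iff hne, mul_comm, hI]; push_cast; rfl
  have hflX : ⌊u⌋₊ ≤ X := Nat.floor_le_of_le huX
  have hsum : ∑ n ∈ Ioc 0 X, (n : ℂ)^(-s) = ∑ n ∈ Ioc 0 ⌊u⌋₊, (n : ℂ)^(-s) + ∑ n ∈ Ioc ⌊u⌋₊ X, (n : ℂ)^(-s) :=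
    (sum_Ioc_consecutive _ (Nat.zero_le _) hflX).symm
  -- The zero-frequency integral from u to X exchanges the correction term at X for the one at u.
  -- The nonzero frequencies S remain to be bounded.
  have key : riemannZeta₀ s - ∑ n ∈ Ioc 0 ⌊u⌋₊, (n : ℂ)^(-s) - ((u : ℂ)^(1 - s) - 1)/(s - 1) =
      (ζ s - ∑ n ∈ Ioc 0 X, (n : ℂ)^(-s) - (X : ℂ)^(1 - s)/(s - 1)) +
      (∑ n ∈ Ioc ⌊u⌋₊ X, (n : ℂ)^(-s) - ((∫ w in u..(X : ℝ), (w : ℂ)^(-s)) + S)) + S := by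
    rw [riemannZeta_eq_inv_sub_add hs1, hsum, hI']; field_simp; ring
  have hZ' : (1 + ‖s‖/s.re)*(X : ℝ)^(-s.re) ≤ 13*√N*M*(1 + log N) := by
    have hsn : ‖s‖ ≤ 2 + N := (Complex.norm_le_abs_re_add_abs_im s).trans (add_le_add (by grind) ht)
    have e1 : ‖s‖/s.re ≤ 4*(2 + N) := by rw [div_le_iff₀ hsre]; nlinarith
    have e2 : (X : ℝ)^(-s.re) ≤ (N : ℝ)^(-4 : ℝ) := by
      rw [hX]; push_cast; rw [← rpow_natCast, ← rpow_mul hN0.le]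
      refine rpow_le_rpow_of_exponent_le (by linarith) ?_
      push_cast; linarith
    have e3 : (N : ℝ)^(-2 : ℝ) ≤ M := by
      calc (N : ℝ)^(-2 : ℝ) ≤ (N : ℝ)^(-s.re) := rpow_le_rpow_of_exponent_le (by linarith) (by linarith)
        _ ≤ M := rpow_le_rpow_of_nonpos hu0 huN (by linarith)
    have e4 : (N : ℝ)^(-4 : ℝ)*N ≤ (N : ℝ)^(-2 : ℝ) := by
      rw [← Real.rpow_add_one hN0.ne']; exact rpow_le_rpow_of_exponent_le (by linarith) (by norm_num)
    have e5 : 0 < (N : ℝ)^(-4 : ℝ) := by positivity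
    calc _ ≤ (1 + 4*(2 + N))*(N : ℝ)^(-4 : ℝ) := by gcongr
      _ ≤ 13*((N : ℝ)^(-4 : ℝ)*N) := by nlinarith
      _ ≤ 13*M := by linarith
      _ = 13*1*M*1 := by ring
      _ ≤ _ := by gcongr; linarith
  rw [key]
  have hpos : 0 ≤ √N*M*(1 + log N) := by positivity
  have h20 : 20*(1 + log N)*M ≤ 20*(√N*M*(1 + log N)) := by
    have : 0 ≤ M*(1 + log N) := by positivity
    nlinarith
  calc _ ≤ _ := norm_add₃_le
    _ ≤ _ := add_le_add (add_le_add (hZ.trans hZ') hP) hSb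
    _ ≤ _ := by linarith

lemma one_le_two_mul_log {N : ℝ} (hN : 2 ≤ N) : 1 ≤ 2*log N := by
  have h := log_le_log two_pos hN
  have := log_two_gt_d9
  linarith

/-- For σ ≤ 1 this is monotonicity in w; for σ above 1 by at most C/log N the right side still
exceeds 1, thanks to the factor e^C. -/
lemma rpow_one_sub_le_of_le_sqrt {C N σ w : ℝ} (hC : 0 ≤ C) (hN : 2 ≤ N) (hσ : σ ≤ 1 + C/log N) (hw1 : 1 ≤ w) (hw : w ≤ √N) :
    w^(1 - σ) ≤ rexp C*N^((1 - σ)/2) := by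
  have hN0 : 0 < N := by linarith
  have hlog : 0 < log N := Real.log_pos (by linarith)
  rcases le_total σ 1 with h | h
  · calc w^(1 - σ) ≤ (√N)^(1 - σ) := rpow_le_rpow (by linarith) hw (by linarith)
      _ = N^((1 - σ)/2) := by rw [sqrt_eq_rpow, ← rpow_mul hN0.le]; ring_nf
      _ ≤ rexp C*N^((1 - σ)/2) := by
        have : 1 ≤ rexp C := one_le_exp hC
        have : 0 < N^((1 - σ)/2) := rpow_pos_of_pos hN0 _
        nlinarith
  · calc w^(1 - σ) ≤ 1 := Real.rpow_le_one_of_one_le_of_nonpos hw1 (by linarith)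
      _ ≤ rexp C*N^((1 - σ)/2) := by
        rw [rpow_def_of_pos hN0, ← Real.exp_add]; refine one_le_exp ?_
        have : (σ - 1)*log N ≤ C := by rw [← le_div_iff₀ hlog]; linarith
        nlinarith

lemma norm_natCast_cpow_neg {n : ℕ} (hn : 0 < n) (s : ℂ) : ‖(n : ℂ)^(-s)‖ = (n : ℝ)^(-s.re) := by
  rw [Complex.norm_natCast_cpow_of_pos hn, neg_re]

lemma sum_Ioc_one_div_le {u : ℝ} (hu : 1 ≤ u) : ∑ n ∈ Ioc 0 ⌊u⌋₊, 1/(n : ℝ) ≤ 1 + log u := by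
  rw [← Finset.Ico_add_one_add_one_eq_Ioc, Finset.sum_Ico_eq_sum_range]
  have h := sum_range_one_div_le_one_add_log ⌊u⌋₊
  have h2 : log ⌊u⌋₊ ≤ log u := log_le_log (mod_cast floor_pos.2 hu) (floor_le (by linarith))
  grind

/-- The integral shows no singularity at s = 1, so it can be estimated uniformly near the pole. -/
lemma div_sub_one_eq_neg_integral {u : ℝ} (hu : 1 ≤ u) {s : ℂ} (hs : s ≠ 1) :
    ((u : ℂ)^(1 - s) - 1)/(s - 1) = -∫ w in (1 : ℝ)..u, (w : ℂ)^(-s) := by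
  have h := sub_one_mul_integral_cpow one_pos hu s
  rw [div_eq_iff (sub_ne_zero.2 hs)]
  simp only [ofReal_one, one_cpow] at h
  linear_combination h

/-- The convexity bound for the zeta function with its pole removed. -/
lemma norm_riemannZeta₀_le_convexity {C : ℝ} (hC : 0 ≤ C) {N : ℕ} (hN : 2 ≤ N) {s : ℂ}
    (hs : 1/4 ≤ s.re) (hs2 : s.re ≤ 2) (hsC : s.re ≤ 1 + C/log N) (ht : |s.im| ≤ N) :
    ‖riemannZeta₀ s‖ ≤ 305*rexp C*(N : ℝ)^((1 - s.re)/2)*log N := by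
  have hN2 : (2 : ℝ) ≤ N := mod_cast hN
  have hN0 : (0 : ℝ) < N := by linarith
  have hlog := one_le_two_mul_log hN2
  have hE : 1 ≤ rexp C := one_le_exp hC
  rcases eq_or_ne s 1 with rfl | hs1
  · have : Real.eulerMascheroniConstant < 2/3 := Real.eulerMascheroniConstant_lt_two_thirds
    have h0 : 1/2 < Real.eulerMascheroniConstant := Real.one_half_lt_eulerMascheroniConstant
    simp only [riemannZeta₀_one, norm_real, norm_eq_abs, one_re, sub_self, zero_div, rpow_zero, mul_one]
    rw [abs_of_pos (by linarith)]
    nlinarith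
  -- Truncation at √N balances the sum of n^(-Re s) against the error √N u^(-Re s): both are N^((1 -
  -- Re s)/2) up to a logarithm.
  have hu1 : 1 ≤ √(N : ℝ) := by rw [one_le_sqrt]; linarith
  have huN : √(N : ℝ) ≤ N := sqrt_le_iff.2 ⟨hN0.le, by nlinarith⟩
  have h := norm_riemannZeta₀_sub_le hN hs hs2 hs1 ht hu1 huN
  set P := (N : ℝ)^((1 - s.re)/2) with hP
  have hP0 : 0 < P := rpow_pos_of_pos hN0 _
  have hbd : ∀ w, 1 ≤ w → w ≤ √(N : ℝ) → w^(-s.re) ≤ rexp C*P*(1/w) := fun w hw1 hw => by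
    have := rpow_one_sub_le_of_le_sqrt hC hN2 hsC hw1 hw
    have hw0 : 0 < w := by linarith
    rw [sub_eq_add_neg, rpow_add hw0, rpow_one] at this; rw [mul_one_div, le_div_iff₀ hw0, mul_comm]
    exact this
  have hsum : ‖∑ n ∈ Ioc 0 ⌊√(N : ℝ)⌋₊, (n : ℂ)^(-s)‖ ≤ rexp C*P*(1 + log N) := by
    refine (norm_sum_le _ _).trans ?_
    calc _ ≤ ∑ n ∈ Ioc 0 ⌊√(N : ℝ)⌋₊, rexp C*P*(1/(n : ℝ)) := by
          refine sum_le_sum fun n hn => ?_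
          rw [mem_Ioc] at hn; rw [norm_natCast_cpow_neg hn.1]
          exact hbd n (mod_cast hn.1) ((le_floor_iff (by positivity)).1 hn.2)
      _ ≤ _ := by
          rw [← mul_sum]; refine mul_le_mul_of_nonneg_left ?_ (by positivity)
          refine (sum_Ioc_one_div_le hu1).trans ?_
          gcongr
  have hint : ‖((√(N : ℝ) : ℝ) : ℂ)^(1 - s) - 1‖/‖s - 1‖ ≤ rexp C*P*log N := by
    rw [← norm_div, div_sub_one_eq_neg_integral hu1 hs1, norm_neg]
    have hI : ∫ w in (1 : ℝ)..√(N : ℝ), rexp C*P*(1/w) = rexp C*P*log (√(N : ℝ)) := by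
      rw [integral_const_mul, integral_one_div_of_pos one_pos (by linarith), div_one]
    calc _ ≤ ∫ w in (1 : ℝ)..√(N : ℝ), rexp C*P*(1/w) := by
          refine norm_integral_le_of_norm_le hu1 ?_ ?_
          · refine ae_of_all _ fun w hw => ?_
            rw [norm_cpow_eq_rpow_re_of_pos (by linarith [hw.1]), neg_re]
            exact hbd w hw.1.le hw.2
          · refine ContinuousOn.intervalIntegrable ?_
            rw [uIcc_of_le hu1]
            refine continuousOn_const.mul (continuousOn_const.div continuousOn_id fun w hw => ?_)
            grind
      _ ≤ _ := by rw [hI]; gcongr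
  have hmain : 100*√(N : ℝ)*√(N : ℝ)^(-s.re)*(1 + log N) = 100*P*(1 + log N) := by
    have : √(N : ℝ)*√(N : ℝ)^(-s.re) = P := by
      rw [hP, sqrt_eq_rpow, ← rpow_mul hN0.le, ← rpow_add hN0]; ring_nf
    rw [mul_assoc 100, this]
  rw [hmain, sub_sub] at h
  have hlast : ‖riemannZeta₀ s‖ ≤ 100*P*(1 + log N) + (rexp C*P*(1 + log N) + rexp C*P*log N) := by
    calc ‖riemannZeta₀ s‖ ≤ _ := norm_le_norm_sub_add _ (∑ n ∈ Ioc 0 ⌊√(N : ℝ)⌋₊, (n : ℂ)^(-s) +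
          (((√(N : ℝ) : ℝ) : ℂ)^(1 - s) - 1)/(s - 1))
      _ ≤ _ := add_le_add h ((norm_add_le _ _).trans (add_le_add hsum (by rwa [norm_div])))
  have hEP : P ≤ rexp C*P := le_mul_of_one_le_left hP0.le hE
  have hEP0 : 0 < rexp C*P := by positivity
  have : 100*P*(1 + log N) ≤ 100*(rexp C*P)*(3*log N) := by
    refine mul_le_mul (by linarith) (by linarith) (by linarith) (by positivity)
  have : rexp C*P*(1 + log N) ≤ (rexp C*P)*(3*log N) := mul_le_mul_of_nonneg_left (by linarith) hEP0.le
  linarith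

/-! ### Van der Corput's method and a subconvexity bound -/

/-- Van der Corput's second derivative test for exponential sums. -/
lemma norm_sum_exp_le_of_le_deriv2 {f f' f'' : ℝ → ℝ} {p q θ r : ℝ} {K : ℕ} (hp : 0 ≤ p)
    (hpq : p ≤ q) (h1 : ∀ w ∈ Icc p q, HasDerivAt f (f' w) w)
    (h2 : ∀ w ∈ Icc p q, HasDerivAt f' (f'' w) w) (h3 : ContinuousOn f'' (Icc p q))
    (hr : 0 < r) (hs : ∀ w ∈ Icc p q, r ≤ f'' w)
    (hθ : ∀ w ∈ Icc p q, |f' w| ≤ θ) (hK : 1 ≤ K) (hθK : θ ≤ π*K) :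
    ‖∑ n ∈ Ioc ⌊p⌋₊ ⌊q⌋₊, cexp (I*f n)‖ ≤ 30*K*(1 + 1/√r) := by
  have h := norm_sum_exp_sub_integrals_le hp hpq h1 h2 h3 (Or.inl fun w hw => hr.le.trans (hs w hw)) hθ hK hθK
  have hK1 : (1 : ℝ) ≤ K := mod_cast hK
  -- A linear term does not change the second derivative, so all frequencies share one bound.
  have hI : ∀ m : ℝ, ‖∫ w in p..q, cexp (I*(f w + m*w : ℝ))‖ ≤ 10/√r := fun m => by
    refine norm_integral_exp_le_of_le_deriv2 (φ' := fun w => f' w + m) hpq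
      (fun w hw => ((h1 w hw).add ((hasDerivAt_id w).const_mul m)).congr_deriv (by simp))
      (fun w hw => (h2 w hw).add_const m) h3 hr hs
  have hc : ∀ m : ℝ, ContinuousOn (fun w => cexp (I*(f w + m*w : ℝ))) (uIcc p q) := fun m w hw => by
    rw [uIcc_of_le hpq] at hw
    exact ((((h1 w hw).add ((hasDerivAt_id w).const_mul m)).ofReal_comp.const_mul I).cexp).continuousAt.continuousWithinAt
  have hcos : ∀ k : ℕ, ‖∫ w in p..q, cexp (I*f w)*(2*cos (2*π*(k + 1)*w) : ℝ)‖ ≤ 20/√r := fun k => by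
    have e : ∫ w in p..q, cexp (I*f w)*(2*cos (2*π*(k + 1)*w) : ℝ) = (∫ w in p..q, cexp (I*(f w + 2*π*(k + 1)*w : ℝ))) +
        ∫ w in p..q, cexp (I*(f w + -(2*π*(k + 1))*w : ℝ)) := by
      rw [← integral_add (hc _).intervalIntegrable (hc _).intervalIntegrable]
      refine integral_congr fun w _ => ?_
      simp only [exp_mul_cos_eq, neg_mul, ← sub_eq_add_neg]
    rw [e]; refine (norm_add_le _ _).trans ((add_le_add (hI _) (hI _)).trans (le_of_eq (by ring)))
  have h0 := hI 0
  simp only [zero_mul, add_zero] at h0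
  have hsum : ‖∑ k ∈ range K, ∫ w in p..q, cexp (I*f w)*(2*cos (2*π*(k + 1)*w) : ℝ)‖ ≤ K*(20/√r) := by
    refine (norm_sum_le_of_le _ fun k _ => hcos k).trans (le_of_eq ?_)
    simp
  have hl : log K ≤ K - 1 := log_le_sub_one_of_pos (by linarith)
  calc _ ≤ _ := norm_le_norm_sub_add _ _
    _ ≤ 10*(1 + log K) + (10/√r + K*(20/√r)) := add_le_add h ((norm_add_le _ _).trans (add_le_add h0 hsum))
    _ ≤ _ := by
      have : 0 ≤ 1/√r := by positivity
      have e1 : 10/√r = 10*(1/√r) := by ring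
      have e2 : 20/√r = 20*(1/√r) := by ring
      rw [e1, e2]; nlinarith

/-- These are the correlations produced by differencing. The second derivative of the phase is
positive, of order at least t/P³ since d − e ≥ 1, while the first derivative is at most tH/P². -/
lemma norm_sum_exp_log_sub_log_le {t : ℝ} (ht : 0 < t) {P Q d e H K : ℕ} (hP : 1 ≤ P)
    (hPQ : P ≤ Q) (hQ : Q ≤ 2*P) (hed : e < d) (hdH : d ≤ H) (hHP : H ≤ P) (hK : 1 ≤ K)
    (hθK : t*H/(P : ℝ)^2 ≤ π*K) :
    ‖∑ n ∈ Ioc P Q, cexp (I*(t*(log ((n : ℝ) + d) - log ((n : ℝ) + e)) : ℝ))‖ ≤ 30*K*(1 + 1/√(t/(14*(P : ℝ)^3))) := by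
  have hP0 : (0 : ℝ) < P := mod_cast hP
  have hQ' : (Q : ℝ) ≤ 2*P := mod_cast hQ
  have hed' : (e : ℝ) + 1 ≤ d := mod_cast hed
  have hdH' : (d : ℝ) ≤ H := mod_cast hdH
  have hHP' : (H : ℝ) ≤ P := mod_cast hHP
  have h := norm_sum_exp_le_of_le_deriv2 (p := P) (q := Q) (K := K) (f := fun w => t*(log (w + d) - log (w + e)))
    (f' := fun w => t*(1/(w + d) - 1/(w + e)))
    (f'' := fun w => t*(1/(w + e)^2 - 1/(w + d)^2))
    (r := t/(14*(P : ℝ)^3)) (θ := t*H/(P : ℝ)^2) hP0.le (mod_cast hPQ)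
    (fun w hw => ?_) (fun w hw => ?_) ?_ (by positivity) (fun w hw => ?_) (fun w hw => ?_) hK hθK
  · simpa only [Nat.floor_natCast] using h
  · have : 0 < w := hP0.trans_le hw.1
    refine (((((hasDerivAt_id w).add_const (d : ℝ)).log ?_).sub (((hasDerivAt_id w).add_const (e : ℝ)).log ?_)).const_mul t)
    · positivity
    positivity
  · have : 0 < w := hP0.trans_le hw.1
    refine ((((hasDerivAt_id w).add_const (d : ℝ)).fun_inv ?_).sub
      (((hasDerivAt_id w).add_const (e : ℝ)).fun_inv ?_)).const_mul t |>.congr_deriv ?_ |>.congr_of_eventuallyEq ?_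
    · positivity
    · positivity
    · simp only [id]; ring
    simp
  · refine continuousOn_const.mul ((continuousOn_const.div (by fun_prop) fun w hw => ?_).sub
      (continuousOn_const.div (by fun_prop) fun w hw => ?_))
    · have : 0 < w := hP0.trans_le hw.1
      positivity
    · have : 0 < w := hP0.trans_le hw.1
      positivity
  · have hw0 : 0 < w := hP0.trans_le hw.1
    have hwP : w ≤ 2*P := hw.2.trans hQ'
    have hu : 0 < w + e := by linarith
    have hv : 0 < w + d := by linarith
    have e1 : 1/(w + e)^2 - 1/(w + d)^2 = (d - e)*(1/((w + e)^2*(w + d)) + 1/((w + e)*(w + d)^2)) := by field_simp; ring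
    have b1 : 1/(27*(P : ℝ)^3) ≤ 1/((w + e)^2*(w + d)) := by
      refine one_div_le_one_div_of_le (by positivity) ?_
      calc (w + e)^2*(w + d) ≤ (3*P)^2*(3*P) := by gcongr <;> linarith
        _ = _ := by ring
    have b2 : 1/(27*(P : ℝ)^3) ≤ 1/((w + e)*(w + d)^2) := by
      refine one_div_le_one_div_of_le (by positivity) ?_
      calc (w + e)*(w + d)^2 ≤ (3*P)*(3*P)^2 := by gcongr <;> linarith
        _ = _ := by ring
    -- Since w ≤ 2P and d, e ≤ P, both w + d and w + e are at most 3P; the two summands together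
    -- give 2/27 ≥ 1/14.
    have b3 : 1/(14*(P : ℝ)^3) ≤ 2*(1/(27*(P : ℝ)^3)) := by
      rw [← mul_div_assoc, div_le_div_iff₀ (by positivity) (by positivity)]
      have : 0 < (P : ℝ)^3 := by positivity
      linarith
    rw [e1, div_eq_mul_one_div]; refine mul_le_mul_of_nonneg_left ?_ ht.le
    have : 0 < 1/(14*(P : ℝ)^3) := by positivity
    nlinarith
  · have hw0 : 0 < w := hP0.trans_le hw.1
    have hu : 0 < w + e := by linarith
    have hv : 0 < w + d := by linarith
    have e1 : 1/(w + d) - 1/(w + e) = -((d - e)/((w + d)*(w + e))) := by field_simp; ring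
    rw [e1, mul_neg, abs_neg, abs_of_nonneg (mul_nonneg ht.le (div_nonneg (by linarith) (by positivity))), mul_div_assoc]
    refine mul_le_mul_of_nonneg_left ?_ ht.le
    have hw1 := hw.1
    refine div_le_div₀ (by linarith) (by linarith) (by positivity) ?_
    rw [pow_two]; gcongr <;> linarith

/-- Weyl–van der Corput differencing for sums of unimodular terms. -/
lemma natCast_mul_norm_sum_le {a : ℕ → ℂ} (ha : ∀ n, ‖a n‖ ≤ 1) {P Q H : ℕ} (hPQ : P ≤ Q)
    {B : ℝ} (hB0 : 0 ≤ B) (hB : ∀ d e : ℕ, d < H → e < H → d ≠ e → ‖∑ n ∈ Ioc P Q, a (n + d)*conj (a (n + e))‖ ≤ B) :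
    H*‖∑ n ∈ Ioc P Q, a n‖ ≤ √((Q - P : ℝ)*(H*(Q - P) + (H : ℝ)^2*B)) + (H : ℝ)^2 := by
  -- A shift by h affects h terms at each end of the range.
  have hsh : ∀ h : ℕ, ‖∑ n ∈ Ioc P Q, a n - ∑ n ∈ Ioc P Q, a (n + h)‖ ≤ 2*h := fun h => by
    have e : ∑ n ∈ Ioc P Q, a (n + h) = ∑ n ∈ Ioc (P + h) (Q + h), a n := by rw [← Finset.map_add_right_Ioc, Finset.sum_map]; rfl
    have e1 := sum_Ioc_consecutive a hPQ (Nat.le_add_right Q h)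
    have e2 := sum_Ioc_consecutive a (Nat.le_add_right P h) (Nat.add_le_add_right hPQ h)
    have b : ∀ m : ℕ, ‖∑ n ∈ Ioc m (m + h), a n‖ ≤ h := fun m => by refine (norm_sum_le_of_le _ fun n _ => ha n).trans (by simp)
    rw [e, show ∑ n ∈ Ioc P Q, a n - ∑ n ∈ Ioc (P + h) (Q + h), a n =
      ∑ n ∈ Ioc P (P + h), a n - ∑ n ∈ Ioc Q (Q + h), a n by grind]
    refine (norm_sub_le _ _).trans ((add_le_add (b P) (b Q)).trans (le_of_eq (by ring)))
  set S := ∑ n ∈ Ioc P Q, a n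
  set A : ℕ → ℂ := fun n => ∑ h ∈ range H, a (n + h) with hA
  have h1 : ‖(H : ℂ)*S - ∑ n ∈ Ioc P Q, A n‖ ≤ (H : ℝ)^2 := by
    rw [hA, sum_comm, show (H : ℂ)*S = ∑ h ∈ range H, S by simp, ← sum_sub_distrib]
    refine (norm_sum_le_of_le _ fun h _ => hsh h).trans ?_
    rw [← mul_sum]
    have : (∑ i ∈ range H, (i : ℝ))*2 = H*(H - 1) := by
      induction H with
      | zero => simp
      | succ k ih => rw [sum_range_succ, add_mul, ih (fun d e hd he => hB d e (by omega) (by omega)) rfl]; push_cast; ring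
    linarith
  have hsq : ∑ n ∈ Ioc P Q, ‖A n‖^2 ≤ H*(Q - P) + (H : ℝ)^2*B := by
    -- Expanding the square leaves the diagonal d = e, at most H(Q − P) in total, and fewer than H²
    -- correlations.
    have e : ((∑ n ∈ Ioc P Q, ‖A n‖^2 : ℝ) : ℂ) = ∑ d ∈ range H, ∑ e ∈ range H, ∑ n ∈ Ioc P Q, a (n + d)*conj (a (n + e)) := by
      push_cast
      calc _ = ∑ n ∈ Ioc P Q, ∑ d ∈ range H, ∑ e ∈ range H, a (n + d)*conj (a (n + e)) := by
            refine sum_congr rfl fun n _ => ?_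
            rw [← Complex.mul_conj', hA]; simp only [map_sum, Finset.sum_mul_sum]
        _ = _ := by rw [sum_comm]; exact sum_congr rfl fun d _ => sum_comm
    have hdiag : ∀ d, ‖∑ n ∈ Ioc P Q, a (n + d)*conj (a (n + d))‖ ≤ Q - P := fun d => by
      refine (norm_sum_le_of_le (n := fun _ => 1) _ fun n _ => ?_).trans ?_
      · rw [norm_mul, RCLike.norm_conj]; exact mul_le_one₀ (ha _) (norm_nonneg _) (ha _)
      · rw [sum_const, card_Ioc, nsmul_eq_mul, mul_one, cast_sub hPQ]
    rw [← norm_of_nonneg (Finset.sum_nonneg fun n _ => sq_nonneg ‖A n‖), ← norm_real, e]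
    calc _ ≤ ∑ d ∈ range H, ((Q - P : ℝ) + H*B) := by
          refine norm_sum_le_of_le _ fun d hd => ?_
          have hd' := mem_range.1 hd
          rw [← Finset.add_sum_erase _ _ hd]; refine (norm_add_le _ _).trans (add_le_add (hdiag d) ?_)
          refine (norm_sum_le_of_le (n := fun _ => B) _ fun e he => ?_).trans ?_
          · grind
          · rw [sum_const, nsmul_eq_mul]; refine mul_le_mul_of_nonneg_right ?_ hB0
            exact_mod_cast (Finset.card_le_card (Finset.erase_subset _ _)).trans (by simp)
      _ = _ := by rw [sum_const, card_range, nsmul_eq_mul]; ring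
  have h2 : ‖∑ n ∈ Ioc P Q, A n‖ ≤ √((Q - P : ℝ)*(H*(Q - P) + (H : ℝ)^2*B)) := by
    refine Real.le_sqrt_of_sq_le ?_
    have hc := sq_sum_le_card_mul_sum_sq (s := Ioc P Q) (f := fun n => ‖A n‖)
    rw [card_Ioc, cast_sub hPQ] at hc
    calc _ ≤ (∑ n ∈ Ioc P Q, ‖A n‖)^2 := by gcongr; exact norm_sum_le _ _
      _ ≤ _ := hc
      _ ≤ _ := mul_le_mul_of_nonneg_left hsq (by rw [sub_nonneg]; exact_mod_cast hPQ)
  calc (H : ℝ)*‖S‖ = ‖(H : ℂ)*S‖ := by simp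
    _ ≤ _ := norm_le_norm_sub_add _ (∑ n ∈ Ioc P Q, A n)
    _ ≤ _ := by linarith

/-- Partial summation with a nonnegative decreasing weight. -/
lemma norm_sum_antitone_mul_le {g : ℕ → ℝ} {a : ℕ → ℂ} {P Q : ℕ} {M : ℝ} (hPQ : P ≤ Q)
    (hg : ∀ n, P ≤ n → g (n + 1) ≤ g n) (hg0 : ∀ n, P ≤ n → 0 ≤ g n)
    (hM : ∀ q, P ≤ q → q ≤ Q → ‖∑ n ∈ Ioc P q, a n‖ ≤ M) :
    ‖∑ n ∈ Ioc P Q, (g n : ℂ)*a n‖ ≤ g P*M := by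
  have key : ∀ q, P ≤ q → q ≤ Q → ‖∑ n ∈ Ioc P q, (g n : ℂ)*a n - g q * ∑ n ∈ Ioc P q, a n‖ ≤ (g P - g q)*M := fun q hq => by
    induction q, hq using Nat.le_induction with
    | base => intro; simp
    | succ q hq ih =>
      intro hqQ
      have h1 := ih (by omega)
      have h2 := hM q hq (by omega)
      rw [sum_Ioc_succ_top (by omega), sum_Ioc_succ_top (by omega)]
      rw [show ∑ n ∈ Ioc P q, (g n : ℂ)*a n + g (q + 1)*a (q + 1) - g (q + 1)*(∑ n ∈ Ioc P q, a n + a (q + 1)) =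
        (∑ n ∈ Ioc P q, (g n : ℂ)*a n - g q * ∑ n ∈ Ioc P q, a n) +
        ((g q - g (q + 1) : ℝ) : ℂ) * ∑ n ∈ Ioc P q, a n by push_cast; ring]
      have hd : 0 ≤ g q - g (q + 1) := sub_nonneg.2 (hg q hq)
      calc _ ≤ _ := norm_add_le _ _
        _ ≤ (g P - g q)*M + (g q - g (q + 1))*M := by
          refine add_le_add h1 ?_
          rw [norm_mul, norm_real, norm_of_nonneg hd]; gcongr
        _ = _ := by ring
  have h1 := key Q hPQ le_rfl
  have h2 := hM Q hPQ le_rfl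
  calc _ ≤ _ := norm_le_norm_sub_add _ ((g Q : ℂ) * ∑ n ∈ Ioc P Q, a n)
    _ ≤ (g P - g Q)*M + g Q*M := by
      refine add_le_add h1 ?_
      rw [norm_mul, norm_real, norm_of_nonneg (hg0 Q hPQ)]; exact mul_le_mul_of_nonneg_left h2 (hg0 Q hPQ)
    _ = _ := by ring

lemma half_le_natFloor {x : ℝ} (hx : 1 ≤ x) : x/2 ≤ (⌊x⌋₊ : ℝ) := by
  have h1 : (1 : ℝ) ≤ ⌊x⌋₊ := mod_cast floor_pos.2 hx
  have h2 := lt_floor_add_one x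
  linarith

lemma natCast_cpow_neg_eq {n : ℕ} (hn : 0 < n) (s : ℂ) :
    (n : ℂ)^(-s) = (((n : ℝ)^(-s.re) : ℝ) : ℂ)*cexp (I*(-s.im*log n : ℝ)) := by
  have := cpow_neg_eq_rpow_mul_exp (w := (n : ℝ)) (mod_cast hn) s
  simpa using this

/-- Van der Corput's bound for `∑ n^(-it)` over a dyadic block of length between `t^0.45` and
`t^0.55`. -/
lemma norm_sum_exp_neg_log_le {τ : ℝ} (hτ : 1 ≤ τ) {P Q : ℕ} (hP : τ^9/2 ≤ P)
    (hP2 : (P : ℝ) ≤ τ^11) (hHP : ⌊τ^2⌋₊ ≤ P) (hPQ : P ≤ Q) (hQ : Q ≤ 2*P) :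
    ‖∑ n ∈ Ioc P Q, cexp (I*(-τ^20*log n : ℝ))‖ ≤ 2*(P/τ) + 21*(τ^6*(P : ℝ)^(1/4 : ℝ)) + τ^2 := by
  have hP0 : (0 : ℝ) < P := lt_of_lt_of_le (by positivity) hP
  have hP1 : 1 ≤ P := mod_cast hP0
  -- With t = τ^20 this shift length is t^(1/10); the diagonal then contributes about P/√H = P/τ.
  set H := ⌊τ^2⌋₊
  have hH1 : (H : ℝ) ≤ τ^2 := floor_le (by positivity)
  have hH2 : τ^2/2 ≤ H := half_le_natFloor (one_le_pow₀ hτ)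
  have hH0 : (0 : ℝ) < H := lt_of_lt_of_le (by positivity) hH2
  set p := (P : ℝ)^(1/4 : ℝ) with hp
  have hp0 : 0 < p := rpow_pos_of_pos hP0 _
  have hp4 : p^4 = P := by rw [hp, ← rpow_natCast, ← rpow_mul hP0.le]; norm_num
  set t := τ^20 with ht
  have ht0 : 0 < t := by positivity
  set θ := t*H/(P : ℝ)^2 with hθ
  set K := ⌈θ⌉₊
  have hθ0 : 0 < θ := by positivity
  have hK1 : 1 ≤ K := Nat.ceil_pos.2 hθ0
  have hθK : θ ≤ π*K := by
    have h1 := le_ceil θ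
    have := pi_gt_three
    nlinarith
  have hKle : (K : ℝ) ≤ 2*(τ^22/P^2) := by
    have h1 := (Nat.ceil_lt_add_one hθ0.le).le
    have h2 : θ ≤ τ^22/P^2 := by
      rw [hθ]; refine div_le_div_of_nonneg_right ?_ (by positivity)
      calc t*H ≤ τ^20*τ^2 := by gcongr
        _ = τ^22 := by ring
    -- Here P ≤ τ^11 enters: rounding the number of frequencies up to an integer at most doubles its
    -- bound τ^22/P².
    have h3 : 1 ≤ τ^22/P^2 := by
      rw [le_div_iff₀ (by positivity), one_mul]
      calc (P : ℝ)^2 ≤ (τ^11)^2 := by gcongr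
        _ = _ := by ring
    linarith
  set B := 30*(K : ℝ)*(1 + 1/√(t/(14*(P : ℝ)^3))) with hB
  have hB0 : 0 ≤ B := by positivity
  have hV := natCast_mul_norm_sum_le (a := fun n : ℕ => cexp (I*(-t*log n : ℝ)))
    (fun n => by rw [mul_comm, norm_exp_ofReal_mul_I]) (H := H) hPQ hB0 (fun d e hd he hde => by
      rcases lt_or_gt_of_ne hde with h | h
      · refine le_trans (le_of_eq ?_) (norm_sum_exp_log_sub_log_le ht0 hP1 hPQ hQ h he.le hHP hK1 hθK)
        congr 1
        refine sum_congr rfl fun n _ => ?_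
        rw [← exp_conj, ← exp_add]; congr 1; simp only [map_mul, conj_I, conj_ofReal]; push_cast; ring
      · refine le_trans (le_of_eq ?_) (norm_sum_exp_log_sub_log_le ht0 hP1 hPQ hQ h hd.le hHP hK1 hθK)
        rw [← RCLike.norm_conj, map_sum]; congr 1; refine sum_congr rfl fun n _ => ?_
        rw [map_mul, conj_conj, ← exp_conj, ← exp_add]; congr 1; simp only [map_mul, conj_I, conj_ofReal]
        push_cast; ring)
  set S := ∑ n ∈ Ioc P Q, cexp (I*(-t*log n : ℝ))
  -- The frequency count τ^22/P², the second derivative bound (P³/τ^20)^(1/2) and the factor P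
  -- multiply to τ^12 P^(1/2), up to a constant.
  have hBle : P*B ≤ (21*(τ^6*p))^2 := by
    have e1 : √(t/(14*(P : ℝ)^3)) = τ^10/(√14*p^6) := by
      rw [← hp4, ht, show τ^20/(14*(p^4)^3) = (τ^10/(√14*p^6))^2 by
        rw [div_pow, mul_pow, sq_sqrt (by norm_num)]; ring, sqrt_sq (by positivity)]
    have e2 : √14 ≤ 4 := sqrt_le_iff.2 (by norm_num)
    have e3 : 1 ≤ 3*(p^6/τ^10) := by
      rw [← mul_div_assoc, le_div_iff₀ (by positivity), one_mul]
      refine (sq_le_sq₀ (by positivity) (by positivity)).1 ?_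
      calc (τ^10)^2 = τ^20 := by ring
        _ ≤ τ^27 := pow_le_pow_right₀ hτ (by norm_num)
        _ ≤ 9*(τ^9/2)^3 := by
          have : 0 < τ^27 := by positivity
          linarith
        _ ≤ 9*(P : ℝ)^3 := by gcongr
        _ = _ := by rw [← hp4]; ring
    have e4 : 1 + 1/√(t/(14*(P : ℝ)^3)) ≤ 7*(p^6/τ^10) := by
      rw [e1, one_div_div]
      have : √14*p^6/τ^10 ≤ 4*(p^6/τ^10) := by rw [mul_div_assoc]; gcongr
      linarith
    calc P*B ≤ P*(30*(2*(τ^22/P^2))*(7*(p^6/τ^10))) := by rw [hB]; gcongr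
      _ = 420*(τ^12*p^2) := by rw [← hp4]; field_simp; ring
      _ ≤ 441*(τ^12*p^2) := by gcongr; norm_num
      _ = _ := by ring
  have hQP : (Q : ℝ) - P ≤ P := by
    have : (Q : ℝ) ≤ 2*P := mod_cast hQ
    linarith
  have hQP0 : 0 ≤ (Q : ℝ) - P := by
    have : (P : ℝ) ≤ Q := mod_cast hPQ
    linarith
  have hR : √((Q - P : ℝ)*(H*(Q - P) + (H : ℝ)^2*B)) ≤ H*(2*(P/τ) + 21*(τ^6*p)) := by
    refine sqrt_le_iff.2 ⟨by positivity, ?_⟩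
    have h1 : (H : ℝ)*P^2 ≤ (H*(2*(P/τ)))^2 := by
      have : (H*(2*(P/τ)))^2 = H*P^2*(4*H/τ^2) := by field_simp; ring
      rw [this]; refine le_mul_of_one_le_right (by positivity) ?_
      rw [le_div_iff₀ (by positivity)]; linarith
    calc (Q - P : ℝ)*(H*(Q - P) + (H : ℝ)^2*B) ≤ P*(H*P + (H : ℝ)^2*B) := by gcongr
      _ = H*P^2 + (H : ℝ)^2*(P*B) := by ring
      _ ≤ (H*(2*(P/τ)))^2 + (H : ℝ)^2*(21*(τ^6*p))^2 := by gcongr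
      _ ≤ _ := by
        have : 0 ≤ (H : ℝ)^2*(2*(P/τ))*(21*(τ^6*p)) := by positivity
        nlinarith
  have : H*‖S‖ ≤ H*(2*(P/τ) + 21*(τ^6*p) + τ^2) := by
    calc _ ≤ _ := hV
      _ ≤ H*(2*(P/τ) + 21*(τ^6*p)) + H*τ^2 := by
        refine add_le_add hR ?_
        rw [pow_two]; gcongr
      _ = _ := by ring
  exact le_of_mul_le_mul_left this hH0

/-- Partial summation with a weight at most P^(-0.499). The first term of the exponential sum bound
is worst at P = τ^11, where it gives τ^4.511; the second is worst at P = τ^9/2, where it gives about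
τ^3.76. The exponent 4.6 leaves room. -/
lemma norm_sum_cpow_block_le {τ : ℝ} (hτ : 1 ≤ τ) {P Q : ℕ} (hP : τ^9/2 ≤ P)
    (hP2 : (P : ℝ) ≤ τ^11) (hHP : ⌊τ^2⌋₊ ≤ P) (hPQ : P ≤ Q) (hQ : Q ≤ 2*P)
    {s : ℂ} (hs : s.im = τ^20) (hs1 : 0.499 ≤ s.re) :
    ‖∑ n ∈ Ioc P Q, (n : ℂ)^(-s)‖ ≤ 45*τ^(4.6 : ℝ) := by
  have hτ0 : 0 < τ := by linarith
  have hP0 : (0 : ℝ) < P := lt_of_lt_of_le (by positivity) hP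
  have hP1 : (1 : ℝ) ≤ P := by
    have : 1 ≤ P := mod_cast hP0
    exact_mod_cast this
  have h := norm_sum_antitone_mul_le (g := fun n => (n : ℝ)^(-s.re)) (a := fun n => cexp (I*(-τ^20*log n : ℝ))) hPQ
    (fun n hn => rpow_le_rpow_of_nonpos (by
      have : (P : ℝ) ≤ n := mod_cast hn
      linarith) (by push_cast; linarith) (by linarith))
    (fun n _ => by positivity)
    (fun q hq hqQ => norm_sum_exp_neg_log_le hτ hP hP2 hHP hq (hqQ.trans hQ))
  have e : ∑ n ∈ Ioc P Q, (n : ℂ)^(-s) = ∑ n ∈ Ioc P Q, (((n : ℝ)^(-s.re) : ℝ) : ℂ)*cexp (I*(-τ^20*log n : ℝ)) := by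
    refine sum_congr rfl fun n hn => ?_
    rw [natCast_cpow_neg_eq (by grind), hs]
  rw [e]
  refine h.trans ?_
  have b0 : (P : ℝ)^(-s.re) ≤ (P : ℝ)^(-0.499 : ℝ) := rpow_le_rpow_of_exponent_le hP1 (by linarith)
  have c1 : (P : ℝ)^(-0.499 : ℝ)*(P/τ) ≤ τ^(4.6 : ℝ) := by
    calc _ = (P : ℝ)^(0.501 : ℝ)/τ := by rw [← mul_div_assoc, ← Real.rpow_add_one hP0.ne']; norm_num
      _ ≤ (τ^11)^(0.501 : ℝ)/τ := by gcongr
      _ = τ^(4.511 : ℝ) := by rw [← rpow_natCast, ← rpow_mul hτ0.le, ← Real.rpow_sub_one hτ0.ne']; norm_num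
      _ ≤ _ := rpow_le_rpow_of_exponent_le hτ (by norm_num)
  have c2 : (P : ℝ)^(-0.499 : ℝ)*(τ^6*(P : ℝ)^(1/4 : ℝ)) ≤ 2*τ^(4.6 : ℝ) := by
    calc _ = τ^6*(P : ℝ)^(-0.249 : ℝ) := by rw [mul_left_comm, ← rpow_add hP0]; norm_num
      _ ≤ τ^6*(τ^9/2)^(-0.249 : ℝ) := by
          gcongr τ^6 * ?_
          exact rpow_le_rpow_of_nonpos (by positivity) hP (by norm_num)
      _ = (τ^(6 : ℝ)*τ^(9*(-0.249) : ℝ))*2^(0.249 : ℝ) := by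
          rw [div_rpow (by positivity) (by positivity), ← rpow_natCast τ 9,
            ← rpow_mul hτ0.le, ← rpow_natCast τ 6, rpow_neg two_pos.le 0.249, div_inv_eq_mul]
          push_cast; ring
      _ ≤ τ^(4.6 : ℝ)*2^(1 : ℝ) := by rw [← rpow_add hτ0]; gcongr <;> norm_num
      _ = _ := by rw [rpow_one]; ring
  have c3 : (P : ℝ)^(-0.499 : ℝ)*τ^2 ≤ τ^(4.6 : ℝ) := by
    calc _ ≤ 1*τ^(2 : ℝ) := by
          rw [← rpow_natCast τ 2]; push_cast; gcongr
          exact Real.rpow_le_one_of_one_le_of_nonpos hP1 (by norm_num)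
      _ ≤ _ := by rw [one_mul]; exact rpow_le_rpow_of_exponent_le hτ (by norm_num)
  calc _ ≤ (P : ℝ)^(-0.499 : ℝ)*(2*(P/τ) + 21*(τ^6*(P : ℝ)^(1/4 : ℝ)) + τ^2) := by gcongr
    _ ≤ _ := by nlinarith

lemma norm_sum_cpow_dyadic_le {D : ℝ} {s : ℂ} {P U : ℕ} (hD0 : 0 ≤ D)
    (hD : ∀ p q : ℕ, P ≤ p → p ≤ U → p ≤ q → q ≤ 2*p → ‖∑ n ∈ Ioc p q, (n : ℂ)^(-s)‖ ≤ D) (j : ℕ) :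
    ∀ q, P ≤ q → q ≤ U → q ≤ 2^j*P → ‖∑ n ∈ Ioc P q, (n : ℂ)^(-s)‖ ≤ j*D := by
  induction j with
  | zero =>
    intro q hq _ hq'
    have : q = P := by omega
    simp [this]
  | succ j ih =>
    intro q hq hqU hq'; push_cast
    rcases le_total q (2^j*P) with h | h
    · grind
    · have h1 : P ≤ 2^j*P := Nat.le_mul_of_pos_left _ (by positivity)
      rw [← sum_Ioc_consecutive _ h1 h]; refine (norm_add_le _ _).trans ?_
      have a1 := ih _ h1 (h.trans hqU) le_rfl
      have a2 := hD _ q h1 (h.trans hqU) h (by rw [pow_succ] at hq'; linarith)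
      linarith

/-- With t = τ^20 the exponent is 0.24 in t. Terms n ≤ τ^9 are summed trivially, those up to τ^11 in
dyadic blocks by van der Corput's bound, and the truncation error at τ^11 is √t · τ^(-5.489) up to a
logarithm. Each part is O(τ^4.6) apart from logarithms, which the remaining τ^0.2 absorbs. -/
lemma exists_norm_riemannZeta₀_le_rpow_of_pos : ∃ K : ℝ, 0 ≤ K ∧ ∀ τ : ℝ, 1 ≤ τ → ∀ s : ℂ, 0.499 ≤ s.re →
    s.re ≤ 0.501 → s.im = τ^20 → ‖riemannZeta₀ s‖ ≤ K*τ^(4.8 : ℝ) := by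
  refine ⟨36000, by norm_num, fun τ hτ s hs1 hs2 hs => ?_⟩
  have hτ0 : 0 < τ := by linarith
  set t := τ^20 with ht
  have ht1 : 1 ≤ t := one_le_pow₀ hτ
  set N := ⌈t⌉₊ + 1 with hN
  have hN2 : 2 ≤ N := by
    have : 0 < ⌈t⌉₊ := Nat.ceil_pos.2 (by linarith)
    omega
  have hNt : t ≤ N := by
    rw [hN]; push_cast
    have := le_ceil t
    linarith
  have hNle : (N : ℝ) ≤ 3*t := by
    rw [hN]; push_cast
    have := (Nat.ceil_lt_add_one (by linarith : 0 ≤ t)).le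
    linarith
  set u := τ^11 with hu
  have hu1 : 1 ≤ u := one_le_pow₀ hτ
  have hu0 : 0 < u := by linarith
  have hut : u ≤ t := pow_le_pow_right₀ hτ (by norm_num)
  have hsne : s ≠ 1 := by rintro rfl; norm_num at hs2
  have hlogτ : 0 ≤ log τ := log_nonneg hτ
  have hlog5 : log τ ≤ 5*τ^(0.2 : ℝ) := by
    have := Real.log_le_rpow_div hτ0.le (by norm_num : (0 : ℝ) < 0.2)
    exact this.trans (le_of_eq (by ring))
  have h02 : 1 ≤ τ^(0.2 : ℝ) := one_le_rpow hτ (by norm_num)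
  have h48 : τ^(4.6 : ℝ)*τ^(0.2 : ℝ) = τ^(4.8 : ℝ) := by rw [← rpow_add hτ0]; norm_num
  have hmain := norm_riemannZeta₀_sub_le hN2 (by linarith) (by linarith) hsne (by grind) hu1 (hut.trans hNt)
  have hE : 100*√(N : ℝ)*u^(-s.re)*(1 + log N) ≤ 174*τ^(4.6 : ℝ)*(103*τ^(0.2 : ℝ)) := by
    have e1 : √(N : ℝ) ≤ 1.74*τ^10 := by
      refine sqrt_le_iff.2 ⟨by positivity, hNle.trans ?_⟩
      linarith
    have e2 : u^(-s.re) ≤ τ^(-5.489 : ℝ) := by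
      calc u^(-s.re) ≤ u^(-0.499 : ℝ) := rpow_le_rpow_of_exponent_le hu1 (by linarith)
        _ = _ := by rw [hu, ← rpow_natCast, ← rpow_mul hτ0.le]; norm_num
    have e3 : log N ≤ 2 + 20*log τ := by
      calc log N ≤ log (3*t) := log_le_log (by linarith) hNle
        _ = log 3 + 20*log τ := by rw [Real.log_mul (by norm_num) (by positivity), ht, log_pow]; norm_num
        _ ≤ _ := by
          have := log_le_sub_one_of_pos (by norm_num : (0 : ℝ) < 3)
          linarith
    have e4 : τ^10*τ^(-5.489 : ℝ) ≤ τ^(4.6 : ℝ) := by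
      rw [← rpow_natCast, ← rpow_add hτ0]; exact rpow_le_rpow_of_exponent_le hτ (by norm_num)
    calc _ ≤ 100*(1.74*τ^10)*τ^(-5.489 : ℝ)*(1 + log N) := by gcongr
      _ = 174*(τ^10*τ^(-5.489 : ℝ))*(1 + log N) := by ring
      _ ≤ _ := by gcongr; linarith
  have hI : ‖((u : ℂ)^(1 - s) - 1)/(s - 1)‖ ≤ 2*τ^(4.8 : ℝ) := by
    have d1 : t ≤ ‖s - 1‖ := by
      have := abs_im_le_norm (s - 1)
      simp only [sub_im, one_im, sub_zero, hs] at this; grind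
    have d2 : ‖(u : ℂ)^(1 - s)‖ ≤ u := by
      rw [norm_cpow_eq_rpow_re_of_pos hu0, sub_re, one_re]
      calc u^(1 - s.re) ≤ u^(1 : ℝ) := rpow_le_rpow_of_exponent_le hu1 (by linarith)
        _ = u := rpow_one u
    have h481 : 1 ≤ τ^(4.8 : ℝ) := one_le_rpow hτ (by norm_num)
    rw [norm_div, div_le_iff₀ (by linarith)]
    calc _ ≤ u + 1 := (norm_sub_le _ _).trans (by simpa using d2)
      _ ≤ 2*1*t := by linarith
      _ ≤ _ := by gcongr
  set P := ⌊τ^9⌋₊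
  have hτ9 : 1 ≤ τ^9 := one_le_pow₀ hτ
  have hPτ : (P : ℝ) ≤ τ^9 := floor_le (by positivity)
  have hPU : P ≤ ⌊u⌋₊ := floor_le_floor (pow_le_pow_right₀ hτ (by norm_num))
  have hHP : ⌊τ^2⌋₊ ≤ P := floor_le_floor (pow_le_pow_right₀ hτ (by norm_num))
  have hPhalf : τ^9/2 ≤ P := half_le_natFloor hτ9
  have hS1 : ‖∑ n ∈ Ioc 0 P, (n : ℂ)^(-s)‖ ≤ τ^(4.6 : ℝ)*(46*τ^(0.2 : ℝ)) := by
    calc _ ≤ ∑ n ∈ Ioc 0 P, τ^(4.6 : ℝ)*(1/(n : ℝ)) := by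
          refine norm_sum_le_of_le _ fun n hn => ?_
          rw [mem_Ioc] at hn
          have hn1 : (1 : ℝ) ≤ n := mod_cast hn.1
          have hn2 : (n : ℝ) ≤ τ^9 := le_trans (mod_cast hn.2) hPτ
          rw [norm_natCast_cpow_neg hn.1, mul_one_div, le_div_iff₀ (by linarith), ← Real.rpow_add_one (by linarith)]
          calc (n : ℝ)^(-s.re + 1) ≤ (n : ℝ)^(0.501 : ℝ) := rpow_le_rpow_of_exponent_le hn1 (by linarith)
            _ ≤ (τ^9)^(0.501 : ℝ) := by gcongr
            _ = τ^(4.509 : ℝ) := by rw [← rpow_natCast, ← rpow_mul hτ0.le]; norm_num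
            _ ≤ _ := rpow_le_rpow_of_exponent_le hτ (by norm_num)
      _ ≤ τ^(4.6 : ℝ)*(1 + log (τ^9)) := by
          rw [← mul_sum]; exact mul_le_mul_of_nonneg_left (sum_Ioc_one_div_le hτ9) (by positivity)
      _ ≤ _ := by rw [log_pow]; gcongr; linarith
  -- Enough dyadic blocks: 20 log 2 > 11, hence 2^j ≥ τ^11.
  set j := ⌈20*log τ⌉₊
  have hjle : (j : ℝ) ≤ 101*τ^(0.2 : ℝ) := by
    have := (Nat.ceil_lt_add_one (by linarith : 0 ≤ 20*log τ)).le
    linarith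
  have h2j : u ≤ (2 : ℝ)^j := by
    have h1 := le_ceil (20*log τ)
    rw [hu, ← Real.log_le_log_iff (by positivity) (by positivity), log_pow, log_pow]
    have := log_two_gt_d9
    push_cast; nlinarith
  have hS2 : ‖∑ n ∈ Ioc P ⌊u⌋₊, (n : ℂ)^(-s)‖ ≤ j*(45*τ^(4.6 : ℝ)) := by
    refine norm_sum_cpow_dyadic_le (U := ⌊u⌋₊) (by positivity) (fun p q hp hpU hpq hq => ?_) j _ hPU le_rfl ?_
    · have hp' : (P : ℝ) ≤ p := mod_cast hp
      exact norm_sum_cpow_block_le hτ (hPhalf.trans hp') ((le_floor_iff hu0.le).1 hpU) (hHP.trans hp) hpq hq hs hs1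
    · have h1 : 0 < P := floor_pos.2 hτ9
      have : ⌊u⌋₊ ≤ 2^j := by
        have := (floor_le hu0.le).trans h2j
        exact_mod_cast this
      exact this.trans (Nat.le_mul_of_pos_right _ h1)
  have hsum := sum_Ioc_consecutive (fun n : ℕ => (n : ℂ)^(-s)) (Nat.zero_le P) hPU
  rw [sub_sub] at hmain
  have hS2' : j*(45*τ^(4.6 : ℝ)) ≤ (101*τ^(0.2 : ℝ))*(45*τ^(4.6 : ℝ)) := by gcongr
  have h480 : 0 < τ^(4.8 : ℝ) := by positivity
  calc ‖riemannZeta₀ s‖ ≤ _ := norm_le_norm_sub_add _ (∑ n ∈ Ioc 0 ⌊u⌋₊, (n : ℂ)^(-s) + ((u : ℂ)^(1 - s) - 1)/(s - 1))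
    _ ≤ 174*τ^(4.6 : ℝ)*(103*τ^(0.2 : ℝ)) + ((τ^(4.6 : ℝ)*(46*τ^(0.2 : ℝ)) +
        (101*τ^(0.2 : ℝ))*(45*τ^(4.6 : ℝ))) + 2*τ^(4.8 : ℝ)) := by
      refine add_le_add (hmain.trans hE) ((norm_add_le _ _).trans (add_le_add ?_ hI))
      rw [← hsum]; exact (norm_add_le _ _).trans (add_le_add hS1 (hS2.trans hS2'))
    _ ≤ _ := by linarith

lemma riemannZeta₀_conj (s : ℂ) : riemannZeta₀ (conj s) = conj (riemannZeta₀ s) := by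
  rcases eq_or_ne s 1 with rfl | hs
  · simp
  · have h := riemannZeta_conj s
    rw [riemannZeta_eq_inv_sub_add hs, riemannZeta_eq_inv_sub_add (by rwa [Ne, map_eq_one_iff _ (RingHom.injective _)])] at h
    simpa using h

/-- A subconvexity bound near the critical line. -/
lemma exists_norm_riemannZeta₀_le_rpow : ∃ K : ℝ, 0 ≤ K ∧ ∀ s : ℂ, 0.499 ≤ s.re →
    s.re ≤ 0.501 → ‖riemannZeta₀ s‖ ≤ K*(1 + |s.im|)^(0.24 : ℝ) := by
  obtain ⟨K, hK0, hK⟩ := exists_norm_riemannZeta₀_le_rpow_of_pos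
  refine ⟨max K (305*rexp 0*(2 : ℝ)*log 2), le_max_of_le_left hK0, fun s hs1 hs2 => ?_⟩
  have hpos : 1 ≤ (1 + |s.im|)^(0.24 : ℝ) := one_le_rpow (by simp) (by norm_num)
  rcases le_total |s.im| 1 with h | h
  · have := norm_riemannZeta₀_le_convexity (C := 0) le_rfl (N := 2) le_rfl (s := s) (by linarith)
      (by linarith) (by simp; linarith) (by push_cast; linarith)
    refine this.trans ?_
    rw [← mul_one (305*_*_*_)]
    refine mul_le_mul (le_max_of_le_right ?_) hpos (by norm_num) (le_max_of_le_left hK0)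
    have h2 := log_two_gt_d9
    push_cast; gcongr
    calc (2 : ℝ)^((1 - s.re)/2) ≤ 2^(1 : ℝ) := rpow_le_rpow_of_exponent_le (by norm_num) (by linarith)
      _ = 2 := rpow_one 2
  · have key : ∀ z : ℂ, 0.499 ≤ z.re → z.re ≤ 0.501 → 1 ≤ z.im →
        ‖riemannZeta₀ z‖ ≤ K*(1 + z.im)^(0.24 : ℝ) := fun z h1 h2 h3 => by
      -- The twentieth root makes all exponents of the method integral; τ^4.8 is (Im z)^0.24.
      set τ := z.im^(1/20 : ℝ) with hτ
      have hτ1 : 1 ≤ τ := one_le_rpow h3 (by norm_num)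
      have hz : z.im = τ^20 := by rw [hτ, ← rpow_natCast, ← rpow_mul (by linarith)]; norm_num
      refine (hK τ hτ1 z h1 h2 hz).trans ?_
      gcongr; rw [hτ, ← rpow_mul (by linarith)]
      norm_num; gcongr; linarith
    have : ‖riemannZeta₀ s‖ ≤ K*(1 + |s.im|)^(0.24 : ℝ) := by
      rcases le_total 0 s.im with h0 | h0
      · grind
      · rw [abs_of_nonpos h0] at h ⊢
        have := key (conj s) (by simpa) (by simpa) (by simpa)
        simpa [riemannZeta₀_conj] using this
    refine this.trans ?_
    gcongr; simp

/-! ### Stirling's formula for Γ and for χ -/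

/-- The elementary part of the logarithm of the Gamma function in Stirling's formula. -/
def stirlingExponent (s : ℂ) : ℂ := (s - 1/2)*Complex.log s - s

/-- Measures how far the exponent is from satisfying the difference equation of log Γ. The defect is
an integral over [0, 1]; subtracting a multiple of the zero-mean function 1/2 − u leaves the
integrand (1/2 − u)²/((s + u)(s + 1/2)), of second order in 1/s. -/
lemma norm_stirlingExponent_add_one_sub_le {s : ℂ} (hs : 0 < s.re) :
    ‖stirlingExponent (s + 1) - stirlingExponent s - Complex.log s‖ ≤ 1/(4*‖s‖^2) := by
  have hsl : ∀ u : ℝ, 0 ≤ u → s + u ∈ slitPlane := fun u hu => by left; simp; linarith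
  have hne : ∀ u : ℝ, 0 ≤ u → s + u ≠ 0 := fun u hu => Complex.slitPlane_ne_zero (hsl u hu)
  have hd : ∀ u ∈ uIcc (0 : ℝ) 1, HasDerivAt (fun u : ℝ => (s + 1/2)*Complex.log (s + u) - u)
      ((s + 1/2)/(s + u) - 1) u := fun u hu => by
    rw [uIcc_of_le zero_le_one] at hu
    have h1 : HasDerivAt (fun u : ℝ => s + (u : ℂ)) 1 u := (ofRealCLM.hasDerivAt).const_add s
    have := ((h1.clog_real (hsl u hu.1)).const_mul (s + 1/2)).sub (ofRealCLM.hasDerivAt (x := u))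
    refine this.congr_deriv ?_
    simp [div_eq_mul_inv]
  have hc : ContinuousOn (fun u : ℝ => (s + 1/2)/(s + u) - 1) (uIcc (0 : ℝ) 1) := by
    rw [uIcc_of_le zero_le_one]
    exact (continuousOn_const.div (by fun_prop) fun u hu => hne u hu.1).sub continuousOn_const
  have hI := integral_eq_sub_of_hasDerivAt hd hc.intervalIntegrable
  have hcc : ContinuousOn (fun u : ℝ => ((1/2 - u)/(s + 1/2) : ℂ)) (uIcc (0 : ℝ) 1) := by fun_prop
  have hh : s + 1/2 ≠ 0 := by have := hne (1/2) (by norm_num); push_cast at this; exact this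
  have hz : ∫ u in (0 : ℝ)..1, ((1/2 - u)/(s + 1/2) : ℂ) = 0 := by
    rw [integral_div]
    have : ∫ u in (0 : ℝ)..1, (1/2 - (u : ℂ)) = ((∫ u in (0 : ℝ)..1, (1/2 - u) : ℝ) : ℂ) := by
      rw [← intervalIntegral.integral_ofReal]; push_cast; rfl
    have h0 : ∫ u in (0 : ℝ)..1, (1/2 - u) = 0 := by
      rw [integral_sub (by simp) (by simp)]
      simp
    rw [this, h0]; simp
  have e : stirlingExponent (s + 1) - stirlingExponent s - Complex.log s =
      ∫ u in (0 : ℝ)..1, ((1/2 - u)^2/((s + u)*(s + 1/2)) : ℂ) := by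
    have e1 : ∫ u in (0 : ℝ)..1, ((1/2 - u)^2/((s + u)*(s + 1/2)) : ℂ) =
        ∫ u in (0 : ℝ)..1, (((s + 1/2)/(s + u) - 1) - (1/2 - u)/(s + 1/2) : ℂ) := by
      refine integral_congr fun u hu => ?_
      rw [uIcc_of_le zero_le_one] at hu; grind
    rw [e1, integral_sub hc.intervalIntegrable hcc.intervalIntegrable, hI, hz]; simp only [stirlingExponent]
    push_cast; ring_nf
  rw [e]
  have hs0 : 0 < ‖s‖ := norm_pos_iff.2 (by simpa using hne 0 le_rfl)
  have hn : ∀ u : ℝ, 0 ≤ u → ‖s‖ ≤ ‖s + u‖ := fun u hu => by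
    rw [norm_def, norm_def]; refine sqrt_le_sqrt ?_
    simp only [normSq_apply, add_re, add_im, ofReal_re, ofReal_im]; nlinarith
  have := norm_integral_le_of_norm_le_const (a := (0 : ℝ)) (b := 1)
    (f := fun u : ℝ => ((1/2 - u)^2/((s + u)*(s + 1/2)) : ℂ)) (C := 1/(4*‖s‖^2)) (fun u hu => by
      rw [uIoc_of_le zero_le_one] at hu; rw [norm_div, norm_mul]
      have a1 := hn u hu.1.le
      have a2 := hn (1/2) (by norm_num)
      push_cast at a2
      have a3 : ‖((1/2 - u)^2 : ℂ)‖ ≤ 1/4 := by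
        rw [show ((1/2 - u)^2 : ℂ) = (((1/2 - u)^2 : ℝ) : ℂ) by push_cast; ring, norm_real, norm_of_nonneg (sq_nonneg _)]
        nlinarith [hu.1, hu.2]
      calc _ ≤ (1/4)/(‖s‖*‖s‖) := by gcongr
        _ = _ := by field_simp)
  simpa using this

lemma sum_one_div_sq_add_le {t : ℝ} (ht : 1 ≤ t) (n : ℕ) : ∑ j ∈ range n, 1/(4*(t^2 + (j : ℝ)^2)) ≤ 1/t := by
  have h : ∑ j ∈ range n, 1/(4*(t^2 + (j : ℝ)^2)) ≤ 1/t - 1/(t + n) := by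
    induction n with
    | zero => simp
    | succ n ih =>
      rw [sum_range_succ]
      have : 1/(4*(t^2 + (n : ℝ)^2)) ≤ 1/(t + n) - 1/(t + (n + 1)) := by
        rw [div_sub_div _ _ (by positivity) (by positivity), div_le_div_iff₀ (by positivity) (by positivity)]
        nlinarith [sq_nonneg (t - n)]
      push_cast; linarith
  have : 0 ≤ 1/(t + n) := by positivity
  linarith

lemma exp_stirlingExponent_prod {s : ℂ} (hs : 0 < s.re) (n : ℕ) :
    ∏ j ∈ range n, (s + j) = cexp (stirlingExponent (s + n) - stirlingExponent s -
      ∑ j ∈ range n, (stirlingExponent (s + j + 1) - stirlingExponent (s + j) - Complex.log (s + j))) := by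
  have h : ∀ j : ℕ, s + j ≠ 0 := fun j h => by
    have := congrArg re h
    simp at this; linarith
  have e : stirlingExponent (s + n) - stirlingExponent s -
      ∑ j ∈ range n, (stirlingExponent (s + j + 1) - stirlingExponent (s + j) - Complex.log (s + j)) =
      ∑ j ∈ range n, Complex.log (s + j) := by
    induction n with
    | zero => simp
    | succ n ih => rw [sum_range_succ, sum_range_succ, ← ih]; push_cast; ring_nf
  rw [e, Complex.exp_sum]
  exact Finset.prod_congr rfl fun j _ => (Complex.exp_log (h j)).symm

/-- Fixes the constant of Stirling's formula: in Euler's limit for Γ the contribution from infinity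
is evaluated by the real formula for n!. -/
lemma tendsto_cpow_mul_factorial_mul_exp_neg_stirlingExponent {s : ℂ} (hs : 0 < s.re) :
    Tendsto (fun n : ℕ => (n : ℂ)^s*(n.factorial : ℂ)*cexp (-stirlingExponent (s + (n + 1 : ℕ)))) atTop (𝓝 (√(2*π) : ℝ)) := by
  have hS := Stirling.tendsto_stirlingSeq_sqrt_pi
  have h1 : Tendsto (fun n : ℕ => (((√2*Stirling.stirlingSeq n : ℝ)) : ℂ)) atTop (𝓝 (√(2*π) : ℝ)) := by
    rw [sqrt_mul two_pos.le]; exact (continuous_ofReal.tendsto _).comp (hS.const_mul _)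
  have h2 : Tendsto (fun n : ℕ => (n : ℂ)*Complex.log (1 + (s + 1)/n)) atTop (𝓝 (s + 1)) := by
    refine Complex.tendsto_nat_mul_log_one_add_of_tendsto ?_
    refine tendsto_const_nhds.congr' ?_
    filter_upwards [eventually_ne_atTop 0] with n hn
    have : (n : ℂ) ≠ 0 := mod_cast hn
    field_simp
  have h3 : Tendsto (fun n : ℕ => (s + 1)/(n : ℂ)) atTop (𝓝 0) := tendsto_const_div_atTop_nhds_zero_nat (s + 1)
  have h4 : Tendsto (fun n : ℕ => Complex.log (1 + (s + 1)/n)) atTop (𝓝 0) := by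
    have := (continuousAt_clog (x := 1) (by simp)).tendsto.comp
      (by simpa using h3.const_add 1 : Tendsto (fun n : ℕ => 1 + (s + 1)/(n : ℂ)) atTop (𝓝 1))
    simpa [comp_def] using this
  have h5 : Tendsto (fun n : ℕ => cexp (s + 1 - ((n : ℂ)*Complex.log (1 + (s + 1)/n) +
      (s + 1/2)*Complex.log (1 + (s + 1)/n)))) atTop (𝓝 1) := by
    have := (continuous_exp.tendsto _).comp ((h2.add (h4.const_mul (s + 1/2))).const_sub (s + 1))
    simpa [comp_def] using this
  have h6 := h1.mul h5
  rw [mul_one] at h6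
  refine h6.congr' ?_
  filter_upwards [eventually_gt_atTop 0] with n hn
  have hn0 : (0 : ℝ) < n := mod_cast hn
  have hnC : (n : ℂ) ≠ 0 := mod_cast hn.ne'
  have hlog : Complex.log (s + (n + 1 : ℕ)) = log n + Complex.log (1 + (s + 1)/n) := by
    have : s + (n + 1 : ℕ) = (n : ℝ)*(1 + (s + 1)/n) := by push_cast; field_simp; ring
    rw [this, log_ofReal_mul hn0]; intro h
    have h' := congrArg re h
    have : ((s + 1)/(n : ℂ)).re = (s.re + 1)/n := by simp
    rw [add_re, one_re, this, Complex.zero_re] at h'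
    have : 0 < (s.re + 1)/n := by positivity
    linarith
  have hfac : (n.factorial : ℂ) = ((√2*Stirling.stirlingSeq n : ℝ) : ℂ)*cexp ((n + 1/2)*log n - n) := by
    rw [show cexp (((n : ℂ) + 1/2)*log n - n) = ((rexp ((n + 1/2)*log n - n) : ℝ) : ℂ) by push_cast; rfl]
    norm_cast; rw [Stirling.stirlingSeq]
    have : rexp ((n + 1/2)*log n - n) = √n*(n/rexp 1)^n := by
      rw [Real.exp_sub, add_mul, Real.exp_add, mul_comm (n : ℝ) (log n), exp_mul, Real.exp_log hn0,
        rpow_natCast, mul_comm (1/2 : ℝ), exp_mul, Real.exp_log hn0, ← sqrt_eq_rpow, div_pow,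
        ← Real.exp_nat_mul, mul_one]
      ring
    rw [this, sqrt_mul two_pos.le]
    have : √(n : ℝ) ≠ 0 := (sqrt_pos.2 hn0).ne'
    field_simp
  rw [hfac, cpow_def_of_ne_zero hnC, mul_comm (cexp (Complex.log n*s)), mul_assoc, mul_assoc, ← exp_add, ← exp_add]
  congr 2
  rw [stirlingExponent, hlog, ← ofReal_natCast n, ← ofReal_log hn0.le]
  push_cast
  ring

/-- Stirling's formula in the right half plane, away from the real axis. -/
lemma norm_Gamma_div_sub_one_le {s : ℂ} (hs : 0 < s.re) (ht : 1 ≤ |s.im|) :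
    ‖Complex.Gamma s/((√(2*π) : ℝ)*cexp (stirlingExponent s)) - 1‖ ≤ 3/|s.im| := by
  set c : ℂ := ((√(2*π) : ℝ) : ℂ) with hc
  have hc0 : c ≠ 0 := by rw [hc, Ne, Complex.ofReal_eq_zero]; positivity
  set R : ℕ → ℂ := fun n => (n : ℂ)^s*(n.factorial : ℂ)*cexp (-stirlingExponent (s + (n + 1 : ℕ))) with hR
  have hRlim : Tendsto R atTop (𝓝 c) := tendsto_cpow_mul_factorial_mul_exp_neg_stirlingExponent hs
  set x : ℕ → ℂ := fun n => ∑ j ∈ range (n + 1), (stirlingExponent (s + j + 1) - stirlingExponent (s + j) - Complex.log (s + j))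
  -- Euler's product telescopes through the exponent: the accumulated defects are O(1/|Im s|)
  -- uniformly in n, and R n tends to √(2π).
  have hG : ∀ n, GammaSeq s n = R n*cexp (stirlingExponent s)*cexp (x n) := fun n => by
    rw [GammaSeq, exp_stirlingExponent_prod hs, hR]
    simp only [div_eq_mul_inv, ← exp_neg, mul_assoc, ← exp_add]; grind
  have hxb : ∀ n, ‖x n‖ ≤ 1/|s.im| := fun n => by
    refine (norm_sum_le_of_le _ fun j _ => ?_).trans (sum_one_div_sq_add_le ht (n + 1))
    have hre : 0 < (s + j).re := by simp only [add_re, natCast_re]; linarith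
    refine (norm_stirlingExponent_add_one_sub_le hre).trans ?_
    refine one_div_le_one_div_of_le (by positivity) ?_
    have : |s.im|^2 + (j : ℝ)^2 ≤ ‖s + j‖^2 := by
      rw [← Complex.normSq_eq_norm_sq, normSq_apply]
      simp only [add_re, natCast_re, add_im, Complex.natCast_im, sq_abs]
      have : (0 : ℝ) ≤ j := j.cast_nonneg
      nlinarith
    linarith
  have hlim : Tendsto (fun n => c*(GammaSeq s n/(R n*cexp (stirlingExponent s)) - 1)) atTop
      (𝓝 (c*(Complex.Gamma s/(c*cexp (stirlingExponent s)) - 1))) :=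
    (((Complex.GammaSeq_tendsto_Gamma s).div (hRlim.mul_const _) (mul_ne_zero hc0 (exp_ne_zero _))).sub_const 1).const_mul c
  have hRne : ∀ᶠ n in atTop, R n ≠ 0 := hRlim.eventually_ne hc0
  have hcn : 0 < ‖c‖ := norm_pos_iff.2 hc0
  have := le_of_tendsto hlim.norm (b := ‖c‖*(3/|s.im|)) (by
    filter_upwards [hRne] with n hn
    rw [norm_mul, hG]; refine mul_le_mul_of_nonneg_left ?_ hcn.le
    rw [mul_div_cancel_left₀ _ (mul_ne_zero hn (exp_ne_zero _))]
    have hx1 : ‖x n‖ ≤ 1 := (hxb n).trans (by rw [div_le_one (by linarith)]; exact ht)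
    calc _ ≤ 2*‖x n‖ := Complex.norm_exp_sub_one_le hx1
      _ ≤ 2*(1/|s.im|) := by gcongr; exact hxb n
      _ ≤ 3/|s.im| := by rw [mul_one_div]; gcongr; norm_num)
  rw [norm_mul] at this
  exact le_of_mul_le_mul_left this hcn

/-- The main term of Stirling's formula for `χ(1 - s)` in the upper half plane. -/
def zetaChiMain (s : ℂ) : ℂ := cexp ((s - 1/2)*log (s.im/(2*π)) - I*s.im - I*(π/4))

lemma zetaChiMain_ne_zero (s : ℂ) : zetaChiMain s ≠ 0 := exp_ne_zero _

lemma norm_zetaChiMain {s : ℂ} (hs : 0 < s.im) : ‖zetaChiMain s‖ = (s.im/(2*π))^(s.re - 1/2) := by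
  rw [zetaChiMain, norm_exp, rpow_def_of_pos (by positivity)]
  congr 1
  simp
  ring

/-- The factor of `χ(1 - s)` that dominates in the upper half plane. -/
def gammaTwist (s : ℂ) : ℂ := (2*(π : ℂ))^(-s)*Complex.Gamma s*cexp (-(I*(π*s/2)))

/-- The second half of the cosine is e^{iπs} times the first, hence exponentially small high up in
the upper half plane. -/
lemma zetaChi_one_sub (s : ℂ) : zetaChi (1 - s) = gammaTwist s*(1 + cexp (I*(π*s))) := by
  rw [zetaChi, gammaTwist, sub_sub_cancel, Complex.cos]
  have : cexp (I*(π*s)) = cexp (I*(π*s/2))*cexp (I*(π*s/2)) := by rw [← exp_add]; ring_nf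
  rw [this, exp_neg, neg_mul, exp_neg, mul_comm I]
  grind

lemma norm_exp_sub_one_le_mul_exp (x : ℂ) : ‖cexp x - 1‖ ≤ ‖x‖*rexp ‖x‖ := by
  have := Complex.norm_exp_sub_sum_le_norm_mul_exp x 1
  simpa using this

/-- s is i · Im s times a number of the right half plane, whose argument can be added to π/2 without
leaving the principal branch. -/
lemma log_eq_log_im_add {s : ℂ} (hs : 0 < s.re) (ht : 0 < s.im) :
    Complex.log s = log s.im + I*(π/2) + Complex.log (1 + -(I*(s.re/s.im))) := by
  have hne : (1 + -(I*(s.re/s.im)) : ℂ) ≠ 0 := fun h => by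
    have := congrArg re h
    simp [← ofReal_div] at this
  have e : s = (s.im : ℝ)*(I*(1 + -(I*(s.re/s.im)))) := by
    have : (s.im : ℂ) ≠ 0 := mod_cast ht.ne'
    conv_lhs => rw [← re_add_im s]
    field_simp
    linear_combination (s.re : ℂ)*I_sq
  have harg : Complex.log (I*(1 + -(I*(s.re/s.im)))) = Complex.log I + Complex.log (1 + -(I*(s.re/s.im))) := by
    refine Complex.log_mul I_ne_zero hne ?_
    rw [Complex.arg_I]
    have hre : 0 < (1 + -(I*(s.re/s.im)) : ℂ).re := by simp
    have h1 := Complex.abs_arg_lt_pi_div_two_iff.2 (Or.inl hre)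
    grind
  conv_lhs => rw [e]
  rw [log_ofReal_mul ht (mul_ne_zero I_ne_zero hne), harg, Complex.log_I]
  ring

lemma gammaTwist_div_zetaChiMain {s : ℂ} (hs : 0 < s.re) (ht : 0 < s.im) :
    gammaTwist s/zetaChiMain s = Complex.Gamma s/((√(2*π) : ℝ)*cexp (stirlingExponent s)) *
      cexp ((s - 1/2)*Complex.log (1 + -(I*(s.re/s.im))) - s.re) := by
  have h2pi : (0 : ℝ) < 2*π := by positivity
  have e1 : ((√(2*π) : ℝ) : ℂ) = cexp (log (2*π)/2) := by
    rw [sqrt_eq_rpow, rpow_def_of_pos h2pi]; push_cast; ring_nf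
  have e2 : (2*(π : ℂ))^(-s) = cexp (-s*log (2*π)) := by
    have : (2*(π : ℂ)) = ((2*π : ℝ) : ℂ) := by push_cast; rfl
    rw [this, cpow_def_of_ne_zero (mod_cast h2pi.ne'), ← ofReal_log h2pi.le]; ring_nf
  rw [gammaTwist, zetaChiMain, e1, e2, stirlingExponent, log_eq_log_im_add hs ht, log_div ht.ne' h2pi.ne']
  have hl : ∀ X Y Z G : ℂ, cexp X*G*cexp Y/cexp Z = G*cexp (X + Y - Z) := by intro X Y Z G; rw [exp_sub, exp_add]; ring
  have hr : ∀ X Y Z G : ℂ, G/(cexp X*cexp Y)*cexp Z = G*cexp (Z - X - Y) := by intro X Y Z G; rw [exp_sub, exp_sub]; field_simp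
  rw [hl, hr]
  congr 2
  have := re_add_im s
  push_cast
  linear_combination this

lemma norm_gammaTwist_div_zetaChiMain_sub_one_le {s : ℂ} (hs : 0 < s.re) (hs2 : s.re ≤ 2)
    (ht : 4 ≤ s.im) : ‖gammaTwist s/zetaChiMain s - 1‖ ≤ 200/s.im := by
  have ht0 : 0 < s.im := by linarith
  set z : ℂ := -(I*(s.re/s.im)) with hz
  have hzn : ‖z‖ = s.re/s.im := by
    rw [hz, norm_neg, norm_mul, norm_I, one_mul, ← ofReal_div, norm_real, norm_of_nonneg (by positivity)]
  have hz2 : ‖z‖ ≤ 2/s.im := by rw [hzn]; gcongr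
  have hz3 : ‖z‖ ≤ 1/2 := hz2.trans (by rw [div_le_div_iff₀ ht0 two_pos]; linarith)
  have hl1 := Complex.norm_log_one_add_sub_self_le (z := z) (by linarith)
  have hl2 := Complex.norm_log_one_add_half_le_self hz3
  have hl1' : ‖Complex.log (1 + z) - z‖ ≤ ‖z‖^2 := by
    refine hl1.trans ?_
    have : (1 - ‖z‖)⁻¹ ≤ 2 := by rw [inv_le_comm₀ (by linarith) two_pos]; linarith
    nlinarith [sq_nonneg ‖z‖]
  set D := (s - 1/2)*Complex.log (1 + z) - s.re with hD
  -- The linear term of the logarithm, multiplied by i Im s, cancels Re s. What survives is Im s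
  -- times the quadratic remainder and a bounded multiple of log(1 + z), both O(1/Im s).
  have hDe : D = I*s.im*(Complex.log (1 + z) - z) + ((s.re - 1/2 : ℝ) : ℂ)*Complex.log (1 + z) := by
    have h1 : I*s.im*z = s.re := by
      rw [hz]
      have : (s.im : ℂ) ≠ 0 := mod_cast ht0.ne'
      field_simp; rw [I_sq]; ring
    rw [mul_sub, h1, hD]; push_cast
    linear_combination Complex.log (1 + z)*(re_add_im s).symm
  have hDn : ‖D‖ ≤ 9/s.im := by
    rw [hDe]; refine (norm_add_le _ _).trans ?_
    rw [norm_mul, norm_mul, norm_mul, norm_I, one_mul, norm_real, norm_real, norm_of_nonneg ht0.le]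
    have h1 : ‖s.re - 1/2‖ ≤ 3/2 := by rw [norm_eq_abs, abs_le]; constructor <;> linarith
    calc _ ≤ s.im*(2/s.im)^2 + 3/2*(3/2*(2/s.im)) := by
          gcongr
          · exact hl1'.trans (by gcongr)
          linarith
      _ ≤ 9/s.im := by
          have : s.im*(2/s.im)^2 + 3/2*(3/2*(2/s.im)) = 8.5/s.im := by field_simp; norm_num
          rw [this]; gcongr; norm_num
  have hD94 : ‖D‖ ≤ 9/4 := hDn.trans (by gcongr)
  have hexp : rexp ‖D‖ ≤ 12 := by
    calc rexp ‖D‖ ≤ rexp (9/4) := exp_le_exp.2 hD94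
      _ = rexp 1^(9/4 : ℝ) := by simp
      _ ≤ 3^(9/4 : ℝ) := by gcongr; linarith [Real.exp_one_lt_d9]
      _ ≤ 12 := by
        rw [show (9/4 : ℝ) = (9 : ℕ)*(1/4 : ℝ) by norm_num, Real.rpow_natCast_mul (by norm_num),
          one_div, Real.rpow_inv_le_iff_of_pos (by norm_num) (by norm_num) (by norm_num)]
        norm_num
  have hE : ‖cexp D - 1‖ ≤ 108/s.im := by
    refine (norm_exp_sub_one_le_mul_exp D).trans ?_
    calc _ ≤ 9/s.im*12 := by gcongr
      _ = _ := by ring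
  have hG := norm_Gamma_div_sub_one_le hs (by grind)
  rw [abs_of_pos ht0] at hG
  rw [gammaTwist_div_zetaChiMain hs ht0]
  set G := Complex.Gamma s/((√(2*π) : ℝ)*cexp (stirlingExponent s))
  have e : G*cexp D - 1 = (G - 1)*(cexp D - 1) + (G - 1) + (cexp D - 1) := by ring
  rw [e]
  calc _ ≤ _ := norm_add₃_le
    _ ≤ 3/4*(108/s.im) + 3/s.im + 108/s.im := by
      rw [norm_mul]
      have : ‖G - 1‖ ≤ 3/4 := hG.trans (by gcongr)
      gcongr
    _ = 192/s.im := by ring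
    _ ≤ _ := by gcongr; norm_num

lemma norm_exp_I_pi_mul_le {s : ℂ} (ht : 0 < s.im) : ‖cexp (I*(π*s))‖ ≤ 1/(3*s.im) := by
  rw [norm_exp]
  have : (I*(π*s)).re = -(π*s.im) := by simp
  rw [this, Real.exp_neg, ← one_div]
  refine one_div_le_one_div_of_le (by positivity) ?_
  have := Real.add_one_le_exp (π*s.im)
  nlinarith [pi_gt_three]

lemma norm_zetaChi_div_zetaChiMain_sub_one_le {s : ℂ} (hs : 0 < s.re) (hs2 : s.re ≤ 2)
    (ht : 4 ≤ s.im) : ‖zetaChi (1 - s)/zetaChiMain s - 1‖ ≤ 300/s.im := by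
  have ht0 : 0 < s.im := by linarith
  have h1 := norm_gammaTwist_div_zetaChiMain_sub_one_le hs hs2 ht
  have h2 := norm_exp_I_pi_mul_le ht0
  rw [zetaChi_one_sub, mul_div_right_comm]
  set G := gammaTwist s/zetaChiMain s
  set E := cexp (I*(π*s))
  have e : G*(1 + E) - 1 = (G - 1)*E + (G - 1) + E := by ring
  rw [e]
  have h3 : ‖E‖ ≤ 1/12 := h2.trans (by gcongr; linarith)
  calc _ ≤ _ := norm_add₃_le
    _ ≤ 200/s.im*(1/12) + 200/s.im + 1/(3*s.im) := by rw [norm_mul]; gcongr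
    _ = (200/12 + 200 + 1/3)/s.im := by field_simp
    _ ≤ _ := by gcongr; norm_num

lemma zetaChi_conj (s : ℂ) : zetaChi (conj s) = conj (zetaChi s) := by
  have h2pi : (0 : ℝ) ≤ 2*π := by positivity
  have : (2*(π : ℂ)) = ((2*π : ℝ) : ℂ) := by push_cast; rfl
  simp only [zetaChi, map_mul, map_ofNat, ← Complex.Gamma_conj, ← Complex.cos_conj, map_sub, map_one, map_div₀, conj_ofReal, this]
  congr 3
  rw [show -(1 - conj s) = conj (-(1 - s)) by simp, cpow_conj _ _
    (by rw [arg_ofReal_of_nonneg h2pi]; exact pi_pos.ne), conj_ofReal]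

lemma zetaChi_mul_zetaChi_one_sub {s : ℂ} (hs : s.im ≠ 0) : zetaChi s*zetaChi (1 - s) = 1 := by
  have hsin : Complex.sin (π*s) ≠ 0 := fun h => by
    rw [Complex.sin_eq_zero_iff] at h
    obtain ⟨k, hk⟩ := h
    have h2 : s = k := by
      have : (π : ℂ) ≠ 0 := mod_cast pi_ne_zero
      grind
    rw [h2] at hs; simp at hs
  have h2pi : (2*(π : ℂ)) ≠ 0 := by simp
  have hG := Complex.Gamma_mul_Gamma_one_sub s
  have hc : Complex.cos (π*(1 - s)/2) = Complex.sin (π*s/2) := by rw [← Complex.cos_pi_div_two_sub]; ring_nf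
  have hs2 : Complex.sin (π*s) = 2*Complex.sin (π*s/2)*Complex.cos (π*s/2) := by rw [← Complex.sin_two_mul]; ring_nf
  have hp : (2*(π : ℂ))^(-(1 - s))*(2*(π : ℂ))^(-s) = (2*(π : ℂ))⁻¹ := by rw [← cpow_add _ _ h2pi, ← cpow_neg_one]; ring_nf
  simp only [zetaChi, sub_sub_cancel, hc]
  grind

/-! ### Phase and amplitude of χ(1 − s) n^(-s) on vertical lines -/

/-- The phase of `χ(1 - s) ν ^ (-s)` on a vertical line. -/
def stirlingPhase (ν t : ℝ) : ℝ := t*log (t/(2*π*ν)) - t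

/-- The derivative vanishes exactly at t = 2πν. This is why the integral up to 2πX detects the
condition n ≤ X. -/
lemma hasDerivAt_stirlingPhase {ν t : ℝ} (hν : 0 < ν) (ht : 0 < t) : HasDerivAt (stirlingPhase ν) (log (t/(2*π*ν))) t := by
  have h1 : HasDerivAt (fun t : ℝ => t/(2*π*ν)) (1/(2*π*ν)) t := (hasDerivAt_id t).div_const _
  refine (((hasDerivAt_id t).mul (h1.log (by positivity))).sub (hasDerivAt_id t)).congr_deriv ?_
  simp only [id]
  field_simp
  ring

lemma hasDerivAt_log_div_const {c t : ℝ} (hc : 0 < c) (ht : 0 < t) : HasDerivAt (fun t : ℝ => log (t/c)) (1/t) t := by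
  refine (((hasDerivAt_id t).div_const c).log (by positivity)).congr_deriv ?_
  grind

/-- A power with exponential damping, the amplitude of `χ(1 - s)` on a vertical line. -/
def dampedPow (r δ t : ℝ) : ℝ := (t/(2*π))^r*rexp (-δ*t)

lemma dampedPow_pos {r δ t : ℝ} (ht : 0 < t) : 0 < dampedPow r δ t := by unfold dampedPow; positivity

lemma hasDerivAt_dampedPow {r δ t : ℝ} (ht : 0 < t) : HasDerivAt (dampedPow r δ) ((r/t - δ)*dampedPow r δ t) t := by
  have h0 : 0 < t/(2*π) := by positivity
  have h1 : HasDerivAt (fun t : ℝ => t/(2*π)) (1/(2*π)) t := (hasDerivAt_id t).div_const _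
  have h2 : HasDerivAt (fun t : ℝ => rexp (-δ*t)) (rexp (-δ*t) * -δ) t :=
    (((hasDerivAt_id t).const_mul (-δ)).congr_deriv (by simp)).exp
  refine ((h1.rpow_const (p := r) (Or.inl h0.ne')).mul h2).congr_deriv ?_
  rw [Real.rpow_sub_one h0.ne', dampedPow]
  field_simp
  ring

lemma continuousOn_deriv_dampedPow {r δ p q : ℝ} (hp : 0 < p) : ContinuousOn (fun t => (r/t - δ)*dampedPow r δ t) (Icc p q) := by
  have h0 : ∀ t ∈ Icc p q, t ≠ 0 := fun t ht => (hp.trans_le ht.1).ne'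
  refine ((continuousOn_const.div continuousOn_id h0).sub continuousOn_const).mul fun t ht => ?_
  exact (hasDerivAt_dampedPow (hp.trans_le ht.1)).continuousAt.continuousWithinAt

/-- In both admitted cases the amplitude is monotone. The decreasing one serves the damped integral
on Re s = 1/4, the increasing undamped one a finite range on a line to the right of 1. -/
lemma dampedPow_variation_le {r δ p q M : ℝ} (hp : 0 < p) (hpq : p ≤ q)
    (hr : (r ≤ 0 ∧ 0 ≤ δ) ∨ (0 ≤ r ∧ δ = 0)) (hM : ∀ w ∈ Icc p q, dampedPow r δ w ≤ M) :
    ‖((dampedPow r δ q : ℝ) : ℂ)‖ + ∫ w in p..q, ‖(((r/w - δ)*dampedPow r δ w : ℝ) : ℂ)‖ ≤ 3*M := by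
  have h1 : ‖((dampedPow r δ q : ℝ) : ℂ)‖ ≤ M := by
    rw [norm_real, norm_of_nonneg (dampedPow_pos (hp.trans_le hpq)).le]; grind
  have h2 := integral_abs_le_of_const_sign hpq (fun w hw => hasDerivAt_dampedPow (r := r) (δ := δ) (hp.trans_le hw.1))
    (continuousOn_deriv_dampedPow hp) (by
      rcases hr with ⟨hr, hd⟩ | ⟨hr, hd⟩
      · right
        intro w hw
        have hw0 := hp.trans_le hw.1
        have : r/w ≤ 0 := div_nonpos_of_nonpos_of_nonneg hr hw0.le
        exact mul_nonpos_of_nonpos_of_nonneg (by linarith) (dampedPow_pos hw0).le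
      · left
        intro w hw
        have hw0 := hp.trans_le hw.1
        rw [hd, sub_zero]; exact mul_nonneg (by positivity) (dampedPow_pos hw0).le)
    (θ := M) (fun w hw => by rw [abs_of_pos (dampedPow_pos (hp.trans_le hw.1))]; exact hM w hw)
  simp only [norm_real, norm_eq_abs] at h1 ⊢
  linarith

lemma norm_integral_dampedPow_le_of_log {ν r δ p q M l : ℝ} (hν : 0 < ν) (hp : 0 < p) (hpq : p ≤ q)
    (hr : (r ≤ 0 ∧ 0 ≤ δ) ∨ (0 ≤ r ∧ δ = 0)) (hM : ∀ w ∈ Icc p q, dampedPow r δ w ≤ M)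
    (hl0 : 0 < l) (hl : ∀ w ∈ Icc p q, l ≤ |log (w/(2*π*ν))|) :
    ‖∫ w in p..q, (dampedPow r δ w : ℂ)*cexp (I*stirlingPhase ν w)‖ ≤ 12*M/l := by
  have hc : 0 < 2*π*ν := by positivity
  refine (norm_integral_mul_exp_le_of_le_abs_deriv hpq (fun w hw => hasDerivAt_stirlingPhase hν (hp.trans_le hw.1))
    (fun w hw => hasDerivAt_log_div_const hc (hp.trans_le hw.1))
    (continuousOn_const.div continuousOn_id fun w hw => (hp.trans_le hw.1).ne')
    (Or.inl fun w hw => by have := hp.trans_le hw.1; positivity) hl0 hl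
    (fun w hw => (hasDerivAt_dampedPow (hp.trans_le hw.1)).ofReal_comp)
    (continuous_ofReal.comp_continuousOn (continuousOn_deriv_dampedPow hp))).trans ?_
  calc _ ≤ 4/l*(3*M) := mul_le_mul_of_nonneg_left (dampedPow_variation_le hp hpq hr hM) (by positivity)
    _ = _ := by ring

lemma norm_integral_dampedPow_le_sqrt {ν r δ p q M : ℝ} (hν : 0 < ν) (hp : 0 < p) (hpq : p ≤ q)
    (hr : (r ≤ 0 ∧ 0 ≤ δ) ∨ (0 ≤ r ∧ δ = 0)) (hM : ∀ w ∈ Icc p q, dampedPow r δ w ≤ M) :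
    ‖∫ w in p..q, (dampedPow r δ w : ℂ)*cexp (I*stirlingPhase ν w)‖ ≤ 30*M*√q := by
  have hc : 0 < 2*π*ν := by positivity
  have hq : 0 < q := hp.trans_le hpq
  refine (norm_integral_mul_exp_le_of_le_deriv2 (r := 1/q) hpq (fun w hw => hasDerivAt_stirlingPhase hν (hp.trans_le hw.1))
    (fun w hw => hasDerivAt_log_div_const hc (hp.trans_le hw.1))
    (continuousOn_const.div continuousOn_id fun w hw => (hp.trans_le hw.1).ne')
    (by positivity) (fun w hw => one_div_le_one_div_of_le (hp.trans_le hw.1) hw.2)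
    (fun w hw => (hasDerivAt_dampedPow (hp.trans_le hw.1)).ofReal_comp)
    (continuous_ofReal.comp_continuousOn (continuousOn_deriv_dampedPow hp))).trans ?_
  calc _ ≤ 10/√(1/q)*(3*M) := mul_le_mul_of_nonneg_left (dampedPow_variation_le hp hpq hr hM) (by positivity)
    _ = _ := by rw [Real.sqrt_div zero_le_one, Real.sqrt_one]; field_simp; ring

lemma zetaChiMain_mul_cpow_mul_exp {n : ℕ} (hn : 0 < n) {s : ℂ} (hs : 0 < s.im) (δ : ℝ) :
    zetaChiMain s*(n : ℂ)^(-s)*cexp (I*(δ*s)) = ((((n : ℝ)^(-s.re) : ℝ) : ℂ)*cexp (I*(δ*s.re - π/4 : ℝ))) *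
      ((dampedPow (s.re - 1/2) δ s.im : ℂ)*cexp (I*stirlingPhase n s.im)) := by
  have hn0 : (0 : ℝ) < n := mod_cast hn
  rw [natCast_cpow_neg_eq hn, dampedPow, stirlingPhase, rpow_def_of_pos (by positivity : 0 < s.im/(2*π)),
    ← div_div s.im (2*π), log_div (by positivity : s.im/(2*π) ≠ 0) hn0.ne', zetaChiMain]
  push_cast
  have : ∀ a b c d e f g h : ℂ, a + c + d = e + f + g + h → cexp a*(b*cexp c)*cexp d =
        b*cexp e*(cexp f*cexp g*cexp h) := fun a b c d e f g h H => by
    calc _ = b*cexp (a + c + d) := by rw [exp_add, exp_add]; ring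
      _ = _ := by rw [H, exp_add, exp_add, exp_add]; ring
  refine this _ _ _ _ _ _ _ _ ?_
  generalize log (s.im/(2*π)) = l
  have h := re_add_im s
  generalize hR : (s.re : ℂ) = R at *
  generalize hT : (s.im : ℂ) = U at *
  subst h
  ring_nf
  rw [I_sq]
  ring

/-! ### The Gamma integral with complex scale and Mellin inversion -/

lemma integrableOn_cpow_mul_exp_neg_mul {a w : ℂ} (ha : 0 < a.re) (hw : 0 < w.re) :
    IntegrableOn (fun t : ℝ => (t : ℂ)^(a - 1)*cexp (-(w*t))) (Ioi 0) := by
  have h := integrableOn_rpow_mul_exp_neg_mul_rpow (s := a.re - 1) (p := 1) (b := w.re) (by linarith) one_pos hw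
  refine (integrable_norm_iff ?_).1 ?_
  · refine ContinuousOn.aestronglyMeasurable (fun t ht => ?_) measurableSet_Ioi
    exact ((continuousAt_ofReal_cpow_const t _ (Or.inr ht.ne')).mul (by fun_prop)).continuousWithinAt
  · refine h.congr_fun (fun t ht => ?_) measurableSet_Ioi
    have ht0 : 0 < t := ht
    simp only [norm_mul, norm_cpow_eq_rpow_re_of_pos ht0, norm_exp, rpow_one]; simp

lemma differentiableOn_integral_cpow_mul_exp_neg_mul {a : ℂ} (ha : 0 < a.re) :
    DifferentiableOn ℂ (fun w : ℂ => ∫ t in Ioi (0 : ℝ), (t : ℂ)^(a - 1)*cexp (-(w*t))) {w : ℂ | 0 < w.re} := fun w hw => by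
  have hw' : 0 < w.re := hw
  have hre : ball w (w.re/2) ⊆ {z : ℂ | w.re/2 < z.re} := fun z hz => by
    have h1 := abs_re_le_norm (z - w)
    have h2 : ‖z - w‖ < w.re/2 := by simpa [dist_eq_norm] using hz
    rw [sub_re] at h1; grind
  have h := hasDerivAt_integral_of_dominated_loc_of_deriv_le (μ := volume.restrict (Ioi (0 : ℝ)))
    (F := fun (w : ℂ) (t : ℝ) => (t : ℂ)^(a - 1)*cexp (-(w*t)))
    (F' := fun (w : ℂ) (t : ℝ) => (t : ℂ)^(a - 1)*(cexp (-(w*t)) * -t))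
    (x₀ := w) (s := ball w (w.re/2))
    (bound := fun t : ℝ => t^a.re*rexp (-(w.re/2)*t^(1 : ℝ)))
    (Metric.ball_mem_nhds w (by linarith)) ?_ (integrableOn_cpow_mul_exp_neg_mul ha hw') ?_ ?_ ?_ ?_
  · exact h.2.differentiableAt.differentiableWithinAt
  · refine (Metric.ball_mem_nhds w (by linarith : 0 < w.re/2)) |> mem_of_superset <| fun z hz => ?_
    have hz1 : w.re/2 < z.re := hre hz
    exact (integrableOn_cpow_mul_exp_neg_mul ha (by linarith)).aestronglyMeasurable
  · refine ContinuousOn.aestronglyMeasurable (fun t ht => ?_) measurableSet_Ioi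
    exact ((continuousAt_ofReal_cpow_const t _ (Or.inr ht.ne')).mul (by fun_prop)).continuousWithinAt
  · refine (ae_restrict_iff' measurableSet_Ioi).2 (ae_of_all _ fun t ht z hz => ?_)
    have ht0 : 0 < t := ht
    have hz1 : w.re/2 < z.re := hre hz
    rw [norm_mul, norm_mul, norm_neg, norm_real, norm_of_nonneg ht0.le,
      norm_cpow_eq_rpow_re_of_pos ht0, norm_exp, rpow_one, sub_re, one_re,
      Real.rpow_sub_one ht0.ne']
    have e : t^a.re/t*(rexp (-(z*t)).re*t) = t^a.re*rexp (-(z*t)).re := by field_simp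
    rw [e]; gcongr; simp; gcongr
  · have := integrableOn_rpow_mul_exp_neg_mul_rpow (s := a.re) (p := 1) (b := w.re/2) (by linarith) one_pos (by linarith)
    exact this
  · refine (ae_restrict_iff' measurableSet_Ioi).2 (ae_of_all _ fun t ht z hz => ?_)
    have : HasDerivAt (fun w : ℂ => cexp (-(w*t))) (cexp (-(z*t)) * -t) z := by
      have := (((hasDerivAt_id z).mul_const (t : ℂ)).neg).cexp
      simpa using this
    exact this.const_mul _

/-- The Gamma integral with a complex scale. -/
lemma integral_cpow_mul_exp_neg_mul_complex {a w : ℂ} (ha : 0 < a.re) (hw : 0 < w.re) :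
    ∫ t in Ioi (0 : ℝ), (t : ℂ)^(a - 1)*cexp (-(w*t)) = w^(-a)*Complex.Gamma a := by
  have hopen : IsOpen {w : ℂ | 0 < w.re} := isOpen_lt continuous_const continuous_re
  have h1 := (differentiableOn_integral_cpow_mul_exp_neg_mul ha).analyticOnNhd hopen
  have h2 : AnalyticOnNhd ℂ (fun w : ℂ => w^(-a)*Complex.Gamma a) {w : ℂ | 0 < w.re} := by
    refine DifferentiableOn.analyticOnNhd (fun z hz => ?_) hopen
    have hz' : z ∈ slitPlane := Or.inl hz
    have : z ≠ 0 := Complex.slitPlane_ne_zero hz'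
    exact ((differentiableAt_id.cpow_const hz').mul_const _).differentiableWithinAt
  have hconv : IsPreconnected {w : ℂ | 0 < w.re} := (convex_halfSpace_re_gt 0).isPreconnected
  -- Both sides are holomorphic in the right half plane and agree at positive reals; the points 1 +
  -- 1/(n + 1) accumulate at 1.
  refine h1.eqOn_of_preconnected_of_frequently_eq h2 hconv (z₀ := 1) (by simp) ?_ hw
  have hreal : ∀ r : ℝ, 0 < r → ∫ t in Ioi (0 : ℝ), (t : ℂ)^(a - 1)*cexp (-((r : ℂ)*t)) =
      (r : ℂ)^(-a)*Complex.Gamma a := fun r hr => by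
    rw [Complex.integral_cpow_mul_exp_neg_mul_Ioi ha hr]; congr 1
    rw [one_div, inv_cpow _ _ (by rw [arg_ofReal_of_nonneg hr.le]; exact pi_pos.ne), cpow_neg]
  have hseq : Tendsto (fun n : ℕ => (((1 + 1/((n : ℝ) + 1) : ℝ)) : ℂ)) atTop (𝓝[≠] 1) := by
    refine tendsto_nhdsWithin_iff.2 ⟨?_, Eventually.of_forall fun n => ?_⟩
    · have := (tendsto_one_div_add_atTop_nhds_zero_nat (𝕜 := ℝ)).const_add 1
      have := (continuous_ofReal.tendsto _).comp this
      simpa [comp_def] using this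
    · have : (0 : ℝ) < 1/((n : ℝ) + 1) := by positivity
      intro h; rw [mem_singleton_iff, ← ofReal_one, Complex.ofReal_inj] at h; linarith
  refine hseq.frequently (Frequently.of_forall fun n => ?_)
  exact hreal _ (by positivity)

/-- The modulus is at most the value at Re s, and the real Γ is convex with value 1 at both 1 and 2.
-/
lemma norm_Gamma_le_of_one_le_re {s : ℂ} (h1 : 1 ≤ s.re) (h2 : s.re ≤ 2) : ‖Complex.Gamma s‖ ≤ 1 := by
  have hs : 0 < s.re := by linarith
  have hle : ‖Complex.Gamma s‖ ≤ Real.Gamma s.re := by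
    rw [Complex.Gamma_eq_integral hs, Complex.GammaIntegral, Real.Gamma_eq_integral hs]
    refine (norm_integral_le_integral_norm _).trans (le_of_eq ?_)
    refine setIntegral_congr_fun measurableSet_Ioi fun t ht => ?_
    have ht0 : 0 < t := ht
    simp only [norm_mul, norm_cpow_eq_rpow_re_of_pos ht0, norm_real, norm_of_nonneg (exp_pos _).le]; simp
  refine hle.trans ?_
  have hc := Real.convexOn_Gamma.2 (mem_Ioi.2 (one_pos (α := ℝ))) (mem_Ioi.2 (two_pos (α := ℝ)))
    (by linarith : 0 ≤ 2 - s.re) (by linarith : 0 ≤ s.re - 1) (by ring)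
  simp only [smul_eq_mul, Real.Gamma_one, Real.Gamma_two] at hc
  grind

/-- The integrand `χ(1 - s) n ^ (-s)`, restricted to its dominant half and damped in the upper
half plane. -/
def dampedTwist (n : ℕ) (δ : ℝ) (s : ℂ) : ℂ := gammaTwist s*(n : ℂ)^(-s)*cexp (I*(δ*s))

lemma differentiableAt_dampedTwist {n : ℕ} (hn : 0 < n) (δ : ℝ) {s : ℂ} (hs : 0 < s.re) :
    DifferentiableAt ℂ (dampedTwist n δ) s := by
  have hpi : (2*(π : ℂ)) ≠ 0 := by simp
  have hn0 : (n : ℂ) ≠ 0 := mod_cast hn.ne'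
  have hG : DifferentiableAt ℂ Complex.Gamma s := by
    refine Complex.differentiableAt_Gamma s fun m h => ?_
    have := congrArg re h
    simp at this; linarith
  unfold dampedTwist gammaTwist
  refine ((((differentiableAt_id.neg.const_cpow (Or.inl hpi)).mul hG).mul ?_).mul
    (differentiableAt_id.neg.const_cpow (Or.inl hn0))).mul ?_
  · fun_prop
  · fun_prop

/-- The damping rotates the scale 2πn·i to 2πn e^{i(π/2 − δ)}, inside the open right half plane,
where the function is the Mellin transform of a decaying exponential. -/
lemma dampedTwist_eq {n : ℕ} (hn : 0 < n) {δ : ℝ} (hδ : 0 < δ) (hδ1 : δ ≤ 1) (s : ℂ) : dampedTwist n δ s =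
      ((2*π*n : ℝ)*cexp (I*(π/2 - δ : ℝ)))^(-s)*Complex.Gamma s := by
  have hpi := pi_gt_three
  have hn0 : (0 : ℝ) < n := mod_cast hn
  have hp : (0 : ℝ) < 2*π := by positivity
  have hlog : Complex.log ((2*π*n : ℝ)*cexp (I*(π/2 - δ : ℝ))) = log (2*π) + log n + I*(π/2 - δ : ℝ) := by
    rw [log_ofReal_mul (by positivity) (exp_ne_zero _), Complex.log_exp, Real.log_mul hp.ne' hn0.ne']
    · push_cast; ring
    · simp; linarith
    · simp; linarith
  have e : (2*(π : ℂ)) = ((2*π : ℝ) : ℂ) := by push_cast; rfl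
  have hne : ((2*π*n : ℝ)*cexp (I*(π/2 - δ : ℝ)) : ℂ) ≠ 0 :=
    mul_ne_zero (mod_cast (by positivity : 2*π*(n : ℝ) ≠ 0)) (exp_ne_zero _)
  rw [cpow_def_of_ne_zero hne, hlog, dampedTwist, gammaTwist, e, cpow_def_of_ne_zero (mod_cast hp.ne'), ← ofReal_natCast n,
    cpow_def_of_ne_zero (mod_cast hn0.ne'), ← ofReal_log hp.le,
    ← ofReal_log hn0.le]
  have : ∀ a b c d f G : ℂ, f = a + b + c + d → cexp a*G*cexp b*cexp c * cexp d = cexp f*G := fun a b c d f G h => by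
    rw [h, exp_add, exp_add, exp_add]; ring
  refine this _ _ _ _ _ _ ?_
  push_cast
  ring

lemma norm_dampedTwist {n : ℕ} (hn : 0 < n) (δ : ℝ) (s : ℂ) :
    ‖dampedTwist n δ s‖ = ‖gammaTwist s‖*(n : ℝ)^(-s.re)*rexp (-δ*s.im) := by
  rw [dampedTwist, norm_mul, norm_mul, norm_natCast_cpow_neg hn, norm_exp]
  congr 2
  simp

lemma norm_gammaTwist (s : ℂ) : ‖gammaTwist s‖ = (2*π)^(-s.re)*‖Complex.Gamma s‖*rexp (π/2*s.im) := by
  have e : (2*(π : ℂ)) = ((2*π : ℝ) : ℂ) := by push_cast; rfl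
  rw [gammaTwist, norm_mul, norm_mul, e, norm_cpow_eq_rpow_re_of_pos (by positivity), neg_re, norm_exp]
  congr 2
  simp
  ring

lemma norm_gammaTwist_le_mul_exp {s : ℂ} (h1 : 1 ≤ s.re) (h2 : s.re ≤ 2) : ‖gammaTwist s‖ ≤ rexp (π/2*s.im) := by
  rw [norm_gammaTwist]
  have hG := norm_Gamma_le_of_one_le_re h1 h2
  have hp : (2*π)^(-s.re) ≤ 1 := Real.rpow_le_one_of_one_le_of_nonpos (by linarith [pi_gt_three]) (by linarith)
  have : (2*π)^(-s.re)*‖Complex.Gamma s‖ ≤ 1 := mul_le_one₀ hp (norm_nonneg _) hG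
  nlinarith [exp_pos (π/2*s.im)]

lemma norm_gammaTwist_le_rpow {s : ℂ} (hs : 0 < s.re) (hs2 : s.re ≤ 2) (ht : 4 ≤ s.im) :
    ‖gammaTwist s‖ ≤ 51*(s.im/(2*π))^(s.re - 1/2) := by
  have h := norm_gammaTwist_div_zetaChiMain_sub_one_le hs hs2 ht
  have h1 : ‖gammaTwist s/zetaChiMain s‖ ≤ 51 := by
    have h50 : 200/s.im ≤ 50 := by rw [div_le_iff₀ (by linarith)]; linarith
    calc _ ≤ _ := norm_le_norm_sub_add _ 1
      _ ≤ 50 + 1 := add_le_add (h.trans h50) (by simp)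
      _ = 51 := by norm_num
  rw [norm_div, div_le_iff₀ (norm_pos_iff.2 (zetaChiMain_ne_zero s)), norm_zetaChiMain (by linarith)] at h1
  exact h1

lemma continuous_dampedTwist_line {n : ℕ} (hn : 0 < n) (δ : ℝ) {σ : ℝ} (hσ : 0 < σ) :
    Continuous fun y : ℝ => dampedTwist n δ (σ + y*I) := by
  rw [continuous_iff_continuousAt]
  intro y
  have := (differentiableAt_dampedTwist hn δ (s := σ + y*I) (by simpa)).continuousAt
  exact ContinuousAt.comp (f := fun y : ℝ => (σ + y*I : ℂ)) this (by fun_prop)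

lemma integrableOn_exp_half_Iic (a : ℝ) : IntegrableOn (fun y : ℝ => rexp (y/2)) (Iic a) := by
  have := integrableOn_exp_mul_Iic (a := (1/2 : ℝ)) (by norm_num) a
  grind

lemma norm_dampedTwist_le_of_im_nonpos {n : ℕ} (hn : 0 < n) {δ : ℝ} (hδ1 : δ ≤ 1) {s : ℂ}
    (h1 : 1 ≤ s.re) (h2 : s.re ≤ 2) (h : s.im ≤ 0) :
    ‖dampedTwist n δ s‖ ≤ (n : ℝ)^(-s.re)*rexp (s.im/2) := by
  rw [norm_dampedTwist hn]
  calc _ ≤ rexp (π/2*s.im)*(n : ℝ)^(-s.re)*rexp (-δ*s.im) := by gcongr; exact norm_gammaTwist_le_mul_exp h1 h2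
    _ = (n : ℝ)^(-s.re)*rexp (π/2*s.im + -δ*s.im) := by rw [Real.exp_add]; ring
    _ ≤ _ := by gcongr; nlinarith [pi_gt_three]

/-- Downwards the function decays like e^{y/2}, because π/2 − δ ≥ 1/2; upwards the damping beats the
power given by Stirling's formula. -/
lemma integrable_dampedTwist {n : ℕ} (hn : 0 < n) {δ : ℝ} (hδ : 0 < δ) (hδ1 : δ ≤ 1) {σ : ℝ}
    (h1 : 1 ≤ σ) (h2 : σ ≤ 2) : Integrable fun y : ℝ => dampedTwist n δ (σ + y*I) := by
  have hc := continuous_dampedTwist_line hn δ (σ := σ) (by linarith)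
  rw [← integrableOn_univ, ← Iic_union_Ioi (a := (0 : ℝ))]
  refine IntegrableOn.union ?_ ?_
  · refine Integrable.mono' ((integrableOn_exp_half_Iic 0).const_mul ((n : ℝ)^(-σ)))
      hc.aestronglyMeasurable ((ae_restrict_iff' measurableSet_Iic).2 (ae_of_all _ fun y hy => ?_))
    have hy0 : y ≤ 0 := hy
    have := norm_dampedTwist_le_of_im_nonpos hn hδ1 (s := σ + y*I) (by simpa) (by simpa) (by simpa)
    simpa using this
  · have hI := integrable_of_isBigO_exp_neg (f := fun y : ℝ => ‖dampedTwist n δ (σ + y*I)‖)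
      (a := 0) (b := δ/2) (by linarith) hc.norm.continuousOn ?_
    · exact (integrable_norm_iff hc.aestronglyMeasurable).1 hI
    · have ho := (isLittleO_rpow_exp_pos_mul_atTop 2 (b := δ/2) (by linarith)).isBigO
      have ho2 := ho.mul (Asymptotics.isBigO_refl (fun y : ℝ => rexp (-δ*y)) atTop)
      refine Asymptotics.IsBigO.trans ?_ (ho2.congr_right (fun y => ?_))
      · refine Asymptotics.IsBigO.of_bound 51 ?_
        filter_upwards [eventually_ge_atTop (2*π)] with y hy
        have hpi := pi_gt_three
        have hy0 : 0 < y := by linarith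
        have hy1 : 1 ≤ y/(2*π) := by rw [le_div_iff₀ (by positivity)]; linarith
        have hg := norm_gammaTwist_le_rpow (s := σ + y*I) (by simp; linarith) (by simpa) (by simp; linarith)
        simp only [add_im, ofReal_im, mul_im, ofReal_re, I_im, mul_one,
          I_re, mul_zero, add_zero, zero_add, add_re, mul_re, sub_zero] at hg
        have hn1 : (n : ℝ)^(-σ) ≤ 1 := Real.rpow_le_one_of_one_le_of_nonpos (mod_cast hn) (by linarith)
        have e1 : (y/(2*π))^(σ - 1/2) ≤ y^(2 : ℝ) := by
          calc (y/(2*π))^(σ - 1/2) ≤ (y/(2*π))^(2 : ℝ) := rpow_le_rpow_of_exponent_le hy1 (by linarith)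
            _ ≤ _ := by gcongr; exact div_le_self (by linarith) (by linarith)
        rw [norm_norm, norm_dampedTwist hn, norm_mul, norm_of_nonneg (by positivity), norm_of_nonneg (by positivity)]
        simp only [add_im, ofReal_im, mul_im, ofReal_re, I_im, mul_one,
          I_re, mul_zero, add_zero, zero_add, add_re, mul_re, sub_zero]
        calc _ ≤ 51*y^(2 : ℝ)*1*rexp (-δ*y) := by gcongr; linarith
          _ = _ := by ring
      · rw [← Real.exp_add]; ring_nf

/-- Mellin inversion for the exponential, on a line to the right of `1`. -/
lemma integral_dampedTwist {n : ℕ} (hn : 0 < n) {δ : ℝ} (hδ : 0 < δ) (hδ1 : δ ≤ 1) {σ : ℝ}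
    (h1 : 1 ≤ σ) (h2 : σ ≤ 2) : ∫ y : ℝ, dampedTwist n δ (σ + y*I) = 2*π*cexp (-((2*π*n : ℝ)*cexp (I*(π/2 - δ : ℝ)))) := by
  set w : ℂ := (2*π*n : ℝ)*cexp (I*(π/2 - δ : ℝ)) with hw
  have hwre : 0 < w.re := by
    rw [hw, Complex.re_ofReal_mul, mul_comm I, Complex.exp_ofReal_mul_I_re, Real.cos_pi_div_two_sub]
    have := Real.sin_pos_of_pos_of_lt_pi hδ (by linarith [pi_gt_three])
    positivity
  have hmel : ∀ s : ℂ, 0 < s.re → mellin (fun t : ℝ => cexp (-(w*t))) s = dampedTwist n δ s := fun s hs => by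
    rw [dampedTwist_eq hn hδ hδ1, mellin]; simp only [smul_eq_mul]
    exact integral_cpow_mul_exp_neg_mul_complex hs hwre
  have hline : ∀ y : ℝ, 0 < ((σ : ℂ) + y*I).re := fun y => by simp; linarith
  have hinv := mellinInv_mellin_eq σ (fun t : ℝ => cexp (-(w*t))) (x := 1) one_pos (by
      have := integrableOn_cpow_mul_exp_neg_mul (a := σ) (w := w) (by simp; linarith) hwre
      simpa [MellinConvergent] using this)
    (by
      refine (integrable_dampedTwist hn hδ hδ1 h1 h2).congr (ae_of_all _ fun y => ?_)
      grind) (by fun_prop)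
  simp only [mellinInv, ofReal_one, one_cpow, one_smul, mul_one] at hinv
  rw [← hinv]
  simp only [hmel _ (hline _)]
  rw [real_smul]
  have : (π : ℂ) ≠ 0 := mod_cast pi_ne_zero
  generalize ∫ y : ℝ, dampedTwist n δ (σ + y*I) = J
  push_cast
  field_simp

/-! ### Gonek's lemma: the integral of χ(1 − s) n^(-s) -/

lemma integral_dampedPow_div {r p q : ℝ} (hr : r ≠ 0) (hp : 0 < p) (hpq : p ≤ q) :
    ∫ y in p..q, dampedPow r 0 y/y = (dampedPow r 0 q - dampedPow r 0 p)/r := by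
  have hu : uIcc p q = Icc p q := uIcc_of_le hpq
  have h0 : ∀ t ∈ Icc p q, t ≠ 0 := fun t ht => (hp.trans_le ht.1).ne'
  rw [eq_div_iff hr, mul_comm, ← integral_const_mul]
  refine integral_eq_sub_of_hasDerivAt (fun y hy => ?_) ?_
  · refine (hasDerivAt_dampedPow (r := r) (δ := 0) (hp.trans_le (hu ▸ hy).1)).congr_deriv ?_
    ring
  · refine ContinuousOn.intervalIntegrable (hu ▸ continuousOn_const.mul (ContinuousOn.div (fun t ht => ?_) continuousOn_id h0))
    exact (hasDerivAt_dampedPow (hp.trans_le ht.1)).continuousAt.continuousWithinAt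

lemma dampedPow_le_of_nonneg {r δ t : ℝ} (ht : 0 < t) (hδ : 0 ≤ δ) : dampedPow r δ t ≤ dampedPow r 0 t := by
  unfold dampedPow
  gcongr

/-- Replacing an integrand by its Stirling approximation. -/
lemma norm_integral_line_le {n : ℕ} (hn : 0 < n) {σ δ p q : ℝ} {f : ℂ → ℂ} (hp : 0 < p) (hpq : p ≤ q)
    (hδ : 0 ≤ δ) (hf : ContinuousOn (fun y : ℝ => f (σ + y*I)) (Icc p q))
    (happ : ∀ y ∈ Icc p q, ‖f (σ + y*I) - zetaChiMain (σ + y*I) * (n : ℂ)^(-(σ + y*I))*cexp (I*(δ*(σ + y*I)))‖ ≤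
      300/y*‖zetaChiMain (σ + y*I) *
      (n : ℂ)^(-(σ + y*I))*cexp (I*(δ*(σ + y*I)))‖) :
    ‖∫ y in p..q, f (σ + y*I)‖ ≤ (n : ℝ)^(-σ) * (‖∫ w in p..q, (dampedPow (σ - 1/2) δ w : ℂ)*cexp (I*stirlingPhase n w)‖ +
        300 * ∫ y in p..q, dampedPow (σ - 1/2) 0 y/y) := by
  have hu : uIcc p q = Icc p q := uIcc_of_le hpq
  have hpos : ∀ y ∈ Icc p q, 0 < y := fun y hy => hp.trans_le hy.1
  have hn0 : (0 : ℝ) < n := mod_cast hn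
  set κ : ℂ := (((n : ℝ)^(-σ) : ℝ) : ℂ)*cexp (I*(δ*σ - π/4 : ℝ)) with hκ
  have hκn : ‖κ‖ = (n : ℝ)^(-σ) := by
    rw [hκ, norm_mul, mul_comm I, norm_exp_ofReal_mul_I, mul_one, norm_real, norm_of_nonneg (by positivity)]
  set G : ℝ → ℂ := fun w => (dampedPow (σ - 1/2) δ w : ℂ)*cexp (I*stirlingPhase n w) with hG
  have hm : ∀ y ∈ Icc p q, zetaChiMain (σ + y*I)*(n : ℂ)^(-(σ + y*I)) * cexp (I*(δ*(σ + y*I))) = κ*G y := fun y hy => by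
    have := zetaChiMain_mul_cpow_mul_exp hn (s := σ + y*I) (by simpa using hpos y hy) δ
    simp only [add_im, ofReal_im, mul_im, ofReal_re, I_im, mul_one,
      I_re, mul_zero, add_zero, zero_add, add_re, mul_re, sub_zero] at this
    exact this
  have hGc : ContinuousOn G (Icc p q) := fun y hy => ((hasDerivAt_dampedPow (hpos y hy)).ofReal_comp.continuousAt.mul
      (((hasDerivAt_stirlingPhase hn0 (hpos y hy)).ofReal_comp.const_mul I).cexp).continuousAt).continuousWithinAt
  have hGn : ∀ y ∈ Icc p q, ‖G y‖ = dampedPow (σ - 1/2) δ y := fun y hy => by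
    rw [hG]; simp only [norm_mul]
    rw [mul_comm I, norm_exp_ofReal_mul_I, mul_one, norm_real, norm_of_nonneg (dampedPow_pos (hpos y hy)).le]
  have hsplit : ∫ y in p..q, f (σ + y*I) = κ*(∫ y in p..q, G y) + ∫ y in p..q, (f (σ + y*I) - κ*G y) := by
    rw [← integral_const_mul, ← integral_add]
    · simp
    · exact ((hu ▸ continuousOn_const.mul hGc : ContinuousOn _ (uIcc p q))).intervalIntegrable
    · exact ((hu ▸ hf.sub (continuousOn_const.mul hGc) : ContinuousOn _ (uIcc p q))).intervalIntegrable
  have herr : ‖∫ y in p..q, (f (σ + y*I) - κ*G y)‖ ≤ ∫ y in p..q, 300*(n : ℝ)^(-σ)*(dampedPow (σ - 1/2) 0 y/y) := by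
    refine norm_integral_le_of_norm_le hpq (ae_of_all _ fun y hy => ?_) ?_
    · have hy' : y ∈ Icc p q := Ioc_subset_Icc_self hy
      have h1 := happ y hy'
      rw [hm y hy', norm_mul, hκn, hGn y hy'] at h1; refine h1.trans ?_
      have := dampedPow_le_of_nonneg (r := σ - 1/2) (hpos y hy') hδ
      have hy0 := hpos y hy'
      calc 300/y*((n : ℝ)^(-σ)*dampedPow (σ - 1/2) δ y) ≤ 300/y*((n : ℝ)^(-σ)*dampedPow (σ - 1/2) 0 y) := by gcongr
        _ = _ := by ring
    · refine ContinuousOn.intervalIntegrable (hu ▸ continuousOn_const.mul (ContinuousOn.div (fun t ht => ?_)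
        continuousOn_id fun t ht => (hpos t ht).ne'))
      exact (hasDerivAt_dampedPow (hpos t ht)).continuousAt.continuousWithinAt
  rw [integral_const_mul] at herr
  rw [hsplit]
  calc _ ≤ _ := norm_add_le _ _
    _ ≤ (n : ℝ)^(-σ)*‖∫ y in p..q, G y‖ + 300*(n : ℝ)^(-σ) * ∫ y in p..q, dampedPow (σ - 1/2) 0 y/y := by
      refine add_le_add (le_of_eq ?_) herr
      rw [norm_mul, hκn]
    _ = _ := by ring

/-- Merges the second derivative bound √X, good near the stationary point, with the first derivative
bound X/D at distance D from it. -/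
lemma min_le_two_mul_div_add {a D X : ℝ} (hX : 0 < X) (hD : 0 ≤ D) (ha0 : 0 ≤ a) (h1 : a ≤ √X)
    (h2 : 0 < D → a ≤ X/D) : a ≤ 2*(X/(D + √X)) := by
  have hs : 0 < √X := sqrt_pos.2 hX
  have hXs : √X*√X = X := mul_self_sqrt hX.le
  rw [← mul_div_assoc, le_div_iff₀ (by positivity)]
  rcases le_total D (√X) with h | h
  · nlinarith
  · have hD0 : 0 < D := hs.trans_le h
    have h3 := h2 hD0
    rw [le_div_iff₀ hD0] at h3; nlinarith

lemma dampedPow_zero_eq (r t : ℝ) : dampedPow r 0 t = (t/(2*π))^r := by simp [dampedPow]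

lemma half_le_log_of_two_le {u : ℝ} (hu : 2 ≤ u) : 1/2 ≤ log u := by
  have h := log_le_log two_pos hu
  have := log_two_gt_d9
  linarith

lemma sub_div_le_log_div {u v : ℝ} (hu : 0 < u) (huv : u ≤ v) : (v - u)/v ≤ log (v/u) := by
  have hv : 0 < v := hu.trans_le huv
  have h := log_le_sub_one_of_pos (show 0 < u/v by positivity)
  rw [log_div hu.ne' hv.ne'] at h
  rw [log_div hv.ne' hu.ne', sub_div, div_self hv.ne']
  linarith

/-- The tail of `χ(1 - s) n ^ (-s)` beyond its stationary point, on the line `Re s = 1 / 4`. -/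
lemma norm_integral_dampedTwist_left_le {n : ℕ} (hn : 0 < n) {δ X T : ℝ} (hδ : 0 ≤ δ) (hX : 1 ≤ X)
    (hnX : n ≤ X) (hT : 4*π*X ≤ T) :
    ‖∫ y in (2*π*X)..T, dampedTwist n δ ((1/4 : ℝ) + y*I)‖ ≤
      1300*((n : ℝ)^(-(1/4) : ℝ)*X^(-(1/4) : ℝ)) + 480*(√X/(X - n + √X)) := by
  have hpi := pi_gt_three
  have hpi4 := pi_lt_four
  have hX0 : 0 < X := by linarith
  have hn0 : (0 : ℝ) < n := mod_cast hn
  set p := 2*π*X with hp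
  have hp6 : 6 ≤ p := by rw [hp]; nlinarith
  have hp0 : 0 < p := by linarith
  have hpT2 : 2*p ≤ T := by rw [hp]; linarith
  have hpT : p ≤ T := by linarith
  have hpX : p/(2*π) = X := by rw [hp]; field_simp
  have h := norm_integral_line_le hn (σ := 1/4) (δ := δ) (f := dampedTwist n δ) hp0 hpT hδ
    (continuous_dampedTwist_line hn δ (by norm_num)).continuousOn (fun y hy => by
      have hy4 : 4 ≤ y := by linarith [hy.1]
      set s : ℂ := ((1/4 : ℝ) : ℂ) + y*I with hs
      have hsim : s.im = y := by simp [hs]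
      have h1 := norm_gammaTwist_div_zetaChiMain_sub_one_le (s := s) (by simp [hs]) (by simp [hs]; norm_num)
        (by rw [hsim]; exact hy4)
      rw [hsim] at h1
      have hz := zetaChiMain_ne_zero s
      have e : dampedTwist n δ s - zetaChiMain s*(n : ℂ)^(-s)*cexp (I*(δ*s)) = (gammaTwist s/zetaChiMain s - 1) *
          (zetaChiMain s*(n : ℂ)^(-s)*cexp (I*(δ*s))) := by
        rw [dampedTwist]; field_simp
      rw [e, norm_mul]; gcongr; refine h1.trans ?_
      gcongr; norm_num)
  set a := X^(-(1/4) : ℝ) with ha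
  set b := (n : ℝ)^(-(1/4) : ℝ)
  have ha0 : 0 < a := by positivity
  have hb0 : 0 < b := by positivity
  have hI : ∫ y in p..T, dampedPow (1/4 - 1/2) 0 y/y ≤ 4*a := by
    rw [integral_dampedPow_div (by norm_num) hp0 hpT, dampedPow_zero_eq, dampedPow_zero_eq, hpX]
    have : 0 ≤ (T/(2*π))^(1/4 - 1/2 : ℝ) := by
      have : 0 < T := by linarith
      positivity
    grind
  have hM : ∀ w, p ≤ w → dampedPow (1/4 - 1/2) δ w ≤ a := fun w hw => by
    have hw0 : 0 < w := by linarith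
    refine (dampedPow_le_of_nonneg hw0 hδ).trans ?_
    rw [dampedPow_zero_eq, ha, ← hpX, show (1/4 - 1/2 : ℝ) = -(1/4) by norm_num]
    exact rpow_le_rpow_of_nonpos (by positivity) (by gcongr) (by norm_num)
  have hsign : ((1/4 - 1/2 : ℝ) ≤ 0 ∧ 0 ≤ δ) ∨ (0 ≤ (1/4 - 1/2 : ℝ) ∧ δ = 0) := Or.inl ⟨by norm_num, hδ⟩
  have hlogmono : ∀ w, p ≤ w → log (X/n) ≤ |log (w/(2*π*n))| := fun w hw => by
    refine (log_le_log (by positivity) ?_).trans (le_abs_self _)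
    rw [div_le_div_iff₀ hn0 (by positivity)]
    have : X*(2*π) ≤ w := by linarith
    nlinarith
  have hdiv0 : 0 ≤ √X/(X - n + √X) := div_nonneg (by positivity) (by positivity)
  -- If 2n ≤ X, the phase derivative log(y/2πn) is at least 1/2 on the whole range. Otherwise this
  -- is guaranteed from 2p on, and the stretch from p to 2p near the stationary point needs both
  -- derivative tests.
  rcases le_or_gt ((n : ℝ)*2) X with hc | hc
  · have hlog : 1/2 ≤ log (X/n) := half_le_log_of_two_le (by rw [le_div_iff₀ hn0]; linarith)
    have hF := norm_integral_dampedPow_le_of_log (ν := n) (r := 1/4 - 1/2) (δ := δ) (M := a) hn0 hp0 hpT hsign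
      (fun w hw => hM w hw.1) (l := 1/2) (by norm_num) (fun w hw => hlog.trans (hlogmono w hw.1))
    calc _ ≤ _ := h
      _ ≤ b*(12*a/(1/2) + 300*(4*a)) := by gcongr
      _ ≤ 1300*(b*a) + 0 := by nlinarith [mul_pos hb0 ha0]
      _ ≤ _ := by linarith
  · set G : ℝ → ℂ := fun w => (dampedPow (1/4 - 1/2) δ w : ℂ)*cexp (I*stirlingPhase n w)
    have hGc : ∀ u v, 0 < u → u ≤ v → IntervalIntegrable G volume u v := fun u v hu huv => by
      refine ContinuousOn.intervalIntegrable ?_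
      rw [uIcc_of_le huv]; intro y hy
      have hy0 := hu.trans_le hy.1
      exact ((hasDerivAt_dampedPow hy0).ofReal_comp.continuousAt.mul
        (((hasDerivAt_stirlingPhase hn0 hy0).ofReal_comp.const_mul I).cexp).continuousAt).continuousWithinAt
    have hsp : ∫ w in p..T, G w = (∫ w in p..(2*p), G w) + ∫ w in (2*p)..T, G w :=
      (integral_add_adjacent_intervals (hGc _ _ hp0 (by linarith)) (hGc _ _ (by linarith) hpT2)).symm
    have hF2 := norm_integral_dampedPow_le_of_log (ν := n) (r := 1/4 - 1/2) (δ := δ) (M := a) hn0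
      (by linarith : 0 < 2*p) hpT2 hsign
      (fun w hw => hM w (by linarith [hw.1])) (l := 1/2) (by norm_num) (fun w hw => by
        refine (half_le_log_of_two_le ?_).trans (le_abs_self _)
        rw [le_div_iff₀ (by positivity)]
        have h1 : 2*(2*π*n) ≤ 2*p := by rw [hp]; gcongr
        exact h1.trans hw.1)
    have hS1 := norm_integral_dampedPow_le_sqrt (ν := n) (r := 1/4 - 1/2) (δ := δ) (M := a) hn0 hp0
      (by linarith : p ≤ 2*p) hsign (fun w hw => hM w hw.1)
    have hsq : √(2*p) ≤ 4*√X := by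
      rw [hp, show 2*(2*π*X) = (4*π)*X by ring, sqrt_mul (by positivity)]
      gcongr; exact sqrt_le_iff.2 ⟨by norm_num, by linarith⟩
    have hF1 : 0 < X - n → ‖∫ w in p..(2*p), G w‖ ≤ 12*a/((X - n)/X) := fun hD =>
      norm_integral_dampedPow_le_of_log (ν := n) (r := 1/4 - 1/2) (δ := δ) (M := a) hn0 hp0
        (by linarith) hsign (fun w hw => hM w hw.1) (by positivity)
        (fun w hw => (sub_div_le_log_div hn0 hnX).trans (hlogmono w hw.1))
    have hmin := min_le_two_mul_div_add (a := ‖∫ w in p..(2*p), G w‖/(120*a)) hX0 (sub_nonneg.2 hnX) (by positivity) (by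
        rw [div_le_iff₀ (by positivity)]
        refine hS1.trans ?_
        calc 30*a*√(2*p) ≤ 30*a*(4*√X) := by gcongr
          _ = _ := by ring) (fun hD => by
        rw [div_le_iff₀ (by positivity)]
        refine (hF1 hD).trans ?_
        rw [div_div_eq_mul_div, div_mul_eq_mul_div]; gcongr ?_/_; nlinarith)
    rw [div_le_iff₀ (by positivity)] at hmin
    have hba : b*a ≤ 2*(1/√X) := by
      have hb' : b ≤ 2*a := by
        calc b ≤ (X/2)^(-(1/4) : ℝ) := rpow_le_rpow_of_nonpos (by positivity) (by linarith) (by norm_num)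
          _ = a*2^(1/4 : ℝ) := by rw [div_rpow hX0.le two_pos.le, rpow_neg two_pos.le, div_inv_eq_mul]
          _ ≤ a*2^(1 : ℝ) := by gcongr <;> norm_num
          _ = 2*a := by rw [rpow_one]; ring
      have haa : a*a = 1/√X := by rw [ha, ← rpow_add hX0, sqrt_eq_rpow, one_div (X^(1/2 : ℝ)), ← rpow_neg hX0.le]; norm_num
      calc b*a ≤ 2*a*a := by gcongr
        _ = _ := by rw [mul_assoc, haa]
    have hXs : X/√X = √X := by rw [Real.div_sqrt]
    have e1 : b*‖∫ w in p..(2*p), G w‖ ≤ 480*(√X/(X - n + √X)) := by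
      calc _ ≤ b*(2*(X/(X - n + √X))*(120*a)) := by gcongr
        _ = 240*(b*a)*(X/(X - n + √X)) := by ring
        _ ≤ 240*(2*(1/√X))*(X/(X - n + √X)) := by gcongr
        _ = 480*(X/√X/(X - n + √X)) := by ring
        _ = _ := by rw [hXs]
    calc _ ≤ _ := h
      _ ≤ b*((‖∫ w in p..(2*p), G w‖ + 12*a/(1/2)) + 300*(4*a)) := by
        gcongr; rw [hsp]; exact (norm_add_le _ _).trans (add_le_add le_rfl hF2)
      _ = b*‖∫ w in p..(2*p), G w‖ + 1224*(b*a) := by ring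
      _ ≤ _ := by linarith [mul_pos hb0 ha0]

lemma norm_dampedTwist_le_rpow {n : ℕ} (hn : 0 < n) {δ : ℝ} {s : ℂ} (hs : 0 < s.re) (hs2 : s.re ≤ 2) (ht : 4 ≤ s.im) :
    ‖dampedTwist n δ s‖ ≤ 51*(s.im/(2*π))^(s.re - 1/2)*(n : ℝ)^(-s.re)*rexp (-δ*s.im) := by
  rw [norm_dampedTwist hn]
  gcongr
  exact norm_gammaTwist_le_rpow hs hs2 ht

/-- Shifting the tail of the damped integral to the line `Re s = 1 / 4`. -/
lemma norm_integral_Ioi_dampedTwist_le {n : ℕ} (hn : 0 < n) {δ σ X : ℝ} (hδ : 0 < δ) (hδ1 : δ ≤ 1)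
    (h1 : 1 ≤ σ) (h2 : σ ≤ 2) (hX : 1 ≤ X) (hnX : n ≤ X) :
    ‖∫ y in Ioi (2*π*X), dampedTwist n δ (σ + y*I)‖ ≤ 1300*((n : ℝ)^(-(1/4) : ℝ)*X^(-(1/4) : ℝ)) + 480*(√X/(X - n + √X)) +
        102*(X^(σ - 1/2)*(n : ℝ)^(-σ)) := by
  have hpi := pi_gt_three
  have hX0 : 0 < X := by linarith
  have hn0 : (0 : ℝ) < n := mod_cast hn
  have hn1 : (1 : ℝ) ≤ n := mod_cast hn
  set p := 2*π*X with hp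
  have hp6 : 6 ≤ p := by rw [hp]; nlinarith
  have hpX : p/(2*π) = X := by rw [hp]; field_simp
  have hint := integrable_dampedTwist hn hδ hδ1 h1 h2
  have hlim := intervalIntegral_tendsto_integral_Ioi p hint.integrableOn tendsto_id
  set E := 1300*((n : ℝ)^(-(1/4) : ℝ)*X^(-(1/4) : ℝ)) + 480*(√X/(X - n + √X)) + 102*(X^(σ - 1/2)*(n : ℝ)^(-σ)) with hE
  have hR : Tendsto (fun T : ℝ => E + 102*(T^(2 : ℝ)*rexp (-δ*T))) atTop (𝓝 (E + 102*0)) := by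
    refine ((?_ : Tendsto (fun T : ℝ => T^(2 : ℝ)*rexp (-δ*T)) atTop (𝓝 0)).const_mul 102).const_add E
    exact tendsto_rpow_mul_exp_neg_mul_atTop_nhds_zero 2 δ hδ
  rw [mul_zero, add_zero] at hR
  -- The rectangle is closed at height T, and its upper edge vanishes as T → ∞ because of the
  -- damping. On Re s = 1/4 the amplitude decreases, so the left edge is bounded uniformly in δ,
  -- whereas the undamped amplitude grows on the original line.
  refine le_of_tendsto_of_tendsto hlim.norm hR ?_
  filter_upwards [eventually_ge_atTop (4*π*X)] with T hT
  have hpT : p ≤ T := by rw [hp]; nlinarith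
  have hT6 : 6 ≤ T := by linarith
  have hrect := Complex.integral_boundary_rect_eq_zero_of_differentiableOn (dampedTwist n δ) ⟨1/4, p⟩ ⟨σ, T⟩ (fun z hz => by
      rw [mem_reProdIm] at hz
      have := hz.1
      rw [uIcc_of_le (by simp; linarith)] at this
      have h4 : 1/4 ≤ z.re := this.1
      exact (differentiableAt_dampedTwist hn δ (by linarith)).differentiableWithinAt)
  simp only [smul_eq_mul] at hrect
  have hleft := norm_integral_dampedTwist_left_le hn hδ.le hX hnX hT
  have hhor : ∀ h B : ℝ, 6 ≤ h → 0 ≤ B → (∀ x, 1/4 ≤ x → x ≤ σ → (h/(2*π))^(x - 1/2)*(n : ℝ)^(-x) *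
      rexp (-δ*h) ≤ B) → ‖∫ x in (1/4 : ℝ)..σ, dampedTwist n δ (x + h*I)‖ ≤ 102*B := fun h B hh hB0 hB => by
    have := norm_integral_le_of_norm_le_const (a := (1/4 : ℝ)) (b := σ)
      (f := fun x : ℝ => dampedTwist n δ (x + h*I)) (C := 51*B) (fun x hx => by
        rw [uIoc_of_le (by linarith)] at hx
        have := norm_dampedTwist_le_rpow hn (δ := δ) (s := x + h*I) (by simp; linarith [hx.1])
          (by simp; linarith [hx.2]) (by simp; linarith)
        simp at this; grind)
    refine this.trans ?_
    rw [abs_of_nonneg (by linarith)]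
    nlinarith
  have htop := hhor T (T^(2 : ℝ)*rexp (-δ*T)) hT6 (by positivity) (fun x hx hxσ => by
    have hT1 : 1 ≤ T/(2*π) := by
      rw [le_div_iff₀ (by positivity)]
      rw [hp] at hpT; nlinarith
    have e1 : (T/(2*π))^(x - 1/2) ≤ T^(2 : ℝ) := by
      calc _ ≤ (T/(2*π))^(2 : ℝ) := rpow_le_rpow_of_exponent_le hT1 (by linarith)
        _ ≤ _ := by gcongr; exact div_le_self (by linarith) (by linarith)
    have e2 : (n : ℝ)^(-x) ≤ 1 := Real.rpow_le_one_of_one_le_of_nonpos hn1 (by linarith)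
    gcongr
    calc _ ≤ T^(2 : ℝ)*1 := by gcongr
      _ = _ := mul_one _)
  -- X^(x - 1/2) n^(-x) = X^(-1/2) (X/n)^x increases with x because n ≤ X, so its maximum is at x =
  -- σ.
  have hbot := hhor p (X^(σ - 1/2)*(n : ℝ)^(-σ)) hp6 (by positivity) (fun x hx hxσ => by
    rw [hpX]
    have e1 : X^(x - 1/2)*(n : ℝ)^(-x) ≤ X^(σ - 1/2)*(n : ℝ)^(-σ) := by
      have e : ∀ z : ℝ, X^(z - 1/2)*(n : ℝ)^(-z) = X^(-(1/2) : ℝ)*(X/n)^z := fun z => by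
        rw [sub_eq_neg_add, rpow_add hX0, div_rpow hX0.le hn0.le, rpow_neg hn0.le]; ring
      rw [e, e]; gcongr; rw [le_div_iff₀ hn0]; linarith
    have e2 : rexp (-δ*p) ≤ 1 := Real.exp_le_one_iff.2 (by nlinarith)
    calc _ ≤ _ := mul_le_of_le_one_right (by positivity) e2
      _ ≤ _ := e1)
  have key : ∫ y in p..T, dampedTwist n δ (σ + y*I) = (∫ y in p..T, dampedTwist n δ ((1/4 : ℝ) + y*I)) +
      I*((∫ x in (1/4 : ℝ)..σ, dampedTwist n δ (x + p*I)) - ∫ x in (1/4 : ℝ)..σ, dampedTwist n δ (x + T*I)) := by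
    linear_combination (-I)*hrect + (∫ y in p..T, dampedTwist n δ (σ + y*I))*I_sq -
      (∫ y in p..T, dampedTwist n δ ((1/4 : ℝ) + y*I))*I_sq
  simp only [id]
  rw [key]
  calc _ ≤ _ := norm_add_le _ _
    _ ≤ (1300*((n : ℝ)^(-(1/4) : ℝ)*X^(-(1/4) : ℝ)) + 480*(√X/(X - n + √X))) +
        (102*(X^(σ - 1/2)*(n : ℝ)^(-σ)) + 102*(T^(2 : ℝ)*rexp (-δ*T))) := by
      refine add_le_add hleft ?_
      rw [norm_mul, norm_I, one_mul]; exact (norm_sub_le _ _).trans (add_le_add hbot htop)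
    _ = _ := by rw [hE]; ring

/-- The contribution of `Im s ≤ 2π` to the damped integral is negligible. -/
lemma norm_integral_Iic_dampedTwist_le {n : ℕ} (hn : 0 < n) {δ σ : ℝ} (hδ : 0 < δ) (hδ1 : δ ≤ 1) (h1 : 1 ≤ σ) (h2 : σ ≤ 2) :
    ‖∫ y in Iic (2*π), dampedTwist n δ (σ + y*I)‖ ≤ rexp (π^2)*(2*rexp π)*(n : ℝ)^(-σ) := by
  have hpi := pi_gt_three
  have hb : ∀ y ∈ Iic (2*π), ‖dampedTwist n δ (σ + y*I)‖ ≤ rexp (π^2)*(n : ℝ)^(-σ)*rexp (y/2) := fun y hy => by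
    have hy : y ≤ 2*π := hy
    rcases le_total y 0 with h | h
    · have := norm_dampedTwist_le_of_im_nonpos hn hδ1 (s := σ + y*I) (by simpa) (by simpa) (by simpa)
      simp at this; refine this.trans ?_
      gcongr; exact le_mul_of_one_le_left (by positivity) (one_le_exp (by positivity))
    · rw [norm_dampedTwist hn]
      have hg := norm_gammaTwist_le_mul_exp (s := σ + y*I) (by simpa) (by simpa)
      simp at hg ⊢
      calc _ ≤ rexp (π^2)*(n : ℝ)^(-σ)*1 := by
            gcongr
            · exact hg.trans (exp_le_exp.2 (by nlinarith))
            · exact Real.exp_le_one_iff.2 (by nlinarith)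
        _ ≤ _ := by gcongr; exact one_le_exp (by linarith)
  have hI : ∫ y in Iic (2*π), rexp (y/2) = 2*rexp π := by
    have := integral_exp_mul_Iic (a := (1/2 : ℝ)) (by norm_num) (2*π)
    grind
  calc _ ≤ ∫ y in Iic (2*π), rexp (π^2)*(n : ℝ)^(-σ)*rexp (y/2) :=
        MeasureTheory.norm_integral_le_of_norm_le ((integrableOn_exp_half_Iic _).const_mul _)
          ((ae_restrict_iff' measurableSet_Iic).2 (ae_of_all _ hb))
    _ = _ := by rw [MeasureTheory.integral_const_mul, hI]; ring

/-- The damped integral over the whole line is known by Mellin inversion. Removing its two tails and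
letting δ → 0 gives the main term, as the exponential tends to e^(-2πin) = 1. -/
lemma norm_integral_dampedTwist_zero_sub_le {n : ℕ} (hn : 0 < n) {σ X : ℝ} (h1 : 1 ≤ σ) (h2 : σ ≤ 2) (hX : 1 ≤ X) (hnX : n ≤ X) :
    ‖(∫ y in (2*π)..(2*π*X), dampedTwist n 0 (σ + y*I)) - 2*π‖ ≤
      1300*((n : ℝ)^(-(1/4) : ℝ)*X^(-(1/4) : ℝ)) + 480*(√X/(X - n + √X)) + 102*(X^(σ - 1/2)*(n : ℝ)^(-σ)) +
      rexp (π^2)*(2*rexp π)*(n : ℝ)^(-σ) := by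
  set D : ℝ → ℂ := fun δ => (∫ y in (2*π)..(2*π*X), dampedTwist n δ (σ + y*I)) -
    2*π*cexp (-((2*π*n : ℝ)*cexp (I*(π/2 - δ : ℝ)))) with hD
  have hcont : Continuous D := by
    refine Continuous.sub ?_ (by fun_prop)
    refine intervalIntegral.continuous_parametric_intervalIntegral_of_continuous' (f := fun δ y : ℝ =>
      dampedTwist n δ (σ + y*I)) ?_ _ _
    have h0 := (continuous_dampedTwist_line hn 0 (σ := σ) (by linarith)).comp continuous_snd (X := ℝ × ℝ)
    have e : uncurry (fun δ y : ℝ => dampedTwist n δ (σ + y*I)) =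
        fun x : ℝ × ℝ => ((fun y : ℝ => dampedTwist n 0 (σ + y*I)) ∘ Prod.snd) x * cexp (I*(x.1*(σ + x.2*I))) := by
      ext x
      simp [uncurry, dampedTwist]
    rw [e]; exact h0.mul (by fun_prop)
  have hD0 : D 0 = (∫ y in (2*π)..(2*π*X), dampedTwist n 0 (σ + y*I)) - 2*π := by
    rw [hD]; simp only [sub_zero]
    have : cexp (I*(π/2 : ℝ)) = I := by rw [mul_comm]; simp
    rw [this]
    have : cexp (-((2*π*n : ℝ)*I)) = 1 := by rw [Complex.exp_eq_one_iff]; exact ⟨-n, by push_cast; ring⟩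
    rw [this, mul_one]
  rw [← hD0]
  refine le_of_tendsto (((hcont.tendsto 0).mono_left (nhdsWithin_le_nhds (s := Ioi 0))).norm) ?_
  have hmem : Set.Ioc (0 : ℝ) 1 ∈ 𝓝[>] (0 : ℝ) := Ioc_mem_nhdsGT one_pos
  filter_upwards [hmem] with δ hδ
  have hint := integrable_dampedTwist hn hδ.1 hδ.2 h1 h2
  have hA := norm_integral_Iic_dampedTwist_le hn hδ.1 hδ.2 h1 h2
  have hB := norm_integral_Ioi_dampedTwist_le hn hδ.1 hδ.2 h1 h2 hX hnX
  have htot := integral_dampedTwist hn hδ.1 hδ.2 h1 h2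
  have hs1 := intervalIntegral.integral_Iic_add_Ioi (b := 2*π*X) hint.integrableOn hint.integrableOn
  have hs2 := intervalIntegral.integral_Iic_sub_Iic (a := 2*π) (b := 2*π*X) hint.integrableOn hint.integrableOn
  have e : D δ = -(∫ y in Iic (2*π), dampedTwist n δ (σ + y*I)) - ∫ y in Ioi (2*π*X), dampedTwist n δ (σ + y*I) := by grind
  rw [e]
  calc _ ≤ _ := norm_sub_le _ _
    _ ≤ _ := by rw [norm_neg]; linarith

/-- The discarded half of the cosine is smaller by a factor e^(-πy), which outweighs the growth
e^(πy/2) and leaves an integrable function. -/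
lemma norm_integral_zetaChi_sub_dampedTwist_le {n : ℕ} (hn : 0 < n) {σ X : ℝ} (h1 : 1 ≤ σ) (h2 : σ ≤ 2) (hX : 1 ≤ X) :
    ‖∫ y in (2*π)..(2*π*X), (zetaChi (1 - (σ + y*I)) * (n : ℂ)^(-(σ + y*I)) - dampedTwist n 0 (σ + y*I))‖ ≤ (n : ℝ)^(-σ) := by
  have hpi := pi_gt_three
  have hp : 2*π ≤ 2*π*X := by nlinarith
  have hI : ∫ y in (2*π)..(2*π*X), rexp (-y) ≤ 1 := by
    rw [integral_comp_neg, integral_exp]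
    have : rexp (-(2*π)) ≤ 1 := Real.exp_le_one_iff.2 (by linarith)
    have := exp_pos (-(2*π*X))
    linarith
  calc _ ≤ ∫ y in (2*π)..(2*π*X), (n : ℝ)^(-σ)*rexp (-y) := by
        refine norm_integral_le_of_norm_le hp (ae_of_all _ fun y hy => ?_) (Continuous.intervalIntegrable (by fun_prop) _ _)
        have hy0 : 0 < y := by linarith [hy.1]
        have hg := norm_gammaTwist_le_mul_exp (s := σ + y*I) (by simpa) (by simpa)
        have e : zetaChi (1 - (σ + y*I))*(n : ℂ)^(-(σ + y*I)) - dampedTwist n 0 (σ + y*I) = gammaTwist (σ + y*I) *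
            cexp (I*(π*(σ + y*I)))*(n : ℂ)^(-(σ + y*I)) := by
          rw [zetaChi_one_sub, dampedTwist]; simp; ring
        rw [e, norm_mul, norm_mul, norm_natCast_cpow_neg hn, norm_exp]
        have e2 : (I*(π*(σ + y*I))).re = -(π*y) := by simp
        rw [e2]; simp at hg ⊢; rw [mul_comm ((n : ℝ)^(-σ))]; gcongr
        calc _ ≤ rexp (π/2*y)*rexp (-(π*y)) := by gcongr
          _ = rexp (-(π/2*y)) := by rw [← Real.exp_add]; ring_nf
          _ ≤ _ := exp_le_exp.2 (by nlinarith)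
    _ = (n : ℝ)^(-σ) * ∫ y in (2*π)..(2*π*X), rexp (-y) := integral_const_mul _ _
    _ ≤ _ := mul_le_of_le_one_right (by positivity) hI

lemma differentiableAt_zetaChi {w : ℂ} (hw : w.re < 1) : DifferentiableAt ℂ zetaChi w := by
  have hpi : (2*(π : ℂ)) ≠ 0 := by simp
  have hG : DifferentiableAt ℂ (fun w => Complex.Gamma (1 - w)) w := by
    refine DifferentiableAt.comp (g := Complex.Gamma) w (Complex.differentiableAt_Gamma _ fun m h => ?_) (by fun_prop)
    have := congrArg re h
    simp at this; linarith
  unfold zetaChi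
  refine ((DifferentiableAt.const_mul ?_ 2).mul hG).mul (by fun_prop)
  exact (by fun_prop : DifferentiableAt ℂ (fun w : ℂ => -(1 - w)) w).const_cpow (Or.inl hpi)

lemma differentiableAt_zetaChi_one_sub {s : ℂ} (hs : 0 < s.re) : DifferentiableAt ℂ (fun s => zetaChi (1 - s)) s :=
  DifferentiableAt.comp (g := zetaChi) s (differentiableAt_zetaChi (by simpa)) (by fun_prop)

lemma continuous_zetaChi_line {σ : ℝ} (hσ : 0 < σ) : Continuous fun y : ℝ => zetaChi (1 - (σ + y*I)) := by
  rw [continuous_iff_continuousAt]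
  intro y
  have := (differentiableAt_zetaChi_one_sub (s := σ + y*I) (by simpa)).continuousAt
  exact ContinuousAt.comp (f := fun y : ℝ => (σ + y*I : ℂ)) this (by fun_prop)

lemma continuous_natCast_cpow_line {n : ℕ} (hn : 0 < n) (σ : ℝ) : Continuous fun y : ℝ => (n : ℂ)^(-(σ + y*I)) := by
  have hn0 : (n : ℂ) ≠ 0 := mod_cast hn.ne'
  exact (by fun_prop : Continuous fun y : ℝ => -(σ + y*I : ℂ)).const_cpow (Or.inl hn0)

/-- The integral of `χ(1 - s) n ^ (-s)` when there is no stationary point in the range. -/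
lemma norm_integral_zetaChi_mul_cpow_le_of_lt {n : ℕ} (hn : 0 < n) {σ X A : ℝ}
    (h1 : 1 ≤ σ) (h2 : σ ≤ 2) (hX : 1 ≤ X) (hnX : X < n) (hA : X^(σ - 1) ≤ A) :
    ‖∫ y in (2*π)..(2*π*X), zetaChi (1 - (σ + y*I))*(n : ℂ)^(-(σ + y*I))‖ ≤
      700*A*(√X*(n : ℝ)^(-σ) + if (n : ℝ) ≤ 2*X then √X/(|n - X| + √X) else 0) := by
  have hpi := pi_gt_three
  have hpi4 := pi_lt_four
  have hX0 : 0 < X := by linarith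
  have hn0 : (0 : ℝ) < n := mod_cast hn
  have hA1 : 1 ≤ A := (one_le_rpow hX (by linarith)).trans hA
  set q := 2*π*X with hq
  have hp0 : (0 : ℝ) < 2*π := by positivity
  have hpq : 2*π ≤ q := by rw [hq]; nlinarith
  have hqX : q/(2*π) = X := by rw [hq]; field_simp
  have h := norm_integral_line_le hn (σ := σ) (δ := 0) (f := fun s => zetaChi (1 - s)*(n : ℂ)^(-s)) hp0 hpq le_rfl
    ((continuous_zetaChi_line (by linarith)).mul (continuous_natCast_cpow_line hn σ)).continuousOn (fun y hy => by
      have hy4 : 4 ≤ y := by linarith [hy.1]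
      set s : ℂ := (σ : ℂ) + y*I with hs
      have hsim : s.im = y := by simp [hs]
      have h1 := norm_zetaChi_div_zetaChiMain_sub_one_le (s := s) (by simp [hs]; linarith) (by simpa [hs])
        (by rw [hsim]; exact hy4)
      rw [hsim] at h1
      have hz := zetaChiMain_ne_zero s
      have e : zetaChi (1 - s)*(n : ℂ)^(-s) - zetaChiMain s*(n : ℂ)^(-s)*cexp (I*((0 : ℝ)*s)) =
          (zetaChi (1 - s)/zetaChiMain s - 1) *
          (zetaChiMain s*(n : ℂ)^(-s)*cexp (I*((0 : ℝ)*s))) := by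
        simp; field_simp
      rw [e, norm_mul]; gcongr)
  set M := X^(σ - 1/2) with hM
  have hMA : M ≤ A*√X := by
    rw [hM, sqrt_eq_rpow, show σ - 1/2 = (σ - 1) + 1/2 by ring, rpow_add hX0]
    gcongr
  have hM0 : 0 < M := by positivity
  have hI : ∫ y in (2*π)..q, dampedPow (σ - 1/2) 0 y/y ≤ 2*M := by
    rw [integral_dampedPow_div (by linarith) hp0 hpq, dampedPow_zero_eq, dampedPow_zero_eq, hqX,
      div_self hp0.ne', Real.one_rpow, div_le_iff₀ (by linarith)]
    nlinarith
  have hMb : ∀ w ∈ Icc (2*π) q, dampedPow (σ - 1/2) 0 w ≤ M := fun w hw => by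
    have hw0 : 0 < w := by linarith [hw.1]
    rw [dampedPow_zero_eq, hM, ← hqX]; refine rpow_le_rpow (by positivity) ?_ (by linarith)
    have := hw.2
    gcongr
  -- The range is finite and needs no damping: the amplitude increases and is at most X^(σ - 1/2) ≤
  -- A√X.
  have hsign : (σ - 1/2 ≤ 0 ∧ (0 : ℝ) ≤ 0) ∨ (0 ≤ σ - 1/2 ∧ (0 : ℝ) = 0) := Or.inr ⟨by linarith, rfl⟩
  have hlogmono : ∀ w ∈ Icc (2*π) q, log (n/X) ≤ |log (w/(2*π*n))| := fun w hw => by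
    have hw0 : 0 < w := by linarith [hw.1]
    refine le_trans ?_ (neg_le_abs _)
    rw [← Real.log_inv, inv_div]; refine log_le_log (by positivity) ?_
    rw [div_le_div_iff₀ hX0 hw0]
    have := hw.2
    rw [hq] at this; nlinarith
  set b := (n : ℝ)^(-σ)
  set J := ‖∫ w in (2*π)..q, (dampedPow (σ - 1/2) 0 w : ℂ)*cexp (I*stirlingPhase n w)‖
   
  have hmain : b*(300*(2*M)) ≤ 600*A*(√X*b) := by
    calc b*(300*(2*M)) ≤ b*(300*(2*(A*√X))) := by gcongr
      _ = _ := by ring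
  have hle : ‖∫ y in (2*π)..q, zetaChi (1 - (σ + y*I))*(n : ℂ)^(-(σ + y*I))‖ ≤ b*J + 600*A*(√X*b) := by
    refine h.trans ?_
    rw [mul_add]; refine add_le_add le_rfl (le_trans ?_ hmain); gcongr
  split_ifs with hc
  · have hD : |(n : ℝ) - X| = n - X := abs_of_pos (by linarith)
    have hS := norm_integral_dampedPow_le_sqrt (ν := n) hn0 hp0 hpq hsign hMb
    have hF := norm_integral_dampedPow_le_of_log (ν := n) hn0 hp0 hpq hsign hMb (l := (n - X)/n)
      (by positivity) (fun w hw => (sub_div_le_log_div hX0 hnX.le).trans (hlogmono w hw))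
    have hsq : √q ≤ 3*√X := by
      rw [hq, sqrt_mul (by positivity)]
      gcongr; exact sqrt_le_iff.2 ⟨by norm_num, by linarith⟩
    have hmin := min_le_two_mul_div_add (a := J/(90*M)) hX0 (by linarith : 0 ≤ n - X) (by positivity) (by
        rw [div_le_iff₀ (by positivity)]
        refine hS.trans ?_
        calc 30*M*√q ≤ 30*M*(3*√X) := by gcongr
          _ = _ := by ring) (fun hD => by
        rw [div_le_iff₀ (by positivity)]
        refine hF.trans ?_
        rw [div_div_eq_mul_div, div_mul_eq_mul_div]; gcongr ?_/_; nlinarith)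
    rw [div_le_iff₀ (by positivity)] at hmin
    have hbn : b ≤ 1/X := by
      calc b ≤ X^(-σ) := rpow_le_rpow_of_nonpos hX0 hnX.le (by linarith)
        _ ≤ X^(-1 : ℝ) := rpow_le_rpow_of_exponent_le hX (by linarith)
        _ = _ := by rw [Real.rpow_neg_one, one_div]
    rw [hD]
    have hden : 0 < n - X + √X := by positivity
    have e1 : b*J ≤ 180*A*(√X/(n - X + √X)) := by
      calc b*J ≤ 1/X*(2*(X/(n - X + √X))*(90*(A*√X))) := by gcongr; exact hmin.trans (by gcongr)
        _ = _ := by field_simp; ring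
    have : 0 ≤ A*(√X/(n - X + √X)) := by positivity
    have : 0 ≤ A*(√X*b) := by positivity
    linarith
  · rw [not_le] at hc
    have hlog : 1/2 ≤ log (n/X) := half_le_log_of_two_le (by rw [le_div_iff₀ hX0]; linarith)
    have hF := norm_integral_dampedPow_le_of_log (ν := n) hn0 hp0 hpq hsign hMb (l := 1/2)
      (by norm_num) (fun w hw => hlog.trans (hlogmono w hw))
    have e1 : b*J ≤ 24*A*(√X*b) := by
      calc b*J ≤ b*(12*(A*√X)/(1/2)) := by gcongr; linarith
        _ = _ := by ring
    have : 0 ≤ A*(√X*b) := by positivity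
    linarith

/-- Gonek's lemma for `χ(1 - s) n ^ (-s)` on a vertical line slightly to the right of `1`. -/
lemma exists_norm_integral_zetaChi_mul_cpow_sub_le : ∃ K : ℝ, 0 ≤ K ∧ ∀ (n : ℕ) (σ X A : ℝ), 0 < n →
    1 ≤ σ → σ ≤ 2 → 1 ≤ X → X^(σ - 1) ≤ A →
    ‖(∫ y in (2*π)..(2*π*X), zetaChi (1 - (σ + y*I)) * (n : ℂ)^(-(σ + y*I))) - (if (n : ℝ) ≤ X then 2*π else 0 : ℝ)‖ ≤
      K*A*(√X*(n : ℝ)^(-σ) + if (n : ℝ) ≤ 2*X then √X/(|n - X| + √X) else 0) := by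
  set C := rexp (π^2)*(2*rexp π)
  have hC0 : 0 < C := by positivity
  refine ⟨2000 + C, by positivity, fun n σ X A hn h1 h2 hX hA => ?_⟩
  have hX0 : 0 < X := by linarith
  have hn0 : (0 : ℝ) < n := mod_cast hn
  have hA1 : 1 ≤ A := (one_le_rpow hX (by linarith)).trans hA
  by_cases hnX : (n : ℝ) ≤ X
  · have hZ := norm_integral_dampedTwist_zero_sub_le hn h1 h2 hX hnX
    have hD := norm_integral_zetaChi_sub_dampedTwist_le hn h1 h2 hX
    rw [if_pos hnX, if_pos (by linarith), abs_of_nonpos (by linarith), neg_sub]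
    have hc1 : Continuous fun y : ℝ => zetaChi (1 - (σ + y*I))*(n : ℂ)^(-(σ + y*I)) :=
      (continuous_zetaChi_line (by linarith)).mul (continuous_natCast_cpow_line hn σ)
    have hc2 := continuous_dampedTwist_line hn 0 (σ := σ) (by linarith)
    rw [integral_sub (hc1.intervalIntegrable _ _) (hc2.intervalIntegrable _ _)] at hD
    set I1 := ∫ y in (2*π)..(2*π*X), zetaChi (1 - (σ + y*I))*(n : ℂ)^(-(σ + y*I))
    set I2 := ∫ y in (2*π)..(2*π*X), dampedTwist n 0 (σ + y*I)
    set b := (n : ℝ)^(-σ) with hb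
    have hb0 : 0 < b := by positivity
    have hsX : 1 ≤ √X := by rw [one_le_sqrt]; exact hX
    set R := √X/(X - n + √X)
    have hR0 : 0 ≤ R := div_nonneg (by positivity) (by linarith)
    -- n^(-1/4) is n^(σ - 1) n^(3/4) n^(-σ), and the first two factors grow when n is replaced by X.
    have e1 : (n : ℝ)^(-(1/4) : ℝ)*X^(-(1/4) : ℝ) ≤ A*(√X*b) := by
      have h3 : (n : ℝ)^(-(1/4) : ℝ) = (n : ℝ)^(σ - 1)*(n : ℝ)^(3/4 : ℝ)*b := by rw [hb, ← rpow_add hn0, ← rpow_add hn0]; ring_nf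
      have h4 : X^(3/4 : ℝ)*X^(-(1/4) : ℝ) = √X := by rw [← rpow_add hX0, sqrt_eq_rpow]; norm_num
      calc _ = (n : ℝ)^(σ - 1)*(n : ℝ)^(3/4 : ℝ)*b*X^(-(1/4) : ℝ) := by rw [h3]
        _ ≤ X^(σ - 1)*X^(3/4 : ℝ)*b*X^(-(1/4) : ℝ) := by gcongr
        _ = X^(σ - 1)*(√X*b) := by rw [← h4]; ring
        _ ≤ _ := by gcongr
    have e2 : X^(σ - 1/2)*b ≤ A*(√X*b) := by
      rw [sqrt_eq_rpow, show σ - 1/2 = (σ - 1) + 1/2 by ring, rpow_add hX0, mul_assoc]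
      gcongr
    have e3 : b ≤ A*(√X*b) := by
      have : 1 ≤ A*√X := one_le_mul_of_one_le_of_one_le hA1 hsX
      nlinarith
    have e4 : R ≤ A*R := le_mul_of_one_le_left hR0 hA1
    have e5 : I1 - ((2*π : ℝ) : ℂ) = (I1 - I2) + (I2 - 2*π) := by push_cast; ring
    rw [e5]
    calc _ ≤ _ := norm_add_le _ _
      _ ≤ b + (1300*((n : ℝ)^(-(1/4) : ℝ)*X^(-(1/4) : ℝ)) + 480*R + 102*(X^(σ - 1/2)*b) + C*b) := add_le_add hD hZ
      _ ≤ A*(√X*b) + (1300*(A*(√X*b)) + 480*(A*R) + 102*(A*(√X*b)) + C*(A*(√X*b))) := by gcongr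
      _ ≤ _ := by
        have : 0 ≤ C*(A*R) := by positivity
        linarith
  · rw [if_neg hnX, ofReal_zero, sub_zero]; rw [not_le] at hnX
    refine (norm_integral_zetaChi_mul_cpow_le_of_lt hn h1 h2 hX hnX hA).trans ?_
    have : 0 ≤ if (n : ℝ) ≤ 2*X then √X/(|n - X| + √X) else 0 := by positivity
    refine mul_le_mul_of_nonneg_right (by nlinarith) (by positivity)

/-! ### Weighted divisor sums near the hyperbola and the absolutely convergent range -/

lemma sum_Ioc_one_div_one_add_abs_sub_le (M : ℕ) (r : ℝ) : ∑ e ∈ Ioc 0 M, 1/(1 + |(e : ℝ) - r|) ≤ 2*(1 + log M) := by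
  -- r may lie far outside the range; clamping it only decreases its distances to the points e.
  set r' : ℝ := max 0 (min r M)
  have hr0 : 0 ≤ r' := le_max_left _ _
  have hrM : r' ≤ M := max_le (cast_nonneg M) (min_le_right _ _)
  set m := ⌊r'⌋₊
  have hmM : m ≤ M := Nat.floor_le_of_le hrM
  have hm1 : (m : ℝ) ≤ r' := floor_le hr0
  have hm2 : r' < m + 1 := lt_floor_add_one r'
  have hclamp : ∀ e ∈ Ioc 0 M, |(e : ℝ) - r'| ≤ |(e : ℝ) - r| := fun e he => by
    rw [mem_Ioc] at he
    have h1 : (0 : ℝ) < e := mod_cast he.1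
    have h2 : (e : ℝ) ≤ M := mod_cast he.2
    grind
  have hlow : ∑ e ∈ Ioc 0 m, 1/(1 + |(e : ℝ) - r|) ≤ ∑ j ∈ range M, 1/((j : ℝ) + 1) := by
    calc _ ≤ ∑ e ∈ Ioc 0 m, 1/(((m - e : ℕ) : ℝ) + 1) := by
          refine sum_le_sum fun e he => ?_
          have hc := hclamp e (Finset.Ioc_subset_Ioc_right hmM he)
          rw [mem_Ioc] at he; rw [cast_sub he.2]
          have he2 : (e : ℝ) ≤ m := mod_cast he.2
          rw [abs_of_nonpos (by linarith)] at hc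
          exact one_div_le_one_div_of_le (by linarith) (by linarith)
      _ = ∑ j ∈ range m, 1/((j : ℝ) + 1) := by
          refine sum_nbij' (fun e => m - e) (fun j => m - j) ?_ ?_ ?_ ?_ ?_
          · grind
          · simp
          · grind
          · grind
          · intro e _; rfl
      _ ≤ _ := Finset.sum_le_sum_of_subset_of_nonneg (range_mono hmM) fun _ _ _ => by positivity
  have hhigh : ∑ e ∈ Ioc m M, 1/(1 + |(e : ℝ) - r|) ≤ ∑ j ∈ range M, 1/((j : ℝ) + 1) := by
    calc _ ≤ ∑ e ∈ Ioc m M, 1/(((e - (m + 1) : ℕ) : ℝ) + 1) := by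
          refine sum_le_sum fun e he => ?_
          have hc := hclamp e (Finset.Ioc_subset_Ioc_left (Nat.zero_le m) he)
          rw [mem_Ioc] at he; rw [cast_sub he.1]
          have he2 : (m : ℝ) + 1 ≤ e := mod_cast he.1
          rw [abs_of_nonneg (by linarith)] at hc
          push_cast; exact one_div_le_one_div_of_le (by linarith) (by linarith)
      _ = ∑ j ∈ range (M - m), 1/((j : ℝ) + 1) := by
          refine sum_nbij' (fun e => e - (m + 1)) (fun j => j + (m + 1)) ?_ ?_ ?_ ?_ ?_
          · grind
          · grind
          · grind
          · simp
          · intro e _; rfl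
      _ ≤ _ := Finset.sum_le_sum_of_subset_of_nonneg (range_mono (Nat.sub_le _ _)) fun _ _ _ => by positivity
  rw [← sum_Ioc_consecutive _ (Nat.zero_le m) hmM]
  linarith [sum_range_one_div_le_one_add_log M]

/-- Factoring d out of |de − X| leaves a harmonic weight centred at X/d. The condition d² ≤ 2X gives
√X ≥ d/2, so the denominator is at least (d/2)(1 + |e − X/d|). -/
lemma sqrt_div_abs_mul_sub_add_sqrt_le {X d e : ℝ} (hX : 0 < X) (hd : 0 < d) (hdX : d^2 ≤ 2*X) :
    √X/(|d*e - X| + √X) ≤ 2*√X*(1/d*(1/(1 + |e - X/d|))) := by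
  have h1 : |d*e - X| = d*|e - X/d| := by rw [← abs_of_pos hd, ← abs_mul, abs_of_pos hd]; congr 1; field_simp
  have h2 : d/2 ≤ √X := by
    refine Real.le_sqrt_of_sq_le ?_
    nlinarith
  have h0 := abs_nonneg (e - X/d)
  rw [h1]
  have e1 : 2*√X*(1/d*(1/(1 + |e - X/d|))) = √X/(d/2*(1 + |e - X/d|)) := by field_simp
  rw [e1]
  gcongr
  nlinarith

/-- A divisor sum weighted towards the hyperbola `de = X`. -/
lemma sum_sum_sqrt_div_le {X : ℝ} (hX : 1 ≤ X) {M : ℕ} (hM : 1 ≤ M) : ∑ d ∈ Ioc 0 M, ∑ e ∈ Ioc 0 M,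
      (if (d : ℝ)*e ≤ 2*X then √X/(|(d : ℝ)*e - X| + √X) else 0) ≤
      8*√X*(1 + log M)^2 := by
  have hX0 : 0 < X := by linarith
  set F : ℕ → ℕ → ℝ := fun d e => 2*√X*(1/(d : ℝ)*(1/(1 + |(e : ℝ) - X/d|))) with hF
  have hF0 : ∀ d e, 0 ≤ F d e := fun d e => by rw [hF]; positivity
  -- When de ≤ 2X, the smaller of d and e has square at most 2X; symmetrization lets it play the
  -- role of d.
  have hpt : ∀ d ∈ Ioc 0 M, ∀ e ∈ Ioc 0 M,
      (if (d : ℝ)*e ≤ 2*X then √X/(|(d : ℝ)*e - X| + √X) else 0) ≤ F d e + F e d := fun d hd e he => by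
    have hd0 : (0 : ℝ) < d := mod_cast (mem_Ioc.1 hd).1
    have he0 : (0 : ℝ) < e := mod_cast (mem_Ioc.1 he).1
    split_ifs with h
    · rcases le_total (d : ℝ) e with hde | hde
      · have := sqrt_div_abs_mul_sub_add_sqrt_le (e := (e : ℝ)) hX0 hd0 (by nlinarith)
        linarith [hF0 e d]
      · have := sqrt_div_abs_mul_sub_add_sqrt_le (e := (d : ℝ)) hX0 he0 (by nlinarith)
        grind
    positivity
  have hsum : ∑ d ∈ Ioc 0 M, ∑ e ∈ Ioc 0 M, F d e ≤ 4*√X*(1 + log M)^2 := by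
    calc _ ≤ ∑ d ∈ Ioc 0 M, 2*√X*(2*(1 + log M))*(1/(d : ℝ)) := by
          refine sum_le_sum fun d _ => ?_
          simp only [hF]; rw [← mul_sum, ← mul_sum]
          have := sum_Ioc_one_div_one_add_abs_sub_le M (X/d)
          calc _ ≤ 2*√X*(1/d*(2*(1 + log M))) := by gcongr
            _ = _ := by ring
      _ ≤ 2*√X*(2*(1 + log M))*(1 + log M) := by
          rw [← mul_sum]
          have := sum_Ioc_one_div_le (u := M) (mod_cast hM)
          rw [Nat.floor_natCast] at this; gcongr
      _ = _ := by ring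
  calc _ ≤ ∑ d ∈ Ioc 0 M, ∑ e ∈ Ioc 0 M, (F d e + F e d) := sum_le_sum fun d hd => sum_le_sum fun e he => hpt d hd e he
    _ = ∑ d ∈ Ioc 0 M, ∑ e ∈ Ioc 0 M, F d e + ∑ d ∈ Ioc 0 M, ∑ e ∈ Ioc 0 M, F e d := by simp only [sum_add_distrib]
    _ = ∑ d ∈ Ioc 0 M, ∑ e ∈ Ioc 0 M, F d e + ∑ d ∈ Ioc 0 M, ∑ e ∈ Ioc 0 M, F d e := by
        congr 1
        exact sum_comm
    _ ≤ _ := by linarith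

lemma sum_range_add_one_rpow_neg_le {σ : ℝ} (hσ : 1 < σ) (M : ℕ) : ∑ n ∈ range M, ((n : ℝ) + 1)^(-σ) ≤ 1 + 1/(σ - 1) := by
  have key : ∀ M : ℕ, ∑ n ∈ range (M + 1), ((n : ℝ) + 1)^(-σ) ≤ 1 + (1 - ((M : ℝ) + 1)^(1 - σ))/(σ - 1) := fun M => by
    induction M with
    | zero => simp
    | succ M ih =>
      rw [sum_range_succ]
      have hM0 : (0 : ℝ) < (M : ℝ) + 1 := by positivity
      have hanti : AntitoneOn (fun x : ℝ => x^(-σ)) (Icc ((M : ℝ) + 1) ((M : ℝ) + 1 + (1 : ℕ))) := fun x hx y _ hxy => by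
        exact rpow_le_rpow_of_nonpos (hM0.trans_le hx.1) hxy (by linarith)
      have h := hanti.sum_le_integral
      rw [integral_rpow (Or.inr ⟨by linarith, by rw [uIcc_of_le (by push_cast; linarith)]; intro h0; linarith [h0.1]⟩)] at h
      simp only [Finset.range_one, sum_singleton, zero_add, cast_one] at h; push_cast
      have e : ((((M : ℝ) + 1 + 1)^(-σ + 1) - ((M : ℝ) + 1)^(-σ + 1))/(-σ + 1)) =
          (((M : ℝ) + 1)^(1 - σ) - ((M : ℝ) + 1 + 1)^(1 - σ))/(σ - 1) := by
        grind
      grind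
  rcases M with _ | M
  · positivity
  · refine (key M).trans ?_
    have : 0 ≤ ((M : ℝ) + 1)^(1 - σ) := by positivity
    have : 0 < σ - 1 := by linarith
    gcongr; linarith

lemma summable_add_one_rpow_neg {σ : ℝ} (hσ : 1 < σ) : Summable fun n : ℕ => ((n : ℝ) + 1)^(-σ) :=
  summable_of_sum_range_le (fun n => by positivity) (sum_range_add_one_rpow_neg_le hσ)

lemma tsum_add_one_rpow_neg_le {σ : ℝ} (hσ : 1 < σ) : ∑' n : ℕ, ((n : ℝ) + 1)^(-σ) ≤ 1 + 1/(σ - 1) :=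
  Real.tsum_le_of_sum_range_le (fun n => by positivity) (sum_range_add_one_rpow_neg_le hσ)

lemma norm_riemannZeta_le_of_one_lt_re {s : ℂ} (hs : 1 < s.re) : ‖ζ s‖ ≤ 1 + 1/(s.re - 1) := by
  rw [zeta_eq_tsum_one_div_nat_add_one_cpow hs]
  have hn : ∀ n : ℕ, ‖1/((n : ℂ) + 1)^s‖ = ((n : ℝ) + 1)^(-s.re) := fun n => by
    have : ((n : ℂ) + 1) = (((n : ℝ) + 1 : ℝ) : ℂ) := by push_cast; rfl
    rw [this, norm_div, norm_one, norm_cpow_eq_rpow_re_of_pos (by positivity), rpow_neg (by positivity), one_div]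
  have hsum := summable_add_one_rpow_neg hs
  refine (norm_tsum_le_tsum_norm (by grind)).trans ?_
  simp only [hn]
  exact tsum_add_one_rpow_neg_le hs

/-- The sum of `d ^ (-c)` over all pairs `(d, e)` with `d e ≤ x`. -/
def twistedDivisorSum (c : ℂ) (x : ℝ) : ℂ := ∑ d ∈ Ioc 0 ⌊x⌋₊, (d : ℂ)^(-c)*(⌊x/d⌋₊ : ℂ)

lemma sum_range_add_one_eq_sum_Ioc {E : Type*} [AddCommMonoid E] (F : ℕ → E) (M : ℕ) :
    ∑ d ∈ range M, F (d + 1) = ∑ d ∈ Ioc 0 M, F d := by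
  induction M with
  | zero => simp
  | succ M ih => rw [sum_range_succ, ih, sum_Ioc_succ_top (Nat.zero_le M)]

lemma hasSum_twistedDivisorSum (c : ℂ) {X : ℝ} (hX : 0 ≤ X) : HasSum (fun p : ℕ × ℕ => (((p.1 + 1 : ℕ) : ℂ)^(-c)) *
      ((if (((p.1 + 1)*(p.2 + 1) : ℕ) : ℝ) ≤ X then 2*π else 0 : ℝ) : ℂ))
      (2*π*twistedDivisorSum c X) := by
  set M := ⌊X⌋₊
  have hz : ∀ p ∉ range M ×ˢ range M, (((p.1 + 1 : ℕ) : ℂ)^(-c)) *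
      ((if (((p.1 + 1)*(p.2 + 1) : ℕ) : ℝ) ≤ X then 2*π else 0 : ℝ) : ℂ) = 0 := fun p hp => by
    rw [if_neg, ofReal_zero, mul_zero]; intro h; apply hp
    have h' : (p.1 + 1)*(p.2 + 1) ≤ M := le_floor h
    grind
  have := hasSum_sum_of_ne_finset_zero (L := .unconditional _) hz
  convert! this using 1
  rw [Finset.sum_product, twistedDivisorSum, mul_sum]
  rw [← sum_range_add_one_eq_sum_Ioc (fun d : ℕ => 2*(π : ℂ)*((d : ℂ)^(-c)*(⌊X/d⌋₊ : ℂ)))]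
  refine sum_congr rfl fun d _ => ?_
  have hcount : ∑ e ∈ range M, ((if (((d + 1)*(e + 1) : ℕ) : ℝ) ≤ X then 2*π else 0 : ℝ) : ℂ) =
      2*π*(⌊X/((d + 1 : ℕ) : ℝ)⌋₊ : ℂ) := by
    have hd : (0 : ℝ) < ((d + 1 : ℕ) : ℝ) := by positivity
    have hle : ⌊X/((d + 1 : ℕ) : ℝ)⌋₊ ≤ M := by
      refine floor_le_floor (div_le_self hX ?_)
      simp
    have hiff : ∀ e : ℕ, (((d + 1)*(e + 1) : ℕ) : ℝ) ≤ X ↔ e ∈ range ⌊X/((d + 1 : ℕ) : ℝ)⌋₊ := fun e => by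
      rw [mem_range, ← Nat.succ_le_iff, le_floor_iff (by positivity), le_div_iff₀ hd]
      push_cast; rw [mul_comm]
    simp only [hiff]; rw [← Finset.sum_subset (range_mono hle)]
    · rw [sum_congr rfl (fun e he => by rw [if_pos he])]
      rw [sum_const, card_range, nsmul_eq_mul]; push_cast; ring
    simp
  dsimp only
  rw [← mul_sum, hcount]
  ring

lemma norm_zetaChi_one_sub_le {s : ℂ} (hs : 0 < s.re) (hs2 : s.re ≤ 2) (ht : 4 ≤ s.im) :
    ‖zetaChi (1 - s)‖ ≤ 76*(s.im/(2*π))^(s.re - 1/2) := by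
  have h := norm_zetaChi_div_zetaChiMain_sub_one_le hs hs2 ht
  have h1 : ‖zetaChi (1 - s)/zetaChiMain s‖ ≤ 76 := by
    have h50 : 300/s.im ≤ 75 := by rw [div_le_iff₀ (by linarith)]; linarith
    calc _ ≤ _ := norm_le_norm_sub_add _ 1
      _ ≤ 75 + 1 := add_le_add (h.trans h50) (by simp)
      _ = 76 := by norm_num
  rwa [norm_div, div_le_iff₀ (norm_pos_iff.2 (zetaChiMain_ne_zero s)), norm_zetaChiMain (by linarith)] at h1

lemma hasSum_riemannZeta_mul {s c : ℂ} (hs : 1 < s.re) (hsc : 1 < s.re + c.re) :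
    HasSum (fun p : ℕ × ℕ => ((p.1 + 1 : ℕ) : ℂ)^(-c)*(((p.1 + 1)*(p.2 + 1) : ℕ) : ℂ)^(-s)) (ζ s*ζ (s + c)) := by
  have hn : ∀ (z : ℂ) (n : ℕ), ‖((n + 1 : ℕ) : ℂ)^(-z)‖ = ((n : ℝ) + 1)^(-z.re) := fun z n => by
    rw [norm_natCast_cpow_neg (Nat.succ_pos n)]; push_cast; rfl
  have hS : ∀ z : ℂ, 1 < z.re → Summable fun n : ℕ => ‖((n + 1 : ℕ) : ℂ)^(-z)‖ := fun z hz => by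
    simpa only [hn] using summable_add_one_rpow_neg hz
  have hz : ∀ z : ℂ, 1 < z.re → ζ z = ∑' n : ℕ, ((n + 1 : ℕ) : ℂ)^(-z) := fun z hz => by
    rw [zeta_eq_tsum_one_div_nat_add_one_cpow hz]; refine tsum_congr fun n => ?_
    rw [cpow_neg, one_div]; push_cast; rfl
  have hsc' : 1 < (s + c).re := by simpa using hsc
  rw [mul_comm, hz s hs, hz _ hsc', tsum_mul_tsum_of_summable_norm (hS _ hsc') (hS _ hs)]
  have := (summable_mul_of_summable_norm (hS _ hsc') (hS _ hs)).hasSum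
  refine this.congr_fun fun p => ?_
  have h0 : ((p.1 + 1 : ℕ) : ℂ) ≠ 0 := Nat.cast_ne_zero.2 (Nat.succ_ne_zero p.1)
  rw [neg_add, cpow_add _ _ h0, Nat.cast_mul, Complex.natCast_mul_natCast_cpow]
  ring

/-- The integral of `χ(1 - s) ζ(s) ζ(s + c)` in the region of absolute convergence. -/
lemma exists_norm_integral_zetaChi_mul_zeta_mul_zeta_sub_le : ∃ K : ℝ, 0 ≤ K ∧
    ∀ (σ X A B : ℝ) (c : ℂ), 1 < σ → σ ≤ 2 → 1 < σ + c.re → 1 ≤ X → X^(σ - 1) ≤ A →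
    (∀ d : ℝ, 1 ≤ d → d ≤ 2*X → d^(-c.re) ≤ B) →
    ‖(∫ y in (2*π)..(2*π*X), zetaChi (1 - (σ + y*I)) * (ζ (σ + y*I)*ζ (σ + y*I + c))) - 2*π*twistedDivisorSum c X‖ ≤
      K*A*(√X*((1 + 1/(σ + c.re - 1))*(1 + 1/(σ - 1))) + B*(8*√X*(1 + log (2*X))^2)) := by
  obtain ⟨K, hK0, hK⟩ := exists_norm_integral_zetaChi_mul_cpow_sub_le
  refine ⟨K, hK0, fun σ X A B c hσ hσ2 hσc hX hA hB => ?_⟩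
  have hpi := pi_gt_three
  have hX0 : 0 < X := by linarith
  have hp : 2*π ≤ 2*π*X := by nlinarith
  have hA1 : 1 ≤ A := (one_le_rpow hX (by linarith)).trans hA
  have hB1 : 1 ≤ B := by simpa using hB 1 le_rfl (by linarith)
  set F : ℕ × ℕ → ℝ → ℂ := fun p y => ((p.1 + 1 : ℕ) : ℂ)^(-c)*(zetaChi (1 - (σ + y*I)) *
    (((p.1 + 1)*(p.2 + 1) : ℕ) : ℂ)^(-(σ + y*I))) with hF
  have hpos : ∀ p : ℕ × ℕ, 0 < (p.1 + 1)*(p.2 + 1) := fun p => by positivity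
  have hre : ∀ y : ℝ, ((σ : ℂ) + y*I).re = σ := fun y => by simp
  have him : ∀ y : ℝ, ((σ : ℂ) + y*I).im = y := fun y => by simp
  have hFc : ∀ p, Continuous (F p) := fun p =>
    continuous_const.mul ((continuous_zetaChi_line (by linarith)).mul (continuous_natCast_cpow_line (hpos p) σ))
  have hS1 := summable_add_one_rpow_neg hσ
  have hS2 := summable_add_one_rpow_neg hσc
  have hprod : HasSum (fun p : ℕ × ℕ => ((p.1 : ℝ) + 1)^(-(σ + c.re))*((p.2 : ℝ) + 1)^(-σ))
      ((∑' n : ℕ, ((n : ℝ) + 1)^(-(σ + c.re))) * ∑' n : ℕ, ((n : ℝ) + 1)^(-σ)) := by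
    have h := hS2.mul_of_nonneg hS1 (fun n => by positivity) (fun n => by positivity)
    rw [hS2.tsum_mul_tsum hS1 h]; exact h.hasSum
  have hcoef : ∀ p : ℕ × ℕ, ((p.1 : ℝ) + 1)^(-c.re)*(((p.1 + 1)*(p.2 + 1) : ℕ) : ℝ)^(-σ) =
      ((p.1 : ℝ) + 1)^(-(σ + c.re))*((p.2 : ℝ) + 1)^(-σ) := fun p => by
    push_cast; rw [Real.mul_rpow (by positivity) (by positivity), neg_add, rpow_add (by positivity)]
    ring
  have hcn : ∀ d : ℕ, ‖((d + 1 : ℕ) : ℂ)^(-c)‖ = ((d : ℝ) + 1)^(-c.re) := fun d => by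
    rw [norm_natCast_cpow_neg (Nat.succ_pos d)]; push_cast; rfl
  set V := 76*X^(σ - 1/2) with hV
  -- Termwise integration is allowed since χ(1 − s) is bounded by V on the range and the double
  -- series converges absolutely.
  have hint := intervalIntegral.hasSum_integral_of_dominated_convergence (μ := volume) (a := 2*π) (b := 2*π*X) (F := F)
    (f := fun y => zetaChi (1 - (σ + y*I))*(ζ (σ + y*I)*ζ (σ + y*I + c)))
    (fun p _ => V*(((p.1 : ℝ) + 1)^(-(σ + c.re))*((p.2 : ℝ) + 1)^(-σ)))
    (fun p => (hFc p).aestronglyMeasurable)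
    (fun p => ae_of_all _ fun y hy => by
      rw [uIoc_of_le hp] at hy
      have hy4 : 4 ≤ y := by linarith [hy.1]
      have hchi := norm_zetaChi_one_sub_le (s := σ + y*I) (by rw [hre]; linarith) (by rw [hre]; exact hσ2)
        (by rw [him]; exact hy4)
      rw [hre, him] at hchi; simp only [hF]
      rw [norm_mul, norm_mul, hcn, norm_natCast_cpow_neg (hpos p), hre, ← hcoef]
      have hyX : y/(2*π) ≤ X := by rw [div_le_iff₀ (by positivity)]; linarith [hy.2]
      have : ‖zetaChi (1 - (σ + y*I))‖ ≤ V := by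
        refine hchi.trans ?_
        rw [hV]; gcongr; linarith
      calc _ ≤ ((p.1 : ℝ) + 1)^(-c.re)*(V*(((p.1 + 1)*(p.2 + 1) : ℕ) : ℝ)^(-σ)) := by gcongr
        _ = _ := by ring)
    (ae_of_all _ fun y _ => hprod.summable.mul_left V)
    intervalIntegrable_const
    (ae_of_all _ fun y _ => by
      have := (hasSum_riemannZeta_mul (s := σ + y*I) (c := c) (by rwa [hre]) (by rwa [hre])).mul_left (zetaChi (1 - (σ + y*I)))
      grind)
  have hmain := hint.sub (hasSum_twistedDivisorSum c hX0.le)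
  set M := ⌊2*X⌋₊
  have hM1 : 1 ≤ M := floor_pos.2 (by linarith)
  set W : ℕ → ℕ → ℝ := fun d e => if (d : ℝ)*e ≤ 2*X then √X/(|(d : ℝ)*e - X| + √X) else 0 with hW
  have hW0 : ∀ d e, 0 ≤ W d e := fun d e => by positivity
  have hWsum : HasSum (fun p : ℕ × ℕ => W (p.1 + 1) (p.2 + 1)) (∑ d ∈ Ioc 0 M, ∑ e ∈ Ioc 0 M, W d e) := by
    have hz : ∀ p ∉ range M ×ˢ range M, W (p.1 + 1) (p.2 + 1) = 0 := fun p hp => by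
      simp only [hW]; rw [if_neg]; intro h; apply hp
      have h' : (p.1 + 1)*(p.2 + 1) ≤ M := le_floor (by push_cast at h ⊢; exact h)
      rw [Finset.mem_product, mem_range, mem_range]
      constructor
      · nlinarith
      · nlinarith
    have := hasSum_sum_of_ne_finset_zero (L := .unconditional _) hz
    rw [Finset.sum_product] at this; rw [← sum_range_add_one_eq_sum_Ioc]
    simp only [← sum_range_add_one_eq_sum_Ioc (fun e => W _ e)]
    exact this
  have hE := ((hprod.mul_left (√X)).add (hWsum.mul_left B)).mul_left (K*A)
  have hbound := hmain.norm_le_of_bounded hE (fun p => by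
    have hd1 : (1 : ℝ) ≤ (p.1 : ℝ) + 1 := by linarith
    have hG := hK ((p.1 + 1)*(p.2 + 1)) σ X A (hpos p) hσ.le hσ2 hX hA
    simp only [hF]; rw [integral_const_mul, ← mul_sub, norm_mul, hcn]
    refine (mul_le_mul_of_nonneg_left hG (by positivity)).trans ?_
    rw [← hcoef]
    -- The weight vanishes unless de ≤ 2X, and then d ≤ 2X, so that d^(-Re c) ≤ B.
    have hWB : ((p.1 : ℝ) + 1)^(-c.re)*W (p.1 + 1) (p.2 + 1) ≤ B*W (p.1 + 1) (p.2 + 1) := by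
      by_cases h : (((p.1 + 1 : ℕ) : ℝ))*((p.2 + 1 : ℕ) : ℝ) ≤ 2*X
      · refine mul_le_mul_of_nonneg_right (hB _ hd1 ?_) (hW0 _ _)
        push_cast at h; nlinarith
      · have : W (p.1 + 1) (p.2 + 1) = 0 := by simp only [hW]; rw [if_neg h]
        rw [this, mul_zero, mul_zero]
    have hWe : (if (((p.1 + 1)*(p.2 + 1) : ℕ) : ℝ) ≤ 2*X then
        √X/(|(((p.1 + 1)*(p.2 + 1) : ℕ) : ℝ) - X| + √X) else 0) = W (p.1 + 1) (p.2 + 1) := by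
      simp only [hW, Nat.cast_mul]
    rw [hWe]
    calc _ = K*A*(√X*(((p.1 : ℝ) + 1)^(-c.re)*(((p.1 + 1)*(p.2 + 1) : ℕ) : ℝ)^(-σ)) +
          ((p.1 : ℝ) + 1)^(-c.re)*W (p.1 + 1) (p.2 + 1)) := by ring
      _ ≤ _ := by gcongr)
  refine hbound.trans ?_
  have hT1 := tsum_add_one_rpow_neg_le hσ
  have hT2 := tsum_add_one_rpow_neg_le hσc
  have hWle : ∑ d ∈ Ioc 0 M, ∑ e ∈ Ioc 0 M, W d e ≤ 8*√X*(1 + log (2*X))^2 := by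
    refine (sum_sum_sqrt_div_le hX hM1).trans ?_
    have h1 : log M ≤ log (2*X) := log_le_log (mod_cast hM1) (floor_le (by linarith))
    gcongr
  gcongr

/-! ### Moving the line of integration -/

lemma continuous_riemannZeta_line {z : ℂ} (hz : z.re ≠ 1) : Continuous fun t : ℝ => ζ (z + t*I) := by
  rw [continuous_iff_continuousAt]
  intro t
  have h1 : z + t*I ≠ 1 := fun h => hz (by simpa using congrArg re h)
  exact ContinuousAt.comp (f := fun t : ℝ => (z + t*I : ℂ)) (differentiableAt_riemannZeta h1).continuousAt (by fun_prop)

lemma integral_one_div_add_abs_le {p q δ R : ℝ} (hpq : p ≤ q) (hδ : 0 < δ) (hp : -R ≤ p) (hq : q ≤ R)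
    (hR : 0 ≤ R) : ∫ u in p..q, 1/(δ + |u|) ≤ 2*log (1 + R/δ) := by
  have hc : Continuous fun u : ℝ => 1/(δ + |u|) := by
    refine continuous_const.div (by fun_prop) fun u => ?_
    positivity
  have hpos : ∀ u : ℝ, 0 ≤ 1/(δ + |u|) := fun u => by positivity
  have h1 : ∫ u in p..q, 1/(δ + |u|) ≤ ∫ u in (-R)..R, 1/(δ + |u|) :=
    intervalIntegral.integral_mono_interval hp hpq hq (ae_of_all _ hpos) (hc.intervalIntegrable _ _)
  have h2 : ∫ u in (0 : ℝ)..R, 1/(δ + |u|) = log (1 + R/δ) := by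
    have : ∫ u in (0 : ℝ)..R, 1/(δ + |u|) = ∫ u in (0 : ℝ)..R, 1/(δ + u) := by
      refine integral_congr fun u hu => ?_
      rw [uIcc_of_le hR] at hu; simp only [abs_of_nonneg hu.1]
    rw [this, intervalIntegral.integral_comp_add_left (fun u => 1/u), integral_one_div_of_pos (by linarith) (by linarith)]
    grind
  have h3 : ∫ u in (-R)..0, 1/(δ + |u|) = log (1 + R/δ) := by
    rw [← h2]
    have := integral_comp_neg (fun u : ℝ => 1/(δ + |u|)) (a := 0) (b := R)
    simp only [abs_neg, neg_zero] at this; exact this.symm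
  have h4 := integral_add_adjacent_intervals (hc.intervalIntegrable (-R) 0) (hc.intervalIntegrable 0 R) (μ := volume)
  linarith

/-- A polar factor costs only a logarithm, because ‖z + it‖ is at least half of δ + |t + Im z|. -/
lemma norm_integral_div_le {f : ℝ → ℂ} {B δ R p q : ℝ} {z : ℂ} (hpq : p ≤ q) (hδ : 0 < δ) (hz : δ ≤ |z.re|)
    (hp : -R ≤ p + z.im) (hq : q + z.im ≤ R) (hR : 0 ≤ R) (hf : ∀ t ∈ Icc p q, ‖f t‖ ≤ B) :
    ‖∫ t in p..q, f t*(z + t*I)⁻¹‖ ≤ 4*B*log (1 + R/δ) := by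
  have hB : 0 ≤ B := (norm_nonneg _).trans (hf p ⟨le_rfl, hpq⟩)
  have hc : Continuous fun u : ℝ => 1/(δ + |u + z.im|) := by
    refine continuous_const.div (by fun_prop) fun u => ?_
    positivity
  have h := norm_integral_le_of_norm_le (μ := volume) hpq (f := fun t => f t*(z + t*I)⁻¹)
    (g := fun t => 2*B*(1/(δ + |t + z.im|))) (ae_of_all _ fun t ht => by
      have h1 : |z.re| ≤ ‖z + t*I‖ := by simpa using abs_re_le_norm (z + t*I)
      have h2 : |t + z.im| ≤ ‖z + t*I‖ := by simpa [add_comm] using abs_im_le_norm (z + t*I)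
      rw [norm_mul, norm_inv]
      have h3 : ‖z + t*I‖⁻¹ ≤ 2*(1/(δ + |t + z.im|)) := by
        rw [mul_one_div, inv_le_comm₀ (by linarith) (by positivity), inv_div]
        linarith
      calc _ ≤ B*(2*(1/(δ + |t + z.im|))) := by gcongr; grind
        _ = _ := by ring) ((hc.const_mul _).intervalIntegrable _ _)
  refine h.trans ?_
  rw [integral_const_mul, integral_comp_add_right (fun u => 1/(δ + |u|))]
  have := integral_one_div_add_abs_le (p := p + z.im) (q := q + z.im) (by linarith) hδ hp hq hR
  nlinarith

lemma riemannZeta_one_sub_eq_zetaChi_mul {s : ℂ} (hs : s.im ≠ 0) : ζ (1 - s) = zetaChi (1 - s)*ζ s := by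
  rw [riemannZeta_one_sub (fun n h => hs (by rw [h]; simp)) (fun h => hs (by rw [h]; simp)), zetaChi]
  rw [sub_sub_cancel]

lemma rpow_le_exp_mul_rpow {N u v D : ℝ} (hN : 0 < N) (h : log N*(u - v) ≤ D) : N^u ≤ rexp D*N^v := by
  rw [rpow_def_of_pos hN, rpow_def_of_pos hN, ← Real.exp_add]
  refine exp_le_exp.2 ?_
  linarith

lemma norm_riemannZeta_le_norm_riemannZeta₀_add {s : ℂ} (hs : 1 ≤ |s.im|) : ‖ζ s‖ ≤ ‖riemannZeta₀ s‖ + 1 := by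
  have h1 : s ≠ 1 := by rintro rfl; norm_num at hs
  rw [riemannZeta_eq_inv_sub_add h1, add_comm]
  refine (norm_add_le _ _).trans ?_
  gcongr
  rw [norm_inv]
  have : 1 ≤ ‖s - 1‖ := hs.trans (by simpa using abs_im_le_norm (s - 1))
  exact inv_le_one_of_one_le₀ this

lemma norm_zetaChi_one_sub_le_exp_mul_rpow {C N : ℝ} (hC : 0 ≤ C) {s : ℂ} (hs : 0 < s.re) (hs2 : s.re ≤ 2)
    (hsC : -C ≤ log N*(s.re - 1/2)) (ht : 2*π ≤ s.im) (htN : s.im ≤ N) :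
    ‖zetaChi (1 - s)‖ ≤ 76*(rexp C*N^(s.re - 1/2)) := by
  have hpi := pi_gt_three
  have hN0 : 0 < N := by linarith
  have hu1 : 1 ≤ s.im/(2*π) := by rw [le_div_iff₀ (by positivity)]; linarith
  have huN : s.im/(2*π) ≤ N := (div_le_self (by linarith) (by linarith)).trans htN
  refine (norm_zetaChi_one_sub_le hs hs2 (by linarith)).trans ?_
  gcongr
  rcases le_total (1/2) s.re with h12 | h12
  · calc _ ≤ N^(s.re - 1/2) := rpow_le_rpow (by linarith) huN (by linarith)
      _ ≤ _ := le_mul_of_one_le_left (by positivity) (one_le_exp hC)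
  · calc _ ≤ (1 : ℝ) := Real.rpow_le_one_of_one_le_of_nonpos hu1 (by linarith)
      _ = N^(0 : ℝ) := (rpow_zero _).symm
      _ ≤ _ := rpow_le_exp_mul_rpow hN0 (by nlinarith)

lemma norm_riemannZeta_le_convexity {D : ℝ} (hD : 0 ≤ D) {N : ℕ} (hN : 1 ≤ log N) {s : ℂ}
    (hs : 1/4 ≤ s.re) (hs2 : s.re ≤ 2) (hsC : log N*(s.re - 1) ≤ D) (ht1 : 1 ≤ |s.im|) (ht : |s.im| ≤ N) :
    ‖ζ s‖ ≤ 306*rexp D*((N : ℝ)^((1 - s.re)/2)*log N) := by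
  have hN0 : (0 : ℝ) < N := by linarith
  have hN2 : 2 ≤ N := by
    by_contra h
    have : (N : ℝ) ≤ 1 := mod_cast (by omega : N ≤ 1)
    linarith [Real.log_nonpos hN0.le this]
  have h1 := norm_riemannZeta₀_le_convexity hD hN2 hs hs2 (by
    rw [← sub_le_iff_le_add', le_div_iff₀ (by linarith)]
    linarith) ht
  have h2 := norm_riemannZeta_le_norm_riemannZeta₀_add ht1
  have h3 : 1 ≤ rexp D*(N : ℝ)^((1 - s.re)/2) := by
    have := rpow_le_exp_mul_rpow (u := 0) (v := (1 - s.re)/2) (D := D) hN0 (by linarith)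
    rwa [rpow_zero] at this
  nlinarith

lemma norm_riemannZeta₀_add_le_convexity {C D : ℝ} (hD : 0 ≤ D) {N : ℕ} (hN : 1 ≤ log N) {s c : ℂ}
    (hs : 1/4 ≤ s.re + c.re) (hs2 : s.re + c.re ≤ 2) (hsC : log N*(s.re + c.re - 1) ≤ D)
    (hκ : log N*|c.re| ≤ 2*C) (ht : |s.im| + |c.im| ≤ N) :
    ‖riemannZeta₀ (s + c)‖ ≤ 305*rexp D*rexp C*((N : ℝ)^((1 - s.re)/2)*log N) := by
  have hN0 : (0 : ℝ) < N := by
    rcases (cast_nonneg N : (0 : ℝ) ≤ N).lt_or_eq with h | h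
    · exact h
    · rw [← h, log_zero] at hN; linarith
  have hN2 : 2 ≤ N := by
    by_contra h
    have : (N : ℝ) ≤ 1 := mod_cast (by omega : N ≤ 1)
    linarith [Real.log_nonpos hN0.le this]
  have h1 := norm_riemannZeta₀_le_convexity hD hN2 (s := s + c) hs hs2 (by
    rw [← sub_le_iff_le_add', le_div_iff₀ (by linarith), add_re]
    linarith) ((abs_add_le _ _).trans ht)
  rw [add_re] at h1
  have hκ' : -(2*C) ≤ log N*c.re := by
    have := mul_le_mul_of_nonneg_left (neg_abs_le c.re) (by linarith : 0 ≤ log N)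
    linarith
  have h3 := rpow_le_exp_mul_rpow (u := (1 - (s.re + c.re))/2) (v := (1 - s.re)/2) (D := C) hN0 (by linarith)
  calc _ ≤ 305*rexp D*(rexp C*(N : ℝ)^((1 - s.re)/2))*log N := h1.trans (by gcongr)
    _ = _ := by ring

/-- Moving the line of integration in the twisted second moment. -/
lemma integral_zeta_mul_zeta_eq {σ σ₁ p q : ℝ} {c : ℂ} (h0 : 0 < σ) (hσσ₁ : σ ≤ σ₁) (hp : 0 < p) (hpq : p ≤ q)
    (h1 : σ + c.re ≠ 1) (h2 : σ₁ + c.re ≠ 1) :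
    ∫ y in p..q, ζ (1 - (σ + y*I))*ζ (σ + y*I + c) = (∫ y in p..q, zetaChi (1 - (σ₁ + y*I)) * (ζ (σ₁ + y*I)*ζ (σ₁ + y*I + c))) -
      (∫ y in p..q, (zetaChi (1 - (σ₁ + y*I))*ζ (σ₁ + y*I))*(σ₁ + c - 1 + y*I)⁻¹) +
      (∫ y in p..q, ζ (1 - (σ + y*I))*(σ + c - 1 + y*I)⁻¹) -
      I*((∫ x in σ..σ₁, zetaChi (1 - (x + p*I))*ζ (x + p*I)*riemannZeta₀ (x + p*I + c)) -
        ∫ x in σ..σ₁, zetaChi (1 - (x + q*I))*ζ (x + q*I)*riemannZeta₀ (x + q*I + c)) := by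
  have hFd : ∀ s : ℂ, 0 < s.re → 0 < s.im → DifferentiableAt ℂ (fun s => zetaChi (1 - s)*ζ s) s := fun s hs hs' => by
    have h1 : s ≠ 1 := by rintro rfl; simp at hs'
    exact (differentiableAt_zetaChi_one_sub hs).mul (differentiableAt_riemannZeta h1)
  have hd : ∀ s : ℂ, 0 < s.re → 0 < s.im →
      DifferentiableAt ℂ (fun s => zetaChi (1 - s)*ζ s*riemannZeta₀ (s + c)) s := fun s hs hs' => by
    fun_prop
  -- The pole of ζ(s + c) at s = 1 − c may lie on the rectangle or close to it. Cauchy's theorem is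
  -- therefore applied with its polar part removed.
  have hrect := Complex.integral_boundary_rect_eq_zero_of_differentiableOn (fun s => zetaChi (1 - s)*ζ s*riemannZeta₀ (s + c))
    ⟨σ, p⟩ ⟨σ₁, q⟩ (fun z hz => by
      rw [mem_reProdIm] at hz
      obtain ⟨h1, h2⟩ := hz
      rw [uIcc_of_le (by simpa)] at h1 h2
      have h3 : σ ≤ z.re := h1.1
      have h4 : p ≤ z.im := h2.1
      exact (hd z (by linarith) (by linarith)).differentiableWithinAt)
  simp only [smul_eq_mul] at hrect
  -- The polar part is restored on the vertical sides only, which avoid Re(s + c) = 1.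
  have hline : ∀ x : ℝ, 0 < x → x + c.re ≠ 1 → ∫ y in p..q, zetaChi (1 - (x + y*I)) * (ζ (x + y*I)*ζ (x + y*I + c)) =
      (∫ y in p..q, zetaChi (1 - (x + y*I))*ζ (x + y*I)*riemannZeta₀ (x + y*I + c)) +
        ∫ y in p..q, (zetaChi (1 - (x + y*I))*ζ (x + y*I))*(x + c - 1 + y*I)⁻¹ := fun x hx hxc => by
    have hne : ∀ y : ℝ, (x + c - 1 + y*I) ≠ 0 := fun y h => hxc (by
      have := congrArg re h
      simp at this; linarith)
    have hmem : ∀ y ∈ uIcc p q, 0 < y := fun y hy => by rw [uIcc_of_le hpq] at hy; linarith [hy.1]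
    have hi1 : ContinuousOn (fun y : ℝ => zetaChi (1 - (x + y*I))*ζ (x + y*I)) (uIcc p q) := fun y hy =>
      (ContinuousAt.comp (f := fun y : ℝ => (x + y*I : ℂ)) (hFd _ (by simpa)
        (by simpa using hmem y hy)).continuousAt (by fun_prop)).continuousWithinAt
    have hi2 : Continuous fun y : ℝ => riemannZeta₀ (x + y*I + c) := differentiable_riemannZeta₀.continuous.comp (by fun_prop)
    have hi3 : Continuous fun y : ℝ => (x + c - 1 + y*I)⁻¹ := (by fun_prop : Continuous fun y : ℝ => (x + c - 1 + y*I)).inv₀ hne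
    refine Eq.trans ?_ (integral_add (hi1.mul hi2.continuousOn).intervalIntegrable (hi1.mul hi3.continuousOn).intervalIntegrable)
    refine integral_congr fun y _ => ?_
    have hne1 : (x + y*I + c) ≠ 1 := fun h => hne y (by linear_combination h)
    rw [riemannZeta_eq_inv_sub_add hne1, show (x + y*I + c - 1 : ℂ) = x + c - 1 + y*I by ring]
    ring
  have hfe : ∀ y ∈ uIcc p q, ζ (1 - (σ + y*I)) = zetaChi (1 - (σ + y*I))*ζ (σ + y*I) := fun y hy => by
    rw [uIcc_of_le hpq] at hy; refine riemannZeta_one_sub_eq_zetaChi_mul ?_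
    simp; linarith [hy.1]
  have hl1 : ∫ y in p..q, ζ (1 - (σ + y*I))*ζ (σ + y*I + c) = ∫ y in p..q, zetaChi (1 - (σ + y*I)) *
      (ζ (σ + y*I)*ζ (σ + y*I + c)) :=
    integral_congr fun y hy => by rw [hfe y hy]; ring
  have hl2 : ∫ y in p..q, ζ (1 - (σ + y*I))*(σ + c - 1 + y*I)⁻¹ =
      ∫ y in p..q, (zetaChi (1 - (σ + y*I))*ζ (σ + y*I))*(σ + c - 1 + y*I)⁻¹ :=
    integral_congr fun y hy => by rw [hfe y hy]
  rw [hl1, hl2, hline σ h0 h1, hline σ₁ (by linarith) h2]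
  linear_combination I*hrect - (∫ y in p..q, zetaChi (1 - (σ₁ + y*I)) * ζ (σ₁ + y*I)*riemannZeta₀ (σ₁ + y*I + c))*I_sq +
      (∫ y in p..q, zetaChi (1 - (σ + y*I))*ζ (σ + y*I)*riemannZeta₀ (σ + y*I + c))*I_sq

/-- The functional equation makes the bound independent of the abscissa: N^(x - 1/2) from χ and
N^((1 - x)/2) from each zeta factor multiply to √N. -/
lemma norm_integral_horizontal_le {C D : ℝ} (hC : 0 ≤ C) (hD : 0 ≤ D) {N : ℕ} (hN : 1 ≤ log N)
    {σ σ₁ h : ℝ} {c : ℂ} (hσ : 1/4 ≤ σ) (hσσ₁ : σ ≤ σ₁) (hσ1 : σ₁ ≤ σ + 1) (hσ₁ : σ₁ ≤ 2) (hσC : -C ≤ log N*(σ - 1/2))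
    (hσ₁D : log N*(σ₁ - 1) ≤ D) (hcD : log N*(σ₁ + c.re - 1) ≤ D) (hσc : 1/4 ≤ σ + c.re)
    (hσ₁c : σ₁ + c.re ≤ 2) (hκ : log N*|c.re| ≤ 2*C) (hh : 2*π ≤ h) (hhN : h + |c.im| ≤ N) :
    ‖∫ x in σ..σ₁, zetaChi (1 - (x + h*I))*ζ (x + h*I)*riemannZeta₀ (x + h*I + c)‖ ≤
      76*rexp C*(306*rexp D)*(305*rexp D*rexp C)*(√N*log N^2) := by
  have hpi := pi_gt_three
  have hc0 := abs_nonneg c.im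
  have hN0 : (0 : ℝ) < N := by linarith
  have hL0 : 0 ≤ log N := by linarith
  have h := norm_integral_le_of_norm_le_const (a := σ) (b := σ₁)
      (f := fun x : ℝ => zetaChi (1 - (x + h*I))*ζ (x + h*I)*riemannZeta₀ (x + h*I + c))
      (C := 76*rexp C*(306*rexp D)*(305*rexp D*rexp C)*(√N*log N^2))
      (fun x hx => by
        rw [uIoc_of_le hσσ₁] at hx
        have hre : ((x : ℂ) + h*I).re = x := by simp
        have him : ((x : ℂ) + h*I).im = h := by simp
        have e : (N : ℝ)^(x - 1/2)*((N : ℝ)^((1 - x)/2)*(N : ℝ)^((1 - x)/2)) = √N := by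
          rw [← rpow_add hN0, ← rpow_add hN0, sqrt_eq_rpow]; ring_nf
        have b1 := norm_zetaChi_one_sub_le_exp_mul_rpow (N := N) hC (s := x + h*I) (by rw [hre]; linarith [hx.1])
          (by rw [hre]; linarith [hx.2]) (by
            rw [hre]; exact hσC.trans (mul_le_mul_of_nonneg_left (by linarith [hx.1]) hL0))
          (by rw [him]; exact hh) (by rw [him]; linarith)
        have b2 := norm_riemannZeta_le_convexity hD hN (s := x + h*I) (by rw [hre]; linarith [hx.1])
          (by rw [hre]; linarith [hx.2]) (by
            rw [hre]; exact (mul_le_mul_of_nonneg_left (by linarith [hx.2]) hL0).trans hσ₁D)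
          (by grind) (by grind)
        have b3 := norm_riemannZeta₀_add_le_convexity (C := C) (c := c) hD hN (s := x + h*I) (by rw [hre]; linarith [hx.1])
          (by rw [hre]; linarith [hx.2]) (by
            rw [hre]; exact (mul_le_mul_of_nonneg_left (by linarith [hx.2]) hL0).trans hcD)
          hκ (by grind)
        rw [hre] at b1 b2 b3; rw [norm_mul, norm_mul]
        calc _ ≤ 76*(rexp C*(N : ℝ)^(x - 1/2))*(306*rexp D*((N : ℝ)^((1 - x)/2)*log N)) *
            (305*rexp D*rexp C*((N : ℝ)^((1 - x)/2)*log N)) := by gcongr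
          _ = 76*rexp C*(306*rexp D)*(305*rexp D*rexp C)*(((N : ℝ)^(x - 1/2) *
              ((N : ℝ)^((1 - x)/2)*(N : ℝ)^((1 - x)/2)))*log N^2) := by ring
          _ = _ := by rw [e])
  refine h.trans ?_
  rw [abs_of_nonneg (by linarith)]
  exact mul_le_of_le_one_right (by positivity) (by linarith)

/-- On the left line the pole is at horizontal distance at least 1/4, so the polar factor integrates
to O(log N) and the convexity bound does the rest. -/
lemma norm_integral_zeta_div_le {C : ℝ} (hC : 0 ≤ C) {N : ℕ} (hN : 3 ≤ log N) {σ p q : ℝ} {c : ℂ}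
    (hpi : 1 ≤ p) (hpq : p ≤ q) (hqN : q + |c.im| ≤ N) (hσ : 1/4 ≤ σ) (hσ2 : σ ≤ 3/4)
    (hσc : σ + c.re ≤ 3/4) :
    ‖∫ y in p..q, ζ (1 - (σ + y*I))*(σ + c - 1 + y*I)⁻¹‖ ≤ 3672*rexp C*(√N*log N^2) := by
  have hc0 := abs_nonneg c.im
  have hN0 : (0 : ℝ) < N := by linarith
  have hLN : log N ≤ N := (log_le_sub_one_of_pos hN0).trans (by linarith)
  have himc := abs_le.1 (le_refl |c.im|)
  have hz1 : ∀ y ∈ Icc p q, ‖ζ (1 - (σ + y*I))‖ ≤ 306*rexp C*(√N*log N) := fun y hy => by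
    have hre : ((1 : ℂ) - (σ + y*I)).re = 1 - σ := by simp
    have him : |((1 : ℂ) - (σ + y*I)).im| = y := by simp; linarith [hy.1]
    have h1 := norm_riemannZeta_le_convexity hC (by linarith : 1 ≤ log N) (s := 1 - (σ + y*I))
      (by rw [hre]; linarith) (by rw [hre]; linarith) (by rw [hre]; nlinarith) (by rw [him]; linarith [hy.1])
      (by rw [him]; linarith [hy.2])
    rw [hre] at h1
    have h3 : (N : ℝ)^((1 - (1 - σ))/2) ≤ √N := by
      rw [sqrt_eq_rpow]; exact rpow_le_rpow_of_exponent_le (by linarith) (by linarith)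
    exact h1.trans (by gcongr)
  have h := norm_integral_div_le (f := fun y => ζ (1 - (σ + y*I))) (z := σ + c - 1) (R := N) (δ := 1/4) hpq (by norm_num) (by
      rw [abs_of_neg (by simp; linarith)]; simp; linarith) (by simp; linarith) (by simp; linarith) hN0.le hz1
  refine h.trans ?_
  have hl1 : log (1 + N/(1/4)) ≤ 3*log N := by
    calc _ ≤ log ((N : ℝ)^3) := log_le_log (by positivity) (by
          have h3 : (3 : ℝ) ≤ N := by linarith
          nlinarith [mul_le_mul h3 h3 (by norm_num) (by linarith)])
      _ = _ := by simp
  calc _ ≤ 4*(306*rexp C*(√N*log N))*(3*log N) := by gcongr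
    _ = _ := by ring

/-- On the right line the pole is at horizontal distance at least 1/log N, still enough for the
polar factor to integrate to O(log N); ζ(s) is O(log N) there and χ(1 − s) is O(√N). -/
lemma norm_integral_zetaChi_mul_zeta_div_le {D : ℝ} {N : ℕ} (hN : 3 ≤ log N) {σ p q : ℝ} {c : ℂ}
    (hp : 2*π ≤ p) (hpq : p ≤ q) (hqN : q + |c.im| ≤ N) (hσ : 1 ≤ log N*(σ - 1)) (hσD : log N*(σ - 1) ≤ D)
    (hσ2 : σ ≤ 2) (hσc : 1 ≤ log N*(σ + c.re - 1)) :
    ‖∫ y in p..q, (zetaChi (1 - (σ + y*I))*ζ (σ + y*I)) * (σ + c - 1 + y*I)⁻¹‖ ≤ 1824*rexp D*(√N*log N^2) := by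
  have hpi := pi_gt_three
  have hc0 := abs_nonneg c.im
  have hN0 : (0 : ℝ) < N := by linarith
  have hLN : log N ≤ N := (log_le_sub_one_of_pos hN0).trans (by linarith)
  have hL0 : 0 < log N := by linarith
  have himc := abs_le.1 (le_refl |c.im|)
  have hσ1 : 0 < σ - 1 := pos_of_mul_pos_right (by linarith : 0 < log N*(σ - 1)) hL0.le
  have hσc1 : 1/log N ≤ σ + c.re - 1 := by rw [div_le_iff₀ hL0]; linarith
  have hiL : 0 < 1/log N := by positivity
  have hre : (σ + c - 1 : ℂ).re = σ + c.re - 1 := by simp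
  have him : (σ + c - 1 : ℂ).im = c.im := by simp
  have h := norm_integral_div_le (f := fun y => zetaChi (1 - (σ + y*I))*ζ (σ + y*I))
    (z := σ + c - 1) (R := N) (δ := 1/log N) (B := 76*(rexp D*√N)*(2*log N)) hpq hiL (by
      grind) (by rw [him]; linarith) (by rw [him]; linarith) hN0.le
    (fun y hy => by
      have hre : ((σ : ℂ) + y*I).re = σ := by simp
      have him : ((σ : ℂ) + y*I).im = y := by simp
      rw [norm_mul]
      have h1 := norm_zetaChi_one_sub_le (s := σ + y*I) (by rw [hre]; linarith) (by rw [hre]; linarith)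
        (by rw [him]; linarith [hy.1])
      have h2 := norm_riemannZeta_le_of_one_lt_re (s := σ + y*I) (by rw [hre]; linarith)
      rw [hre, him] at h1; rw [hre] at h2
      have h3 : 1/(σ - 1) ≤ log N := by rw [div_le_iff₀ hσ1]; exact hσ
      have h4 : (y/(2*π))^(σ - 1/2) ≤ rexp D*√N := by
        have h5 := rpow_le_exp_mul_rpow (u := σ - 1/2) (v := 1/2) (D := D) hN0 (by linarith)
        rw [sqrt_eq_rpow]; refine le_trans (rpow_le_rpow ?_ ?_ (by linarith)) h5
        · have : 0 ≤ y := by linarith [hy.1]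
          positivity
        · exact (div_le_self (by linarith [hy.1]) (by linarith)).trans (by linarith [hy.2])
      gcongr
      · linarith
      · linarith)
  refine h.trans ?_
  have hl1 : log (1 + N/(1/log N)) ≤ 3*log N := by
    calc _ ≤ log ((N : ℝ)^3) := log_le_log (by positivity) (by
          rw [div_div_eq_mul_div, div_one]
          have h3 : (3 : ℝ) ≤ N := by linarith
          have : N*log N ≤ (N : ℝ)*N := by gcongr
          nlinarith [mul_le_mul h3 h3 (by norm_num) (by linarith)])
      _ = _ := by simp
  calc _ ≤ 4*(76*(rexp D*√N)*(2*log N))*(3*log N) := by gcongr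
    _ = _ := by ring

/-- The twisted second moment along the critical line as a divisor sum, by moving the line of integration
into the region of absolute convergence. -/
lemma exists_norm_integral_zeta_mul_zeta_sub_le {C : ℝ} (hC : 0 ≤ C) : ∃ K : ℝ, 0 ≤ K ∧
    ∀ (N : ℕ) (σ X : ℝ) (c : ℂ), 100*(C + 1) ≤ log N → log N*|σ - 1/2| ≤ C →
    log N*|c.re| ≤ 2*C → 1 ≤ X → 2*π*X + |c.im| ≤ N →
    ‖(∫ y in (2*π)..(2*π*X), ζ (1 - (σ + y*I))*ζ (σ + y*I + c)) - 2*π*twistedDivisorSum c X‖ ≤ K*(√N*log N^2) := by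
  obtain ⟨K, hK0, hK⟩ := exists_norm_integral_zetaChi_mul_zeta_mul_zeta_sub_le
  set D := 4*C + 1
  set G := 76*rexp C*(306*rexp D)*(305*rexp D*rexp C)
  refine ⟨K*rexp D*(4 + 32*rexp D) + 1824*rexp D + 3672*rexp C + 2*G, by positivity, fun N σ X c hL hσ hκ hX hXN => ?_⟩
  set L := log N
  have hpi := pi_gt_three
  have hL100 : 100 ≤ L := by linarith
  have hL0 : 0 < L := by linarith
  have hX0 : 0 < X := by linarith
  have hcim := abs_nonneg c.im
  have hXN' : X ≤ N := by nlinarith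
  have h2XN : 2*X ≤ N := by nlinarith
  have hN0 : (0 : ℝ) < N := by linarith
  have hσ' := abs_le.1 (le_of_mul_le_mul_left (hσ.trans (by linarith : C ≤ L*(1/100))) hL0)
  have hκ' := abs_le.1 (le_of_mul_le_mul_left (hκ.trans (by linarith : 2*C ≤ L*(2/100))) hL0)
  have hσL : -C ≤ L*(σ - 1/2) ∧ L*(σ - 1/2) ≤ C := abs_le.1 (by grind)
  have hκL : -(2*C) ≤ L*c.re ∧ L*c.re ≤ 2*C := abs_le.1 (by grind)
  -- With (2C + 1)/log N both σ₁ and σ₁ + Re c exceed 1 by at least 1/log N, since |Re c| log N ≤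
  -- 2C, while X^(σ₁ - 1) stays bounded.
  obtain ⟨σ₁, hσ₁⟩ : ∃ σ₁ : ℝ, L*(σ₁ - 1) = 2*C + 1 := ⟨1 + (2*C + 1)/L, by field_simp; ring⟩
  have hσ₁1 : 1/L ≤ σ₁ - 1 := by rw [div_le_iff₀ hL0]; linarith
  have hσ₁κ : 1/L ≤ σ₁ + c.re - 1 := by rw [div_le_iff₀ hL0]; linarith
  have hiL : 0 < 1/L := by positivity
  have hσ₁2 : σ₁ - 1 ≤ 3/100 := le_of_mul_le_mul_left (by linarith : L*(σ₁ - 1) ≤ L*(3/100)) hL0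
  have hpq : 2*π ≤ 2*π*X := by nlinarith
  have hA : X^(σ₁ - 1) ≤ rexp D := by
    calc _ ≤ (N : ℝ)^(σ₁ - 1) := rpow_le_rpow hX0.le hXN' (by linarith)
      _ ≤ rexp D*(N : ℝ)^(0 : ℝ) := rpow_le_exp_mul_rpow hN0 (by linarith)
      _ = _ := by simp
  have hBd : ∀ d : ℝ, 1 ≤ d → d ≤ 2*X → d^(-c.re) ≤ rexp D := fun d hd1 hd2 => by
    rw [rpow_def_of_pos (by linarith)]
    refine exp_le_exp.2 ?_
    have h1 : log d ≤ L := log_le_log (by linarith) (by linarith)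
    have h0 : 0 ≤ log d := log_nonneg hd1
    calc _ ≤ log d*|c.re| := by gcongr; exact neg_le_abs _
      _ ≤ L*|c.re| := by gcongr
      _ ≤ D := by linarith
  have hmain := hK σ₁ X (rexp D) (rexp D) c (by linarith) (by linarith) (by linarith) hX hA hBd
  have hmainle : K*rexp D*(√X*((1 + 1/(σ₁ + c.re - 1))*(1 + 1/(σ₁ - 1))) + rexp D*(8*√X*(1 + log (2*X))^2)) ≤
      K*rexp D*(4 + 32*rexp D)*(√N*L^2) := by
    have h1 : 1 + 1/(σ₁ + c.re - 1) ≤ 2*L := by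
      have : 1/(σ₁ + c.re - 1) ≤ L := by rw [one_div_le (by linarith) hL0]; exact hσ₁κ
      linarith
    have h2 : 1 + 1/(σ₁ - 1) ≤ 2*L := by
      have : 1/(σ₁ - 1) ≤ L := by rw [one_div_le (by linarith) hL0]; exact hσ₁1
      linarith
    have h3 : 1 + log (2*X) ≤ 2*L := by
      have := log_le_log (by linarith) h2XN
      linarith
    have h30 : 0 ≤ log (2*X) := log_nonneg (by linarith)
    have h40 : 0 ≤ 1 + 1/(σ₁ - 1) := by
      have : 0 < σ₁ - 1 := by linarith
      positivity
    have h4 : √X ≤ √N := sqrt_le_sqrt hXN'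
    have h5 : (1 + 1/(σ₁ + c.re - 1))*(1 + 1/(σ₁ - 1)) ≤ (2*L)*(2*L) := mul_le_mul h1 h2 h40 (by linarith)
    calc _ ≤ K*rexp D*(√N*((2*L)*(2*L)) + rexp D*(8*√N*(2*L)^2)) := by
          gcongr
          have : 0 < σ₁ + c.re - 1 := by linarith
          positivity
      _ = _ := by ring
  rw [integral_zeta_mul_zeta_eq (σ₁ := σ₁) (c := c) (by linarith) (by linarith) (by linarith) hpq (by linarith) (by linarith)]
  have hhor : ∀ h : ℝ, 2*π ≤ h → h + |c.im| ≤ N → _ := fun h hh hhN =>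
    norm_integral_horizontal_le (C := C) (D := D) (N := N) (σ := σ) (σ₁ := σ₁) (c := c) hC (by linarith) (by linarith)
      (by linarith) (by linarith) (by linarith) (by linarith) hσL.1 (by linarith) (by linarith) (by linarith) (by linarith) hκ hh hhN
  have hbot := hhor (2*π) le_rfl (by linarith)
  have htop := hhor (2*π*X) hpq hXN
  push_cast at hbot htop ⊢
  have hleft := norm_integral_zeta_div_le hC (N := N) (σ := σ) (c := c) (by linarith) (by linarith) hpq hXN (by linarith) (by linarith)
    (by linarith)
  have hright := norm_integral_zetaChi_mul_zeta_div_le (D := D) (N := N) (σ := σ₁) (c := c) (by linarith) le_rfl hpq hXN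
    (by linarith) (by linarith) (by linarith) (by linarith)
  have e : ∀ A B E H₁ H₂ M : ℂ, A - B + E - I*(H₁ - H₂) - M = (A - M) - B + E - I*(H₁ - H₂) := by intros; ring
  rw [e]
  have hbd : ∀ A B E H₁ H₂ : ℂ, ‖A - B + E - I*(H₁ - H₂)‖ ≤ ‖A‖ + ‖B‖ + ‖E‖ + (‖H₁‖ + ‖H₂‖) := fun A B E H₁ H₂ => by
    have : ‖I*(H₁ - H₂)‖ ≤ ‖H₁‖ + ‖H₂‖ := by rw [norm_mul, norm_I, one_mul]; exact norm_sub_le _ _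
    have h1 := norm_sub_le (A - B + E) (I*(H₁ - H₂))
    have h2 := norm_add_le (A - B) E
    have h3 := norm_sub_le A B
    linarith
  refine (hbd _ _ _ _ _).trans ((add_le_add (add_le_add (add_le_add (hmain.trans hmainle) hright) hleft)
    (add_le_add hbot htop)).trans (le_of_eq ?_))
  ring

/-! ### The twisted divisor problem -/

lemma integral_div_sq {p q : ℝ} (hp : 0 < p) (hpq : p ≤ q) (x : ℝ) : ∫ w in p..q, x/w^2 = x/p - x/q := by
  have h := integral_eq_sub_of_hasDerivAt (a := p) (b := q) (f := fun w : ℝ => -x/w) (f' := fun w : ℝ => x/w^2) (fun w hw => by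
      rw [uIcc_of_le hpq] at hw
      exact hasDerivAt_neg_div (by linarith [hw.1]) x) (by
      refine ContinuousOn.intervalIntegrable fun w hw => ?_
      rw [uIcc_of_le hpq] at hw
      have : w ≠ 0 := by linarith [hw.1]
      exact (ContinuousAt.div (by fun_prop) (by fun_prop) (by positivity)).continuousWithinAt)
  rw [h]
  ring

/-- The function `w ^ (-κ) {x / w}` on the interval where `x / w` has integral part `e`. -/
def fractAmplitude (κ x e w : ℝ) : ℝ := w^(-κ)*(x/w - e)

def fractAmplitudeDeriv (κ x e w : ℝ) : ℝ := -κ*w^(-κ - 1)*(x/w - e) - w^(-κ)*(x/w^2)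

section
variable {κ x e M p q : ℝ}

lemma hasDerivAt_fractAmplitude {w : ℝ} (hw : 0 < w) :
    HasDerivAt (fun w => (fractAmplitude κ x e w : ℂ)) (fractAmplitudeDeriv κ x e w : ℂ) w := by
  have h1 : HasDerivAt (fun w : ℝ => w^(-κ)) (-κ*w^(-κ - 1)) w := Real.hasDerivAt_rpow_const (Or.inl hw.ne')
  have h2 := ((hasDerivAt_neg_div hw x).neg).sub_const e
  refine HasDerivAt.ofReal_comp ?_
  refine ((h1.mul h2).congr_deriv ?_).congr_of_eventuallyEq ?_
  · rw [fractAmplitudeDeriv]; simp only [Pi.neg_apply]; ring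
  · refine Eventually.of_forall fun w => ?_
    simp only [fractAmplitude, Pi.mul_apply, Pi.neg_apply]; ring

lemma continuousOn_fractAmplitudeDeriv (hp : 0 < p) : ContinuousOn (fun w => (fractAmplitudeDeriv κ x e w : ℂ)) (Icc p q) := by
  refine continuous_ofReal.comp_continuousOn fun w hw => ContinuousAt.continuousWithinAt ?_
  have hw0 : w ≠ 0 := by linarith [hw.1]
  have h1 : ContinuousAt (fun w : ℝ => w^(-κ - 1)) w := Real.continuousAt_rpow_const _ _ (Or.inl hw0)
  have h2 : ContinuousAt (fun w : ℝ => w^(-κ)) w := Real.continuousAt_rpow_const _ _ (Or.inl hw0)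
  have h3 : ContinuousAt (fun w : ℝ => x/w) w := continuousAt_const.div continuousAt_id hw0
  have h4 : ContinuousAt (fun w : ℝ => x/w^2) w := continuousAt_const.div (by fun_prop) (by positivity)
  exact ((continuousAt_const.mul h1).mul (h3.sub_const e)).sub (h2.mul h4)

/-- On this interval x/w − e runs through [0, 1], and it vanishes at the right end. The variation
comes from the power, at most 2M, and from x/w, at most M. -/
lemma fractAmplitude_variation_le (hx : 0 < x) (he : 1 ≤ e) (hM : ∀ w ∈ Icc (x/(e + 1)) (x/e), w^(-κ) ≤ M) :
    ‖(fractAmplitude κ x e (x/e) : ℂ)‖ + ∫ w in (x/(e + 1))..(x/e), ‖(fractAmplitudeDeriv κ x e w : ℂ)‖ ≤ 3*M := by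
  have he0 : 0 < e := by linarith
  have hp : 0 < x/(e + 1) := by positivity
  have hpq : x/(e + 1) ≤ x/e := by gcongr; linarith
  have h0 : fractAmplitude κ x e (x/e) = 0 := by rw [fractAmplitude, div_div_cancel₀ hx.ne', sub_self, mul_zero]
  rw [h0, ofReal_zero, norm_zero, zero_add]
  have hv := rpow_variation_le hp hpq hM
  have hi1 := (continuousOn_ofReal_rpow_deriv (q := x/e) hp κ).norm
  have hi2 : ContinuousOn (fun w : ℝ => M*(x/w^2)) (Icc (x/(e + 1)) (x/e)) := fun w hw => by
    have hw0 : w ≠ 0 := by linarith [hw.1]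
    exact (continuousAt_const.mul (continuousAt_const.div (by fun_prop) (by positivity))).continuousWithinAt
  rw [← uIcc_of_le hpq] at hi1 hi2
  have hle : ∫ w in (x/(e + 1))..(x/e), ‖(fractAmplitudeDeriv κ x e w : ℂ)‖ ≤
      ∫ w in (x/(e + 1))..(x/e), (‖((-κ*w^(-κ - 1) : ℝ) : ℂ)‖ + M*(x/w^2)) := by
    refine integral_mono_on hpq ?_ (hi1.intervalIntegrable.add hi2.intervalIntegrable) fun w hw => ?_
    · refine ContinuousOn.intervalIntegrable ?_
      rw [uIcc_of_le hpq]; exact (continuousOn_fractAmplitudeDeriv hp).norm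
    have hw0 : 0 < w := by linarith [hw.1]
    have hlo : 0 ≤ x/w - e := by
      rw [sub_nonneg, le_div_iff₀ hw0]
      have := hw.2
      rw [le_div_iff₀ he0] at this; linarith
    have hhi : x/w - e ≤ 1 := by
      rw [sub_le_iff_le_add, div_le_iff₀ hw0]
      have := hw.1
      rw [div_le_iff₀ (by linarith)] at this
      linarith
    rw [norm_real, norm_real, fractAmplitudeDeriv]; refine (norm_sub_le _ _).trans ?_
    gcongr
    · rw [norm_mul _ (x/w - e), norm_of_nonneg hlo]; exact mul_le_of_le_one_right (norm_nonneg _) hhi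
    · rw [norm_of_nonneg (by positivity)]
      gcongr; exact hM w hw
  rw [integral_add hi1.intervalIntegrable hi2.intervalIntegrable,
    integral_const_mul, integral_div_sq hp hpq, div_div_cancel₀ hx.ne', div_div_cancel₀ hx.ne'] at hle
  have := norm_nonneg (((x/e)^(-κ) : ℝ) : ℂ)
  linarith

lemma norm_sum_fractAmplitude_sub_integral_le {K : ℕ} {y : ℝ} (hx : 0 < x) (he : 1 ≤ e) (hy : 0 ≤ y)
    (hM : ∀ w ∈ Icc (x/(e + 1)) (x/e), w^(-κ) ≤ M) (hK : 1 ≤ K) (hyK : y*(e + 1)/x ≤ π*K) :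
    ‖∑ n ∈ Ioc ⌊x/(e + 1)⌋₊ ⌊x/e⌋₊, (fractAmplitude κ x e n : ℂ)*cexp (I*(-y*log n : ℝ)) -
      ∫ w in (x/(e + 1))..(x/e), (fractAmplitude κ x e w : ℂ)*cexp (I*(-y*log w : ℝ)) *
        dirichletKernel K w‖ ≤ 30*(1 + log K)*M := by
  have hp : 0 < x/(e + 1) := by positivity
  have hpq : x/(e + 1) ≤ x/e := by gcongr; linarith
  have hpos : ∀ w ∈ Icc (x/(e + 1)) (x/e), 0 < w := fun w hw => by linarith [hw.1]
  have h := norm_sum_mul_exp_sub_integral_le (K := K) (θ := y*(e + 1)/x) (f := fun w => -y*log w) (f' := fun w => -y/w)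
    (f'' := fun w => y/w^2) (g := fun w => (fractAmplitude κ x e w : ℂ)) (g' := fun w => (fractAmplitudeDeriv κ x e w : ℂ))
    hp.le hpq (fun w hw => hasDerivAt_neg_mul_log (hpos w hw) y) (fun w hw => hasDerivAt_neg_div (hpos w hw) y)
    (fun w hw => by
      have := (hpos w hw).ne'
      exact (ContinuousAt.div (by fun_prop) (by fun_prop) (by positivity)).continuousWithinAt)
    (Or.inl fun w hw => by positivity) (fun w hw => by
      rw [abs_div, abs_neg, abs_of_nonneg hy, abs_of_pos (hpos w hw), div_le_div_iff₀ (hpos w hw) hx]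
      have := hw.1
      rw [div_le_iff₀ (by linarith)] at this
      nlinarith) hK hyK (fun w hw => hasDerivAt_fractAmplitude (hpos w hw)) (continuousOn_fractAmplitudeDeriv hp)
  refine h.trans ?_
  have hv := fractAmplitude_variation_le hx he hM
  calc _ ≤ 10*(1 + log K)*(3*M) := by gcongr
    _ = _ := by ring

lemma norm_integral_fractAmplitude_mul_exp_le_of_le {y m l : ℝ} (hx : 0 < x) (he : 1 ≤ e) (hy : 0 ≤ y)
    (hM : ∀ w ∈ Icc (x/(e + 1)) (x/e), w^(-κ) ≤ M) (hl : 0 < l)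
    (hlm : ∀ w ∈ Icc (x/(e + 1)) (x/e), l ≤ |-y/w + m|) :
    ‖∫ w in (x/(e + 1))..(x/e), (fractAmplitude κ x e w : ℂ) * cexp (I*(-y*log w + m*w : ℝ))‖ ≤ 12*M/l := by
  have hp : 0 < x/(e + 1) := by positivity
  have hpq : x/(e + 1) ≤ x/e := by gcongr; linarith
  have hpos : ∀ w ∈ Icc (x/(e + 1)) (x/e), 0 < w := fun w hw => by linarith [hw.1]
  have h := norm_integral_mul_exp_le_of_le_abs_deriv (φ := fun w => -y*log w + m*w) (φ' := fun w => -y/w + m)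
    (φ'' := fun w => y/w^2) (g := fun w => (fractAmplitude κ x e w : ℂ)) (g' := fun w => (fractAmplitudeDeriv κ x e w : ℂ))
    hpq (fun w hw =>  ((hasDerivAt_neg_mul_log (hpos w hw) y).add ((hasDerivAt_id w).const_mul m)).congr_deriv (by simp))
    (fun w hw => (hasDerivAt_neg_div (hpos w hw) y).add_const m) (fun w hw => by
      have := (hpos w hw).ne'
      exact (ContinuousAt.div (by fun_prop) (by fun_prop) (by positivity)).continuousWithinAt)
    (Or.inl fun w hw => by positivity) hl hlm
    (fun w hw => hasDerivAt_fractAmplitude (hpos w hw)) (continuousOn_fractAmplitudeDeriv hp)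
  refine h.trans ?_
  have hv := fractAmplitude_variation_le hx he hM
  calc _ ≤ 4/l*(3*M) := by gcongr
    _ = _ := by ring

lemma norm_integral_fractAmplitude_mul_exp_le_sqrt {y m : ℝ} (hx : 0 < x) (he : 1 ≤ e) (hy : 0 < y)
    (hM : ∀ w ∈ Icc (x/(e + 1)) (x/e), w^(-κ) ≤ M) :
    ‖∫ w in (x/(e + 1))..(x/e), (fractAmplitude κ x e w : ℂ) * cexp (I*(-y*log w + m*w : ℝ))‖ ≤ 30*M*x/(e*√y) := by
  have he0 : 0 < e := by linarith
  have hp : 0 < x/(e + 1) := by positivity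
  have hpq : x/(e + 1) ≤ x/e := by gcongr; linarith
  have hpos : ∀ w ∈ Icc (x/(e + 1)) (x/e), 0 < w := fun w hw => by linarith [hw.1]
  have hyx : 0 < (e*√y/x)^2 := by positivity
  have h := norm_integral_mul_exp_le_of_le_deriv2 (φ := fun w => -y*log w + m*w) (φ' := fun w => -y/w + m)
    (φ'' := fun w => y/w^2) (g := fun w => (fractAmplitude κ x e w : ℂ)) (g' := fun w => (fractAmplitudeDeriv κ x e w : ℂ))
    hpq (fun w hw =>  ((hasDerivAt_neg_mul_log (hpos w hw) y).add ((hasDerivAt_id w).const_mul m)).congr_deriv (by simp))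
    (fun w hw => (hasDerivAt_neg_div (hpos w hw) y).add_const m) (fun w hw => by
      have := (hpos w hw).ne'
      exact (ContinuousAt.div (by fun_prop) (by fun_prop) (by positivity)).continuousWithinAt)
    hyx (fun w hw => by
      have hw0 := hpos w hw
      have h2 := hw.2
      rw [le_div_iff₀ he0] at h2
      rw [div_pow, mul_pow, sq_sqrt hy.le, div_le_div_iff₀ (by positivity) (by positivity)]
      have : (w*e)^2 ≤ x^2 := by gcongr
      nlinarith)
    (fun w hw => hasDerivAt_fractAmplitude (hpos w hw)) (continuousOn_fractAmplitudeDeriv hp)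
  refine h.trans ?_
  have hv := fractAmplitude_variation_le hx he hM
  rw [sqrt_sq (by positivity)]
  calc _ ≤ 10/(e*√y/x)*(3*M) := by gcongr
    _ = _ := by field_simp; ring

/-- First and second derivative bounds for the nonzero frequencies, combined. -/
lemma norm_integral_fractAmplitude_mul_cos_le {y k : ℝ} (hx : 0 < x) (he : 1 ≤ e) (hy : 0 ≤ y)
    (hM : ∀ w ∈ Icc (x/(e + 1)) (x/e), w^(-κ) ≤ M) (hk : 0 < k) :
    ‖∫ w in (x/(e + 1))..(x/e), (fractAmplitude κ x e w : ℂ) * cexp (I*(-y*log w : ℝ))*(2*cos (2*π*k*w) : ℝ)‖ ≤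
      45*M*((√y*(y/x)/k + 1)/(y/x + |y/x*e - 2*π*k|)) + 2*M/k := by
  have hpi := pi_gt_three
  have he0 : 0 < e := by linarith
  have hp : 0 < x/(e + 1) := by positivity
  have hpq : x/(e + 1) ≤ x/e := by gcongr; linarith
  have hpos : ∀ w ∈ Icc (x/(e + 1)) (x/e), 0 < w := fun w hw => by linarith [hw.1]
  have hM0 : 0 ≤ M := le_trans (by positivity) (hM _ ⟨hpq, le_rfl⟩)
  set m := 2*π*k with hm
  have hm0 : 0 < m := by positivity
  set η := y/x with hη
  have hη0 : 0 ≤ η := by positivity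
  -- The local frequency y/w stays in an interval of length η above ηe.
  have hyw : ∀ w ∈ Icc (x/(e + 1)) (x/e), η*e ≤ y/w ∧ y/w ≤ η*(e + 1) := fun w hw => by
    have hw0 := hpos w hw
    have h1 := hw.1
    have h2 := hw.2
    rw [div_le_iff₀ (by linarith)] at h1
    rw [le_div_iff₀ he0] at h2
    rw [le_div_iff₀ hw0, div_le_iff₀ hw0, hη, div_mul_eq_mul_div, div_mul_eq_mul_div, div_mul_eq_mul_div, div_mul_eq_mul_div,
      div_le_iff₀ hx, le_div_iff₀ hx]
    constructor <;> nlinarith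
  have hcont : ∀ m : ℝ, ContinuousOn (fun w : ℝ => (fractAmplitude κ x e w : ℂ) *
      cexp (I*(-y*log w + m*w : ℝ))) (uIcc (x/(e + 1)) (x/e)) := fun m w hw => by
    rw [uIcc_of_le hpq] at hw
    have hw0 := (hpos w hw).ne'
    refine ((hasDerivAt_fractAmplitude (hpos w hw)).continuousAt.mul ?_).continuousWithinAt
    fun_prop
  have hsplit : ∫ w in (x/(e + 1))..(x/e), (fractAmplitude κ x e w : ℂ) * cexp (I*(-y*log w : ℝ))*(2*cos (m*w) : ℝ) =
      (∫ w in (x/(e + 1))..(x/e), (fractAmplitude κ x e w : ℂ)*cexp (I*(-y*log w + m*w : ℝ))) +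
      ∫ w in (x/(e + 1))..(x/e), (fractAmplitude κ x e w : ℂ)*cexp (I*(-y*log w + -m*w : ℝ)) := by
    rw [← integral_add (hcont m).intervalIntegrable (hcont (-m)).intervalIntegrable]
    refine integral_congr fun w _ => ?_
    rw [mul_assoc, exp_mul_cos_eq, mul_add, neg_mul m w, ← sub_eq_add_neg]
  rw [hsplit]
  have hneg : ‖∫ w in (x/(e + 1))..(x/e), (fractAmplitude κ x e w : ℂ) * cexp (I*(-y*log w + -m*w : ℝ))‖ ≤ 2*M/k := by
    have h := norm_integral_fractAmplitude_mul_exp_le_of_le (m := -m) (l := m) hx he hy hM hm0 (fun w hw => by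
      have : 0 ≤ y/w := div_nonneg hy (hpos w hw).le
      rw [neg_div, abs_of_nonpos (by linarith)]
      linarith)
    refine h.trans ?_
    rw [hm, div_le_div_iff₀ (by positivity) hk]
    nlinarith [mul_nonneg hM0 hk.le]
  refine (norm_add_le _ _).trans (add_le_add ?_ hneg)
  -- If m is at least 2η away from ηe, the phase derivative is at least |ηe − m| − η or more, hence
  -- at least (η + |ηe − m|)/3. Otherwise there may be a stationary point and the second derivative
  -- test is used; then m ≤ 3ηe turns its bound into the same shape.
  rcases le_or_gt (2*η) |η*e - m| with h | h
  · have hpos' : 0 < |η*e - m| := by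
      rcases (abs_nonneg (η*e - m)).lt_or_eq with h' | h'
      · exact h'
      · rw [← h'] at h
        have : η = 0 := by linarith
        rw [this] at h'; simp at h'; grind
    have h1 := norm_integral_fractAmplitude_mul_exp_le_of_le (m := m) (l := (η + |η*e - m|)/3) hx he hy hM (by positivity)
      (fun w hw => by
        obtain ⟨h1, h2⟩ := hyw w hw
        rw [neg_div]
        rcases le_total m (η*e) with h3 | h3
        · rw [abs_of_nonneg (by linarith)] at h ⊢
          rw [abs_of_nonpos (by linarith)]
          linarith
        · rw [abs_of_nonpos (by linarith)] at h ⊢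
          rw [abs_of_nonneg (by linarith)]
          linarith)
    refine h1.trans ?_
    have hz : 0 ≤ √y*η/k := by positivity
    calc 12*M/((η + |η*e - m|)/3) = 36*M*(1/(η + |η*e - m|)) := by field_simp; ring
      _ ≤ 45*M*((√y*η/k + 1)/(η + |η*e - m|)) := by
        gcongr
        · norm_num
        · linarith
  · have hη1 : 0 < η := by
      have := abs_nonneg (η*e - m)
      linarith
    have hy1 : 0 < y := by grind
    have h1 := norm_integral_fractAmplitude_mul_exp_le_sqrt (m := m) hx he hy1 hM
    refine h1.trans ?_
    have h2 := (abs_lt.1 h).1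
    have hme : m ≤ 3*(η*e) := by nlinarith
    have hηx : η*x = √y*√y := by grind
    have h3 : x/(e*√y) ≤ √y/(2*k) := by
      rw [div_le_div_iff₀ (by positivity) (by positivity)]
      have h6 : 2*k ≤ η*e := by
        have : 6*k ≤ m := by rw [hm]; nlinarith
        linarith
      calc x*(2*k) ≤ x*(η*e) := by gcongr
        _ = η*x*e := by ring
        _ = √y*(e*√y) := by rw [hηx]; ring
    have h4 : √y/(2*k) ≤ 3/2*((√y*η/k + 1)/(η + |η*e - m|)) := by
      rw [mul_div_assoc', div_le_div_iff₀ (by positivity) (by positivity)]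
      have h5 : √y*(η + |η*e - m|) ≤ √y*(3*η) := by gcongr; linarith
      have h6 : √y*η/k*k = √y*η := by field_simp
      nlinarith
    calc 30*M*x/(e*√y) = 30*M*(x/(e*√y)) := by ring
      _ ≤ 30*M*(3/2*((√y*η/k + 1)/(η + |η*e - m|))) := by gcongr; exact h3.trans h4
      _ = _ := by ring

end

/-- If r ≤ 2ηE, dividing by η gives a harmonic sum centred at r/η, and 1/η ≤ 2E/r. If r > 2ηE, every
denominator is at least r/2. -/
lemma sum_Ioc_div_add_abs_sub_le {η r S : ℝ} (hη : 0 ≤ η) (hr : 0 < r) (hS : 0 ≤ S) {E : ℕ} (hE : 1 ≤ E) :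
    ∑ e ∈ Ioc 0 E, (S*η/r + 1)/(η + |η*e - r|) ≤ 4*((S + E)/r)*(1 + log E) := by
  have hE0 : (0 : ℝ) < E := mod_cast hE
  have hlog : 0 ≤ log E := log_natCast_nonneg E
  rcases le_or_gt r (2*η*E) with h | h
  · have hη0 : 0 < η := by nlinarith
    have heq : ∀ e ∈ Ioc 0 E, (S*η/r + 1)/(η + |η*e - r|) = (S/r + 1/η)*(1/(1 + |(e : ℝ) - r/η|)) := fun e _ => by
      have : |η*e - r| = η*|(e : ℝ) - r/η| := by rw [← abs_of_pos hη0, ← abs_mul, abs_of_pos hη0]; grind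
      grind
    rw [sum_congr rfl heq, ← mul_sum]
    have h1 : 1/η ≤ 2*(E/r) := by rw [mul_div_assoc', div_le_div_iff₀ hη0 hr]; linarith
    have h2 := sum_Ioc_one_div_one_add_abs_sub_le E (r/η)
    have h3 : S/r + 1/η ≤ 2*((S + E)/r) := by
      rw [add_div]
      have : 0 ≤ S/r := by positivity
      linarith
    calc _ ≤ 2*((S + E)/r)*(2*(1 + log E)) := by gcongr
      _ = _ := by ring
  · have hle : ∀ e ∈ Ioc 0 E, (S*η/r + 1)/(η + |η*e - r|) ≤ 2*((S/E + 1)/r) := fun e he => by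
      have he2 : (e : ℝ) ≤ E := mod_cast (mem_Ioc.1 he).2
      have h1 : η*e ≤ η*E := by gcongr
      have h2 : r/2 ≤ η + |η*e - r| := by grind
      have h3 : S*η/r ≤ S/E := by rw [div_le_div_iff₀ hr hE0, mul_assoc]; gcongr; linarith
      calc _ ≤ (S/E + 1)/(r/2) := by gcongr
        _ = _ := by field_simp
    refine (sum_le_sum hle).trans ?_
    rw [sum_const, card_Ioc, nsmul_eq_mul, Nat.sub_zero]
    have : E*(2*((S/E + 1)/r)) = 2*((S + E)/r) := by field_simp
    rw [this]
    have : 0 ≤ (S + E)/r := by positivity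
    nlinarith

/-- The contribution of the nonzero frequencies to `∑ d ^ (-c) {x / d}` over the pieces where `⌊x / d⌋ = e`. -/
lemma sum_norm_integral_fractAmplitude_mul_cos_le {κ x y M : ℝ} {E K : ℕ} (hx : 0 < x) (hE : 1 ≤ E) (hy : 0 ≤ y)
    (hM0 : 0 ≤ M) (hM : ∀ w ∈ Icc (x/(E + 1)) x, w^(-κ) ≤ M) :
    ∑ e ∈ Ioc 0 E, ∑ k ∈ range K, ‖∫ w in (x/(e + 1))..(x/e), (fractAmplitude κ x e w : ℂ) *
      cexp (I*(-y*log w : ℝ))*(2*cos (2*π*(k + 1)*w) : ℝ)‖ ≤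
      1300*M*(√y + E)*(1 + log E)*(1 + log K) := by
  have hpi := pi_gt_three
  have hpi4 := pi_lt_four
  have hE0 : (0 : ℝ) < E := mod_cast hE
  have hlog : 0 ≤ log E := log_natCast_nonneg E
  have hbound : ∀ k ∈ range K, ∑ e ∈ Ioc 0 E, ‖∫ w in (x/(e + 1))..(x/e), (fractAmplitude κ x e w : ℂ) *
      cexp (I*(-y*log w : ℝ))*(2*cos (2*π*(k + 1)*w) : ℝ)‖ ≤
      1300*M*(√y + E)*(1 + log E)*(1/((k : ℝ) + 1)) := fun k _ => by
    have hk : (0 : ℝ) < k + 1 := by positivity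
    have hr : (0 : ℝ) < 2*π*(k + 1) := by positivity
    have hterm : ∀ e ∈ Ioc 0 E, ‖∫ w in (x/(e + 1))..(x/e), (fractAmplitude κ x e w : ℂ) *
      cexp (I*(-y*log w : ℝ))*(2*cos (2*π*(k + 1)*w) : ℝ)‖ ≤ 360*M*((√y*(y/x)/(2*π*(k + 1)) + 1)/(y/x + |y/x*e - 2*π*(k + 1)|)) +
          2*M/(k + 1) := fun e he => by
      obtain ⟨he1, he2⟩ := mem_Ioc.1 he
      have he1' : (1 : ℝ) ≤ e := mod_cast he1
      have he2' : (e : ℝ) ≤ E := mod_cast he2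
      have h := norm_integral_fractAmplitude_mul_cos_le (κ := κ) (M := M) (k := k + 1) hx he1' hy (fun w hw => hM w
        ⟨le_trans (by gcongr) hw.1, hw.2.trans (div_le_self hx.le he1')⟩) hk
      refine h.trans (add_le_add ?_ le_rfl)
      have hz : √y*(y/x)/(k + 1) + 1 ≤ 8*(√y*(y/x)/(2*π*(k + 1)) + 1) := by
        have : √y*(y/x)/(k + 1) ≤ 8*(√y*(y/x)/(2*π*(k + 1))) := by
          rw [show 8*(√y*(y/x)/(2*π*(k + 1))) = 4/π*(√y*(y/x)/(k + 1)) by field_simp; ring]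
          exact le_mul_of_one_le_left (by positivity) ((one_le_div (by positivity)).2 hpi4.le)
        linarith
      calc _ ≤ 45*M*((8*(√y*(y/x)/(2*π*(k + 1)) + 1)) / (y/x + |y/x*e - 2*π*(k + 1)|)) := by gcongr
        _ = _ := by ring
    refine (sum_le_sum hterm).trans ?_
    rw [sum_add_distrib, ← mul_sum, sum_const, card_Ioc, nsmul_eq_mul, Nat.sub_zero]
    have h1 := sum_Ioc_div_add_abs_sub_le (η := y/x) (S := √y) (by positivity) hr (sqrt_nonneg y) hE
    have h2 : (√y + E)/(2*π*(k + 1)) ≤ (√y + E)/(2*(k + 1)) := by gcongr; linarith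
    calc _ ≤ 360*M*(4*((√y + E)/(2*(k + 1)))*(1 + log E)) + E*(2*M/(k + 1)) := by
          gcongr; exact h1.trans (by gcongr)
      _ = (720*(√y + E)*(1 + log E) + 2*E)*M*(1/((k : ℝ) + 1)) := by field_simp; ring
      _ ≤ (1300*(√y + E)*(1 + log E))*M*(1/((k : ℝ) + 1)) := by
          gcongr
          have := sqrt_nonneg y
          nlinarith [mul_nonneg hE0.le hlog, mul_nonneg this hlog]
      _ = _ := by ring
  rw [sum_comm]
  refine (sum_le_sum hbound).trans ?_
  rw [← mul_sum]
  have := sum_range_one_div_le_one_add_log K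
  gcongr

lemma integral_cpow_neg_mul_sub {p q : ℝ} (hp : 0 < p) (hpq : p ≤ q) {c : ℂ} (hc : c ≠ 0) (hc1 : c ≠ 1) (x e : ℂ) :
    ∫ w in p..q, (w : ℂ)^(-c)*(x/w - e) = x*((p : ℂ)^(-c) - (q : ℂ)^(-c))/c - e*((q : ℂ)^(1 - c) - (p : ℂ)^(1 - c))/(1 - c) := by
  have hmem : ∀ w ∈ uIcc p q, w ≠ 0 := fun w hw => by rw [uIcc_of_le hpq] at hw; linarith [hw.1]
  have h1c : 1 - c ≠ 0 := sub_ne_zero.2 hc1.symm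
  have hd : ∀ w ∈ uIcc p q, HasDerivAt (fun w : ℝ => -x*(w : ℂ)^(-c)/c - e*(w : ℂ)^(1 - c)/(1 - c))
      ((w : ℂ)^(-c)*(x/w - e)) w := fun w hw => by
    have hw0 := hmem w hw
    have hwc : (w : ℂ) ≠ 0 := mod_cast hw0
    have h1 := hasDerivAt_ofReal_cpow_const hw0 (r := -c) (neg_ne_zero.2 hc)
    have h2 := hasDerivAt_ofReal_cpow_const hw0 (r := 1 - c) h1c
    rw [show 1 - c - 1 = -c by ring] at h2
    have h3 := (h1.const_mul (-x/c)).sub (h2.const_mul (e/(1 - c)))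
    refine (h3.congr_deriv ?_).congr_of_eventuallyEq ?_
    · rw [Complex.cpow_sub _ _ hwc, cpow_one]; field_simp
    · refine Eventually.of_forall fun w => ?_
      simp only [Pi.sub_apply]; field_simp
  rw [integral_eq_sub_of_hasDerivAt hd]
  · field_simp; ring
  · refine ContinuousOn.intervalIntegrable fun w hw => ?_
    have hw0 := hmem w hw
    have hwc : (w : ℂ) ≠ 0 := mod_cast hw0
    have h1 : ContinuousAt (fun w : ℝ => (w : ℂ)^(-c)) w := continuousAt_ofReal_cpow_const _ _ (Or.inr hw0)
    exact (h1.mul ((continuousAt_const.div continuous_ofReal.continuousAt hwc).sub continuousAt_const)).continuousWithinAt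

/-- The zero-frequency integrals telescope over the pieces to a truncated sum for ζ(1 − c) with its
correction term. This produces the secondary main term of the divisor sum. -/
lemma sum_integral_cpow_neg_mul_sub {x : ℝ} (hx : 0 < x) {c : ℂ} (hc : c ≠ 0) (hc1 : c ≠ 1) (E : ℕ) :
    ∑ e ∈ Ioc 0 E, ∫ w in (x/(e + 1))..(x/e), (w : ℂ)^(-c)*(x/w - e) =
      -(x : ℂ)^(1 - c)/c - (x : ℂ)^(1 - c)/(1 - c)*((∑ e ∈ Ioc 0 (E + 1), (e : ℂ)^(-(1 - c))) - ((E + 1 : ℕ) : ℂ)^c/c) := by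
  have h1c : 1 - c ≠ 0 := sub_ne_zero.2 hc1.symm
  have hx0 : (x : ℂ) ≠ 0 := mod_cast hx.ne'
  have hpow : ∀ (n : ℕ) (s : ℂ), ((x/(n + 1 : ℝ) : ℝ) : ℂ)^s = (x : ℂ)^s*((n + 1 : ℕ) : ℂ)^(-s) := fun n s => by
    have : (x/(n + 1 : ℝ) : ℝ) = x*((n + 1 : ℕ) : ℝ)⁻¹ := by push_cast; ring
    rw [this, ofReal_mul, Complex.mul_cpow_ofReal_nonneg hx.le (by positivity), Complex.ofReal_inv,
      ofReal_natCast, inv_cpow _ _ (by rw [natCast_arg]; exact pi_ne_zero.symm), cpow_neg]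
  have hx1 : (x : ℂ)*(x : ℂ)^(-c) = (x : ℂ)^(1 - c) := by rw [sub_eq_add_neg, cpow_add _ _ hx0, cpow_one]
  have hn1 : ∀ n : ℕ, ((n + 1 : ℕ) : ℂ)*((n + 1 : ℕ) : ℂ)^(-(1 - c)) = ((n + 1 : ℕ) : ℂ)^c := fun n => by
    have h0 : ((n + 1 : ℕ) : ℂ) ≠ 0 := Nat.cast_ne_zero.2 (Nat.succ_ne_zero n)
    rw [show (c : ℂ) = 1 + (-(1 - c)) by ring, cpow_add _ _ h0, cpow_one]
    ring_nf
  induction E with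
  | zero =>
    simp only [Finset.Ioc_self, Finset.sum_empty, zero_add, Nat.Ioc_succ_singleton, sum_singleton, cast_one, one_cpow]
    field_simp; ring
  | succ E ih =>
    rw [sum_Ioc_succ_top (Nat.zero_le E), ih, sum_Ioc_succ_top (Nat.zero_le (E + 1))]
    have hcast : (((E + 1 : ℕ) : ℝ)) = (E : ℝ) + 1 := by push_cast; ring
    rw [integral_cpow_neg_mul_sub (by positivity) (by gcongr; linarith) hc hc1, hpow (E + 1), hpow (E + 1), hcast, hpow E, hpow E]
    simp only [neg_neg]
    have a1 := hn1 E
    have a2 := hn1 (E + 1)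
    grind

lemma sum_Ioc_floor_div_eq (x : ℝ) (hx : 0 ≤ x) (f : ℕ → ℂ) (E : ℕ) : ∑ d ∈ Ioc ⌊x/(E + 1)⌋₊ ⌊x⌋₊, f d =
      ∑ e ∈ Ioc 0 E, ∑ d ∈ Ioc ⌊x/(e + 1)⌋₊ ⌊x/e⌋₊, f d := by
  induction E with
  | zero => simp
  | succ E ih =>
    rw [sum_Ioc_succ_top (Nat.zero_le E), ← ih]
    have hcast : (((E + 1 : ℕ) : ℝ)) = (E : ℝ) + 1 := by push_cast; ring
    rw [hcast]; refine ((add_comm _ _).trans (sum_Ioc_consecutive f ?_ ?_)).symm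
    · exact floor_le_floor (by gcongr; linarith)
    · refine floor_le_floor (div_le_self hx ?_)
      linarith

lemma floor_div_eq_of_mem_Ioc {x : ℝ} {d e : ℕ} (he : 0 < e) (hd : d ∈ Ioc ⌊x/(e + 1)⌋₊ ⌊x/e⌋₊) (hx : 0 < x) : ⌊x/d⌋₊ = e := by
  obtain ⟨h1, h2⟩ := mem_Ioc.1 hd
  have he0 : (0 : ℝ) < e := mod_cast he
  have hd0 : (0 : ℝ) < d := mod_cast (Nat.zero_le _).trans_lt h1
  rw [Nat.floor_lt (by positivity), div_lt_iff₀ (by positivity)] at h1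
  rw [le_floor_iff (by positivity), le_div_iff₀ he0] at h2
  rw [Nat.floor_eq_iff (by positivity), le_div_iff₀ hd0, div_lt_iff₀ hd0]
  constructor <;> linarith

/-- Poisson summation on one piece. The subtracted integral is the zero frequency; the nonzero
frequencies are carried along, to be summed over all pieces at once. -/
lemma norm_sum_cpow_mul_fract_sub_integral_le {c : ℂ} {x M : ℝ} {e K : ℕ} (hx : 0 < x) (he : 0 < e) (hy : 0 ≤ c.im)
    (hM : ∀ w ∈ Icc (x/(e + 1)) (x/e), w^(-c.re) ≤ M) (hK : 1 ≤ K) (hyK : c.im*(e + 1)/x ≤ π*K) :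
    ‖∑ d ∈ Ioc ⌊x/(e + 1)⌋₊ ⌊x/e⌋₊, (d : ℂ)^(-c)*(x/d - ⌊x/d⌋₊) -
      ∫ w in (x/(e + 1))..(x/e), (w : ℂ)^(-c)*(x/w - e)‖ ≤ 30*(1 + log K)*M +
        ∑ k ∈ range K, ‖∫ w in (x/(e + 1))..(x/e), (fractAmplitude c.re x e w : ℂ) *
          cexp (I*(-c.im*log w : ℝ))*(2*cos (2*π*(k + 1)*w) : ℝ)‖ := by
  have he1 : (1 : ℝ) ≤ e := mod_cast he
  have hp : 0 < x/(e + 1 : ℝ) := by positivity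
  have hpq : x/(e + 1 : ℝ) ≤ x/e := by gcongr; linarith
  have h := norm_sum_fractAmplitude_sub_integral_le (K := K) (y := c.im) hx he1 hy hM hK hyK
  have hcont : ContinuousOn (fun w : ℝ => (fractAmplitude c.re x e w : ℂ) *
      cexp (I*(-c.im*log w : ℝ))) (uIcc (x/(e + 1)) (x/e)) := fun w hw => by
    rw [uIcc_of_le hpq] at hw
    have hw0 : 0 < w := by linarith [hw.1]
    refine ((hasDerivAt_fractAmplitude hw0).continuousAt.mul ?_).continuousWithinAt
    fun_prop
  rw [integral_mul_dirichletKernel K hcont] at h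
  have hamp : ∀ w : ℝ, 0 < w → (w : ℂ)^(-c)*(x/w - e) = (fractAmplitude c.re x e w : ℂ) *
      cexp (I*(-c.im*log w : ℝ)) := fun w hw => by
    rw [cpow_neg_eq_rpow_mul_exp hw, fractAmplitude]; push_cast; ring
  have e1 : ∑ d ∈ Ioc ⌊x/(e + 1)⌋₊ ⌊x/e⌋₊, (d : ℂ)^(-c)*(x/d - ⌊x/d⌋₊) =
      ∑ n ∈ Ioc ⌊x/(e + 1)⌋₊ ⌊x/e⌋₊, (fractAmplitude c.re x e n : ℂ)*cexp (I*(-c.im*log n : ℝ)) := by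
    refine sum_congr rfl fun d hd => ?_
    rw [floor_div_eq_of_mem_Ioc he hd hx]
    have hd0 : (0 : ℝ) < d := mod_cast (Nat.zero_le _).trans_lt (mem_Ioc.1 hd).1
    have := hamp d hd0
    push_cast at this ⊢; exact this
  have e2 : ∫ w in (x/(e + 1))..(x/e), (w : ℂ)^(-c)*(x/w - e) = ∫ w in (x/(e + 1))..(x/e),
      (fractAmplitude c.re x e w : ℂ)*cexp (I*(-c.im*log w : ℝ)) := by
    refine integral_congr fun w hw => ?_
    rw [uIcc_of_le hpq] at hw; grind
  rw [e1, e2]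
  rw [← sub_sub] at h
  have h2 := norm_sum_le (range K) fun k => ∫ w in (x/(e + 1))..(x/e), (fractAmplitude c.re x e w : ℂ) *
          cexp (I*(-c.im*log w : ℝ))*(2*cos (2*π*(k + 1)*w) : ℝ)
  have h3 := norm_le_norm_sub_add (∑ n ∈ Ioc ⌊x/(e + 1)⌋₊ ⌊x/e⌋₊, (fractAmplitude c.re x e n : ℂ) *
    cexp (I*(-c.im*log n : ℝ)) - ∫ w in (x/(e + 1))..(x/e), (fractAmplitude c.re x e w : ℂ)*cexp (I*(-c.im*log w : ℝ)))
    (∑ k ∈ range K, ∫ w in (x/(e + 1))..(x/e), (fractAmplitude c.re x e w : ℂ) *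
          cexp (I*(-c.im*log w : ℝ))*(2*cos (2*π*(k + 1)*w) : ℝ))
  linarith

lemma twistedDivisorSum_conj (c : ℂ) (x : ℝ) : twistedDivisorSum (conj c) x = conj (twistedDivisorSum c x) := by
  rw [twistedDivisorSum, twistedDivisorSum, map_sum]
  refine sum_congr rfl fun d _ => ?_
  rw [map_mul, conj_natCast, ← map_neg, cpow_conj _ _ (by rw [natCast_arg]; exact pi_ne_zero.symm), conj_natCast]

lemma rpow_neg_le_exp {L D κ w : ℝ} (hw : 0 < w) (hκ : L*|κ| ≤ D) (h1 : log w ≤ L) (h2 : -L ≤ log w) : w^(-κ) ≤ rexp D := by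
  rw [rpow_def_of_pos hw]
  refine exp_le_exp.2 ?_
  calc _ ≤ |log w * -κ| := le_abs_self _
    _ = |log w| *|κ| := by simp
    _ ≤ L*|κ| := by gcongr; grind
    _ ≤ D := hκ

set_option maxHeartbeats 800000 in
-- Write ⌊x/d⌋ = x/d − {x/d}. The smooth part is x times a truncation of ζ(1 + c). In the fractional
-- part small d are bounded trivially, and larger d are grouped by the value of ⌊x/d⌋ and treated by
-- Poisson summation, whose zero frequencies yield the term with ζ(1 − c).
lemma norm_twistedDivisorSum_sub_le_of_im_nonneg {D : ℝ} {N : ℕ} {c : ℂ} {x : ℝ} (hL : 50*(D + 1) ≤ log N)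
    (hD : 0 ≤ D) (hκ : log N*|c.re| ≤ D) (hc : c ≠ 0) (hx : 1 ≤ x) (hxN : x + |c.im| ≤ N) (hy : 0 ≤ c.im) :
    ‖twistedDivisorSum c x - (x*ζ (1 + c) + (x : ℂ)^(1 - c)/(1 - c)*ζ (1 - c))‖ ≤ 10700*rexp D*(√N*log N^2) := by
  set L := log N
  have hpi := pi_gt_three
  have hL50 : 50 ≤ L := by linarith
  have hL0 : 0 < L := by linarith
  have hx0 : 0 < x := by linarith
  have hcim := abs_nonneg c.im
  have hxN' : x ≤ N := by linarith
  have hN0 : (0 : ℝ) < N := by linarith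
  have hLN : L ≤ N := (log_le_sub_one_of_pos hN0).trans (by linarith)
  have hN2 : 2 ≤ N := by
    have : (2 : ℝ) ≤ N := by linarith
    exact_mod_cast this
  have hyN : c.im ≤ N := by grind
  have hκ' := abs_le.1 (le_of_mul_le_mul_left (hκ.trans (by linarith : D ≤ L*(1/50))) hL0)
  set M := rexp D
  have hM0 : 0 < M := exp_pos _
  have hxc : (x : ℂ) ≠ 0 := mod_cast hx0.ne'
  have hc1 : c ≠ 1 := by rintro rfl; norm_num at hκ'
  have h1c : 1 - c ≠ 0 := sub_ne_zero.2 hc1.symm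
  have hMw : ∀ w : ℝ, 1/2 ≤ w → w ≤ N → w^(-c.re) ≤ M := fun w hw1 hw2 => by
    refine rpow_neg_le_exp (L := L) (by linarith) hκ (log_le_log (by linarith) hw2) ?_
    have h := log_le_log (by norm_num) hw1
    have h2 := Real.log_two_lt_d9
    rw [one_div, Real.log_inv] at h; linarith
  -- The values ⌊x/d⌋ = e ≤ E are treated piece by piece; the remaining d are at most u = x/(E + 1)
  -- ≤ √x in number.
  set E := ⌊√x⌋₊
  have hsx1 : 1 ≤ √x := one_le_sqrt.2 hx
  have hsx : √x*√x = x := mul_self_sqrt hx0.le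
  have hE1 : 1 ≤ E := le_floor (mod_cast hsx1)
  have hEx : (E : ℝ) ≤ √x := floor_le (sqrt_nonneg x)
  have hxE : √x ≤ E + 1 := (lt_floor_add_one _).le
  have hE0 : (1 : ℝ) ≤ E := mod_cast hE1
  have hsN : √x ≤ √N := sqrt_le_sqrt hxN'
  have hs1 : 1 ≤ √(N : ℝ) := hsx1.trans hsN
  set u := x/(E + 1) with hu
  have hu0 : 0 < u := by positivity
  have hu2 : 1/2 ≤ u := by
    rw [hu, le_div_iff₀ (by positivity)]
    nlinarith
  have huE : u*(E + 1) = x := by rw [hu]; field_simp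
  have hux : u ≤ √x := by
    rw [hu, div_le_iff₀ (by positivity)]
    nlinarith
  have huN : u ≤ N := (div_le_self hx0.le (by linarith)).trans hxN'
  have hlogE : log E ≤ L := log_le_log (by linarith) (by nlinarith)
  -- the sum of `d ^ (-1 - c)`
  have hA : ‖(x : ℂ) * ∑ d ∈ Ioc 0 ⌊x⌋₊, (d : ℂ)^(-(1 + c)) - (x*ζ (1 + c) - (x : ℂ)^(1 - c)/c)‖ ≤ 100*√N*M*(1 + L) := by
    have hs1 : (1 + c : ℂ) ≠ 1 := by simpa using hc
    have h := norm_riemannZeta₀_sub_le hN2 (s := 1 + c) (by simp; linarith) (by simp; linarith) hs1 (by simp; linarith) hx hxN'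
    have e : (x : ℂ) * ∑ d ∈ Ioc 0 ⌊x⌋₊, (d : ℂ)^(-(1 + c)) - (x*ζ (1 + c) - (x : ℂ)^(1 - c)/c) =
        -(x*(riemannZeta₀ (1 + c) - ∑ d ∈ Ioc 0 ⌊x⌋₊, (d : ℂ)^(-(1 + c)) - ((x : ℂ)^(1 - (1 + c)) - 1)/(1 + c - 1))) := by
      rw [riemannZeta_eq_inv_sub_add hs1, show 1 - (1 + c) = -c by ring, show (1 + c - 1) = c by ring, sub_eq_add_neg (1 : ℂ) c,
        cpow_add _ _ hxc, cpow_one]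
      field_simp; ring
    rw [e, norm_neg, norm_mul, norm_real, norm_of_nonneg hx0.le]
    have hp : x*x^(-(1 + c).re) = x^(-c.re) := by
      rw [add_re, one_re, neg_add, rpow_add hx0, Real.rpow_neg_one]; field_simp
    calc _ ≤ x*(100*√N*x^(-(1 + c).re)*(1 + L)) := by gcongr
      _ = 100*√N*(x*x^(-(1 + c).re))*(1 + L) := by ring
      _ ≤ _ := by rw [hp]; gcongr; exact hMw x (by linarith) hxN'
  -- the initial segment
  have hB : ‖∑ d ∈ Ioc 0 ⌊u⌋₊, (d : ℂ)^(-c)*(x/d - ⌊x/d⌋₊)‖ ≤ M*√x := by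
    refine (norm_sum_le_of_le (n := fun _ => M) _ fun d hd => ?_).trans ?_
    · obtain ⟨h1, h2⟩ := mem_Ioc.1 hd
      have hd1 : (1 : ℝ) ≤ d := mod_cast h1
      have hdu : (d : ℝ) ≤ u := (le_floor_iff hu0.le).1 h2
      have hr : ((x : ℂ)/d - ⌊x/d⌋₊) = ((x/d - ⌊x/d⌋₊ : ℝ) : ℂ) := by push_cast; rfl
      rw [norm_mul, norm_natCast_cpow_neg h1, hr, norm_real]
      have h3 : ‖x/d - ⌊x/d⌋₊‖ ≤ 1 := by
        have h4 := floor_le (by positivity : 0 ≤ x/d)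
        have h5 := lt_floor_add_one (x/d)
        rw [norm_of_nonneg (by linarith)]
        linarith
      calc _ ≤ M*1 := by gcongr; exact hMw d (by linarith) (hdu.trans huN)
        _ = M := mul_one M
    · rw [sum_const, card_Ioc, nsmul_eq_mul, Nat.sub_zero, mul_comm]; gcongr
      exact (floor_le hu0.le).trans hux
  -- the pieces
  have hC : ‖∑ e ∈ Ioc 0 E, (∑ d ∈ Ioc ⌊x/(e + 1)⌋₊ ⌊x/e⌋₊, (d : ℂ)^(-c)*(x/d - ⌊x/d⌋₊) -
      ∫ w in (x/(e + 1))..(x/e), (w : ℂ)^(-c)*(x/w - e))‖ ≤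
      E*(30*(1 + L)*M) + 1300*M*(√c.im + E)*(1 + log E)*(1 + L) := by
    refine (norm_sum_le_of_le (n := fun e : ℕ => 30*(1 + L)*M + ∑ k ∈ range N, ‖∫ w in (x/(e + 1))..(x/e), (fractAmplitude c.re x e w : ℂ) *
          cexp (I*(-c.im*log w : ℝ))*(2*cos (2*π*(k + 1)*w) : ℝ)‖) _ fun e he => ?_).trans (le_of_eq_of_le ?_ (add_le_add le_rfl
      (sum_norm_integral_fractAmplitude_mul_cos_le (κ := c.re) (K := N) hx0 hE1 hy hM0.le
        (fun w hw => hMw w (hu2.trans hw.1) (hw.2.trans hxN')))))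
    · obtain ⟨he1, he2⟩ := mem_Ioc.1 he
      have he1' : (1 : ℝ) ≤ e := mod_cast he1
      have he2' : (e : ℝ) ≤ E := mod_cast he2
      refine norm_sum_cpow_mul_fract_sub_integral_le hx0 he1 hy (fun w hw => hMw w (hu2.trans ?_) ?_) (by omega) ?_
      · exact le_trans (by rw [hu]; gcongr) hw.1
      · exact hw.2.trans ((div_le_self hx0.le he1').trans hxN')
      -- The cut-off N covers every frequency: Im c · (e + 1)/x ≤ 3N ≤ πN.
      · rw [div_le_iff₀ hx0]
        calc c.im*(e + 1) ≤ N*(E + 1) := by gcongr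
          _ ≤ N*(3*x) := by gcongr; nlinarith
          _ ≤ N*(π*x) := by gcongr
          _ = _ := by ring
    · rw [sum_add_distrib, sum_const, card_Ioc, nsmul_eq_mul, Nat.sub_zero]
  -- the integral of the pieces
  have hI := sum_integral_cpow_neg_mul_sub hx0 hc hc1 E
  have hZ : ‖(x : ℂ)^(1 - c)/(1 - c)*((∑ e ∈ Ioc 0 (E + 1), (e : ℂ)^(-(1 - c))) - ((E + 1 : ℕ) : ℂ)^c/c) -
      (x : ℂ)^(1 - c)/(1 - c)*ζ (1 - c)‖ ≤ 4*M*√x := by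
    have hs1 : (1 - c : ℂ) ≠ 1 := by simpa using hc
    have hre : (1 - c : ℂ).re = 1 - c.re := by simp
    have h := norm_riemannZeta_sub_le (M := E + 1) (by omega) (s := 1 - c) (by rw [hre]; linarith) hs1
    rw [show 1 - (1 - c) = c by ring, show (1 - c - 1) = -c by ring, div_neg, sub_neg_eq_add, hre] at h
    have hn : 1/2 ≤ ‖1 - c‖ := by
      have := abs_re_le_norm (1 - c)
      rw [hre, abs_of_nonneg (by linarith)] at this
      linarith
    have hn0 : 0 < ‖1 - c‖ := by linarith
    rw [← mul_sub, norm_mul, norm_div, norm_cpow_eq_rpow_re_of_pos hx0, hre, norm_sub_rev _ (ζ (1 - c))]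
    rw [show ∀ a b d : ℂ, a - (b - d) = a - b + d by intros; ring]
    have hcast : (((E + 1 : ℕ) : ℝ)) = (E : ℝ) + 1 := by push_cast; ring
    rw [hcast] at h
    have hpow : x^(1 - c.re)*((E : ℝ) + 1)^(-(1 - c.re)) = u*u^(-c.re) := by
      rw [rpow_neg (by positivity), ← div_eq_mul_inv, ← div_rpow hx0.le (by positivity), ← hu, sub_eq_add_neg,
        rpow_add hu0, rpow_one]
    have hk : (1 + ‖1 - c‖/(1 - c.re))/‖1 - c‖ ≤ 4 := by
      rw [div_le_iff₀ hn0]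
      have : ‖1 - c‖/(1 - c.re) ≤ 2*‖1 - c‖ := by
        rw [div_le_iff₀ (by linarith)]
        have : 1 ≤ 2*(1 - c.re) := by linarith
        nlinarith only [this, hn0]
      linarith
    have hku : u*u^(-c.re) ≤ √x*M := by gcongr; exact hMw u hu2 huN
    calc _ ≤ x^(1 - c.re)/‖1 - c‖*((1 + ‖1 - c‖/(1 - c.re))*((E : ℝ) + 1)^(-(1 - c.re))) := by gcongr
      _ = (1 + ‖1 - c‖/(1 - c.re))/‖1 - c‖*(x^(1 - c.re)*((E : ℝ) + 1)^(-(1 - c.re))) := by ring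
      _ ≤ 4*(√x*M) := by rw [hpow]; gcongr
      _ = _ := by ring
  have hS : twistedDivisorSum c x = (x : ℂ) * ∑ d ∈ Ioc 0 ⌊x⌋₊, (d : ℂ)^(-(1 + c)) -
      ((∑ d ∈ Ioc 0 ⌊u⌋₊, (d : ℂ)^(-c)*(x/d - ⌊x/d⌋₊)) +
        ∑ e ∈ Ioc 0 E, ∑ d ∈ Ioc ⌊x/(e + 1)⌋₊ ⌊x/e⌋₊, (d : ℂ)^(-c)*(x/d - ⌊x/d⌋₊)) := by
    rw [← sum_Ioc_floor_div_eq x hx0.le, sum_Ioc_consecutive _ (Nat.zero_le _) (floor_le_floor (div_le_self hx0.le (by linarith))),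
      mul_sum, ← sum_sub_distrib, twistedDivisorSum]
    refine sum_congr rfl fun d hd => ?_
    have hd0 : (d : ℂ) ≠ 0 := Nat.cast_ne_zero.2 (by have := (mem_Ioc.1 hd).1; omega)
    rw [neg_add, cpow_add _ _ hd0, cpow_neg_one]; ring
  rw [sum_sub_distrib, hI] at hC
  rw [hS]
  -- The term x^(1-c)/c, denoted i, occurs both in the smooth sum and in the zero frequencies, and
  -- cancels.
  have htri : ∀ a a' b s i z z' : ℂ, ‖a - (b + s) - (a' + z')‖ ≤ ‖a - (a' - i)‖ + ‖b‖ + ‖s - (-i - z)‖ + ‖z - z'‖ := fun a a' b s i z z' => by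
    have : a - (b + s) - (a' + z') = (a - (a' - i)) - b - (s - (-i - z)) + (z - z') := by ring
    rw [this]
    exact (norm_add_le _ _).trans (add_le_add ((norm_sub_le _ _).trans (add_le_add (norm_sub_le _ _) le_rfl)) le_rfl)
  rw [neg_div] at hC
  refine (htri _ _ _ _ _ _ _).trans ((add_le_add (add_le_add (add_le_add hA hB) hC) hZ).trans ?_)
  have hsy : √c.im ≤ √N := sqrt_le_sqrt hyN
  have h1L : 1 + L ≤ 2*L := by linarith
  calc _ ≤ 100*√N*M*(2*L) + M*√N + (√N*(30*(2*L)*M) + 1300*M*(√N + √N)*(2*L)*(2*L)) + 4*M*√N := by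
        have : (E : ℝ) ≤ √N := hEx.trans hsN
        have : 1 + log E ≤ 2*L := by linarith
        gcongr
    _ = M*√N*(260*L + 5 + 10400*L^2) := by ring
    _ ≤ M*√N*(10700*L^2) := by gcongr; nlinarith only [hL50]
    _ = _ := by ring

/-- The summatory function of the twisted divisor function, uniformly in the twist. -/
lemma norm_twistedDivisorSum_sub_le {D : ℝ} {N : ℕ} {c : ℂ} {x : ℝ} (hL : 50*(D + 1) ≤ log N)
    (hD : 0 ≤ D) (hκ : log N*|c.re| ≤ D) (hc : c ≠ 0) (hx : 1 ≤ x) (hxN : x + |c.im| ≤ N) :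
    ‖twistedDivisorSum c x - (x*ζ (1 + c) + (x : ℂ)^(1 - c)/(1 - c)*ζ (1 - c))‖ ≤ 10700*rexp D*(√N*log N^2) := by
  rcases le_total 0 c.im with hy | hy
  · exact norm_twistedDivisorSum_sub_le_of_im_nonneg hL hD hκ hc hx hxN hy
  · have h := norm_twistedDivisorSum_sub_le_of_im_nonneg (c := conj c) hL hD (by simpa using hκ)
      (fun h => hc (by simpa using h)) hx (by simpa using hxN) (by simpa using hy)
    have hx0 : (0 : ℝ) ≤ x := by linarith
    have e1 : (1 : ℂ) + conj c = conj (1 + c) := by simp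
    have e2 : (1 : ℂ) - conj c = conj (1 - c) := by simp
    have e3 : (x : ℂ)^conj (1 - c) = conj ((x : ℂ)^(1 - c)) := by
      rw [cpow_conj _ _ (by rw [arg_ofReal_of_nonneg hx0]; exact pi_ne_zero.symm), conj_ofReal]
    rw [e1, e2, e3, twistedDivisorSum_conj, riemannZeta_conj, riemannZeta_conj] at h; rw [← Complex.norm_conj]
    simpa only [map_sub, map_add, map_mul, map_div₀, conj_ofReal] using h

/-! ### The moment with a main term in powers of t/2π -/

lemma integral_div_two_pi_cpow {X : ℝ} (hX : 1 ≤ X) {c : ℂ} (hc1 : c ≠ 1) :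
    ∫ y in (2*π)..(2*π*X), ((y/(2*π) : ℝ) : ℂ)^(-c) = 2*π*(((X : ℂ)^(1 - c) - 1)/(1 - c)) := by
  have hpi : 2*π ≠ 0 := by positivity
  rw [intervalIntegral.integral_comp_div (fun w : ℝ => (w : ℂ)^(-c)) hpi, div_self hpi, mul_div_cancel_left₀ _ hpi]
  have h := sub_one_mul_integral_cpow one_pos hX c
  have h1c : 1 - c ≠ 0 := sub_ne_zero.2 hc1.symm
  rw [ofReal_one, one_cpow] at h
  rw [real_smul]
  push_cast
  grind

lemma continuousOn_div_two_pi_cpow {p q : ℝ} (hp : 0 < p) (c : ℂ) :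
    ContinuousOn (fun y : ℝ => ((y/(2*π) : ℝ) : ℂ)^(-c)) (Icc p q) := fun y hy => by
  have hy0 : y/(2*π) ≠ 0 := by
    have : 0 < y := by linarith [hy.1]
    positivity
  exact (ContinuousAt.comp (f := fun y : ℝ => y/(2*π)) (continuousAt_ofReal_cpow_const _ (-c) (Or.inr hy0))
    (by fun_prop)).continuousWithinAt

/-- The twisted second moment along the critical line, with its main term in terms of powers of `t / 2π`. -/
lemma exists_norm_integral_zeta_mul_zeta_sub_main_le {C : ℝ} (hC : 0 ≤ C) : ∃ K : ℝ, 0 ≤ K ∧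
    ∀ (N : ℕ) (σ X : ℝ) (c : ℂ), 100*(C + 1) ≤ log N → log N*|σ - 1/2| ≤ C →
    log N*|c.re| ≤ 2*C → c ≠ 0 → 1 ≤ X → 2*π*X + |c.im| ≤ N →
    ‖∫ y in (2*π)..(2*π*X), (ζ (1 - (σ + y*I))*ζ (σ + y*I + c) - (ζ (1 + c) +
        ζ (1 - c)*((y/(2*π) : ℝ) : ℂ)^(-c)))‖ ≤ K*(√N*log N^2) := by
  obtain ⟨K, hK0, hK⟩ := exists_norm_integral_zeta_mul_zeta_sub_le hC
  refine ⟨K + 8 + 2*8*(10700*rexp (2*C)), by positivity, fun N σ X c hL hσ hκ hc hX hXN => ?_⟩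
  have h1 := hK N σ X c hL hσ hκ hX hXN
  have hpi := pi_gt_three
  have hpi4 := pi_lt_four
  have hL0 : 0 < log N := by linarith
  have hcim := abs_nonneg c.im
  have h2 := norm_twistedDivisorSum_sub_le (D := 2*C) (x := X) (by linarith) (by linarith) hκ hc hX (by nlinarith)
  have h3 := norm_twistedDivisorSum_sub_le (D := 2*C) (x := 1) (by linarith) (by linarith) hκ hc le_rfl (by nlinarith)
  have hκ' := abs_le.1 (le_of_mul_le_mul_left (hκ.trans (by linarith : 2*C ≤ log N*(2/100))) hL0)
  have hσ' := abs_le.1 (le_of_mul_le_mul_left (hσ.trans (by linarith : C ≤ log N*(1/100))) hL0)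
  have hc1 : c ≠ 1 := by rintro rfl; norm_num at hκ'
  -- The integral starts at y = 2π, that is at X = 1, so its main term is 2π times a difference of
  -- two values of the divisor asymptotics. The value at 1 is compared with the divisor sum 1.
  have hS1 : twistedDivisorSum c 1 = 1 := by
    rw [twistedDivisorSum, Nat.floor_one, Nat.Ioc_succ_singleton, sum_singleton]; simp
  rw [hS1] at h3
  have hpq : 2*π ≤ 2*π*X := by nlinarith
  have hc2 : Continuous fun y : ℝ => ζ (σ + y*I + c) := by
    have := continuous_riemannZeta_line (z := σ + c) (by simp; linarith)
    grind
  have hc3 : Continuous fun y : ℝ => ζ (1 - (σ + y*I)) := by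
    have := (continuous_riemannZeta_line (z := 1 - σ) (by simp; linarith)).comp continuous_neg
    refine this.congr fun y => ?_
    simp only [comp_apply]; push_cast; ring_nf
  have hcY := continuousOn_div_two_pi_cpow (p := 2*π) (q := 2*π*X) (by positivity) c
  rw [← uIcc_of_le hpq] at hcY
  have hi1 : IntervalIntegrable (fun y : ℝ => ζ (1 - (σ + y*I))*ζ (σ + y*I + c))
    volume (2*π) (2*π*X) := (hc3.mul hc2).intervalIntegrable _ _
  have hi2 := hcY.intervalIntegrable.const_mul (μ := volume) (ζ (1 - c))
  rw [integral_sub hi1 (intervalIntegrable_const.add hi2),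
    integral_add intervalIntegrable_const hi2, integral_const_mul, integral_div_two_pi_cpow hX hc1, intervalIntegral.integral_const, real_smul]
  push_cast
  rw [ofReal_one, one_cpow] at h3
  set I := ∫ y in (2*π)..(2*π*X), ζ (1 - (σ + y*I))*ζ (σ + y*I + c)
  set S := twistedDivisorSum c X
  set B := 10700*rexp (2*C)*(√N*log N^2) with hB
  set m1 := (X*ζ (1 + c) + (X : ℂ)^(1 - c)/(1 - c)*ζ (1 - c))
  set m2 := (1*ζ (1 + c) + 1/(1 - c)*ζ (1 - c))
  have e : I - ((2*π*X - 2*π)*ζ (1 + c) + ζ (1 - c)*(2*π*(((X : ℂ)^(1 - c) - 1)/(1 - c)))) =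
      (I - 2*π*S) + (2*π : ℝ)*((S - m1) - (1 - m2)) + (2*π : ℝ) := by
    push_cast; grind
  rw [e]
  have hN1 : (1 : ℝ) ≤ N := by nlinarith
  have hsN : 1 ≤ √(N : ℝ) := one_le_sqrt.2 hN1
  have hU : 1 ≤ √N*log N^2 := one_le_mul_of_one_le_of_one_le hsN (by nlinarith)
  have hn : ‖((2*π : ℝ) : ℂ)‖ ≤ 8 := by
    rw [norm_real, norm_of_nonneg (by positivity)]
    linarith
  calc _ ≤ ‖I - 2*π*S‖ + ‖((2*π : ℝ) : ℂ)‖*(‖S - m1‖ + ‖1 - m2‖) + ‖((2*π : ℝ) : ℂ)‖ := by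
        refine (norm_add_le _ _).trans (add_le_add ((norm_add_le _ _).trans (add_le_add le_rfl ?_)) le_rfl)
        rw [norm_mul]; gcongr; exact norm_sub_le _ _
    _ ≤ K*(√N*log N^2) + 8*(B + B) + 8*(√N*log N^2) := by gcongr; linarith
    _ = _ := by rw [hB]; ring

/-! ### The product of two χ-factors compared with a power -/

/-- Stirling's approximation to `χ`, up to an eighth root of unity. -/
def zetaChiModel (w : ℂ) : ℂ := cexp ((1/2 - w)*log (w.im/(2*π)) + I*w.im)

/-- In the lower half plane this is Stirling's formula for χ(1 − s) at s = 1 − w; in the upper one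
χ(w) is the reciprocal of χ(1 − w). Both give one formula because the real logarithm is even; only
the root of unity depends on the half plane. -/
lemma norm_zetaChi_sub_zetaChiModel_le {w : ℂ} (h1 : 0 < w.re) (h2 : w.re < 1) (h : 600 ≤ |w.im|) :
    ‖zetaChi w - cexp (I*(sign w.im*(π/4)))*zetaChiModel w‖ ≤ 600/|w.im| *‖zetaChiModel w‖ := by
  have key : ∀ m ρ : ℂ, m ≠ 0 → ‖zetaChi w/m - 1‖ ≤ 600/|w.im| → m = ρ*zetaChiModel w → ‖ρ‖ = 1 →
      ‖zetaChi w - ρ*zetaChiModel w‖ ≤ 600/|w.im| *‖zetaChiModel w‖ := fun m ρ hm hle hmρ hρ => by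
    have e : zetaChi w - m = (zetaChi w/m - 1)*m := by field_simp
    rw [← hmρ, e, norm_mul]; gcongr; rw [hmρ, norm_mul, hρ, one_mul]
  have hunit : ∀ x : ℝ, ‖cexp (I*(x*(π/4)))‖ = 1 := fun x => by
    have : I*(x*(π/4)) = ((x*(π/4) : ℝ) : ℂ)*I := by push_cast; ring
    rw [this, norm_exp_ofReal_mul_I]
  rcases le_or_gt w.im 0 with hw | hw
  · rw [abs_of_nonpos hw] at h key ⊢
    have hb := norm_zetaChi_div_zetaChiMain_sub_one_le (s := 1 - w) (by simp; linarith) (by simp; linarith) (by simp; linarith)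
    rw [sub_sub_cancel, show (1 - w).im = -w.im by simp] at hb
    refine key (zetaChiMain (1 - w)) _ (zetaChiMain_ne_zero _) (hb.trans (by gcongr; norm_num)) ?_ (hunit _)
    rw [zetaChiMain, zetaChiModel, ← exp_add, show (1 - w).im = -w.im by simp, neg_div, Real.log_neg_eq_log,
      sign_of_neg (by linarith)]
    congr 1
    push_cast; ring
  · rw [abs_of_pos hw] at h key ⊢
    have hb := norm_zetaChi_div_zetaChiMain_sub_one_le (s := w) h1 (by linarith) (by linarith)
    have hχ := zetaChi_mul_zetaChi_one_sub (s := w) hw.ne'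
    have hm := zetaChiMain_ne_zero w
    have hχ0 : zetaChi (1 - w) ≠ 0 := right_ne_zero_of_mul_eq_one hχ
    set ρ := zetaChi (1 - w)/zetaChiMain w with hρ
    have hρ0 : ρ ≠ 0 := div_ne_zero hχ0 hm
    have h300 : 300/w.im ≤ 1/2 := by rw [div_le_iff₀ hw]; linarith
    have hρ1 : 1/2 ≤ ‖ρ‖ := by
      have := norm_sub_norm_le (1 : ℂ) (1 - ρ)
      rw [sub_sub_cancel, norm_one, norm_sub_rev] at this; linarith
    refine key (zetaChiMain w)⁻¹ _ (inv_ne_zero hm) ?_ ?_ (hunit _)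
    · have e : zetaChi w/(zetaChiMain w)⁻¹ - 1 = -(ρ - 1)/ρ := by grind
      rw [e, norm_div, norm_neg, div_le_iff₀ (by linarith)]
      calc _ ≤ 300/w.im := hb
        _ = 600/w.im*(1/2) := by ring
        _ ≤ _ := by gcongr
    · rw [zetaChiMain, zetaChiModel, ← exp_add, ← exp_neg, sign_of_pos hw]; congr 1; push_cast; ring

lemma abs_log_div_two_pi_le {N x : ℝ} (hx : 600 ≤ |x|) (hxN : |x| ≤ N) : |log (x/(2*π))| ≤ log N := by
  have hpi := pi_gt_three
  have hpi4 := pi_lt_four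
  have h1 : 1 ≤ |x|/(2*π) := by rw [le_div_iff₀ (by positivity)]; linarith
  rw [← Real.log_abs, abs_div, abs_of_pos (by positivity : 0 < 2*π), abs_of_nonneg (log_nonneg h1)]
  exact log_le_log (by linarith) ((div_le_self (abs_nonneg x) (by linarith)).trans hxN)

lemma norm_zetaChiModel_le {N D : ℝ} {w : ℂ} (hw : log N*|w.re - 1/2| ≤ D) (h : 600 ≤ |w.im|) (hN : |w.im| ≤ N) :
    ‖zetaChiModel w‖ ≤ rexp D := by
  rw [zetaChiModel, norm_exp]
  refine exp_le_exp.2 ?_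
  have e : ((1/2 - w)*log (w.im/(2*π)) + I*w.im).re = -(w.re - 1/2)*log (w.im/(2*π)) := by simp
  rw [e]
  calc _ ≤ _ := le_abs_self _
    _ = |log (w.im/(2*π))| *|w.re - 1/2| := by grind
    _ ≤ _ := (mul_le_mul_of_nonneg_right (abs_log_div_two_pi_le h hN) (abs_nonneg _)).trans hw

lemma exists_norm_zetaChi_le_of_abs_im_le (R : ℝ) :
    ∃ K : ℝ, 0 ≤ K ∧ ∀ w : ℂ, 1/8 ≤ w.re → w.re ≤ 7/8 → |w.im| ≤ R → ‖zetaChi w‖ ≤ K := by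
  obtain ⟨K, hK⟩ := (isCompact_Icc.reProdIm isCompact_Icc : IsCompact (Icc (1/8 : ℝ) (7/8) ×ℂ Icc (-R) R)).exists_bound_of_continuousOn
    (f := zetaChi) fun w hw => (differentiableAt_zetaChi (hw.1.2.trans_lt (by norm_num))).continuousAt.continuousWithinAt
  exact ⟨|K|, abs_nonneg K, fun w h1 h2 h3 => (hK w ⟨⟨h1, h2⟩, abs_le.1 h3⟩).trans (le_abs_self K)⟩

lemma exists_norm_zetaChi_le_rpow : ∃ K : ℝ, 0 ≤ K ∧ ∀ w : ℂ, |w.re - 1/2| ≤ 3/8 → ‖zetaChi w‖ ≤ K*(1 + |w.im|)^|w.re - 1/2| := by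
  obtain ⟨K, hK0, hK⟩ := exists_norm_zetaChi_le_of_abs_im_le 600
  refine ⟨K + 2, by positivity, fun w hw => ?_⟩
  have hre := abs_le.1 hw
  have h0 := abs_nonneg w.im
  have h1 : 1 ≤ (1 + |w.im|)^|w.re - 1/2| := one_le_rpow (by linarith) (abs_nonneg _)
  rcases le_total |w.im| 600 with h | h
  · have := hK w (by linarith) (by linarith) h
    nlinarith
  · have h1 := norm_zetaChi_sub_zetaChiModel_le (w := w) (by linarith) (by linarith) h
    have h2 := norm_zetaChiModel_le (w := w) (N := 1 + |w.im|) le_rfl h (by linarith)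
    rw [← rpow_def_of_pos (by linarith)] at h2
    have h3 : 600/|w.im| ≤ 1 := by rw [div_le_one (by linarith)]; exact h
    have h4 := norm_le_norm_sub_add (zetaChi w) (cexp (I*(sign w.im*(π/4)))*zetaChiModel w)
    rw [norm_mul, show I*(sign w.im*(π/4)) = ((sign w.im*(π/4) : ℝ) : ℂ)*I by
      push_cast; ring, norm_exp_ofReal_mul_I, one_mul, mul_comm _ I] at h4
    push_cast at h4; nlinarith [mul_le_mul_of_nonneg_right h3 (norm_nonneg (zetaChiModel w))]

lemma exists_norm_zetaChi_le {D : ℝ} (hD : 0 ≤ D) : ∃ K : ℝ, 0 ≤ K ∧ ∀ (N : ℝ) (w : ℂ), 8*D + 1 ≤ log N →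
    log N*|w.re - 1/2| ≤ D → |w.im| ≤ N → ‖zetaChi w‖ ≤ K := by
  obtain ⟨K, hK0, hK⟩ := exists_norm_zetaChi_le_rpow
  refine ⟨K*rexp (2*D), by positivity, fun N w hN hw hwN => ?_⟩
  have h0 := abs_nonneg w.im
  have hN2 : 2 ≤ N := by
    have := log_le_sub_one_of_pos (x := N) (h0.trans hwN |>.lt_of_ne fun h => by rw [← h, log_zero] at hN; linarith)
    linarith
  refine (hK w (le_of_mul_le_mul_left (hw.trans (by linarith : D ≤ log N*(3/8))) (by linarith))).trans ?_
  rw [rpow_def_of_pos (by linarith)]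
  have : log (1 + |w.im|) ≤ 2*log N := by
    rw [← log_rpow (by linarith), Real.rpow_two]
    exact log_le_log (by linarith) (by nlinarith)
  refine mul_le_mul_of_nonneg_left (exp_le_exp.2 ?_) hK0
  nlinarith [mul_le_mul_of_nonneg_right this (abs_nonneg (w.re - 1/2))]

/-- The product of the two factors of the functional equation, as a function of the height. -/
def chiPair (α β y t : ℝ) : ℂ := zetaChi (1/2 + β + (t + y)*I)*zetaChi (1/2 - α - t*I)

/-- Modulus of the product of the two Stirling models. Since `Real.log` is even, the formula is also
valid for t + y < 0. -/
def chiPairAmplitude (α β y t : ℝ) : ℝ := rexp (α*log (t/(2*π)) - β*log ((t + y)/(2*π)))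

def chiPairPhase (y t : ℝ) : ℝ := t*log (t/(2*π)) - (t + y)*log ((t + y)/(2*π)) + y

lemma continuous_chiPair {α β : ℝ} (hα : -(1/4) ≤ α) (hβ : β ≤ 1/4) (y : ℝ) : Continuous (chiPair α β y) := by
  have h : ∀ f : ℝ → ℂ, Continuous f → (∀ t, (f t).re < 1) → Continuous fun t => zetaChi (f t) := fun f hf h =>
    continuous_iff_continuousAt.2 fun t => (differentiableAt_zetaChi (h t)).continuousAt.comp hf.continuousAt
  exact (h _ (by fun_prop) fun t => by simp; linarith).mul (h _ (by fun_prop) fun t => by simp; linarith)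

/-- Stirling's approximation to `chiPair`. -/
lemma norm_chiPair_sub_le {α β y t : ℝ} (hα : |α| ≤ 3/8) (hβ : |β| ≤ 3/8) (ht : 600 ≤ t) (hy : 600 ≤ |t + y|) :
    ‖chiPair α β y t - cexp (I*((sign (t + y) - 1)*(π/4))) * (chiPairAmplitude α β y t*cexp (I*chiPairPhase y t))‖ ≤
      1200*(1/t + 1/|t + y|)*chiPairAmplitude α β y t := by
  have ha := abs_le.1 hα
  have hb := abs_le.1 hβ
  set w₁ : ℂ := 1/2 + β + (t + y)*I with hw₁
  set w₂ : ℂ := 1/2 - α - t*I with hw₂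
  have r1 : w₁.re = 1/2 + β := by simp [hw₁]
  have i1 : w₁.im = t + y := by simp [hw₁]
  have r2 : w₂.re = 1/2 - α := by simp [hw₂]
  have i2 : w₂.im = -t := by simp [hw₂]
  have hti : |w₂.im| = t := by grind
  have a1 := norm_zetaChi_sub_zetaChiModel_le (w := w₁) (by linarith) (by linarith) (by rwa [i1])
  have a2 := norm_zetaChi_sub_zetaChiModel_le (w := w₂) (by linarith) (by linarith) (by rwa [hti])
  have hunit : ∀ x : ℝ, ‖cexp (I*(x*(π/4)))‖ = 1 := fun x => by
    rw [show I*(x*(π/4)) = ((x*(π/4) : ℝ) : ℂ)*I by push_cast; ring, norm_exp_ofReal_mul_I]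
  rw [i1] at a1
  rw [hti, i2, sign_of_neg (by linarith)] at a2
  set e₁ := cexp (I*(sign (t + y)*(π/4))) with he₁
  set e₂ := cexp (I*((-1 : ℝ)*(π/4))) with he₂
  have hprod : cexp (I*((sign (t + y) - 1)*(π/4)))*(chiPairAmplitude α β y t*cexp (I*chiPairPhase y t)) =
      (e₁*zetaChiModel w₁)*(e₂*zetaChiModel w₂) := by
    rw [he₁, he₂, zetaChiModel, zetaChiModel, i1, i2, chiPairAmplitude, chiPairPhase, ofReal_exp, neg_div,
      Real.log_neg_eq_log, ← exp_add, ← exp_add, ← exp_add, ← exp_add, ← exp_add, hw₁, hw₂]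
    congr 1
    push_cast; ring
  have hnorm : chiPairAmplitude α β y t = ‖zetaChiModel w₁‖*‖zetaChiModel w₂‖ := by
    have := congrArg norm hprod
    rw [← ofReal_one, ← Complex.ofReal_sub] at this
    simp only [norm_mul, hunit, he₁, he₂, one_mul, mul_comm I (chiPairPhase y t : ℂ),
      norm_exp_ofReal_mul_I, mul_one, norm_real] at this
    exact (norm_of_nonneg (exp_pos _).le).symm.trans this
  have hc2 : ‖zetaChi w₂‖ ≤ 2*‖zetaChiModel w₂‖ := by
    have h4 := norm_le_norm_sub_add (zetaChi w₂) (e₂*zetaChiModel w₂)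
    rw [norm_mul, hunit, one_mul] at h4
    have h3 : 600/t ≤ 1 := by rw [div_le_one (by linarith)]; exact ht
    linarith [mul_le_mul_of_nonneg_right h3 (norm_nonneg (zetaChiModel w₂))]
  have e : zetaChi w₁*zetaChi w₂ - (e₁*zetaChiModel w₁)*(e₂*zetaChiModel w₂) =
      (zetaChi w₁ - e₁*zetaChiModel w₁)*zetaChi w₂ + (e₁*zetaChiModel w₁)*(zetaChi w₂ - e₂*zetaChiModel w₂) := by ring
  rw [chiPair, hprod, e, hnorm]
  calc _ ≤ 600/|t + y| *‖zetaChiModel w₁‖*(2*‖zetaChiModel w₂‖) + ‖zetaChiModel w₁‖*(600/t*‖zetaChiModel w₂‖) := by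
        refine (norm_add_le _ _).trans (add_le_add ?_ ?_)
        · rw [norm_mul]; gcongr
        · rw [norm_mul, norm_mul, hunit, one_mul]; gcongr
    _ = (1200/|t + y| + 600/t)*(‖zetaChiModel w₁‖*‖zetaChiModel w₂‖) := by ring
    _ ≤ (1200/|t + y| + 1200/t)*(‖zetaChiModel w₁‖*‖zetaChiModel w₂‖) := by gcongr; norm_num
    _ = _ := by ring

lemma integral_one_div_add_one_div_abs_le {N y p q : ℝ} (hp : 600 ≤ p) (hpq : p ≤ q)
    (hy : ∀ t ∈ Icc p q, 600 ≤ |t + y|) (hN : q + |y| ≤ N) :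
    IntervalIntegrable (fun t => 1/t + 1/|t + y|) volume p q ∧ ∫ t in p..q, (1/t + 1/|t + y|) ≤ 16*log N := by
  have hyy := neg_abs_le y
  have hyy' := le_abs_self y
  have c1 : IntervalIntegrable (fun t => 1/t + 1/|t + y|) volume p q :=
    ContinuousOn.intervalIntegrable_of_Icc hpq <| (continuousOn_const.div continuousOn_id fun t ht => by
      grind).add (continuousOn_const.div (by fun_prop) fun t ht => by
      have := hy t ht; linarith)
  have hc : Continuous fun u : ℝ => 1/(1 + |u|) := by
    refine continuous_const.div (by fun_prop) fun u => ?_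
    positivity
  have i1 : IntervalIntegrable (fun t : ℝ => 1/(1 + |t|)) volume p q := hc.intervalIntegrable _ _
  have i2 : IntervalIntegrable (fun t : ℝ => 1/(1 + |t + y|)) volume p q :=
    (hc.comp (continuous_add_const y)).intervalIntegrable _ _
  have h1 := integral_one_div_add_abs_le (R := N) hpq one_pos (by linarith) (by linarith) (by linarith)
  have h2 := integral_one_div_add_abs_le (R := N) (p := p + y) (q := q + y) (by linarith) one_pos (by linarith) (by linarith) (by linarith)
  rw [← integral_comp_add_right (fun u => 1/(1 + |u|))] at h2
  have hl : log (1 + N/1) ≤ 2*log N := by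
    rw [div_one, ← log_rpow (by linarith)]
    refine log_le_log (by linarith) ?_
    rw [Real.rpow_two]; nlinarith
  have hb : ∀ u : ℝ, 600 ≤ |u| → 1/|u| ≤ 2*(1/(1 + |u|)) := fun u hu => by
    rw [mul_one_div, div_le_div_iff₀ (by linarith) (by linarith)]; linarith
  refine ⟨c1, ?_⟩
  calc _ ≤ ∫ t in p..q, (2*(1/(1 + |t|)) + 2*(1/(1 + |t + y|))) := by
        refine integral_mono_on hpq c1 ((i1.const_mul 2).add (i2.const_mul 2)) fun t ht => ?_
        grind
    _ = 2*(∫ t in p..q, 1/(1 + |t|)) + 2 * ∫ t in p..q, 1/(1 + |t + y|) := by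
        rw [integral_add (i1.const_mul 2) (i2.const_mul 2), integral_const_mul, integral_const_mul]
    _ ≤ _ := by linarith

lemma hasDerivAt_log_div_two_pi {u : ℝ} (hu : u ≠ 0) : HasDerivAt (fun u => log (u/(2*π))) (1/u) u := by
  have := pi_pos
  refine (((hasDerivAt_id u).div_const (2*π)).log (by simp [hu, this.ne'])).congr_deriv ?_
  grind

lemma hasDerivAt_chiPairPhase {y t : ℝ} (ht : t ≠ 0) (hy : t + y ≠ 0) :
    HasDerivAt (chiPairPhase y) (log (t/(2*π)) - log ((t + y)/(2*π))) t := by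
  have h1 := (hasDerivAt_id t).mul (hasDerivAt_log_div_two_pi ht)
  have h2 := ((hasDerivAt_id (t + y)).mul (hasDerivAt_log_div_two_pi hy)).comp_add_const t y
  refine ((h1.sub h2).add_const y).congr_deriv ?_
  grind

lemma hasDerivAt_deriv_chiPairPhase {y t : ℝ} (ht : t ≠ 0) (hy : t + y ≠ 0) :
    HasDerivAt (fun t => log (t/(2*π)) - log ((t + y)/(2*π))) (1/t - 1/(t + y)) t :=
  (hasDerivAt_log_div_two_pi ht).sub ((hasDerivAt_log_div_two_pi hy).comp_add_const t y)

lemma hasDerivAt_chiPairAmplitude (α β : ℝ) {y t : ℝ} (ht : t ≠ 0) (hy : t + y ≠ 0) :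
    HasDerivAt (chiPairAmplitude α β y) (chiPairAmplitude α β y t*(α/t - β/(t + y))) t := by
  refine (((hasDerivAt_log_div_two_pi ht).const_mul α).sub
    (((hasDerivAt_log_div_two_pi hy).comp_add_const t y).const_mul β)).exp.congr_deriv ?_
  rw [mul_one_div, mul_one_div]
  rfl

lemma chiPairAmplitude_le {N D α β y t : ℝ} (hα : log N*|α| ≤ D)
    (hβ : log N*|β| ≤ D) (ht : 600 ≤ t) (htN : t ≤ N) (hy : 600 ≤ |t + y|) (hyN : |t + y| ≤ N) :
    chiPairAmplitude α β y t ≤ rexp (2*D) := by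
  have key : ∀ γ u : ℝ, log N*|γ| ≤ D → 600 ≤ |u| → |u| ≤ N → |γ*log (u/(2*π))| ≤ D := fun γ u h1 h2 h3 => by
    rw [abs_mul, mul_comm]
    exact (mul_le_mul_of_nonneg_right (abs_log_div_two_pi_le h2 h3) (abs_nonneg _)).trans h1
  have h1 := abs_le.1 (key α t hα (by rwa [abs_of_nonneg (by linarith)]) (by rwa [abs_of_nonneg (by linarith)]))
  have h2 := abs_le.1 (key β _ hβ hy hyN)
  exact exp_le_exp.2 (by linarith)

/-- The logarithmic derivative has size (1/t + 1/|t + y|) D/log N, so its integral is O(D) in spite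
of the logarithm from integration. -/
lemma chiPairAmplitude_variation_le {N D α β y p q : ℝ} (hα : log N*|α| ≤ D) (hβ : log N*|β| ≤ D) (hp : 600 ≤ p) (hpq : p ≤ q)
    (hy : ∀ t ∈ Icc p q, 600 ≤ |t + y|) (hN : q + |y| ≤ N) :
    ContinuousOn (fun t => ((chiPairAmplitude α β y t*(α/t - β/(t + y)) : ℝ) : ℂ)) (Icc p q) ∧
    ‖(chiPairAmplitude α β y q : ℂ)‖ + ∫ t in p..q, ‖((chiPairAmplitude α β y t*(α/t - β/(t + y)) : ℝ) : ℂ)‖ ≤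
      rexp (2*D)*(1 + 32*D) := by
  have hy0 := abs_nonneg y
  have h0 : ∀ t ∈ Icc p q, t ≠ 0 ∧ t + y ≠ 0 := fun t ht => ⟨by linarith [ht.1], fun h => by grind⟩
  have hle : ∀ t ∈ Icc p q, chiPairAmplitude α β y t ≤ rexp (2*D) := fun t ht =>
    chiPairAmplitude_le hα hβ (hp.trans ht.1) (by linarith [ht.2]) (hy t ht) ((abs_add_le t y).trans (by grind))
  have hpos : ∀ t, 0 ≤ chiPairAmplitude α β y t := fun t => (exp_pos _).le
  have hc : ContinuousOn (fun t => ((chiPairAmplitude α β y t*(α/t - β/(t + y)) : ℝ) : ℂ)) (Icc p q) := by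
    refine continuous_ofReal.comp_continuousOn (ContinuousOn.mul (fun t ht =>
      (hasDerivAt_chiPairAmplitude α β (h0 t ht).1 (h0 t ht).2).continuousAt.continuousWithinAt) ?_)
    exact (continuousOn_const.div continuousOn_id fun t ht => (h0 t ht).1).sub
      (continuousOn_const.div (by fun_prop) fun t ht => (h0 t ht).2)
  obtain ⟨hi, hI⟩ := integral_one_div_add_one_div_abs_le hp hpq hy hN
  refine ⟨hc, ?_⟩
  have hs : ∀ t ∈ Icc p q, ‖((chiPairAmplitude α β y t*(α/t - β/(t + y)) : ℝ) : ℂ)‖ ≤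
      rexp (2*D)*(|α| + |β|)*(1/t + 1/|t + y|) := fun t ht => by
    have ht0 : 0 < t := by linarith [ht.1]
    rw [norm_real, norm_eq_abs, abs_mul, abs_of_nonneg (hpos t), mul_assoc]
    have : |α/t - β/(t + y)| ≤ (|α| + |β|)*(1/t + 1/|t + y|) := by
      refine (abs_sub _ _).trans ?_
      rw [abs_div, abs_div, abs_of_pos ht0]
      have : 0 ≤ |α| *(1/|t + y|) + |β| *(1/t) := by positivity
      grind
    exact mul_le_mul (hle t ht) this (abs_nonneg _) (exp_pos _).le
  have hint : ∫ t in p..q, ‖((chiPairAmplitude α β y t*(α/t - β/(t + y)) : ℝ) : ℂ)‖ ≤ rexp (2*D)*(|α| + |β|)*(16*log N) := by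
    refine (integral_mono_on hpq (hc.norm.intervalIntegrable_of_Icc hpq) (hi.const_mul _) hs).trans ?_
    rw [integral_const_mul]; gcongr
  rw [norm_real, norm_eq_abs, abs_of_nonneg (hpos q)]
  have := hle q ⟨hpq, le_rfl⟩
  have h3 : rexp (2*D)*(log N*|α| + log N*|β|) ≤ rexp (2*D)*(2*D) := by gcongr; linarith
  linarith

/-- `chiPair` up to a unimodular constant, in the form of an oscillatory integrand. -/
lemma norm_integral_chiPairAmplitude_mul_exp_le {N D α β y p q : ℝ} (hα : log N*|α| ≤ D)
    (hβ : log N*|β| ≤ D) (hp : 600 ≤ p) (hpq : p ≤ q) (hN : q + |y| ≤ N) (hyN : √N ≤ |y|)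
    (hy : (∀ t ∈ Icc p q, 600 ≤ t + y) ∨ (∀ t ∈ Icc p q, t + y ≤ -600)) :
    ‖∫ t in p..q, (chiPairAmplitude α β y t : ℂ)*cexp (I*chiPairPhase y t)‖ ≤ 10*√N*(rexp (2*D)*(1 + 32*D)) := by
  have hy0 := abs_nonneg y
  have hN0 : 0 < N := by linarith
  have hsN : 0 < √N := sqrt_pos.2 hN0
  have hya : ∀ t ∈ Icc p q, 600 ≤ |t + y| := hy.elim (fun h t ht => (h t ht).trans (le_abs_self _))
    fun h t ht => le_abs'.2 (Or.inl (h t ht))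
  have h0 : ∀ t ∈ Icc p q, t ≠ 0 ∧ t + y ≠ 0 := fun t ht => ⟨by linarith [ht.1], fun h => by grind⟩
  obtain ⟨hc, hV⟩ := chiPairAmplitude_variation_le hα hβ hp hpq hya hN
  have hg : ∀ t ∈ Icc p q, HasDerivAt (fun t => (chiPairAmplitude α β y t : ℂ))
      ((chiPairAmplitude α β y t*(α/t - β/(t + y)) : ℝ) : ℂ) t := fun t ht =>
    (hasDerivAt_chiPairAmplitude α β (h0 t ht).1 (h0 t ht).2).ofReal_comp
  have h1 : ∀ t ∈ Icc p q, HasDerivAt (chiPairPhase y) _ t := fun t ht => hasDerivAt_chiPairPhase (h0 t ht).1 (h0 t ht).2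
  have h2 : ∀ t ∈ Icc p q, HasDerivAt _ _ t := fun t ht => hasDerivAt_deriv_chiPairPhase (h0 t ht).1 (h0 t ht).2
  have h3 : ContinuousOn (fun t => 1/t - 1/(t + y)) (Icc p q) :=
    (continuousOn_const.div continuousOn_id fun t ht => (h0 t ht).1).sub
      (continuousOn_const.div (by fun_prop) fun t ht => (h0 t ht).2)
  have hyb := abs_le.1 (le_refl |y|)
  rcases hy with hy | hy
  -- t and t + y have the same sign: the phase derivative is the logarithm of their quotient, of
  -- modulus at least |y|/N ≥ 1/√N.
  · have hl : ∀ t ∈ Icc p q, 1/√N ≤ |log (t/(2*π)) - log ((t + y)/(2*π))| := fun t ht => by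
      have ht0 : 0 < t := by linarith [ht.1]
      have hty : 0 < t + y := by linarith [hy t ht]
      have hle : ∀ u v : ℝ, 0 < u → 0 < v → v ≤ N → |y| = v - u → 1/√N ≤ log (v/(2*π)) - log (u/(2*π)) := fun u v hu hv hvN huv => by
        have := Real.one_sub_inv_le_log_of_pos (div_pos hv hu)
        rw [← log_div (by positivity) (by positivity), div_div_div_cancel_right₀ (by positivity)]
        refine le_trans ?_ this
        rw [inv_div, one_sub_div hv.ne', ← huv, div_le_div_iff₀ hsN hv, one_mul]
        nlinarith [mul_self_sqrt hN0.le]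
      rcases le_total 0 y with h | h
      · rw [abs_sub_comm]; refine (hle t (t + y) ht0 hty ?_ ?_).trans (le_abs_self _)
        · linarith [ht.2]
        · rw [abs_of_nonneg h]; ring
      · refine (hle (t + y) t hty ht0 ?_ ?_).trans (le_abs_self _)
        · linarith [ht.2]
        · rw [abs_of_nonpos h]; ring
    have hs : (∀ t ∈ Icc p q, 0 ≤ 1/t - 1/(t + y)) ∨ (∀ t ∈ Icc p q, 1/t - 1/(t + y) ≤ 0) := by
      refine (le_total 0 y).imp (fun h t ht => ?_) (fun h t ht => ?_)
      · exact sub_nonneg.2 (one_div_le_one_div_of_le (by linarith [ht.1]) (by linarith))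
      · exact sub_nonpos.2 (one_div_le_one_div_of_le (by linarith [hy t ht]) (by linarith))
    refine (norm_integral_mul_exp_le_of_le_abs_deriv hpq h1 h2 h3 hs (by positivity) hl hg hc).trans ?_
    rw [div_div_eq_mul_div, div_one]
    exact mul_le_mul (by linarith) hV (add_nonneg (norm_nonneg _) (intervalIntegral.integral_nonneg hpq fun _ _ => norm_nonneg _)) (by positivity)
  -- t + y is negative: both parts of the second derivative are positive and 1/t alone is at least
  -- 1/N. A stationary point is now possible, at t = −y/2.
  · have hr : ∀ t ∈ Icc p q, 1/N ≤ 1/t - 1/(t + y) := fun t ht => by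
      have e1 := one_div_le_one_div_of_le (by linarith [ht.1] : 0 < t) (by linarith [ht.2] : t ≤ N)
      have e2 : 1/(t + y) ≤ 0 := one_div_nonpos.2 (by linarith [hy t ht])
      linarith
    refine (norm_integral_mul_exp_le_of_le_deriv2 hpq h1 h2 h3 (by positivity) hr hg hc).trans ?_
    rw [Real.sqrt_div zero_le_one, Real.sqrt_one, div_div_eq_mul_div, div_one]; gcongr

lemma norm_integral_chiPair_sub_le {N D α β y p q ς : ℝ} (hNL : 8*D + 1 ≤ log N) (hα : log N*|α| ≤ D)
    (hβ : log N*|β| ≤ D) (hp : 600 ≤ p) (hpq : p ≤ q) (hN : q + |y| ≤ N)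
    (hy : ∀ t ∈ Icc p q, 600 ≤ |t + y|) (hς : ∀ t ∈ Icc p q, sign (t + y) = ς) :
    IntervalIntegrable (fun t => (chiPairAmplitude α β y t : ℂ)*cexp (I*chiPairPhase y t)) volume p q ∧
    ‖(∫ t in p..q, chiPair α β y t) - cexp (I*((ς - 1)*(π/4))) *
      ∫ t in p..q, (chiPairAmplitude α β y t : ℂ)*cexp (I*chiPairPhase y t)‖ ≤
      19200*rexp (2*D)*log N := by
  have hy0 := abs_nonneg y
  obtain ⟨hi, hI⟩ := integral_one_div_add_one_div_abs_le hp hpq hy hN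
  have h0 : ∀ t ∈ Icc p q, t ≠ 0 ∧ t + y ≠ 0 := fun t ht => ⟨by linarith [ht.1], fun h => by grind⟩
  have hD : 0 ≤ D := (mul_nonneg (log_nonneg (by linarith)) (abs_nonneg α)).trans hα
  have hα' := abs_le.1 (le_of_mul_le_mul_left (hα.trans (by linarith : D ≤ log N*(1/8))) (by linarith))
  have hβ' := abs_le.1 (le_of_mul_le_mul_left (hβ.trans (by linarith : D ≤ log N*(1/8))) (by linarith))
  have iP : IntervalIntegrable (fun t => (chiPairAmplitude α β y t : ℂ)*cexp (I*chiPairPhase y t)) volume p q := by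
    refine ContinuousOn.intervalIntegrable_of_Icc hpq fun t ht => ContinuousAt.continuousWithinAt ?_
    exact (hasDerivAt_chiPairAmplitude α β (h0 t ht).1 (h0 t ht).2).continuousAt.ofReal.mul
      (continuousAt_const.mul (hasDerivAt_chiPairPhase (h0 t ht).1 (h0 t ht).2).continuousAt.ofReal).cexp
  have iX := (continuous_chiPair (α := α) (β := β) (by linarith) (by linarith) y).intervalIntegrable (μ := volume) p q
  refine ⟨iP, ?_⟩
  rw [← integral_const_mul, ← integral_sub iX (iP.const_mul _)]
  refine (norm_integral_le_of_norm_le hpq ?_ (hi.const_mul (1200*rexp (2*D)))).trans ?_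
  · refine .of_forall fun t ht => ?_
    have ht' := Ioc_subset_Icc_self ht
    rw [← hς t ht']
    have hty : |t + y| ≤ N := (abs_add_le t y).trans (by grind)
    have ht0 : 0 < t := by linarith [ht'.1]
    refine (norm_chiPair_sub_le (abs_le.2 ⟨by linarith, by linarith⟩) (abs_le.2 ⟨by linarith, by linarith⟩) (hp.trans ht'.1)
      (hy t ht')).trans ?_
    rw [mul_right_comm]; gcongr
    exact chiPairAmplitude_le hα hβ (hp.trans ht'.1) (by linarith [ht'.2]) (hy t ht') hty
  · rw [integral_const_mul]; nlinarith [mul_le_mul_of_nonneg_left hI (exp_pos (2*D)).le]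

lemma exists_norm_chiPair_le {D : ℝ} (hD : 0 ≤ D) : ∃ K : ℝ, 0 ≤ K ∧ ∀ N α β y t : ℝ, 100*(D + 1) ≤ log N →
    log N*|α| ≤ D → log N*|β| ≤ D → 0 ≤ t → t + |y| ≤ N → ‖chiPair α β y t‖ ≤ K := by
  obtain ⟨K, hK0, hK⟩ := exists_norm_zetaChi_le hD
  refine ⟨K*K, by positivity, fun N α β y t hNL hα hβ ht htN => ?_⟩
  have hy0 := abs_nonneg y
  rw [chiPair, norm_mul]
  refine mul_le_mul (hK N _ (by linarith) ?_ ?_) (hK N _ (by linarith) ?_ ?_) (norm_nonneg _) hK0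
  · simpa using hβ
  · have := abs_add_le t y
    rw [abs_of_nonneg ht] at this; simpa using this.trans htN
  · simpa using hα
  · have : |t| ≤ N := by grind
    simpa using this

/-- For |y| ≥ √N the product oscillates wherever Stirling's formula applies, that is for t ≥ 600 and
|t + y| ≥ 600. The excluded set has bounded length, and the product is bounded on it. -/
lemma exists_norm_integral_chiPair_le {D : ℝ} (hD : 0 ≤ D) : ∃ K : ℝ, 0 ≤ K ∧ ∀ N α β y q : ℝ,
    100*(D + 1) ≤ log N → log N*|α| ≤ D → log N*|β| ≤ D → √N ≤ |y| → 2*π ≤ q → q + |y| ≤ N →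
    ‖∫ t in (2*π)..q, chiPair α β y t‖ ≤ K*(√N*log N) := by
  obtain ⟨K, hK0, hK⟩ := exists_norm_chiPair_le hD
  refine ⟨1800*K + 2*(10*(rexp (2*D)*(1 + 32*D)) + 19200*rexp (2*D)), by positivity, fun N α β y q hNL hα hβ hyN hq hqN => ?_⟩
  have hy0 := abs_nonneg y
  have hpi := pi_gt_three
  have hpi4 := pi_lt_four
  have hN1 : 1 ≤ √N := one_le_sqrt.2 (by linarith)
  have hL1 : 1 ≤ log N := by linarith
  have hSL : 1 ≤ √N*log N := one_le_mul_of_one_le_of_one_le hN1 hL1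
  have hα' := abs_le.1 (le_of_mul_le_mul_left (hα.trans (by linarith : D ≤ log N*(1/8))) (by linarith))
  have hβ' := abs_le.1 (le_of_mul_le_mul_left (hβ.trans (by linarith : D ≤ log N*(1/8))) (by linarith))
  have hX : ∀ p r, IntervalIntegrable (chiPair α β y) volume p r := fun p r =>
    (continuous_chiPair (by linarith) (by linarith) y).intervalIntegrable _ _
  have htriv : ∀ p r, 0 ≤ p → p ≤ r → r ≤ q → ‖∫ t in p..r, chiPair α β y t‖ ≤ K*(r - p) := fun p r hp hpr hr => by
    have := norm_integral_le_of_norm_le_const (f := chiPair α β y) (a := p) (b := r) (C := K) fun t ht => by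
      rw [uIoc_of_le hpr] at ht; exact hK N α β y t hNL hα hβ (by linarith [ht.1]) (by linarith [ht.2])
    rwa [abs_of_nonneg (by linarith)] at this
  set B := (10*(rexp (2*D)*(1 + 32*D)) + 19200*rexp (2*D))*(√N*log N) with hB
  have hB0 : 0 ≤ B := by positivity
  have hseg : ∀ p r, p ≤ r → r ≤ q → (p < r → 600 ≤ p ∧ ((∀ t ∈ Icc p r, 600 ≤ t + y) ∨ (∀ t ∈ Icc p r, t + y ≤ -600))) →
      ‖∫ t in p..r, chiPair α β y t‖ ≤ B := fun p r hpr hr h => by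
    rcases hpr.eq_or_lt with rfl | hlt
    · rw [integral_same, norm_zero]; exact hB0
    obtain ⟨hp, hy⟩ := h hlt
    have hya : ∀ t ∈ Icc p r, 600 ≤ |t + y| := hy.elim (fun h t ht => (h t ht).trans (le_abs_self _))
      fun h t ht => le_abs'.2 (Or.inl (h t ht))
    obtain ⟨ς, hς⟩ : ∃ ς : ℝ, ∀ t ∈ Icc p r, sign (t + y) = ς := hy.elim
      (fun h => ⟨1, fun t ht => sign_of_pos (by linarith [h t ht])⟩)
      (fun h => ⟨-1, fun t ht => sign_of_neg (by linarith [h t ht])⟩)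
    have h1 := (norm_integral_chiPair_sub_le (by linarith) hα hβ hp hpr (by linarith) hya hς).2
    have h2 := norm_integral_chiPairAmplitude_mul_exp_le hα hβ hp hpr (by linarith) hyN hy
    have h3 := norm_le_norm_sub_add (∫ t in p..r, chiPair α β y t) (cexp (I*((ς - 1)*(π/4))) *
      ∫ t in p..r, (chiPairAmplitude α β y t : ℂ)*cexp (I*chiPairPhase y t))
    rw [norm_mul, show I*((ς - 1)*(π/4)) = (((ς - 1)*(π/4) : ℝ) : ℂ)*I by push_cast; ring, norm_exp_ofReal_mul_I, one_mul] at h3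
    rw [show I*((ς - 1)*(π/4)) = (((ς - 1)*(π/4) : ℝ) : ℂ)*I by push_cast; ring] at h1
    have e1 : rexp (2*D)*log N ≤ rexp (2*D)*(√N*log N) := by gcongr; exact le_mul_of_one_le_left (by linarith) hN1
    have e2 : √N*(rexp (2*D)*(1 + 32*D)) ≤ √N*log N*(rexp (2*D)*(1 + 32*D)) := by
      gcongr; exact le_mul_of_one_le_right (by linarith) hL1
    rw [hB]; linarith
  -- p₁ and p₂ bound the window |t + y| ≤ 600 within t ≥ 600; on either side of it t + y has
  -- constant sign.
  set p₁ := max 600 (-y - 600)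
  set p₂ := max 600 (-y + 600)
  have h12 : p₁ ≤ p₂ := max_le_max le_rfl (by linarith)
  have h12' : p₂ ≤ p₁ + 1200 := max_le (by linarith [le_max_left 600 (-y - 600)]) (by linarith [le_max_right 600 (-y - 600)])
  have h01 : 600 ≤ p₁ := le_max_left _ _
  rw [← integral_add_adjacent_intervals (hX _ (min 600 q)) (hX _ q),
    ← integral_add_adjacent_intervals (hX (min 600 q) (min p₁ q)) (hX _ q),
    ← integral_add_adjacent_intervals (hX (min p₁ q) (min p₂ q)) (hX _ q)]
  have b0 := htriv (2*π) (min 600 q) (by linarith) (le_min (by linarith) hq) (min_le_right _ _)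
  have b1 := hseg (min 600 q) (min p₁ q) (min_le_min_right q h01) (min_le_right _ _) fun h => by
    rcases le_total q 600 with hq6 | hq6
    · rw [min_eq_right hq6, min_eq_right (hq6.trans h01)] at h; linarith
    rw [min_eq_left hq6] at h ⊢; refine ⟨le_rfl, Or.inr fun t ht => ?_⟩
    rcases max_choice 600 (-y - 600) with h' | h'
    · exact absurd (h.trans_le (min_le_left _ _)) (by linarith)
    · have := ht.2.trans (min_le_left _ _)
      linarith
  have b2 := htriv (min p₁ q) (min p₂ q) (le_min (by linarith) (by linarith)) (min_le_min_right q h12) (min_le_right _ _)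
  have b3 := hseg (min p₂ q) q (min_le_right _ _) le_rfl fun h => by
    have hle : p₂ ≤ q := le_of_not_ge fun h' => by rw [min_eq_right h'] at h; exact lt_irrefl _ h
    rw [min_eq_left hle] at h ⊢
    exact ⟨h01.trans h12, Or.inl fun t ht => by linarith [ht.1, le_max_right 600 (-y + 600)]⟩
  have l2 : min p₂ q - min p₁ q ≤ 1200 := by
    rcases le_total p₁ q with h | h
    · rw [min_eq_left h]; linarith [min_le_left p₂ q]
    · rw [min_eq_right h]; simp
  have e3 := mul_le_mul_of_nonneg_left (by linarith [min_le_left 600 q] : min 600 q - 2*π + (min p₂ q - min p₁ q) ≤ 1800) hK0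
  have e4 := mul_le_mul_of_nonneg_left hSL (by positivity : 0 ≤ 1800*K)
  refine (norm_add_le_of_le b0 (norm_add_le_of_le b1 (norm_add_le_of_le b2 b3))).trans ?_
  rw [hB]
  linarith

lemma abs_log_add_sub_le {y t : ℝ} (ht : 0 < t) (hy : 2*|y| ≤ t) :
    |log ((t + y)/(2*π)) - log (t/(2*π)) - y/t| ≤ 2*(y/t)^2 := by
  have hy' := abs_le.1 (le_refl |y|)
  have hty : 0 < t + y := by linarith
  rw [← log_div (by positivity) (by positivity), div_div_div_cancel_right₀ (by positivity)]
  have h1 := log_le_sub_one_of_pos (div_pos hty ht)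
  have h2 := Real.one_sub_inv_le_log_of_pos (div_pos hty ht)
  have e1 : (t + y)/t - 1 = y/t := by field_simp; ring
  have e2 : 1 - ((t + y)/t)⁻¹ = y/t - y/t*(y/(t + y)) := by field_simp; ring
  have h3 : y/t*(y/(t + y)) ≤ 2*(y/t)^2 := by
    rw [div_mul_div_comm, div_pow, ← mul_div_assoc, div_le_div_iff₀ (by positivity) (by positivity)]
    have : 0 ≤ y^2*t*(t + 2*y) := mul_nonneg (by positivity) (by linarith)
    linarith
  grind

/-- The logarithm of the quotient of `chiPair` by its approximation by a power. -/
def chiPairExponent (β y t : ℝ) : ℂ := -(β*(log ((t + y)/(2*π)) - log (t/(2*π)))) +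
    I*(y - (t + y)*(log ((t + y)/(2*π)) - log (t/(2*π))))

lemma div_two_pi_cpow_eq {t : ℝ} (ht : 0 < t) (c : ℂ) : ((t/(2*π) : ℝ) : ℂ)^c = cexp (log (t/(2*π))*c) := by
  have := pi_pos
  rw [cpow_def_of_ne_zero (mod_cast (by positivity : t/(2*π) ≠ 0)), ofReal_log (by positivity)]

lemma chiPairAmplitude_mul_exp_eq {α β y t : ℝ} (ht : 0 < t) : chiPairAmplitude α β y t*cexp (I*chiPairPhase y t) =
      ((t/(2*π) : ℝ) : ℂ)^(-(β - α + y*I : ℂ))*cexp (chiPairExponent β y t) := by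
  rw [div_two_pi_cpow_eq ht, chiPairAmplitude, chiPairPhase, chiPairExponent, ofReal_exp, ← exp_add, ← exp_add]
  congr 1
  push_cast
  ring

/-- With l the difference of logarithms, y − (t + y)l = −t(l − y/t) − yl: the linear terms of the
phase cancel and it is quadratic in y. -/
lemma norm_chiPairExponent_le {β y t : ℝ} (hβ : |β| ≤ 1/2) (ht : 0 < t) (hy : 2*|y| ≤ t) :
    ‖chiPairExponent β y t‖ ≤ (|y| + 4*y^2)/t := by
  have h := abs_log_add_sub_le ht hy
  set l := log ((t + y)/(2*π)) - log (t/(2*π)) with hl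
  have hyt : |y/t| ≤ 1/2 := by rw [abs_div, abs_of_pos ht, div_le_iff₀ ht]; linarith
  have hl2 : |l| ≤ 2*|y/t| := by
    have h1 := norm_le_norm_sub_add l (y/t)
    rw [norm_eq_abs, norm_eq_abs, norm_eq_abs] at h1; rw [← sq_abs] at h; nlinarith [abs_nonneg (y/t)]
  have e : chiPairExponent β y t = ((-(β*l) : ℝ) : ℂ) + I*(((-t*(l - y/t) - y*l : ℝ)) : ℂ) := by
    rw [chiPairExponent, hl, show -t*(l - y/t) - y*l = y - (t + y)*l by field_simp; ring, hl]
    push_cast; ring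
  rw [e]
  refine (norm_add_le _ _).trans ?_
  rw [norm_mul, norm_I, one_mul, norm_real, norm_real, norm_eq_abs, norm_eq_abs, abs_neg, abs_mul]
  have h4 := abs_sub (-t*(l - y/t)) (y*l)
  rw [abs_mul, abs_mul, abs_neg, abs_of_pos ht] at h4
  calc _ ≤ 1/2*(2*|y/t|) + (t*(2*(y/t)^2) + |y| *(2*|y/t|)) := by refine add_le_add ?_ (h4.trans ?_) <;> gcongr
    _ = _ := by rw [abs_div, abs_of_pos ht]; grind

lemma norm_div_two_pi_cpow_le {N D t : ℝ} {c : ℂ} (hc : log N*|c.re| ≤ D) (ht : 2*π ≤ t) (htN : t ≤ N) :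
    ‖((t/(2*π) : ℝ) : ℂ)^c‖ ≤ rexp D := by
  have hpi := pi_gt_three
  have h1 : 1 ≤ t/(2*π) := by rw [one_le_div (by positivity)]; exact ht
  rw [div_two_pi_cpow_eq (by linarith), norm_exp, Complex.re_ofReal_mul]
  refine exp_le_exp.2 (le_trans ?_ hc)
  exact (mul_le_mul_of_nonneg_left (le_abs_self _) (log_nonneg h1)).trans (mul_le_mul_of_nonneg_right
    (log_le_log (by linarith) ((div_le_self (by linarith) (by linarith)).trans htN)) (abs_nonneg _))

/-- Pointwise the difference is O((|y| + y²)/t), which would integrate to y² log N and be too large.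
The factor 1 − c turns the integrand into the derivative of t times the difference, up to a small
remainder; dividing by |1 − c| ≥ |y| afterwards saves a factor |y|. -/
lemma norm_one_sub_mul_integral_sub_le {N D α β y p q : ℝ} (hL : 1 ≤ log N) (hα : log N*|α| ≤ D)
    (hβ : log N*|β| ≤ D) (hβ2 : |β| ≤ 1/2) (hp : 2*|y| + 1200 ≤ p) (hpq : p ≤ q) (hqN : q + |y| ≤ N) :
    ‖(1 - (β - α + y*I : ℂ)) * ∫ t in p..q, ((chiPairAmplitude α β y t : ℂ)*cexp (I*chiPairPhase y t) -
      ((t/(2*π) : ℝ) : ℂ)^(-(β - α + y*I : ℂ)))‖ ≤ 7*rexp (2*D)*(|y| + 4*y^2)*log N := by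
  have hy0 := abs_nonneg y
  have hya := abs_le.1 (le_refl |y|)
  have hpi := pi_gt_three
  have hpi4 := pi_lt_four
  set c : ℂ := β - α + y*I with hc
  have hcre : log N*|(-c).re| ≤ 2*D := by
    have : (-c).re = α - β := by simp [hc]
    rw [this]; nlinarith [abs_sub α β]
  set P : ℝ → ℂ := fun t => (chiPairAmplitude α β y t : ℂ)*cexp (I*chiPairPhase y t) with hP
  set Y : ℝ → ℂ := fun t => cexp (log (t/(2*π)) * -c) with hY
  have h0 : ∀ t ∈ Icc p q, 0 < t ∧ 0 < t + y ∧ 2*|y| ≤ t ∧ 600 ≤ t ∧ 600 ≤ t + y ∧ t + y ≤ N ∧ t ≤ N := fun t ht => by grind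
  have hYe : ∀ t ∈ Icc p q, ((t/(2*π) : ℝ) : ℂ)^(-c) = Y t := fun t ht => div_two_pi_cpow_eq (h0 t ht).1 _
  have hYle : ∀ t ∈ Icc p q, ‖Y t‖ ≤ rexp (2*D) := fun t ht => by
    rw [← hYe t ht]; exact norm_div_two_pi_cpow_le hcre (by grind) (h0 t ht).2.2.2.2.2.2
  have hPle : ∀ t ∈ Icc p q, ‖P t‖ ≤ rexp (2*D) := fun t ht => by
    obtain ⟨h1, h2, h3, h4, h5, h6, h7⟩ := h0 t ht
    simp only [hP]; rw [norm_mul, mul_comm I, norm_exp_ofReal_mul_I, mul_one, norm_real]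
    refine (norm_of_nonneg (exp_pos _).le).trans_le ?_
    exact chiPairAmplitude_le hα hβ h4 h7 (by rwa [abs_of_pos h2]) (by rwa [abs_of_pos h2])
  set l : ℝ → ℝ := fun t => log ((t + y)/(2*π)) - log (t/(2*π)) with hl
  -- The remainder: (1 − c)(P − Y) + r is the derivative of t(P − Y).
  set r : ℝ → ℂ := fun t => P t*(β*y/(t + y) + I*(y - t*l t)) with hr
  have hdiff : ∀ t ∈ Icc p q, t*‖P t - Y t‖ ≤ 3*rexp (2*D)*(|y| + 4*y^2) := fun t ht => by
    obtain ⟨h1, -, h3, -⟩ := h0 t ht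
    have hE := norm_chiPairExponent_le hβ2 h1 h3
    have hE' : t*‖chiPairExponent β y t‖ ≤ |y| + 4*y^2 := by rwa [le_div_iff₀ h1, mul_comm] at hE
    have : ‖P t - Y t‖ ≤ 3*rexp (2*D)*‖chiPairExponent β y t‖ := by
      rcases le_total ‖chiPairExponent β y t‖ 1 with h | h
      · have e : P t - Y t = Y t*(cexp (chiPairExponent β y t) - 1) := by
          rw [mul_sub, mul_one, ← hYe t ht, ← chiPairAmplitude_mul_exp_eq h1]
        rw [e, norm_mul]
        calc _ ≤ rexp (2*D)*(‖chiPairExponent β y t‖*rexp 1) :=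
              mul_le_mul (hYle t ht) ((norm_exp_sub_one_le_mul_exp _).trans (by gcongr)) (norm_nonneg _) (exp_pos _).le
          _ ≤ rexp (2*D)*(‖chiPairExponent β y t‖*3) := by gcongr; linarith [Real.exp_one_lt_d9]
          _ = _ := by ring
      · have := norm_sub_le_of_le (hPle t ht) (hYle t ht)
        nlinarith [exp_pos (2*D)]
    calc _ ≤ t*(3*rexp (2*D)*‖chiPairExponent β y t‖) := by gcongr
      _ = 3*rexp (2*D)*(t*‖chiPairExponent β y t‖) := by ring
      _ ≤ _ := by gcongr
  have hrle : ∀ t ∈ Icc p q, ‖r t‖ ≤ rexp (2*D)*(|y| + 4*y^2)*(1/t) := fun t ht => by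
    obtain ⟨h1, h2, h3, -⟩ := h0 t ht
    simp only [hr]; rw [norm_mul, mul_assoc]; refine mul_le_mul (hPle t ht) ?_ (norm_nonneg _) (exp_pos _).le
    have e : (β*y/(t + y) + I*(y - t*l t) : ℂ) = ((β*y/(t + y) : ℝ) : ℂ) + I*((-t*(l t - y/t) : ℝ) : ℂ) := by
      rw [show -t*(l t - y/t) = y - t*l t by field_simp; ring]
      simp
    rw [e]; refine (norm_add_le _ _).trans ?_
    rw [norm_mul, norm_I, one_mul, norm_real, norm_real, norm_eq_abs, norm_eq_abs, abs_div, abs_mul,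
      abs_mul, abs_neg, abs_of_pos h1, abs_of_pos h2]
    have h4 := abs_log_add_sub_le h1 h3
    calc _ ≤ 1/2*|y|/(t/2) + t*(2*(y/t)^2) := by gcongr; linarith
      _ = (|y| + 2*y^2)*(1/t) := by field_simp
      _ ≤ _ := by gcongr; norm_num
  have dP : ∀ t ∈ Icc p q, HasDerivAt P (P t*(α/t - β/(t + y) - I*l t)) t := fun t ht => by
    obtain ⟨h1, h2, -⟩ := h0 t ht
    refine ((hasDerivAt_chiPairAmplitude α β h1.ne' h2.ne').ofReal_comp.mul
      (((hasDerivAt_chiPairPhase h1.ne' h2.ne').ofReal_comp.const_mul I).cexp)).congr_deriv ?_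
    simp only [hP, hl]; push_cast; ring
  have dY : ∀ t ∈ Icc p q, HasDerivAt Y (Y t*(-c/t)) t := fun t ht => by
    refine ((hasDerivAt_log_div_two_pi (h0 t ht).1.ne').ofReal_comp.mul_const (-c)).cexp.congr_deriv ?_
    simp only [hY]; push_cast; ring
  have dQ : ∀ t ∈ Icc p q, HasDerivAt (fun t : ℝ => (t : ℂ)*(P t - Y t)) ((1 - c)*(P t - Y t) + r t) t := fun t ht => by
    obtain ⟨h1, h2, -⟩ := h0 t ht
    refine ((hasDerivAt_id t).ofReal_comp.mul ((dP t ht).sub (dY t ht))).congr_deriv ?_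
    have e1 : (t : ℂ) ≠ 0 := mod_cast h1.ne'
    have e2 : (t + y : ℂ) ≠ 0 := mod_cast h2.ne'
    simp only [hr, hc, id, ofReal_one, Pi.sub_apply]; field_simp; ring
  have cP : ContinuousOn P (Icc p q) := HasDerivAt.continuousOn dP
  have cY : ContinuousOn Y (Icc p q) := HasDerivAt.continuousOn dY
  have cl : ContinuousOn l (Icc p q) := fun t ht =>
    (hasDerivAt_deriv_chiPairPhase (h0 t ht).1.ne' (h0 t ht).2.1.ne').neg.continuousAt.continuousWithinAt.congr
      (fun u _ => (neg_sub _ _).symm) (neg_sub _ _).symm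
  have cr : ContinuousOn r (Icc p q) := by
    refine cP.mul (.add (.div (by fun_prop) (by fun_prop) fun t ht => ?_) (by fun_prop))
    exact_mod_cast (h0 t ht).2.1.ne'
  have i1 : IntervalIntegrable (fun t => (1 - c)*(P t - Y t)) volume p q :=
    (continuousOn_const.mul (cP.sub cY)).intervalIntegrable_of_Icc hpq
  have i2 : IntervalIntegrable r volume p q := cr.intervalIntegrable_of_Icc hpq
  have hu : uIcc p q = Icc p q := uIcc_of_le hpq
  have hFTC := integral_eq_sub_of_hasDerivAt (fun t ht => dQ t (hu ▸ ht)) (i1.add i2)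
  rw [integral_add i1 i2, integral_const_mul] at hFTC
  have e3 : ∫ t in p..q, (P t - ((t/(2*π) : ℝ) : ℂ)^(-c)) = ∫ t in p..q, (P t - Y t) :=
    integral_congr fun t ht => by rw [← hYe t (hu ▸ ht)]
  have hp0 : 0 < p := by linarith
  have hI : ‖∫ t in p..q, r t‖ ≤ rexp (2*D)*(|y| + 4*y^2)*log N := by
    have ii : IntervalIntegrable (fun t : ℝ => 1/t) volume p q :=
      (continuousOn_const.div continuousOn_id fun t ht => (h0 t ht).1.ne').intervalIntegrable_of_Icc hpq
    refine (norm_integral_le_of_norm_le hpq (.of_forall fun t ht => hrle t (Ioc_subset_Icc_self ht)) (ii.const_mul _)).trans ?_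
    rw [integral_const_mul, integral_one_div_of_pos hp0 (by linarith)]
    gcongr
    · exact div_pos (by linarith) hp0
    · exact (div_le_self (by linarith) (by linarith)).trans (by linarith)
  have n1 : ∀ t ∈ Icc p q, ‖(t : ℂ)*(P t - Y t)‖ ≤ 3*rexp (2*D)*(|y| + 4*y^2) := fun t ht => by
    rw [norm_mul, norm_real, norm_of_nonneg (h0 t ht).1.le]; exact hdiff t ht
  rw [e3, eq_sub_of_add_eq hFTC]
  refine (norm_sub_le_of_le (norm_sub_le_of_le (n1 q ⟨hpq, le_rfl⟩) (n1 p ⟨le_rfl, hpq⟩)) hI).trans ?_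
  have : 0 ≤ rexp (2*D)*(|y| + 4*y^2) := by positivity
  nlinarith

/-- If |y| ≥ √N, the two integrals are small separately: the first by oscillation, the second
because its primitive is O(N/|1 − c|). If |y| < √N, the range t ≤ 2|y| + 1200 is bounded trivially,
and beyond it the product is compared with the power by partial integration. -/
lemma exists_norm_integral_chiPair_sub_le {D : ℝ} (hD : 0 ≤ D) : ∃ K : ℝ, 0 ≤ K ∧ ∀ N α β y q : ℝ,
    100*(D + 1) ≤ log N → log N*|α| ≤ D → log N*|β| ≤ D → 2*π ≤ q → q + |y| ≤ N →
    ‖∫ t in (2*π)..q, (chiPair α β y t - ((t/(2*π) : ℝ) : ℂ)^(-(β - α + y*I : ℂ)))‖ ≤ K*(√N*log N) := by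
  obtain ⟨K₁, hK₁, h1⟩ := exists_norm_integral_chiPair_le hD
  obtain ⟨K₂, hK₂, h2⟩ := exists_norm_chiPair_le hD
  set E := rexp (2*D)
  refine ⟨K₁ + (E + 7) + ((K₂ + E)*1202 + 19200*E + 35*E), by positivity, fun N α β y q hNL hα hβ hq hqN => ?_⟩
  have hpi := pi_gt_three
  have hpi4 := pi_lt_four
  have hy0 := abs_nonneg y
  have hN0 : 0 < N := by linarith
  have hN1 : 1 ≤ √N := one_le_sqrt.2 (by linarith)
  have hL1 : 1 ≤ log N := by linarith
  have hNL' : √N ≤ √N*log N := le_mul_of_one_le_right (by linarith) hL1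
  have hNL'' : log N ≤ √N*log N := le_mul_of_one_le_left (by linarith) hN1
  have hss := mul_self_sqrt hN0.le
  have hα' := abs_le.1 (le_of_mul_le_mul_left (hα.trans (by linarith : D ≤ log N*(1/8))) (by linarith))
  have hβ' := abs_le.1 (le_of_mul_le_mul_left (hβ.trans (by linarith : D ≤ log N*(1/8))) (by linarith))
  set c : ℂ := β - α + y*I with hc
  have hre : (1 - c).re = 1 - (β - α) := by simp [hc]
  have him : (1 - c).im = -y := by simp [hc]
  have hc1 : 1/2 ≤ ‖1 - c‖ := (by rw [hre]; linarith : 1/2 ≤ (1 - c).re).trans (Complex.re_le_norm _)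
  have hcy : |y| ≤ ‖1 - c‖ := by have := abs_im_le_norm (1 - c); grind
  have hcre : log N*|(-c).re| ≤ 2*D := by
    have : (-c).re = α - β := by simp [hc]
    rw [this]; nlinarith [abs_sub α β]
  have hX : ∀ p r, IntervalIntegrable (chiPair α β y) volume p r := fun p r =>
    (continuous_chiPair (by linarith) (by linarith) y).intervalIntegrable _ _
  have hY : ∀ p r, 2*π ≤ p → 2*π ≤ r → IntervalIntegrable (fun t : ℝ => ((t/(2*π) : ℝ) : ℂ)^(-c)) volume p r := fun p r hp hr =>
    ((continuousOn_div_two_pi_cpow (lt_min (by linarith) (by linarith)) c).mono Set.Subset.rfl).intervalIntegrable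
  have hYle : ∀ t, 2*π ≤ t → t ≤ q → ‖((t/(2*π) : ℝ) : ℂ)^(-c)‖ ≤ E := fun t h h' => norm_div_two_pi_cpow_le hcre h (by linarith)
  rcases le_total √N |y| with hy | hy
  · have b1 := h1 N α β y q hNL hα hβ hy hq hqN
    have hX1 : 1 ≤ q/(2*π) := by rw [one_le_div (by positivity)]; exact hq
    have b2 := integral_div_two_pi_cpow hX1 (c := c) (by rintro h; rw [h, sub_self, norm_zero] at hc1; linarith)
    rw [mul_div_cancel₀ _ (by positivity)] at b2
    have b3 : ‖∫ t in (2*π)..q, ((t/(2*π) : ℝ) : ℂ)^(-c)‖ ≤ (E + 7)*√N := by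
      rw [b2, norm_mul, norm_div, ← mul_div_assoc, div_le_iff₀ (by linarith), sub_eq_add_neg 1 c, cpow_add _ _ (by
        exact_mod_cast (by positivity : q/(2*π) ≠ 0)), cpow_one]
      have n1 : ‖((q/(2*π) : ℝ) : ℂ)*((q/(2*π) : ℝ) : ℂ)^(-c) - 1‖ ≤ q/(2*π)*E + 1 := by
        refine norm_sub_le_of_le ?_ norm_one.le
        rw [norm_mul, norm_real, norm_of_nonneg (by positivity)]
        exact mul_le_mul_of_nonneg_left (hYle q hq le_rfl) (by positivity)
      have n2 : ‖(2*π : ℂ)‖ = 2*π := by rw [← Complex.ofReal_ofNat, ← ofReal_mul, norm_real, norm_of_nonneg (by positivity)]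
      rw [n2]
      have n3 : N ≤ √N*‖1 - c‖ := by exact hss.symm.trans_le (by gcongr; exact hy.trans hcy)
      calc _ ≤ 2*π*(q/(2*π)*E + 1) := by gcongr
        _ = q*E + 2*π := by field_simp
        _ ≤ (E + 7)*N := by linarith [mul_le_mul_of_nonneg_right (by linarith : q ≤ N) (exp_pos (2*D)).le, Real.pi_lt_d2]
        _ ≤ (E + 7)*(√N*‖1 - c‖) := by gcongr
        _ = _ := (mul_assoc _ _ _).symm
    rw [integral_sub (hX _ _) (hY _ _ le_rfl hq)]; refine (norm_sub_le_of_le b1 b3).trans ?_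
    have := mul_le_mul_of_nonneg_left hNL' (by positivity : 0 ≤ E + 7)
    have : 0 ≤ ((K₂ + E)*1202 + 19200*E + 35*E)*(√N*log N) := by positivity
    linarith
  · set m := min (2*|y| + 1200) q with hm
    have hm1 : 2*π ≤ m := le_min (by linarith) hq
    have hmq : m ≤ q := min_le_right _ _
    have b1 : ‖∫ t in (2*π)..m, (chiPair α β y t - ((t/(2*π) : ℝ) : ℂ)^(-c))‖ ≤ (K₂ + E)*(1202*√N) := by
      have := norm_integral_le_of_norm_le_const (a := 2*π) (b := m) (C := K₂ + E)
        (f := fun t => chiPair α β y t - ((t/(2*π) : ℝ) : ℂ)^(-c)) fun t ht => by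
          rw [uIoc_of_le hm1] at ht
          exact norm_sub_le_of_le (h2 N α β y t hNL hα hβ (by linarith [ht.1]) (by linarith [ht.2])) (hYle t ht.1.le (by linarith [ht.2]))
      refine this.trans (mul_le_mul_of_nonneg_left ?_ (by positivity))
      rw [abs_of_nonneg (by linarith)]
      linarith [min_le_left (2*|y| + 1200) q]
    have b2 : ‖∫ t in m..q, (chiPair α β y t - ((t/(2*π) : ℝ) : ℂ)^(-c))‖ ≤ 19200*E*log N + 35*E*(√N*log N) := by
      rcases le_total q (2*|y| + 1200) with h | h
      · rw [hm, min_eq_right h, integral_same, norm_zero]; positivity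
      have hme : m = 2*|y| + 1200 := min_eq_left h
      have hty : ∀ t ∈ Icc m q, 600 ≤ t + y := fun t ht => by linarith [ht.1, neg_abs_le y]
      obtain ⟨iP, b3⟩ := norm_integral_chiPair_sub_le (ς := 1) (y := y) (by linarith) hα hβ (by linarith) hmq hqN
        (fun t ht => (hty t ht).trans (le_abs_self _)) fun t ht => sign_of_pos (by linarith [hty t ht])
      have b4 := norm_one_sub_mul_integral_sub_le hL1 hα hβ (abs_le.2 ⟨by linarith, by linarith⟩) hme.ge hmq hqN
      rw [norm_mul] at b4
      have b5 := le_of_mul_le_mul_left (b4.trans (?_ : _ ≤ ‖1 - c‖*(35*E*(√N*log N)))) (by linarith)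
      · rw [integral_sub iP (hY _ _ hm1 hq)] at b5; rw [integral_sub (hX _ _) (hY _ _ hm1 hq)]
        rw [ofReal_one, sub_self, zero_mul, mul_zero, exp_zero, one_mul] at b3
        have := norm_add_le_of_le b3 b5
        rwa [sub_add_sub_cancel] at this
      · have : |y| + 4*y^2 ≤ ‖1 - c‖*(5*√N) := by
          linarith [mul_le_mul hcy hy hy0 (norm_nonneg (1 - c)), mul_le_mul hcy hN1 zero_le_one (norm_nonneg (1 - c)), sq_abs y, sq |y|]
        calc _ ≤ 7*E*(‖1 - c‖*(5*√N))*log N := by gcongr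
          _ = _ := by ring
    have hXY : ∀ p r, 2*π ≤ p → 2*π ≤ r → IntervalIntegrable (fun t => chiPair α β y t - ((t/(2*π) : ℝ) : ℂ)^(-c)) volume p r :=
      fun p r hp hr => (hX p r).sub (hY p r hp hr)
    rw [← integral_add_adjacent_intervals (hXY _ m le_rfl hm1) (hXY m q hm1 hq)]
    refine (norm_add_le_of_le b1 b2).trans ?_
    have := mul_le_mul_of_nonneg_left hNL' (by positivity : 0 ≤ (K₂ + E)*1202)
    have := mul_le_mul_of_nonneg_left hNL'' (by positivity : 0 ≤ 19200*E)
    have : 0 ≤ (K₁ + (E + 7))*(√N*log N) := by positivity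
    linarith

/-! ### Small shifts: gaining a factor |c| -/

/-- The real points missing from the off-axis version are supplied by continuity along vertical
lines. -/
lemma zetaChi_mul_zetaChi_one_sub_of_re {s : ℂ} (h0 : 0 < s.re) (h1 : s.re < 1) : zetaChi s*zetaChi (1 - s) = 1 := by
  have hc : ∀ f : ℝ → ℂ, Continuous f → (∀ t, (f t).re < 1) → Continuous fun t => zetaChi (f t) := fun f hf h =>
    continuous_iff_continuousAt.2 fun t => (differentiableAt_zetaChi (h t)).continuousAt.comp hf.continuousAt
  have h : (fun t : ℝ => zetaChi (s.re + t*I)*zetaChi (1 - (s.re + t*I))) = fun _ => 1 :=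
    Continuous.ext_on (dense_compl_singleton (0 : ℝ)) ((hc _ (by fun_prop) fun t => by simpa).mul (hc _ (by fun_prop) fun t => by simpa))
      continuous_const fun t ht => zetaChi_mul_zetaChi_one_sub (by simpa using ht)
  simpa using congrFun h s.im

lemma chiPair_eq (α t : ℝ) (z : ℂ) : chiPair α (α + z.re) z.im t = zetaChi (1/2 + α + t*I + z)*zetaChi (1/2 - α - t*I) := by
  rw [chiPair]
  congr 2
  nth_rewrite 3 [← re_add_im z]
  push_cast
  ring

/-- The product with g is holomorphic in the shift z and equals 1 at z = 0, since χ(s)χ(1 − s) = 1.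
By the Schwarz lemma a bound B on the disc of radius r improves to (B/r)‖c‖ inside; outside the disc
the bound at c itself suffices. -/
lemma norm_chiPair_mul_sub_one_le {α t r B : ℝ} {g : ℂ → ℂ} {c : ℂ} (hα : |α| ≤ 1/8) (hr0 : 0 < r) (hr : r ≤ 1/4)
    (hg : Differentiable ℂ g) (hg0 : g 0 = 1)
    (hB : ∀ z : ℂ, z = c ∨ ‖z‖ < r → ‖chiPair α (α + z.re) z.im t*g z - 1‖ ≤ B) :
    ‖chiPair α (α + c.re) c.im t*g c - 1‖ ≤ B/r*‖c‖ := by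
  have hB0 : 0 ≤ B := (norm_nonneg _).trans (hB c (Or.inl rfl))
  rcases le_or_gt r ‖c‖ with h | h
  · refine (hB c (Or.inl rfl)).trans ?_
    rw [div_mul_eq_mul_div, le_div_iff₀ hr0]; gcongr
  have ha := abs_le.1 hα
  set f : ℂ → ℂ := fun z => zetaChi (1/2 + α + t*I + z)*zetaChi (1/2 - α - t*I)*g z with hf
  have hf0 : f 0 = 1 := by
    have := zetaChi_mul_zetaChi_one_sub_of_re (s := 1/2 + α + t*I) (by simp; linarith) (by simp; linarith)
    grind
  have hfd : DifferentiableOn ℂ f (ball 0 r) := fun z hz => by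
    have hz' : |z.re| < r := (abs_re_le_norm z).trans_lt (by simpa using hz)
    refine ((DifferentiableAt.mul_const ?_ _).mul hg.differentiableAt).differentiableWithinAt
    exact (differentiableAt_zetaChi (by simp; linarith [(abs_lt.1 hz').2])).comp z (by fun_prop)
  have := Complex.dist_le_div_mul_dist_of_mapsTo_ball (R₂ := B) hfd (fun z hz => by
    rw [Metric.mem_closedBall, dist_eq_norm, hf0]; simp only [hf, ← chiPair_eq]
    exact hB z (Or.inr (by simpa using hz))) (z := c) (by simpa using h)
  rw [chiPair_eq]
  rwa [dist_eq_norm, dist_zero_right, hf0] at this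

/-- Stirling's formula gives O(1/t) on the disc |z| < 1/4, with compactness in place of it for
bounded t, and the Schwarz lemma adds the factor ‖c‖. -/
lemma exists_norm_chiPair_mul_cpow_sub_one_le : ∃ K : ℝ, 0 ≤ K ∧ ∀ (α t : ℝ) (c : ℂ), |α| ≤ 1/8 → 2*π ≤ t → ‖c‖ < 1/4 →
    ‖chiPair α (α + c.re) c.im t*((t/(2*π) : ℝ) : ℂ)^c - 1‖ ≤ K*‖c‖*(1/t) := by
  obtain ⟨K, hK0, hK⟩ := exists_norm_zetaChi_le_of_abs_im_le 1301
  set M := (K*K*rexp (log 1300) + 1)*1300 + 10803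
  refine ⟨M*4, by positivity, fun α t c hα ht hc => ?_⟩
  have hpi := pi_gt_three
  have hpi4 := pi_lt_four
  have ha := abs_le.1 hα
  have ht0 : 0 < t := by linarith
  have hbase : ((t/(2*π) : ℝ) : ℂ) ≠ 0 := mod_cast (by positivity : t/(2*π) ≠ 0)
  have hmain : ∀ z : ℂ, ‖z‖ < 1/4 → ‖chiPair α (α + z.re) z.im t*((t/(2*π) : ℝ) : ℂ)^z - 1‖ ≤ M/t := fun z hz => by
    have hre := (abs_re_le_norm z).trans hz.le
    have him := (abs_im_le_norm z).trans hz.le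
    have hre' := abs_le.1 hre
    have him' := abs_le.1 him
    -- For t ≥ 1300 both t and t + Im z exceed 600, as Stirling's formula requires.
    rcases le_total t 1300 with h | h
    · rw [le_div_iff₀ ht0]
      have n1 : ‖chiPair α (α + z.re) z.im t‖ ≤ K*K := by
        rw [chiPair, norm_mul]
        refine mul_le_mul (hK _ ?_ ?_ ?_) (hK _ ?_ ?_ ?_) (norm_nonneg _) hK0 <;> simp [abs_le] <;> first | linarith | (constructor <;> linarith)
      have n2 : ‖((t/(2*π) : ℝ) : ℂ)^z‖ ≤ rexp (log 1300) :=
        norm_div_two_pi_cpow_le (mul_le_of_le_one_right (log_nonneg (by norm_num)) (by linarith)) ht h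
      have n3 : ‖chiPair α (α + z.re) z.im t*((t/(2*π) : ℝ) : ℂ)^z - 1‖ ≤ K*K*rexp (log 1300) + 1 := by
        refine norm_sub_le_of_le ?_ norm_one.le
        rw [norm_mul]; gcongr
      have := mul_le_mul n3 h ht0.le (by positivity)
      linarith
    · have hty : 0 < t + z.im := by linarith
      have hA : chiPairAmplitude α (α + z.re) z.im t =
          ‖(chiPairAmplitude α (α + z.re) z.im t : ℂ)*cexp (I*chiPairPhase z.im t)‖ := by
        rw [norm_mul, mul_comm I, norm_exp_ofReal_mul_I, mul_one, norm_real]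
        exact (norm_of_nonneg (exp_pos _).le).symm
      have hX := (norm_chiPair_sub_le (α := α) (β := α + z.re) (y := z.im) (t := t) (by linarith) (abs_le.2 ⟨by linarith, by linarith⟩)
        (by linarith) (by grind)).trans_eq (congrArg (HMul.hMul _) hA)
      have hc : -(((α + z.re : ℝ) : ℂ) - α + z.im*I) = -z := by simp
      rw [sign_of_pos hty, ofReal_one, sub_self, zero_mul, mul_zero, exp_zero, one_mul,
        chiPairAmplitude_mul_exp_eq ht0, hc, abs_of_pos hty] at hX
      set E := cexp (chiPairExponent (α + z.re) z.im t)
      have hEx : ‖chiPairExponent (α + z.re) z.im t‖ ≤ 1/t := by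
        refine (norm_chiPairExponent_le (abs_le.2 ⟨by linarith, by linarith⟩) ht0 (by linarith)).trans ?_
        gcongr; rw [← sq_abs]; nlinarith [abs_nonneg z.im]
      have h1t : 1/t ≤ 1 := by rw [div_le_one ht0]; linarith
      have e3 : rexp 1 ≤ 3 := by linarith [Real.exp_one_lt_d9]
      have n1 : ‖E - 1‖ ≤ 1/t*3 := (norm_exp_sub_one_le_mul_exp _).trans (mul_le_mul hEx
        ((exp_le_exp.2 (hEx.trans h1t)).trans e3) (exp_pos _).le (by positivity))
      have n2 : ‖E‖ ≤ 3 := (Complex.norm_exp_le_exp_norm _).trans ((exp_le_exp.2 (hEx.trans h1t)).trans e3)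
      have hinv : ((t/(2*π) : ℝ) : ℂ)^(-z)*((t/(2*π) : ℝ) : ℂ)^z = 1 := by rw [← cpow_add _ _ hbase, neg_add_cancel, cpow_zero]
      have n3 : ‖chiPair α (α + z.re) z.im t*((t/(2*π) : ℝ) : ℂ)^z - E‖ ≤ 3600/t*3 := by
        have e : chiPair α (α + z.re) z.im t*((t/(2*π) : ℝ) : ℂ)^z - E =
            (chiPair α (α + z.re) z.im t - ((t/(2*π) : ℝ) : ℂ)^(-z)*E)*((t/(2*π) : ℝ) : ℂ)^z := by
          grind
        rw [e, norm_mul]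
        have hn : ‖((t/(2*π) : ℝ) : ℂ)^(-z)‖*‖((t/(2*π) : ℝ) : ℂ)^z‖ = 1 := by rw [← norm_mul, hinv, norm_one]
        have h2 : 1/(t + z.im) ≤ 2/t := by rw [div_le_div_iff₀ hty ht0]; linarith
        calc _ ≤ 1200*(1/t + 2/t)*‖((t/(2*π) : ℝ) : ℂ)^(-z)*E‖*‖((t/(2*π) : ℝ) : ℂ)^z‖ := by
              gcongr; exact hX.trans (by gcongr)
          _ = 3600/t*‖E‖*(‖((t/(2*π) : ℝ) : ℂ)^(-z)‖*‖((t/(2*π) : ℝ) : ℂ)^z‖) := by rw [norm_mul]; ring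
          _ ≤ _ := by rw [hn, mul_one]; gcongr
      have := norm_add_le_of_le n3 n1
      rw [sub_add_sub_cancel] at this; refine this.trans ?_
      rw [show 3600/t*3 + 1/t*3 = 10803/t by ring]
      gcongr
      have : 0 ≤ (K*K*rexp (log 1300) + 1)*1300 := by positivity
      linarith
  have := norm_chiPair_mul_sub_one_le (g := fun z => ((t/(2*π) : ℝ) : ℂ)^z) hα (by norm_num) le_rfl
    (fun z => DifferentiableAt.const_cpow differentiableAt_id (Or.inl hbase)) (cpow_zero _)
    (B := M/t) (c := c) fun z hz => hmain z (hz.elim (fun h => h ▸ hc) id)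
  refine this.trans_eq ?_
  ring

lemma exists_norm_integral_chiPair_sub_le_mul_norm {D : ℝ} (hD : 0 ≤ D) : ∃ K : ℝ, 0 ≤ K ∧ ∀ (N α q : ℝ) (c : ℂ),
    100*(D + 1) ≤ log N → log N*|α| ≤ D → log N*|c.re| ≤ 2*D → ‖c‖ < 1/4 → 2*π ≤ q → q ≤ N →
    ‖∫ t in (2*π)..q, (chiPair α (α + c.re) c.im t - ((t/(2*π) : ℝ) : ℂ)^(-c))‖ ≤ K*(‖c‖*log N) := by
  obtain ⟨K, hK0, hK⟩ := exists_norm_chiPair_mul_cpow_sub_one_le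
  refine ⟨rexp (2*D)*K, by positivity, fun N α q c hNL hα hκ hc hq hqN => ?_⟩
  have hpi := pi_gt_three
  have hα' := le_of_mul_le_mul_left (hα.trans (by linarith : D ≤ log N*(1/8))) (by linarith)
  have hpt : ∀ t ∈ Set.Ioc (2*π) q, ‖chiPair α (α + c.re) c.im t - ((t/(2*π) : ℝ) : ℂ)^(-c)‖ ≤
      rexp (2*D)*(K*‖c‖)*(1/t) := fun t ht => by
    have ht0 : 0 < t := by linarith [ht.1]
    have hinv : ((t/(2*π) : ℝ) : ℂ)^c*((t/(2*π) : ℝ) : ℂ)^(-c) = 1 := by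
      rw [← cpow_add _ _ (mod_cast (by positivity : t/(2*π) ≠ 0)), add_neg_cancel, cpow_zero]
    have e : chiPair α (α + c.re) c.im t - ((t/(2*π) : ℝ) : ℂ)^(-c) =
        ((t/(2*π) : ℝ) : ℂ)^(-c)*(chiPair α (α + c.re) c.im t*((t/(2*π) : ℝ) : ℂ)^c - 1) := by
      grind
    rw [e, norm_mul, mul_assoc]
    exact mul_le_mul (norm_div_two_pi_cpow_le (by rwa [neg_re, abs_neg]) ht.1.le (ht.2.trans hqN))
      (hK α t c hα' ht.1.le hc) (norm_nonneg _) (exp_pos _).le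
  have ii : IntervalIntegrable (fun t : ℝ => 1/t) volume (2*π) q :=
    (continuousOn_const.div continuousOn_id fun t ht => by grind).intervalIntegrable_of_Icc hq
  refine (norm_integral_le_of_norm_le hq (.of_forall hpt) (ii.const_mul _)).trans ?_
  rw [integral_const_mul, integral_one_div_of_pos (by linarith) (by linarith), mul_assoc, mul_assoc, mul_assoc]
  gcongr
  · exact div_pos (by linarith) (by linarith)
  · exact (div_le_self (by linarith) (by linarith)).trans hqN

/-! ### The defect of the moment -/

lemma norm_riemannZeta₀_one_add_le {D : ℝ} {N : ℕ} {c : ℂ} (hD : 0 ≤ D) (hL : 100*(D + 1) ≤ log N)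
    (hκ : log N*|c.re| ≤ 2*D) (hy : |c.im| ≤ N) : ‖riemannZeta₀ (1 + c)‖ ≤ 305*rexp (3*D)*log N := by
  have hN0 : (0 : ℝ) < N := ((abs_nonneg _).trans hy).lt_of_ne fun h => by rw [← h, log_zero] at hL; linarith
  have hN2 : (2 : ℝ) ≤ N := by linarith [log_le_sub_one_of_pos hN0]
  have hκ' := abs_le.1 (le_of_mul_le_mul_left (hκ.trans (by linarith : 2*D ≤ log N*(1/8))) (by linarith))
  have h := norm_riemannZeta₀_le_convexity (C := 2*D) (by linarith) (N := N) (mod_cast hN2) (s := 1 + c)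
    (by simp; linarith) (by simp; linarith) (by
      simp only [add_re, one_re]; rw [add_le_add_iff_left, le_div_iff₀ (by linarith), mul_comm]
      exact (mul_le_mul_of_nonneg_left (le_abs_self _) (by linarith)).trans hκ) (by simpa using hy)
  refine h.trans ?_
  rw [rpow_def_of_pos hN0, mul_assoc 305, ← Real.exp_add]
  gcongr
  rw [add_re, one_re]
  nlinarith [mul_le_mul_of_nonneg_left (neg_abs_le c.re) (by linarith : 0 ≤ log N)]

/-- The polar parts of ζ(1 + c) and ζ(1 − c) combine to (1 − X)/c, which is bounded near c = 0 as
soon as X − 1 = O(‖c‖). -/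
lemma riemannZeta_add_mul_eq {c : ℂ} (hc : c ≠ 0) (X : ℂ) : ζ (1 + c) + ζ (1 - c)*X =
    riemannZeta₀ (1 + c) + riemannZeta₀ (1 - c)*X - (X - 1)/c := by
  rw [riemannZeta_eq_inv_sub_add (s := 1 + c) (by simpa using hc), riemannZeta_eq_inv_sub_add (s := 1 - c) (by simpa using hc),
    add_sub_cancel_left, sub_sub_cancel_left, inv_neg]
  ring

lemma norm_riemannZeta_add_mul_le {c : ℂ} (hc : c ≠ 0) (X : ℂ) : ‖ζ (1 + c) + ζ (1 - c)*X‖ ≤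
    ‖riemannZeta₀ (1 + c)‖ + ‖riemannZeta₀ (1 - c)‖*‖X‖ + ‖X - 1‖/‖c‖ := by
  rw [riemannZeta_add_mul_eq hc, ← norm_mul, ← norm_div]
  exact norm_sub_le_of_le (norm_add_le _ _) le_rfl

lemma norm_riemannZeta_half_add_le {D : ℝ} {N : ℕ} {s : ℂ} (hD : 0 ≤ D) (hL : 100*(D + 1) ≤ log N)
    (hs : log N*|s.re - 1/2| ≤ D) (hy : |s.im| ≤ N) :
    ‖ζ s‖ ≤ 309*rexp D*(N : ℝ)^(1/4 : ℝ)*log N := by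
  have hN0 : (0 : ℝ) < N := ((abs_nonneg _).trans hy).lt_of_ne fun h => by rw [← h, log_zero] at hL; linarith
  have hN2 : (2 : ℝ) ≤ N := by linarith [log_le_sub_one_of_pos hN0]
  have hs' := abs_le.1 (le_of_mul_le_mul_left (hs.trans (by linarith : D ≤ log N*(1/8))) (by linarith))
  have h := norm_riemannZeta₀_le_convexity le_rfl (N := N) (mod_cast hN2) (s := s)
    (by linarith) (by linarith) (by rw [zero_div]; linarith) hy
  have hs1 : s ≠ 1 := fun h => by rw [h, one_re] at hs'; linarith
  rw [riemannZeta_eq_inv_sub_add hs1]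
  have h2 : ‖(s - 1)⁻¹‖ ≤ 4 := by
    have := abs_re_le_norm (s - 1)
    rw [norm_inv, inv_le_comm₀ (norm_pos_iff.2 (sub_ne_zero.2 hs1)) (by norm_num)]
    rw [sub_re, one_re, abs_of_neg (by linarith)] at this
    linarith
  refine (norm_add_le_of_le h2 h).trans ?_
  have h3 : (N : ℝ)^((1 - s.re)/2) ≤ rexp D*(N : ℝ)^(1/4 : ℝ) := by
    rw [rpow_def_of_pos hN0, rpow_def_of_pos hN0, ← Real.exp_add]; gcongr
    nlinarith [mul_le_mul_of_nonneg_left (neg_abs_le (s.re - 1/2)) (by linarith : 0 ≤ log N)]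
  have h4 : 1 ≤ rexp D*(N : ℝ)^(1/4 : ℝ)*log N :=
    one_le_mul_of_one_le_of_one_le (one_le_mul_of_one_le_of_one_le (one_le_exp hD) (one_le_rpow (by linarith) (by norm_num)))
      (by linarith)
  have h5 := mul_le_mul_of_nonneg_right h3 (by linarith : 0 ≤ 305*log N)
  rw [Real.exp_zero]
  linarith

/-- The difference of the two integrands, with the second shift absorbed into the variable. -/
def momentDefect (α : ℝ) (c : ℂ) (t : ℝ) : ℂ := ζ (1 - ((1/2 + α : ℝ) + t*I))*ζ ((1/2 + α : ℝ) + t*I + c) -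
    (ζ (1 + c) + ζ (1 - c)*chiPair α (α + c.re) c.im t)

lemma continuous_momentDefect {α : ℝ} {c : ℂ} (hα : |α| ≤ 1/8) (hβ : |α + c.re| ≤ 1/8) : Continuous (momentDefect α c) := by
  have hα' := abs_le.1 hα
  have hβ' := abs_le.1 hβ
  have h1 : Continuous fun t : ℝ => ζ (1 - ((1/2 + α : ℝ) + t*I)) := by
    refine ((continuous_riemannZeta_line (z := 1 - (1/2 + α : ℝ)) (by simp; linarith)).comp continuous_neg).congr fun t => ?_
    rw [comp_apply]; congr 1; push_cast; ring
  have h2 : Continuous fun t : ℝ => ζ ((1/2 + α : ℝ) + t*I + c) := by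
    simpa only [add_right_comm] using continuous_riemannZeta_line (z := (1/2 + α : ℝ) + c) (by simp; linarith)
  exact (h1.mul h2).sub (continuous_const.add (continuous_const.mul
    (continuous_chiPair (α := α) (β := α + c.re) (y := c.im) (by linarith) (by linarith))))

/-- Extends bounds from positive heights to negative ones, which occur once the variable has been
translated by Im b. -/
lemma momentDefect_neg (α : ℝ) (c : ℂ) (t : ℝ) : momentDefect α c (-t) = conj (momentDefect α (conj c) t) := by
  simp only [momentDefect, chiPair, map_sub, map_mul, map_add, ← riemannZeta_conj, ← zetaChi_conj, map_one, conj_ofReal,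
    conj_I, conj_conj, conj_re, conj_im, map_div₀, map_ofNat]
  push_cast
  ring_nf

set_option maxHeartbeats 1000000 in
-- On [0, 2π] the defect is bounded pointwise: convexity gives N^(1/4) log N for each zeta factor,
-- and the main term is O(log N) by the Schwarz lemma. Beyond 2π the moment with a power in its main
-- term is used, and ζ(1 − c) times the difference between `chiPair` and that power is added.
lemma exists_norm_integral_momentDefect_le_of_nonneg {D : ℝ} (hD : 0 ≤ D) : ∃ K : ℝ, 0 ≤ K ∧
    ∀ (N : ℕ) (α τ : ℝ) (c : ℂ), 100*(D + 1) ≤ log N → log N*|α| ≤ D → log N*|α + c.re| ≤ D →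
    c ≠ 0 → 0 ≤ τ → τ + |c.im| ≤ N → 7 + |c.im| ≤ N →
    ‖∫ t in (0 : ℝ)..τ, momentDefect α c t‖ ≤ K*(√N*log N^2) := by
  obtain ⟨K₁, hK₁, h1⟩ := exists_norm_integral_zeta_mul_zeta_sub_main_le hD
  obtain ⟨K₂, hK₂, h2⟩ := exists_norm_integral_chiPair_sub_le hD
  obtain ⟨K₃, hK₃, h3⟩ := exists_norm_integral_chiPair_sub_le_mul_norm hD
  obtain ⟨K₄, hK₄, h4⟩ := exists_norm_chiPair_le hD
  obtain ⟨K₅, hK₅, h5⟩ := exists_norm_zetaChi_le_of_abs_im_le 8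
  set Z := 305*rexp (3*D)
  have hZ0 : 0 ≤ Z := by positivity
  set B := K₄ + K₅*K₅ + 1
  have hB0 : 0 ≤ B := by positivity
  refine ⟨7*((309*rexp D)^2 + (Z*(1 + B) + 4*B)) + (K₁ + ((Z + 4)*K₂ + (Z + 4)*K₃)), by positivity,
    fun N α τ c hL hα hβ hc hτ hτN hN => ?_⟩
  have hpi := pi_gt_three
  have hpi4 : π < 3.15 := Real.pi_lt_d2
  have hy0 := abs_nonneg c.im
  set L := log N with hLdef
  have hL1 : 1 ≤ L := by linarith
  have hN1 : 1 ≤ √(N : ℝ) := one_le_sqrt.2 (by linarith)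
  have hα8 := le_of_mul_le_mul_left (hα.trans (by linarith : D ≤ L*(1/8))) (by linarith)
  have hβ8 := le_of_mul_le_mul_left (hβ.trans (by linarith : D ≤ L*(1/8))) (by linarith)
  have hα' := abs_le.1 hα8
  have hκ : L*|c.re| ≤ 2*D := by
    have := abs_sub (α + c.re) α
    rw [add_sub_cancel_left] at this; nlinarith
  have hκ' := abs_le.1 (le_of_mul_le_mul_left (hκ.trans (by linarith : 2*D ≤ L*(1/8))) (by linarith))
  have hc0 : 0 < ‖c‖ := norm_pos_iff.2 hc
  have z1 := norm_riemannZeta₀_one_add_le hD hL hκ (by linarith)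
  have z2 := norm_riemannZeta₀_one_add_le (c := -c) hD hL (by rwa [neg_re, abs_neg]) (by rw [neg_im, abs_neg]; linarith)
  rw [← sub_eq_add_neg] at z2
  have hLL : L ≤ √N*L^2 := by nlinarith [mul_le_mul hN1 hL1 zero_le_one (by linarith)]
  have hLL2 : L^2 ≤ √N*L^2 := le_mul_of_one_le_left (sq_nonneg L) hN1
  have hi := fun p q => (continuous_momentDefect hα8 hβ8).intervalIntegrable (μ := volume) p q
  set m := min τ (2*π) with hm
  have hm0 : 0 ≤ m := le_min hτ (by linarith)
  have b1 : ‖∫ t in (0 : ℝ)..m, momentDefect α c t‖ ≤ 7*((309*rexp D)^2 + (Z*(1 + B) + 4*B))*(√N*L^2) := by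
    have := norm_integral_le_of_norm_le_const (a := 0) (b := m) (f := momentDefect α c)
      (C := ((309*rexp D)^2 + (Z*(1 + B) + 4*B))*(√N*L^2)) fun t ht => by
      rw [uIoc_of_le hm0] at ht
      have ht0 := ht.1
      have ht2 : t ≤ 2*π := ht.2.trans (min_le_right _ _)
      have hty := abs_add_le t c.im
      rw [abs_of_pos ht0] at hty
      have f1 := norm_riemannZeta_half_add_le (s := 1 - ((1/2 + α : ℝ) + t*I)) hD hL (by simp; ring_nf; rwa [abs_neg])
        (by simp; rw [abs_of_pos ht0]; linarith)
      have f2 := norm_riemannZeta_half_add_le (s := (1/2 + α : ℝ) + t*I + c) hD hL (by simp; ring_nf; exact hβ)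
        (by simp; linarith)
      have hX : ∀ z : ℂ, z = c ∨ ‖z‖ < 1/4 → ‖chiPair α (α + z.re) z.im t‖ ≤ K₄ + K₅*K₅ := by
        rintro z (rfl | hz)
        · exact (h4 N α _ _ t hL hα hβ ht0.le (by linarith)).trans (le_add_of_nonneg_right (by positivity))
        · have hre := abs_le.1 ((abs_re_le_norm z).trans hz.le)
          have him := abs_le.1 ((abs_im_le_norm z).trans hz.le)
          rw [chiPair, norm_mul]
          refine (mul_le_mul (h5 _ ?_ ?_ ?_) (h5 _ ?_ ?_ ?_) (norm_nonneg _) hK₅).trans (le_add_of_nonneg_left hK₄) <;>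
            simp [abs_le] <;> first | linarith | (constructor <;> linarith)
      have hX1 := norm_chiPair_mul_sub_one_le (g := fun _ => 1) (B := B) (c := c) hα8 (by norm_num) le_rfl
        (differentiable_const _) rfl fun z hz => by
          rw [mul_one]; exact norm_sub_le_of_le (hX z hz) norm_one.le
      rw [mul_one] at hX1
      have hG := norm_riemannZeta_add_mul_le hc (chiPair α (α + c.re) c.im t)
      have hG2 : ‖ζ (1 + c) + ζ (1 - c)*chiPair α (α + c.re) c.im t‖ ≤ (Z*(1 + B) + 4*B)*L := by
        have e1 : ‖chiPair α (α + c.re) c.im t - 1‖/‖c‖ ≤ 4*B := by rw [div_le_iff₀ hc0]; linarith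
        have e2 := mul_le_mul z2 ((hX c (Or.inl rfl)).trans (le_add_of_nonneg_right zero_le_one)) (norm_nonneg _) (by positivity)
        nlinarith [mul_le_mul_of_nonneg_left hL1 (by linarith : 0 ≤ 4*B)]
      have hq : ((N : ℝ)^(1/4 : ℝ))*(N : ℝ)^(1/4 : ℝ) = √N := by rw [← rpow_add (by linarith), sqrt_eq_rpow]; norm_num
      rw [momentDefect]
      have hF := mul_le_mul f1 f2 (norm_nonneg _) (by positivity)
      rw [← norm_mul, ← hLdef, show ∀ E n : ℝ, E*n*L*(E*n*L) = E^2*(n*n*L^2) by intros; ring, hq] at hF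
      refine (norm_sub_le_of_le hF hG2).trans ?_
      have := mul_le_mul_of_nonneg_left hLL (by positivity : 0 ≤ Z*(1 + B) + 4*B)
      linarith
    rw [sub_zero, abs_of_nonneg hm0] at this; refine this.trans ?_
    rw [mul_comm, mul_assoc 7]
    exact mul_le_mul_of_nonneg_right (by linarith [min_le_right τ (2*π)]) (by positivity)
  have b2 : ‖∫ t in m..τ, momentDefect α c t‖ ≤ (K₁ + ((Z + 4)*K₂ + (Z + 4)*K₃))*(√N*L^2) := by
    rcases le_total τ (2*π) with h | h
    · rw [hm, min_eq_left h, integral_same, norm_zero]; positivity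
    have hX1 : 1 ≤ τ/(2*π) := by rw [one_le_div (by positivity)]; exact h
    have hpτ : 2*π*(τ/(2*π)) = τ := by field_simp
    have a1 := h1 N (1/2 + α) (τ/(2*π)) c hL (by rwa [add_sub_cancel_left]) hκ hc hX1 (by rwa [hpτ])
    rw [hpτ] at a1
    set Y : ℝ → ℂ := fun t => ((t/(2*π) : ℝ) : ℂ)^(-c) with hY
    have hz : ‖ζ (1 - c)‖ ≤ 1/‖c‖ + Z*L := by
      rw [riemannZeta_eq_inv_sub_add (s := 1 - c) (by simpa using hc), sub_sub_cancel_left]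
      exact norm_add_le_of_le (by simp) z2
    have a2 : ‖ζ (1 - c) * ∫ t in (2*π)..τ, (chiPair α (α + c.re) c.im t - Y t)‖ ≤ ((Z + 4)*K₂ + (Z + 4)*K₃)*(√N*L^2) := by
      rw [norm_mul]
      -- For small c the factor ‖c‖ in the difference cancels the pole of ζ(1 − c); for ‖c‖ ≥ 1/4
      -- the value ζ(1 − c) is O(log N) and the general comparison suffices.
      rcases lt_or_ge ‖c‖ (1/4) with h' | h'
      · have := h3 N α τ c hL hα hκ h' h (by linarith)
        calc _ ≤ (1/‖c‖ + Z*L)*(K₃*(‖c‖*L)) := mul_le_mul hz this (norm_nonneg _) (by positivity)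
          _ = K₃*(L + Z*‖c‖*L^2) := by field_simp
          _ ≤ K₃*(√N*L^2 + Z*1*(√N*L^2)) := by gcongr; linarith
          _ ≤ _ := by
            have : 0 ≤ ((Z + 4)*K₂ + 3*K₃)*(√N*L^2) := by positivity
            linarith
      · have := h2 N α (α + c.re) c.im τ hL hα hβ h hτN
        have e : (((α + c.re : ℝ) : ℂ) - α + c.im*I) = c := by simp
        rw [e] at this
        have h4 : 1/‖c‖ ≤ 4*L := by rw [div_le_iff₀ hc0]; nlinarith
        calc _ ≤ (4*L + Z*L)*(K₂*(√N*L)) := mul_le_mul (hz.trans (by linarith)) this (norm_nonneg _) (by positivity)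
          _ = (Z + 4)*K₂*(√N*L^2) := by ring
          _ ≤ _ := by gcongr; exact le_add_of_nonneg_right (by positivity)
    have iY : IntervalIntegrable Y volume (2*π) τ := (continuousOn_div_two_pi_cpow (by linarith) c).intervalIntegrable_of_Icc h
    have iX := (continuous_chiPair (α := α) (β := α + c.re) (y := c.im) (by linarith) (by linarith)).intervalIntegrable
      (μ := volume) (2*π) τ
    have iXY : IntervalIntegrable (fun t => ζ (1 - c)*(chiPair α (α + c.re) c.im t - Y t)) volume (2*π) τ :=
      (iX.sub iY).const_mul _
    rw [← integral_const_mul] at a2; rw [hm, min_eq_right h]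
    have := norm_sub_le_of_le (a₁ := ∫ t in (2*π)..τ, (momentDefect α c t + ζ (1 - c)*(chiPair α (α + c.re) c.im t - Y t)))
      (r₁ := K₁*(√N*L^2)) ?_ a2
    · rw [integral_add (hi _ _) iXY, add_sub_cancel_right] at this; linarith
    · refine le_trans (le_of_eq (congrArg norm (integral_congr fun t _ => ?_))) a1
      simp only [momentDefect, hY]; ring
  rw [← integral_add_adjacent_intervals (hi 0 m) (hi m τ)]
  refine (norm_add_le_of_le b1 b2).trans_eq ?_
  ring

lemma exists_norm_integral_momentDefect_le {D : ℝ} (hD : 0 ≤ D) : ∃ K : ℝ, 0 ≤ K ∧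
    ∀ (N : ℕ) (α p q : ℝ) (c : ℂ), 100*(D + 1) ≤ log N → log N*|α| ≤ D → log N*|α + c.re| ≤ D →
    c ≠ 0 → |p| + |c.im| ≤ N → |q| + |c.im| ≤ N → 7 + |c.im| ≤ N →
    ‖∫ t in p..q, momentDefect α c t‖ ≤ K*(√N*log N^2) := by
  obtain ⟨K, hK0, hK⟩ := exists_norm_integral_momentDefect_le_of_nonneg hD
  refine ⟨2*K, by positivity, fun N α p q c hL hα hβ hc hp hq hN => ?_⟩
  have hα8 := le_of_mul_le_mul_left (hα.trans (by linarith : D ≤ log N*(1/8))) (by linarith)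
  have hβ8 := le_of_mul_le_mul_left (hβ.trans (by linarith : D ≤ log N*(1/8))) (by linarith)
  have hi := fun p q => (continuous_momentDefect hα8 hβ8).intervalIntegrable (μ := volume) p q
  have key : ∀ τ : ℝ, |τ| + |c.im| ≤ N → ‖∫ t in (0 : ℝ)..τ, momentDefect α c t‖ ≤ K*(√N*log N^2) := fun τ h => by
    rcases le_total 0 τ with hτ | hτ
    · grind
    · rw [abs_of_nonpos hτ] at h
      have := hK N α (-τ) (conj c) hL hα (by rwa [conj_re]) (by simpa using hc) (by linarith)
        (by rwa [conj_im, abs_neg]) (by rwa [conj_im, abs_neg])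
      rw [integral_symm, norm_neg, ← neg_zero, ← neg_neg τ, ← integral_comp_neg]; simp only [momentDefect_neg]
      rw [integral_of_le (by linarith), integral_conj, ← integral_of_le (by linarith), RCLike.norm_conj]
      exact this
  rw [← intervalIntegral.integral_interval_sub_left (hi 0 q) (hi 0 p)]
  refine (norm_sub_le_of_le (key q hq) (key p hp)).trans_eq (by ring)

/-- Two subconvex factors W^0.24 make the exponent 0.48; χ near the critical line and ζ near the
line Re s = 1 cost only tiny powers. The point is an exponent below 1/2, for use when the shifts are
huge compared with T. -/
lemma exists_norm_momentDefect_le : ∃ K : ℝ, 0 ≤ K ∧ ∀ (α t W : ℝ) (c : ℂ), |α| ≤ 1/5000 → |α + c.re| ≤ 1/5000 → c ≠ 0 →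
    8 ≤ W → 2*|t| ≤ W → 2*|t + c.im| ≤ W → 2*|c.im| ≤ W → ‖momentDefect α c t‖ ≤ K*W^(0.48 : ℝ) := by
  obtain ⟨K₁, hK₁, h1⟩ := exists_norm_riemannZeta₀_le_rpow
  obtain ⟨K₂, hK₂, h2⟩ := exists_norm_zetaChi_le_rpow
  refine ⟨(K₁ + 4)^2 + 156000*(K₂^2 + 2), by positivity, fun α t W c hα hβ hc hW ht hty hy => ?_⟩
  have hα' := abs_le.1 hα
  have hβ' := abs_le.1 hβ
  have hW0 : 0 < W := by linarith
  have hW1 : 1 ≤ W := by linarith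
  have hp1 : ∀ {x : ℝ}, 0 ≤ x → 1 ≤ W^x := fun h => one_le_rpow hW1 h
  have hζ : ∀ s : ℂ, 0.499 ≤ s.re → s.re ≤ 0.501 → 2*|s.im| ≤ W → ‖ζ s‖ ≤ (K₁ + 4)*W^(0.24 : ℝ) := fun s hs1 hs2 hs => by
    have hne : s ≠ 1 := fun h => by rw [h, one_re] at hs2; norm_num at hs2
    have hre := abs_re_le_norm (s - 1)
    rw [sub_re, one_re, abs_of_neg (by linarith)] at hre
    have e1 : ‖(s - 1)⁻¹‖ ≤ 4 := by
      rw [norm_inv, inv_le_comm₀ (by linarith) (by norm_num)]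
      linarith
    have e2 : K₁*(1 + |s.im|)^(0.24 : ℝ) ≤ K₁*W^(0.24 : ℝ) := by gcongr; linarith
    rw [riemannZeta_eq_inv_sub_add hne]; refine (norm_add_le_of_le e1 ((h1 s hs1 hs2).trans e2)).trans ?_
    grind
  have hχ : ∀ w : ℂ, |w.re - 1/2| ≤ 0.002 → 2*|w.im| ≤ W + 2 → ‖zetaChi w‖ ≤ K₂*W^(0.002 : ℝ) := fun w hw hwi => by
    refine (h2 w (by linarith)).trans ?_
    gcongr; refine (rpow_le_rpow_of_exponent_le (by simp) hw).trans ?_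
    gcongr; linarith
  -- The convexity bound is applied with C = 0.002 log N, so that e^C is only N^0.002.
  have hζ₀ : ∀ d : ℂ, |d.re| ≤ 0.002 → 2*|d.im| ≤ W → ‖riemannZeta₀ (1 + d)‖ ≤ 152500*W^(0.005 : ℝ) := fun d hd hdi => by
    set N := ⌊W⌋₊
    have hN8 : 8 ≤ N := le_floor (mod_cast hW)
    have hN8' : (8 : ℝ) ≤ N := mod_cast hN8
    have hNW : (N : ℝ) ≤ W := floor_le hW0.le
    have hlt : W < N + 1 := lt_floor_add_one W
    have hd' := abs_le.1 hd
    have hL : 0 < log N := Real.log_pos (by linarith)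
    have h := norm_riemannZeta₀_le_convexity (C := 0.002*log N) (by positivity) (N := N) (by omega) (s := 1 + d)
      (by simp; linarith) (by simp; linarith) (by rw [mul_div_cancel_right₀ _ hL.ne']; simp; linarith) (by simp; linarith)
    have e0 : ((N : ℝ)^((1 - (1 + d).re)/2)) ≤ N^(0.001 : ℝ) := by
      refine rpow_le_rpow_of_exponent_le (by linarith) ?_
      simp; linarith
    have e1 : rexp (0.002*log N) = (N : ℝ)^(0.002 : ℝ) := by rw [rpow_def_of_pos (by linarith), mul_comm]
    have e2 := Real.log_le_rpow_div (x := N) (by linarith) (ε := 0.002) (by norm_num)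
    rw [e1] at h
    calc _ ≤ _ := h
      _ ≤ 305*(N : ℝ)^(0.002 : ℝ)*N^(0.001 : ℝ)*(N^(0.002 : ℝ)/0.002) := by gcongr
      _ = 152500*(N : ℝ)^(0.005 : ℝ) := by
        rw [show (0.005 : ℝ) = 0.002 + 0.001 + 0.002 by norm_num, rpow_add (by linarith), rpow_add (by linarith)]; ring
      _ ≤ _ := by gcongr
  have hX : ∀ z : ℂ, z = c ∨ ‖z‖ < 1/1000 → ‖chiPair α (α + z.re) z.im t‖ ≤ K₂^2*W^(0.004 : ℝ) := fun z hz => by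
    have hz' : |α + z.re| ≤ 0.002 ∧ 2*|t + z.im| ≤ W + 2 := by
      rcases hz with rfl | hz
      · constructor <;> linarith
      · have := abs_le.1 ((abs_re_le_norm z).trans hz.le)
        have h3 := (abs_im_le_norm z).trans hz.le
        have := abs_add_le t z.im
        exact ⟨abs_le.2 ⟨by linarith, by linarith⟩, by linarith⟩
    rw [chiPair, norm_mul]
    refine (mul_le_mul (hχ _ (by simpa using hz'.1) (by simpa using hz'.2)) (hχ _ (by simp; linarith) (by simp; linarith))
      (norm_nonneg _) (by positivity)).trans_eq ?_
    rw [show (0.004 : ℝ) = 0.002 + 0.002 by norm_num, rpow_add hW0]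
    ring
  -- The Schwarz lemma bounds (X − 1)/c uniformly in c, so no lower bound on ‖c‖ is needed.
  have hX1 := norm_chiPair_mul_sub_one_le (g := fun _ => 1) (B := (K₂^2 + 1)*W^(0.004 : ℝ)) (c := c) (r := 1/1000)
    (hα.trans (by norm_num)) (by norm_num) (by norm_num) (differentiable_const _) rfl fun z hz => by
      rw [mul_one]; refine (norm_sub_le_of_le (hX z hz) norm_one.le).trans ?_
      grind
  rw [mul_one, div_div_eq_mul_div, div_one] at hX1
  have hκ := abs_sub (α + c.re) α
  rw [add_sub_cancel_left] at hκ
  have z1 := hζ₀ c (by linarith) hy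
  have z2 := hζ₀ (-c) (by rw [neg_re, abs_neg]; linarith) (by rwa [neg_im, abs_neg])
  rw [← sub_eq_add_neg] at z2
  have hG := (norm_riemannZeta_add_mul_le hc (chiPair α (α + c.re) c.im t)).trans (add_le_add_three z1
    (mul_le_mul z2 (hX c (Or.inl rfl)) (norm_nonneg _) (by positivity)) ((div_le_iff₀ (norm_pos_iff.2 hc)).2 hX1))
  have hF := mul_le_mul (hζ (1 - ((1/2 + α : ℝ) + t*I)) (by simp; linarith) (by simp; linarith) (by simpa using ht))
    (hζ ((1/2 + α : ℝ) + t*I + c) (by simp; linarith) (by simp; linarith) (by simpa using hty)) (norm_nonneg _) (by positivity)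
  rw [← norm_mul, show (K₁ + 4)*W^(0.24 : ℝ)*((K₁ + 4)*W^(0.24 : ℝ)) = (K₁ + 4)^2*W^(0.48 : ℝ) by
    rw [show (0.48 : ℝ) = 0.24 + 0.24 by norm_num, rpow_add hW0]; ring] at hF
  rw [momentDefect]
  refine (norm_sub_le_of_le hF hG).trans ?_
  have m1 : W^(0.005 : ℝ) ≤ W^(0.48 : ℝ) := rpow_le_rpow_of_exponent_le hW1 (by norm_num)
  have m2 : W^(0.004 : ℝ) ≤ W^(0.48 : ℝ) := rpow_le_rpow_of_exponent_le hW1 (by norm_num)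
  have m3 : W^(0.005 : ℝ)*W^(0.004 : ℝ) ≤ W^(0.48 : ℝ) := by
    rw [← rpow_add hW0]; exact rpow_le_rpow_of_exponent_le hW1 (by norm_num)
  have m4 : 0 ≤ W^(0.48 : ℝ) := by positivity
  linarith [mul_le_mul_of_nonneg_left m3 (sq_nonneg K₂), mul_le_mul_of_nonneg_left m2 (sq_nonneg K₂), mul_nonneg (sq_nonneg K₂) m4]

/-- Either V ≤ T^100, so that log N is comparable with log T and the uniform estimate applies with N
of size T + 2V; or V > T^100, and the pointwise bound V^0.48 times the length T ≤ V^0.01 stays below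
√V up to a constant. -/
lemma exists_norm_integral_momentDefect_add_le {C : ℝ} (hC : 0 ≤ C) : ∃ K T₀ : ℝ, 0 ≤ K ∧ 2 ≤ T₀ ∧ C < log T₀*(1/5000) ∧
    ∀ (T : ℝ) (a b : ℂ), T₀ ≤ T → |a.re| ≤ C/log T → |b.re| ≤ C/log T → a ≠ b →
    ‖∫ t in (0 : ℝ)..T, momentDefect b.re (a - b) (t + b.im)‖ ≤ K*((√T + √|a.im| + √|b.im|)*log T^2) := by
  -- In the first case log N ≤ 101 log T, so |Re a| and |Re b| are at most D/log N.
  set D := 101*C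
  have hD0 : 0 ≤ D := by positivity
  obtain ⟨K₁, hK₁, h1⟩ := exists_norm_integral_momentDefect_le hD0
  obtain ⟨K₂, hK₂, h2⟩ := exists_norm_momentDefect_le
  refine ⟨20402*K₁ + 2*K₂, rexp (100*(D + 1)), by positivity, ?_, ?_, fun T a b hT ha hb hab => ?_⟩
  · linarith [Real.add_one_le_exp (100*(D + 1))]
  · rw [Real.log_exp]; linarith
  have hlT : 100*(D + 1) ≤ log T := (Real.le_log_iff_exp_le ((exp_pos _).trans_le hT)).2 hT
  have hT100 : 100 ≤ T := by linarith [Real.add_one_le_exp (100*(D + 1))]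
  have hlT0 : 0 < log T := by linarith
  have hsm : C/log T ≤ 1/5000 := by rw [div_le_iff₀ hlT0]; linarith
  set V := |a.im| + |b.im|
  have hV0 : 0 ≤ V := by positivity
  have hy := abs_sub a.im b.im
  have hsV : √V ≤ √|a.im| + √|b.im| := by
    rw [Real.sqrt_le_left (by positivity), add_sq, sq_sqrt (abs_nonneg _), sq_sqrt (abs_nonneg _)]
    linarith [mul_nonneg (sqrt_nonneg |a.im|) (sqrt_nonneg |b.im|)]
  have hre : b.re + (a - b).re = a.re := by rw [sub_re]; ring
  have hc : a - b ≠ 0 := sub_ne_zero.2 hab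
  have hsq : 1 ≤ log T^2 := one_le_pow₀ (by linarith)
  rcases le_or_gt V (T^(100 : ℝ)) with hVT | hVT
  · set N := ⌈T + 2*V⌉₊ + 8 with hN
    have hNle : (N : ℝ) ≤ T + 2*V + 9 := by push_cast [hN]; linarith [Nat.ceil_lt_add_one (by linarith : 0 ≤ T + 2*V)]
    have hNge : T + 2*V + 8 ≤ N := by push_cast [hN]; linarith [le_ceil (T + 2*V)]
    have hlog : log N ≤ 101*log T := by
      rw [← log_rpow (by linarith)]
      refine log_le_log (by linarith) (hNle.trans ?_)
      have : T ≤ T^(100 : ℝ) := Real.self_le_rpow_of_one_le (by linarith) (by norm_num)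
      rw [show (101 : ℝ) = 100 + 1 by norm_num, rpow_add (by linarith), rpow_one]
      nlinarith
    have hlog' : log T ≤ log N := log_le_log (by linarith) (by linarith)
    have hDle : ∀ x : ℝ, |x| ≤ C/log T → log N*|x| ≤ D := fun x hx => by
      rw [le_div_iff₀ hlT0] at hx; nlinarith [abs_nonneg x]
    have hT2 : √(N : ℝ) ≤ 2*(√T + √V) := by
      rw [Real.sqrt_le_left (by positivity), mul_pow, add_sq, sq_sqrt (by linarith), sq_sqrt hV0]
      nlinarith [mul_nonneg (sqrt_nonneg T) (sqrt_nonneg V)]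
    have := h1 N b.re (0 + b.im) (T + b.im) (a - b) (by linarith) (hDle _ hb) (by rw [hre]; exact hDle _ ha) hc
      (by rw [zero_add, sub_im]; linarith [abs_nonneg a.im])
      (by rw [sub_im]; have := abs_add_le T b.im; rw [abs_of_nonneg (by linarith : 0 ≤ T)] at this; linarith [abs_nonneg a.im])
      (by rw [sub_im]; linarith)
    rw [← integral_comp_add_right] at this; refine this.trans ?_
    calc _ ≤ K₁*(2*(√T + √|a.im| + √|b.im|)*(101*log T)^2) := by gcongr; linarith
      _ = 20402*K₁*((√T + √|a.im| + √|b.im|)*log T^2) := by ring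
      _ ≤ _ := by gcongr; linarith
  · have hTV : T ≤ V := (Real.self_le_rpow_of_one_le (by linarith) (by norm_num)).trans hVT.le
    have hTV' : T ≤ V^(0.01 : ℝ) := by
      have := rpow_le_rpow (by positivity) hVT.le (by norm_num : (0 : ℝ) ≤ 0.01)
      rwa [← rpow_mul (by linarith), show (100 : ℝ)*0.01 = 1 by norm_num, rpow_one] at this
    have hpt := norm_integral_le_of_norm_le_const (a := 0) (b := T)
      (f := fun t => momentDefect b.re (a - b) (t + b.im)) (C := K₂*(4*V)^(0.48 : ℝ)) fun t ht => by
      rw [uIoc_of_le (by linarith)] at ht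
      have e1 := abs_add_le t b.im
      have e2 := abs_add_le t a.im
      rw [abs_of_pos ht.1] at e1 e2; refine h2 _ _ _ _ (hb.trans hsm) (by grind) hc (by linarith) ?_ ?_ ?_
      · grind
      · rw [sub_im, add_add_sub_cancel]; grind
      · rw [sub_im]; linarith
    rw [sub_zero, abs_of_nonneg (by linarith)] at hpt
    have hV1 : 0 < V := by linarith
    have hfin : (4*V)^(0.48 : ℝ)*T ≤ 2*√V := by
      calc _ ≤ (4*V)^(0.48 : ℝ)*(4*V)^(0.01 : ℝ) := by
            gcongr; exact hTV'.trans (rpow_le_rpow hV0 (by linarith) (by norm_num))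
        _ ≤ (4*V)^(1/2 : ℝ) := by
            rw [← rpow_add (by linarith)]
            exact rpow_le_rpow_of_exponent_le (by linarith) (by norm_num)
        _ = _ := by rw [← sqrt_eq_rpow, sqrt_mul (by norm_num), show (4 : ℝ) = 2^2 by norm_num, sqrt_sq (by norm_num)]
    calc _ ≤ _ := hpt
      _ = K₂*((4*V)^(0.48 : ℝ)*T) := by ring
      _ ≤ K₂*(2*((√T + √|a.im| + √|b.im|)*1)) := mul_le_mul_of_nonneg_left (by linarith [sqrt_nonneg T]) hK₂
      _ ≤ K₂*(2*((√T + √|a.im| + √|b.im|)*log T^2)) := by gcongr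
      _ = 2*K₂*((√T + √|a.im| + √|b.im|)*log T^2) := by ring
      _ ≤ _ := by gcongr; linarith

/-! ### The diagonal a = b and the conclusion -/

/-- Translating t by Im b makes the second shift real, so that all imaginary shifts sit in c = a −
b. -/
lemma shiftedZetaProduct_sub_mainIntegrandOffDiag (a b : ℂ) (t : ℝ) :
    shiftedZetaProduct a b t - mainIntegrandOffDiag a b t = momentDefect b.re (a - b) (t + b.im) := by
  have h : (b.re : ℂ) = b - b.im*I := by linear_combination re_add_im b
  have h' : ((a - b).re : ℂ) = a - b - (a - b).im*I := by linear_combination re_add_im (a - b)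
  have e1 : 1 - (((1/2 + b.re : ℝ) : ℂ) + ((t + b.im : ℝ) : ℂ)*I) = 1/2 - b - I*t := by push_cast [h]; ring
  have e2 : ((1/2 + b.re : ℝ) : ℂ) + ((t + b.im : ℝ) : ℂ)*I + (a - b) = 1/2 + a + I*t := by push_cast [h]; ring
  have e3 : (1/2 : ℂ) + ((b.re + (a - b).re : ℝ) : ℂ) + (((t + b.im : ℝ) : ℂ) + (a - b).im)*I = 1/2 + a + I*t := by
    push_cast [h, h']; ring
  have e4 : (1/2 : ℂ) - b.re - ((t + b.im : ℝ) : ℂ)*I = 1/2 - b - I*t := by push_cast [h]; ring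
  rw [momentDefect, chiPair, e1, e2, e3, e4, shiftedZetaProduct, mainIntegrandOffDiag, mul_comm (ζ (1/2 - b - I*t))]

/-- The main term near the diagonal, with the removable singularity removed. -/
def mainIntegrandNearDiag (a : ℂ) (δ t : ℝ) : ℂ := riemannZeta₀ (1 + δ*I) + riemannZeta₀ (1 - δ*I) *
    (zetaChi (1/2 + a + I*t)*zetaChi (1/2 - (a - δ*I) - I*t)) -
    zetaChi (1/2 - (a - δ*I) - I*t) * ∫ s in (0 : ℝ)..1, deriv zetaChi (1/2 + (a - δ*I) + I*t + s*(δ*I))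

lemma analyticAt_zetaChi {w : ℂ} (hw : w.re < 1) : AnalyticAt ℂ zetaChi w :=
  DifferentiableOn.analyticAt (s := {w : ℂ | w.re < 1}) (fun _ hz => (differentiableAt_zetaChi hz).differentiableWithinAt)
    ((isOpen_lt continuous_re continuous_const).mem_nhds hw)

/-- Since χ(s)χ(1 − s) = 1, the quotient (X − 1)/c is a χ-factor times a difference quotient of χ.
Written as an integral of χ' along a segment, it makes sense at δ = 0 and is jointly continuous in δ
and t. -/
lemma mainIntegrandNearDiag_eq {a : ℂ} (ha : |a.re| ≤ 1/4) {δ : ℝ} (hδ : δ ≠ 0) (t : ℝ) :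
    mainIntegrandNearDiag a δ t = mainIntegrandOffDiag a (a - δ*I) t := by
  have ha' := abs_le.1 ha
  have hc : (δ*I : ℂ) ≠ 0 := mul_ne_zero (mod_cast hδ) I_ne_zero
  have hre : ∀ s : ℝ, (1/2 + (a - δ*I) + I*t + s*(δ*I)).re < 1 := fun s => by simp; linarith
  have h1 := intervalIntegral.integral_unitInterval_deriv_eq_sub (f := zetaChi) (f' := deriv zetaChi) (z₀ := 1/2 + (a - δ*I) + I*t) (z₁ := δ*I)
    (fun s _ => by
      simp only [real_smul]
      exact ((analyticAt_zetaChi (hre s)).deriv.continuousAt.comp (f := fun s : ℝ => 1/2 + (a - δ*I) + I*t + s*(δ*I))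
        (by fun_prop)).continuousWithinAt)
    (fun s _ => by rw [real_smul]; exact (differentiableAt_zetaChi (hre s)).hasDerivAt)
  have h2 := zetaChi_mul_zetaChi_one_sub_of_re (s := 1/2 + (a - δ*I) + I*t) (by simp; linarith) (by simp; linarith)
  rw [show (1 : ℂ) - (1/2 + (a - δ*I) + I*t) = 1/2 - (a - δ*I) - I*t by ring] at h2
  simp only [real_smul, smul_eq_mul] at h1
  rw [show (1/2 : ℂ) + (a - δ*I) + I*t + δ*I = 1/2 + a + I*t by ring] at h1
  rw [mainIntegrandOffDiag, sub_sub_cancel, riemannZeta_add_mul_eq hc, mainIntegrandNearDiag, sub_right_inj, eq_div_iff hc]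
  grind

lemma continuous_mainIntegrandNearDiag {a : ℂ} (ha : |a.re| ≤ 1/4) :
    Continuous fun p : ℝ × ℝ => mainIntegrandNearDiag a p.1 p.2 := by
  have ha' := abs_le.1 ha
  have hχ : ∀ f : ℝ × ℝ → ℂ, Continuous f → (∀ p, (f p).re < 1) → Continuous fun p => zetaChi (f p) := fun f hf h =>
    continuous_iff_continuousAt.2 fun p => (differentiableAt_zetaChi (h p)).continuousAt.comp hf.continuousAt
  have hχ' : Continuous fun q : (ℝ × ℝ) × ℝ => deriv zetaChi (1/2 + (a - q.1.1*I) + I*q.1.2 + q.2*(q.1.1*I)) :=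
    continuous_iff_continuousAt.2 fun q => (analyticAt_zetaChi (by simp; linarith)).deriv.continuousAt.comp
      (f := fun q : (ℝ × ℝ) × ℝ => 1/2 + (a - q.1.1*I) + I*q.1.2 + q.2*(q.1.1*I)) (by fun_prop)
  have hζ : Continuous riemannZeta₀ := differentiable_riemannZeta₀.continuous
  have h1 := hχ (fun p => 1/2 - (a - p.1*I) - I*p.2) (by fun_prop) fun p => by simp; linarith
  exact ((hζ.comp (by fun_prop)).add ((hζ.comp (by fun_prop)).mul ((hχ (fun p => 1/2 + a + I*p.2) (by fun_prop)
    fun p => by simp; linarith).mul h1))).sub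
    (h1.mul (intervalIntegral.continuous_parametric_intervalIntegral_of_continuous' hχ' 0 1))

/-- Both points of the difference quotient move independently, so its limit requires strict
differentiability of χ, which analyticity provides. -/
lemma tendsto_mainIntegrandOffDiag {a : ℂ} (ha : |a.re| ≤ 1/4) (t : ℝ) :
    Tendsto (fun p : ℂ × ℂ => mainIntegrandOffDiag p.1 p.2 t) (𝓝[{p : ℂ × ℂ | p.1 ≠ p.2}] (a, a))
      (𝓝 (mainIntegrandNearDiag a 0 t)) := by
  have ha' := abs_le.1 ha
  have hle : 𝓝[{p : ℂ × ℂ | p.1 ≠ p.2}] (a, a) ≤ 𝓝 (a, a) := nhdsWithin_le_nhds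
  have hcont : ∀ f : ℂ × ℂ → ℂ, Continuous f → Tendsto f (𝓝[{p : ℂ × ℂ | p.1 ≠ p.2}] (a, a)) (𝓝 (f (a, a))) := fun f hf =>
    hf.continuousAt.tendsto.mono_left hle
  have hζ : Continuous riemannZeta₀ := differentiable_riemannZeta₀.continuous
  have hχ : ∀ f : ℂ × ℂ → ℂ, Continuous f → (f (a, a)).re < 1 →
      Tendsto (fun p => zetaChi (f p)) (𝓝[{p : ℂ × ℂ | p.1 ≠ p.2}] (a, a)) (𝓝 (zetaChi (f (a, a)))) := fun f hf h =>
    (differentiableAt_zetaChi h).continuousAt.tendsto.comp (hcont f hf)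
  have h2 := hχ (fun p => 1/2 - p.2 - I*t) (by fun_prop) (by simp; linarith)
  have hs := ((analyticAt_zetaChi (w := 1/2 + a + I*t) (by simp; linarith)).hasStrictDerivAt.isLittleO.comp_tendsto
    (show Tendsto (fun p : ℂ × ℂ => ((1/2 + p.1 + I*t, 1/2 + p.2 + I*t) : ℂ × ℂ)) (𝓝[{p : ℂ × ℂ | p.1 ≠ p.2}] (a, a)) _ from
      ((by fun_prop : Continuous fun p : ℂ × ℂ => ((1/2 + p.1 + I*t, 1/2 + p.2 + I*t) : ℂ × ℂ)).tendsto (a, a)).mono_left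
        hle)).tendsto_div_nhds_zero
  have hlim := (((hcont (fun p => riemannZeta₀ (1 + (p.1 - p.2))) (hζ.comp (by fun_prop))).add
    ((hcont (fun p => riemannZeta₀ (1 - (p.1 - p.2))) (hζ.comp (by fun_prop))).mul
      ((hχ (fun p => 1/2 + p.1 + I*t) (by fun_prop) (by simp; linarith)).mul h2)))).sub
    (h2.mul (hs.add_const (deriv zetaChi (1/2 + a + I*t))))
  have e : mainIntegrandNearDiag a 0 t = riemannZeta₀ (1 + (a - a)) + riemannZeta₀ (1 - (a - a)) *
      (zetaChi (1/2 + a + I*t)*zetaChi (1/2 - a - I*t)) -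
      zetaChi (1/2 - a - I*t)*(0 + deriv zetaChi (1/2 + a + I*t)) := by
    simp [mainIntegrandNearDiag]
  rw [e]
  refine hlim.congr' ?_
  have hev : ∀ᶠ p : ℂ × ℂ in 𝓝[{p : ℂ × ℂ | p.1 ≠ p.2}] (a, a), |p.2.re| < 1/2 :=
    hle ((isOpen_lt (by fun_prop : Continuous fun p : ℂ × ℂ => |p.2.re|) continuous_const).mem_nhds (by simp; linarith))
  filter_upwards [hev, self_mem_nhdsWithin] with p hp hne
  have hc : p.1 - p.2 ≠ 0 := sub_ne_zero.2 hne
  have hp' := abs_lt.1 hp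
  have h2 := zetaChi_mul_zetaChi_one_sub_of_re (s := 1/2 + p.2 + I*t) (by simp; linarith) (by simp; linarith)
  rw [show (1 : ℂ) - (1/2 + p.2 + I*t) = 1/2 - p.2 - I*t by ring] at h2
  rw [mainIntegrandOffDiag, riemannZeta_add_mul_eq hc, sub_right_inj, eq_div_iff hc]
  simp only [comp_apply, ContinuousLinearMap.toSpanSingleton_apply, smul_eq_mul,
    show ∀ x y : ℂ, 1/2 + x + I*t - (1/2 + y + I*t) = x - y by intros; ring]
  grind

lemma mainIntegrand_self {a : ℂ} (ha : |a.re| ≤ 1/4) (t : ℝ) : mainIntegrand a a t = mainIntegrandNearDiag a 0 t := by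
  -- The diagonal point is a limit of off-diagonal ones, so the limit is unique and `limUnder`
  -- returns it.
  have : (𝓝[{p : ℂ × ℂ | p.1 ≠ p.2}] (a, a)).NeBot := mem_closure_iff_nhdsWithin_neBot.1 <|
    mem_closure_of_tendsto (b := 𝓝[≠] (0 : ℂ)) (f := fun z => (a + z, a))
      (((by fun_prop : Continuous fun z : ℂ => (a + z, a)).tendsto' 0 _ (by simp)).mono_left nhdsWithin_le_nhds)
      (eventually_mem_nhdsWithin.mono fun z hz => by simpa using hz)
  rw [mainIntegrand, if_pos rfl]
  exact (tendsto_mainIntegrandOffDiag ha t).limUnder_eq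

lemma continuous_shiftedZetaProduct {a b : ℂ} (ha : |a.re| ≤ 1/4) (hb : |b.re| ≤ 1/4) : Continuous (shiftedZetaProduct a b) := by
  have ha' := abs_le.1 ha
  have hb' := abs_le.1 hb
  have h : ∀ f : ℝ → ℂ, Continuous f → (∀ t, (f t).re ≠ 1) → Continuous fun t => ζ (f t) := fun f hf h =>
    continuous_iff_continuousAt.2 fun t => (differentiableAt_riemannZeta fun e => h t (by rw [e, one_re])).continuousAt.comp
      hf.continuousAt
  exact (h _ (by fun_prop) fun t => by simp; linarith).mul (h _ (by fun_prop) fun t => by simp; linarith)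

end

theorem theorem1 (C : ℝ) :
    ∃ K T₀ : ℝ, 2 ≤ T₀ ∧ ∀ (T : ℝ) (a b : ℂ), T₀ ≤ T →
      |a.re| ≤ C / Real.log T → |b.re| ≤ C / Real.log T →
        (a = b → ∀ t ∈ Set.Icc 0 T,
          Tendsto (fun p : ℂ × ℂ => mainIntegrandOffDiag p.1 p.2 t)
            (𝓝[{p : ℂ × ℂ | p.1 ≠ p.2}] (a, b)) (𝓝 (mainIntegrand a b t))) ∧
        IntervalIntegrable (shiftedZetaProduct a b) MeasureTheory.volume 0 T ∧
        IntervalIntegrable (mainIntegrand a b) MeasureTheory.volume 0 T ∧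
        ‖(∫ t in (0 : ℝ)..T, shiftedZetaProduct a b t) -
            ∫ t in (0 : ℝ)..T, mainIntegrand a b t‖ ≤
          K * ((Real.sqrt T + Real.sqrt |a.im| + Real.sqrt |b.im|) * Real.log T ^ 2) := by
  -- C may be negative; replacing it by max C 0 only weakens the hypotheses on the real parts.
  obtain ⟨K, T₀, hK0, hT₀, hCT, hK⟩ := exists_norm_integral_momentDefect_add_le (le_max_right C 0)
  refine ⟨K, T₀, hT₀, fun T a b hT ha hb => ?_⟩
  have hlog : Real.log T₀ ≤ Real.log T := Real.log_le_log (by linarith) hT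
  have hlT : 0 < Real.log T := by linarith [le_max_right C 0]
  have hC : C / Real.log T ≤ max C 0 / Real.log T := by gcongr; exact le_max_left C 0
  have hsm : max C 0 / Real.log T ≤ 1 / 8 := by rw [div_le_iff₀ hlT]; linarith
  have ha8 := ha.trans (hC.trans hsm)
  have hb8 := hb.trans (hC.trans hsm)
  have ha4 : |a.re| ≤ 1 / 4 := by linarith
  have hb4 : |b.re| ≤ 1 / 4 := by linarith
  have hF := continuous_shiftedZetaProduct ha4 hb4
  rcases eq_or_ne a b with rfl | hab
  · have hM : mainIntegrand a a = mainIntegrandNearDiag a 0 := funext (mainIntegrand_self ha4)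
    have hN := continuous_mainIntegrandNearDiag ha4
    have hN0 : Continuous (mainIntegrandNearDiag a 0) := hN.comp (by fun_prop : Continuous fun t : ℝ => ((0, t) : ℝ × ℝ))
    rw [hM]
    refine ⟨fun _ t _ => tendsto_mainIntegrandOffDiag ha4 t, hF.intervalIntegrable _ _, hN0.intervalIntegrable _ _, ?_⟩
    have hFδ : Continuous fun p : ℝ × ℝ => shiftedZetaProduct a (a - p.1 * Complex.I) p.2 := by
      have ha' := abs_le.1 ha4
      have h : ∀ f : ℝ × ℝ → ℂ, Continuous f → (∀ p, (f p).re ≠ 1) → Continuous fun p => riemannZeta (f p) := fun f hf h =>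
        continuous_iff_continuousAt.2 fun p => (differentiableAt_riemannZeta fun e =>
          h p (by rw [e, Complex.one_re])).continuousAt.comp hf.continuousAt
      exact (h _ (by fun_prop) fun p => by simp; linarith).mul (h _ (by fun_prop) fun p => by simp; linarith)
    -- On the diagonal the bound is a limit of the bounds for b = a − iδ: an imaginary displacement
    -- preserves the hypothesis on Re b, and both sides are continuous in δ.
    have hJ := (intervalIntegral.continuous_parametric_intervalIntegral_of_continuous' (μ := MeasureTheory.volume)
      (f := fun δ t : ℝ => shiftedZetaProduct a (a - δ * Complex.I) t - mainIntegrandNearDiag a δ t) (hFδ.sub hN) 0 T).norm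
    have hR : Continuous fun δ : ℝ => K * ((Real.sqrt T + Real.sqrt |a.im| + Real.sqrt |a.im - δ|) * Real.log T ^ 2) := by fun_prop
    have := le_of_tendsto_of_tendsto ((hJ.tendsto 0).mono_left (nhdsWithin_le_nhds (s := {0}ᶜ)))
      ((hR.tendsto 0).mono_left nhdsWithin_le_nhds) (by
        filter_upwards [self_mem_nhdsWithin] with δ hδ
        have hδ0 : δ ≠ 0 := hδ
        have := hK T a (a - δ * Complex.I) hT (ha.trans hC) (by simpa using ha.trans hC) fun h => hδ0 (by simpa using h.symm)
        simp only [← shiftedZetaProduct_sub_mainIntegrandOffDiag, ← mainIntegrandNearDiag_eq ha4 hδ0] at this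
        simpa using this)
    simp only [Complex.ofReal_zero, zero_mul, sub_zero] at this
    rwa [intervalIntegral.integral_sub (hF.intervalIntegrable _ _) (hN0.intervalIntegrable _ _)] at this
  · have hM : mainIntegrand a b = mainIntegrandOffDiag a b := funext fun t => by rw [mainIntegrand, if_neg hab]
    have hc : Continuous (mainIntegrandOffDiag a b) := by
      have h : |b.re + (a - b).re| ≤ 1 / 8 := by rwa [Complex.sub_re, add_sub_cancel]
      refine (hF.sub ((continuous_momentDefect hb8 h).comp (continuous_add_const b.im))).congr fun t => ?_
      change _ - momentDefect _ _ (t + b.im) = _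
      rw [← shiftedZetaProduct_sub_mainIntegrandOffDiag, sub_sub_cancel]
    rw [hM]
    refine ⟨fun h => absurd h hab, hF.intervalIntegrable _ _, hc.intervalIntegrable _ _, ?_⟩
    rw [← intervalIntegral.integral_sub (hF.intervalIntegrable _ _) (hc.intervalIntegrable _ _)]
    simp only [shiftedZetaProduct_sub_mainIntegrandOffDiag]
    exact hK T a b hT (ha.trans hC) (hb.trans hC) hab
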